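/- Manifolds are smooth ($C^\infty$), finite-dimensional and without boundary; they need not be Hausdorff unless this is said, and different connected components may have different dimensions. A Lie groupoid $G$ over a Hausdorff manifold $M$ has a (possibly non-Hausdorff) manifold of arrows, also denoted $G$; its source and target maps $s,t\colon G\to M$ are submersions, and its composition (defined on pairs $(g,h)$ with $s(g)=t(h)$), inverse and unit maps are smooth. - $G$ is *regular* if for each $x\in M$ the restriction $t\colon s^{-1}(x)\to M$ has constant rank $r(x)$, and $r$ is locally constant on $M$. - $G$ is *proper* if $G$ is Hausdorff and $(s,t)\colon G\to M\times M$ is a proper map (a closed map with compact fibres). - $G$ is an *orbifold groupoid* if it is proper and the fibres of $(s,t)\colon G\to M\times M$ are discrete. - A *bundle of Lie groups* over $M$ is a Lie groupoid $K$ over $M$ with $s=t$. It is *locally trivial* if each point of $M$ has an open neighbourhood $U$ over which $K$ is isomorphic, as a bundle of Lie groups, to $L\times U\to U$ for some Lie group $L$. It is a bundle of *compact connected* Lie groups if $s=t$ is a proper map and its fibres are compact and connected. - An *extension* $K\xrightarrow{\,j\,}G\xrightarrow{\,\pi\,}E$ over $M$ consists of a bundle of Lie groups $K$ over $M$, Lie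 groupoids $G$ and $E$ over $M$, and homomorphisms of Lie groupoids $j$ and $\pi$ that are the identity on $M$, such that $j$ is a smooth embedding, $\pi$ is a surjective submersion with connected fibres, and the image of $j$ is the kernel of $\pi$, i.e. the set of arrows which $\pi$ maps to units. **Corollary 2.6.** Every proper regular Lie groupoid $G$ over a Hausdorff manifold $M$ fits into an extension $K\to G\to E$ over $M$ in which $E$ is an orbifold groupoid and $K$ is a locally trivial bundle of compact connected Lie groups. -/

import Mathlib

open scoped ContDiff Manifold
open Set Topology

universe u v w

/-- A smooth (`C^∞`) atlas of finite-dimensional charts on a topological space `X`, i.e. the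
structure of a smooth manifold without boundary on `X`. In contrast with a Mathlib `ChartedSpace`,
which has one fixed model space, the dimension of the charts may depend on the chart, so that
different connected components of `X` may have different dimensions.
Neither the Hausdorff property nor countability is part of the definition. -/
structure SmoothAtlas (X : Type u) [TopologicalSpace X] where
  /-- the charts: a dimension `n` and a homeomorphism from an open set onto an open set of `ℝⁿ` -/
  charts : Set (Σ n : ℕ, OpenPartialHomeomorph X (EuclideanSpace ℝ (Fin n)))
  cover : ∀ x : X, ∃ a ∈ charts, x ∈ a.2.source
  compatible : ∀ a ∈ charts, ∀ b ∈ charts,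
    ContDiffOn ℝ ∞ (b.2 ∘ a.2.symm) (a.2.symm ≫ₕ b.2).source

namespace SmoothAtlas

variable {X : Type u} [TopologicalSpace X] {Y : Type v} [TopologicalSpace Y]
  {Z : Type w} [TopologicalSpace Z]

/-- The smooth atlas of a Mathlib manifold modelled on `ℝᵈ`. -/
def ofManifold (d : ℕ) (L : Type u) [TopologicalSpace L]
    [ChartedSpace (EuclideanSpace ℝ (Fin d)) L] [IsManifold (𝓡 d) ∞ L] : SmoothAtlas L where
  charts := (fun φ : OpenPartialHomeomorph L (EuclideanSpace ℝ (Fin d)) =>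
    (⟨d, φ⟩ : Σ n : ℕ, OpenPartialHomeomorph L (EuclideanSpace ℝ (Fin n)))) ''
      atlas (EuclideanSpace ℝ (Fin d)) L
  cover x := ⟨⟨d, chartAt _ x⟩, ⟨_, chart_mem_atlas _ x, rfl⟩, mem_chart_source _ x⟩
  compatible := by
    rintro _ ⟨φ, hφ, rfl⟩ _ ⟨ψ, hψ, rfl⟩
    have h := (contDiffGroupoid ∞ (𝓡 d)).compatible hφ hψ
    have h' := (contDiffGroupoid ∞ (𝓡 d)).mem_of_eqOnSource h (Setoid.refl _)
    rw [contDiffGroupoid, mem_groupoid_of_pregroupoid] at h'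
    simpa [contDiffPregroupoid] using h'.1

/-- Smoothness of `f` on a subset `S`. If `S` is open, or more generally an embedded
submanifold, this is smoothness of the restriction of `f` to the manifold `S`. -/
def SmoothOn (A : SmoothAtlas X) (B : SmoothAtlas Y) (f : X → Y) (S : Set X) : Prop :=
  ContinuousOn f S ∧ ∀ a ∈ A.charts, ∀ b ∈ B.charts,
    ContDiffOn ℝ ∞ (b.2 ∘ f ∘ a.2.symm)
      {v | v ∈ a.2.target ∧ a.2.symm v ∈ S ∧ f (a.2.symm v) ∈ b.2.source}

/-- Smooth maps between manifolds. -/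
def Smooth (A : SmoothAtlas X) (B : SmoothAtlas Y) (f : X → Y) : Prop :=
  SmoothOn A B f univ

/-- Smoothness of a map of two variables on a subset `S` of the product manifold `X × Y`,
whose charts are the products of a chart of `X` and a chart of `Y`. -/
def SmoothOn₂ (A : SmoothAtlas X) (B : SmoothAtlas Y) (C : SmoothAtlas Z)
    (f : X → Y → Z) (S : Set (X × Y)) : Prop :=
  ContinuousOn (fun p : X × Y => f p.1 p.2) S ∧
  ∀ a ∈ A.charts, ∀ b ∈ B.charts, ∀ c ∈ C.charts,
    ContDiffOn ℝ ∞
      (fun v : EuclideanSpace ℝ (Fin a.1) × EuclideanSpace ℝ (Fin b.1) =>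
        c.2 (f (a.2.symm v.1) (b.2.symm v.2)))
      {v | v.1 ∈ a.2.target ∧ v.2 ∈ b.2.target ∧ (a.2.symm v.1, b.2.symm v.2) ∈ S ∧
        f (a.2.symm v.1) (b.2.symm v.2) ∈ c.2.source}

/-- The derivative of `f` at `x` in the charts `a` around `x` and `b` around `f x`. -/
noncomputable def chartDeriv (f : X → Y)
    (a : Σ n : ℕ, OpenPartialHomeomorph X (EuclideanSpace ℝ (Fin n)))
    (b : Σ n : ℕ, OpenPartialHomeomorph Y (EuclideanSpace ℝ (Fin n))) (x : X) :
    EuclideanSpace ℝ (Fin a.1) →L[ℝ] EuclideanSpace ℝ (Fin b.1) :=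
  fderiv ℝ (b.2 ∘ f ∘ a.2.symm) (a.2 x)

/-- Submersions: smooth maps all of whose derivatives are surjective. -/
def Submersion (A : SmoothAtlas X) (B : SmoothAtlas Y) (f : X → Y) : Prop :=
  Smooth A B f ∧ ∀ x, ∀ a ∈ A.charts, ∀ b ∈ B.charts, x ∈ a.2.source → f x ∈ b.2.source →
    Function.Surjective (chartDeriv f a b x)

/-- Smooth embeddings: immersions that are homeomorphisms onto their image. -/
def Embedding (A : SmoothAtlas X) (B : SmoothAtlas Y) (f : X → Y) : Prop :=
  Smooth A B f ∧ IsEmbedding f ∧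
  ∀ x, ∀ a ∈ A.charts, ∀ b ∈ B.charts, x ∈ a.2.source → f x ∈ b.2.source →
    Function.Injective (chartDeriv f a b x)

end SmoothAtlas

/-- A Lie groupoid with manifold of objects `M` and (possibly non-Hausdorff) manifold of arrows
`G`. The composition `mul g h` of `g` and `h` is meaningful only if `src g = tgt h`; its values on
other pairs are irrelevant. -/
structure LieGroupoid {M : Type v} [TopologicalSpace M] (A : SmoothAtlas M)
    {G : Type u} [TopologicalSpace G] (B : SmoothAtlas G) where
  src : G → M
  tgt : G → M
  mul : G → G → G
  inv : G → G
  unit : M → G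
  src_submersion : SmoothAtlas.Submersion B A src
  tgt_submersion : SmoothAtlas.Submersion B A tgt
  smooth_mul : SmoothAtlas.SmoothOn₂ B B B mul {p | src p.1 = tgt p.2}
  smooth_inv : SmoothAtlas.Smooth B B inv
  smooth_unit : SmoothAtlas.Smooth A B unit
  src_mul : ∀ g h, src g = tgt h → src (mul g h) = src h
  tgt_mul : ∀ g h, src g = tgt h → tgt (mul g h) = tgt g
  mul_assoc : ∀ g h k, src g = tgt h → src h = tgt k → mul (mul g h) k = mul g (mul h k)
  src_unit : ∀ x, src (unit x) = x
  tgt_unit : ∀ x, tgt (unit x) = x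
  unit_mul : ∀ g, mul (unit (tgt g)) g = g
  mul_unit : ∀ g, mul g (unit (src g)) = g
  src_inv : ∀ g, src (inv g) = tgt g
  tgt_inv : ∀ g, tgt (inv g) = src g
  inv_mul : ∀ g, mul (inv g) g = unit (src g)
  mul_inv : ∀ g, mul g (inv g) = unit (tgt g)

namespace LieGroupoid

variable {M : Type v} [TopologicalSpace M] {A : SmoothAtlas M}
  {G : Type u} [TopologicalSpace G] {B : SmoothAtlas G}
  {H : Type w} [TopologicalSpace H] {C : SmoothAtlas H}

/-- The pair (source, target). -/
def srcTgt (Γ : LieGroupoid A B) : G → M × M := fun g => (Γ.src g, Γ.tgt g)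

/-- `Γ` is proper: its manifold of arrows is Hausdorff and (source, target) is a proper map. -/
def IsProper (Γ : LieGroupoid A B) : Prop :=
  T2Space G ∧ IsProperMap Γ.srcTgt

/-- `Γ` is regular: for each `x`, the restriction of the target map to the source fibre
`src ⁻¹ {x}`, whose tangent space at `g` is the kernel of the derivative of `src` at `g`, has
constant rank `r x`, and `r` is locally constant on `M`. -/
def IsRegular (Γ : LieGroupoid A B) : Prop :=
  ∃ r : M → ℕ, IsLocallyConstant r ∧
    ∀ g, ∀ b ∈ B.charts, ∀ a ∈ A.charts, ∀ a' ∈ A.charts,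
      g ∈ b.2.source → Γ.src g ∈ a.2.source → Γ.tgt g ∈ a'.2.source →
      Module.finrank ℝ
        (Submodule.map (SmoothAtlas.chartDeriv Γ.tgt b a' g).toLinearMap
          (LinearMap.ker (SmoothAtlas.chartDeriv Γ.src b a g).toLinearMap)) = r (Γ.src g)

/-- `Γ` is a foliation groupoid: the fibres of (source, target) are discrete. -/
def IsFoliation (Γ : LieGroupoid A B) : Prop :=
  ∀ p : M × M, DiscreteTopology (Γ.srcTgt ⁻¹' {p})

/-- An orbifold groupoid is a proper foliation groupoid. -/
def IsOrbifold (Γ : LieGroupoid A B) : Prop :=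
  Γ.IsProper ∧ Γ.IsFoliation

/-- `Γ` is a bundle of Lie groups: source and target coincide. -/
def IsGroupBundle (Γ : LieGroupoid A B) : Prop :=
  Γ.src = Γ.tgt

/-- A bundle of Lie groups is locally trivial if each point of `M` has an open neighbourhood `U`
over which the bundle is isomorphic to the trivial bundle `L × U` for a Lie group `L`. The
isomorphism is `k ↦ (χ k, src k)`, and `Ψ` is its inverse. -/
def IsLocallyTrivial (Γ : LieGroupoid A B) : Prop :=
  ∀ x : M, ∃ U : Set M, IsOpen U ∧ x ∈ U ∧
    ∃ (d : ℕ) (L : Type u) (_ : Group L) (_ : TopologicalSpace L)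
      (_ : ChartedSpace (EuclideanSpace ℝ (Fin d)) L) (_ : LieGroup (𝓡 d) ∞ L)
      (χ : G → L) (Ψ : L → M → G),
      SmoothAtlas.SmoothOn B (SmoothAtlas.ofManifold d L) χ (Γ.src ⁻¹' U) ∧
      SmoothAtlas.SmoothOn₂ (SmoothAtlas.ofManifold d L) A B Ψ (univ ×ˢ U) ∧
      (∀ k, Γ.src k ∈ U → Ψ (χ k) (Γ.src k) = k) ∧
      (∀ l, ∀ y ∈ U, Γ.src (Ψ l y) = y ∧ χ (Ψ l y) = l) ∧
      (∀ k k', Γ.src k ∈ U → Γ.src k = Γ.src k' → χ (Γ.mul k k') = χ k * χ k')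

/-- `Γ` is a locally trivial bundle of compact connected Lie groups. -/
def IsLocallyTrivialCompactConnectedGroupBundle (Γ : LieGroupoid A B) : Prop :=
  Γ.IsGroupBundle ∧ Γ.IsLocallyTrivial ∧
  IsProperMap Γ.src ∧ ∀ x, IsCompact (Γ.src ⁻¹' {x}) ∧ IsConnected (Γ.src ⁻¹' {x})

/-- Homomorphisms of Lie groupoids over `M` that are the identity on objects. -/
structure IsHom (Γ : LieGroupoid A B) (Δ : LieGroupoid A C) (f : G → H) : Prop where
  smooth : SmoothAtlas.Smooth B C f
  src_map : ∀ g, Δ.src (f g) = Γ.src g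
  tgt_map : ∀ g, Δ.tgt (f g) = Γ.tgt g
  map_mul : ∀ g h, Γ.src g = Γ.tgt h → f (Γ.mul g h) = Δ.mul (f g) (f h)
  map_inv : ∀ g, f (Γ.inv g) = Δ.inv (f g)
  map_unit : ∀ x, f (Γ.unit x) = Δ.unit x

/-- `K → G → E` is an extension of Lie groupoids over `M`: `j` and `π` are homomorphisms, `j` is an
embedding of the bundle of Lie groups `K`, `π` is a surjective submersion with connected fibres,
and the image of `j` is the kernel of `π`. -/
structure IsExtension {K : Type u} [TopologicalSpace K] {AK : SmoothAtlas K}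
    {E : Type w} [TopologicalSpace E] {AE : SmoothAtlas E}
    (κ : LieGroupoid A AK) (Γ : LieGroupoid A B) (ε : LieGroupoid A AE)
    (j : K → G) (π : G → E) : Prop where
  groupBundle : κ.IsGroupBundle
  hom_j : IsHom κ Γ j
  hom_π : IsHom Γ ε π
  embedding : SmoothAtlas.Embedding AK B j
  submersion : SmoothAtlas.Submersion B AE π
  surjective : Function.Surjective π
  connected_fibres : ∀ e, IsConnected (π ⁻¹' {e})
  range_eq_kernel : range j = {g | ∃ x, π g = ε.unit x}

end LieGroupoid

/-! The bundle K is the `core` of G: the union over x of the identity components `coreAt x` of the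
isotropy groups. It is stable under products, inverses and conjugation, because translations and
conjugations are continuous and so respect connected components. The base E is G modulo right
multiplication by the core.

Smoothness of K and E comes from regularity. A constant rank argument
(`IsRegular.exists_coordinates`) shows that near any arrow the source, together with r linear
functions of the target, forms a submersion, and that these functions already determine the target.
Near a unit the isotropy is therefore a submanifold submersing onto M, with slices that are balls
and hence lie in the core. So the core is open in the isotropy. Since a connected group is generated
by any neighbourhood of its unit, every element of the core lies on a smooth local section
(`IsRegular.exists_core_section`). Translating by such sections carries the coordinates at the units
to all of K, makes G → E open, and gives lifts of the charts of E through every arrow. Openness of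
the core in the isotropy also makes the fibres of (source, target) on E discrete.

Properness enters through `IsRegular.isClosed_core`. An isotropy group is compact, so its identity
component and the rest have disjoint open neighbourhoods. These still cover the isotropy groups over
nearby points, and a connected group whose unit lies in the first neighbourhood stays inside it.
From closedness follow properness of K → M and the Hausdorff property of E.

The hardest assertion is local triviality, which is proved for every proper bundle of Lie groups
with Hausdorff total space (`IsGroupBundle.isLocallyTrivial`). Let L be the compact fibre over a
point. Local transports of L to nearby fibres, smooth in the base point but only continuous along L,
are glued to a global one by interpolating in coordinates around the units. Its failure to be
multiplicative is a small cochain c on L × L, with values in the coordinate space W of L near 1. The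
implicit function theorem in the Banach space C(L, W) perturbs the transport so that the Haar mean
of c in its second variable becomes a coboundary (`exists_gauge`). The nonlinear cocycle identity
for c, averaged over its last variable, then bounds the norm of c by half of itself, so c = 0
(`exists_correction`). This is the rigidity of compact groups, the vanishing of their second
cohomology made quantitative.

The resulting family of homomorphisms is still only continuous along L. Averaging over L against a
smooth bump function moves the dependence on the group variable into the bump, by invariance of Haar
measure, and this gives joint smoothness (`contDiffAt_coordMap`). The inverse function theorem near
the unit, translations, compactness of L and properness of the bundle then turn the family into a
trivialization. -/

open Filter

/-! ### Calculus in atlases: smoothness tested on plots from normed spaces and on functions to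
normed spaces. -/

namespace SmoothAtlas

variable {X : Type u} [TopologicalSpace X] {Y : Type v} [TopologicalSpace Y]
  {Z : Type w} [TopologicalSpace Z]
  {E : Type*} [NormedAddCommGroup E] [NormedSpace ℝ E]
  {F : Type*} [NormedAddCommGroup F] [NormedSpace ℝ F]
  {A : SmoothAtlas X} {B : SmoothAtlas Y} {C : SmoothAtlas Z}

/-- Smoothness at `p` within `S` of a map from a normed space to a manifold. -/
def PlotAt (A : SmoothAtlas X) (γ : E → X) (S : Set E) (p : E) : Prop :=
  ContinuousWithinAt γ S p ∧
    ∀ a ∈ A.charts, γ p ∈ a.2.source → ContDiffWithinAt ℝ ∞ (a.2 ∘ γ) S p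

/-- Smoothness at `x` of a map from a manifold to a normed space. -/
def FunAt (A : SmoothAtlas X) (h : X → F) (x : X) : Prop :=
  ∀ a ∈ A.charts, x ∈ a.2.source → ContDiffAt ℝ ∞ (h ∘ a.2.symm) (a.2 x)

theorem contDiffAt_transition {a b : Σ n : ℕ, OpenPartialHomeomorph X (EuclideanSpace ℝ (Fin n))}
    (ha : a ∈ A.charts) (hb : b ∈ A.charts) {x : X} (hxa : x ∈ a.2.source) (hxb : x ∈ b.2.source) :
    ContDiffAt ℝ ∞ (b.2 ∘ a.2.symm) (a.2 x) := by
  refine (A.compatible a ha b hb).contDiffAt ((a.2.symm ≫ₕ b.2).open_source.mem_nhds ?_)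
  simp [hxa, hxb]

/-- Transition maps are smooth, so a single chart around the point decides. -/
theorem PlotAt.of_chart {γ : E → X} {S : Set E} {p : E}
    {a : Σ n : ℕ, OpenPartialHomeomorph X (EuclideanSpace ℝ (Fin n))} (ha : a ∈ A.charts)
    (hs : γ p ∈ a.2.source) (hc : ContinuousWithinAt γ S p)
    (h : ContDiffWithinAt ℝ ∞ (a.2 ∘ γ) S p) : A.PlotAt γ S p := by
  refine ⟨hc, fun b hb hbs => ?_⟩
  have h1 : ContDiffWithinAt ℝ ∞ ((b.2 ∘ a.2.symm) ∘ (a.2 ∘ γ)) S p :=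
    (contDiffAt_transition ha hb hs hbs).comp_contDiffWithinAt p h
  refine h1.congr_of_eventuallyEq ?_ (by simp [a.2.left_inv hs])
  filter_upwards [hc (a.2.open_source.mem_nhds hs)] with q hq
  simp [a.2.left_inv hq]

theorem PlotAt.continuousAt {γ : E → X} {p : E} (h : A.PlotAt γ univ p) : ContinuousAt γ p :=
  (continuousWithinAt_univ _ _).1 h.1

theorem PlotAt.congr {γ γ' : E → X} {S : Set E} {p : E} (h : A.PlotAt γ S p)
    (he : γ' =ᶠ[𝓝[S] p] γ) (hp : γ' p = γ p) : A.PlotAt γ' S p := by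
  refine ⟨h.1.congr_of_eventuallyEq he hp, fun a ha hs => ?_⟩
  refine (h.2 a ha (hp ▸ hs)).congr_of_eventuallyEq ?_ (by simp [hp])
  filter_upwards [he] with q hq
  simp [hq]

theorem PlotAt.congr_nhds {γ γ' : E → X} {p : E} (h : A.PlotAt γ univ p)
    (he : γ' =ᶠ[𝓝 p] γ) : A.PlotAt γ' univ p :=
  h.congr (by rwa [nhdsWithin_univ]) he.self_of_nhds

theorem PlotAt.mono {γ : E → X} {S T : Set E} {p : E} (h : A.PlotAt γ S p) (hT : T ⊆ S) :
    A.PlotAt γ T p :=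
  ⟨h.1.mono hT, fun a ha hs => (h.2 a ha hs).mono hT⟩

theorem PlotAt.of_mem_nhdsWithin {γ : E → X} {S T : Set E} {p : E} (h : A.PlotAt γ S p)
    (hT : S ∈ 𝓝[T] p) : A.PlotAt γ T p :=
  ⟨h.1.mono_of_mem_nhdsWithin hT, fun a ha hs => (h.2 a ha hs).mono_of_mem_nhdsWithin hT⟩

theorem PlotAt.comp {γ : E → X} {φ : F → E} {S : Set E} {T : Set F} {p : F}
    (h : A.PlotAt γ S (φ p)) (hφ : ContDiffWithinAt ℝ ∞ φ T p) (hm : MapsTo φ T S) :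
    A.PlotAt (γ ∘ φ) T p :=
  ⟨h.1.comp hφ.continuousWithinAt hm, fun a ha hs => (h.2 a ha hs).comp p hφ hm⟩

theorem PlotAt.comp_within {γ : E → X} {φ : F → E} {T : Set F} {p : F}
    (h : A.PlotAt γ univ (φ p)) (hφ : ContDiffWithinAt ℝ ∞ φ T p) :
    A.PlotAt (γ ∘ φ) T p := h.comp hφ (mapsTo_univ _ _)

theorem PlotAt.comp_contDiffAt {γ : E → X} {φ : F → E} {p : F}
    (h : A.PlotAt γ univ (φ p)) (hφ : ContDiffAt ℝ ∞ φ p) :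
    A.PlotAt (γ ∘ φ) univ p := h.comp hφ.contDiffWithinAt (mapsTo_univ _ _)

theorem PlotAt.contDiffAt {γ : E → X} {p : E} (h : A.PlotAt γ univ p)
    {a : Σ n : ℕ, OpenPartialHomeomorph X (EuclideanSpace ℝ (Fin n))} (ha : a ∈ A.charts)
    (hs : γ p ∈ a.2.source) : ContDiffAt ℝ ∞ (a.2 ∘ γ) p :=
  contDiffWithinAt_univ.1 (h.2 a ha hs)

theorem plotAt_symm {a : Σ n : ℕ, OpenPartialHomeomorph X (EuclideanSpace ℝ (Fin n))}
    (ha : a ∈ A.charts) {p : EuclideanSpace ℝ (Fin a.1)} (hp : p ∈ a.2.target) :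
    A.PlotAt a.2.symm univ p := by
  refine PlotAt.of_chart ha (a.2.map_target hp)
    (a.2.symm.continuousAt (by simpa using hp)).continuousWithinAt ?_
  rw [contDiffWithinAt_univ]
  refine contDiffAt_id.congr_of_eventuallyEq ?_
  filter_upwards [a.2.open_target.mem_nhds hp] with q hq
  simp [a.2.right_inv hq]

theorem plotAt_const (x : X) (S : Set E) (p : E) : A.PlotAt (fun _ => x) S p :=
  ⟨continuousWithinAt_const, fun _ _ _ => contDiffWithinAt_const⟩

theorem FunAt.of_chart {h : X → F} {x : X}
    {a : Σ n : ℕ, OpenPartialHomeomorph X (EuclideanSpace ℝ (Fin n))} (ha : a ∈ A.charts)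
    (hs : x ∈ a.2.source) (hh : ContDiffAt ℝ ∞ (h ∘ a.2.symm) (a.2 x)) : A.FunAt h x := by
  intro b hb hbs
  have h1 : ContDiffAt ℝ ∞ ((h ∘ a.2.symm) ∘ (a.2 ∘ b.2.symm)) (b.2 x) := by
    refine ContDiffAt.comp _ ?_ (contDiffAt_transition hb ha hbs hs)
    simpa [b.2.left_inv hbs] using hh
  refine h1.congr_of_eventuallyEq ?_
  have : ∀ᶠ q in 𝓝 (b.2 x), b.2.symm q ∈ a.2.source := by
    refine (b.2.symm.continuousAt (by simpa using b.2.map_source hbs)).eventually ?_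
    rw [b.2.left_inv hbs]
    exact a.2.open_source.mem_nhds hs
  filter_upwards [this] with q hq
  simp [a.2.left_inv hq]

theorem funAt_chart {a : Σ n : ℕ, OpenPartialHomeomorph X (EuclideanSpace ℝ (Fin n))}
    (ha : a ∈ A.charts) {x : X} (hs : x ∈ a.2.source) : A.FunAt a.2 x := by
  refine FunAt.of_chart ha hs (contDiffAt_id.congr_of_eventuallyEq ?_)
  filter_upwards [a.2.open_target.mem_nhds (a.2.map_source hs)] with q hq
  simp [a.2.right_inv hq]

/-- The chart cancels in the middle, so the pairing of a function with a plot is an ordinary map of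
normed spaces. Most smoothness arguments below reduce to this pairing. -/
theorem FunAt.comp_plotAt {h : X → F} {γ : E → X} {S : Set E} {p : E} (hh : A.FunAt h (γ p))
    (hγ : A.PlotAt γ S p) : ContDiffWithinAt ℝ ∞ (h ∘ γ) S p := by
  obtain ⟨a, ha, hs⟩ := A.cover (γ p)
  have h1 : ContDiffWithinAt ℝ ∞ ((h ∘ a.2.symm) ∘ (a.2 ∘ γ)) S p :=
    (hh a ha hs).comp_contDiffWithinAt p (hγ.2 a ha hs)
  refine h1.congr_of_eventuallyEq ?_ (by simp [a.2.left_inv hs])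
  filter_upwards [hγ.1 (a.2.open_source.mem_nhds hs)] with q hq
  simp [a.2.left_inv hq]

theorem FunAt.comp_plot {h : X → F} {γ : E → X} {p : E} (hh : A.FunAt h (γ p))
    (hγ : A.PlotAt γ univ p) : ContDiffAt ℝ ∞ (h ∘ γ) p :=
  contDiffWithinAt_univ.1 (hh.comp_plotAt hγ)

theorem FunAt.continuousAt {h : X → F} {x : X} (hh : A.FunAt h x) : ContinuousAt h x := by
  obtain ⟨a, ha, hs⟩ := A.cover x
  have h1 := ((hh a ha hs).continuousAt).comp (a.2.continuousAt hs)
  refine h1.congr ?_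
  filter_upwards [a.2.open_source.mem_nhds hs] with q hq
  simp [a.2.left_inv hq]

/-- A function is smooth at a point if its composition with the inverse of each chart is. -/
theorem ContDiffAt.comp_funAt {h : X → E} {φ : E → F} {x : X} (hφ : ContDiffAt ℝ ∞ φ (h x))
    (hh : A.FunAt h x) : A.FunAt (φ ∘ h) x := by
  intro a ha hs
  refine ContDiffAt.comp (g := φ) (f := h ∘ a.2.symm) _ ?_ (hh a ha hs)
  simpa [a.2.left_inv hs] using hφ

theorem Smooth.plotAt {f : X → Y} (hf : Smooth A B f) {γ : E → X} {S : Set E}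
    {p : E} (hγ : A.PlotAt γ S p) : B.PlotAt (f ∘ γ) S p := by
  obtain ⟨a, ha, hsa⟩ := A.cover (γ p)
  obtain ⟨b, hb, hsb⟩ := B.cover (f (γ p))
  have hcf : ContinuousAt f (γ p) := by simpa using hf.1.continuousAt univ_mem
  have hc : ContinuousWithinAt (f ∘ γ) S p := hcf.comp_continuousWithinAt hγ.1
  refine PlotAt.of_chart hb hsb hc ?_
  have e1 : ∀ᶠ q in 𝓝[S] p, γ q ∈ a.2.source := hγ.1 (a.2.open_source.mem_nhds hsa)
  have e2 : ∀ᶠ q in 𝓝[S] p, f (γ q) ∈ b.2.source := hc (b.2.open_source.mem_nhds hsb)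
  have h0 := hf.2 a ha b hb (a.2 (γ p)) ⟨a.2.map_source hsa, by
    rw [a.2.left_inv hsa]; exact ⟨trivial, hsb⟩⟩
  have h1 : ContDiffWithinAt ℝ ∞ ((b.2 ∘ f ∘ a.2.symm) ∘ (a.2 ∘ γ)) S p := by
    refine ContDiffWithinAt.comp_of_preimage_mem_nhdsWithin p h0 (hγ.2 a ha hsa) ?_
    filter_upwards [e1, e2] with q h1 h2
    refine ⟨a.2.map_source h1, ?_⟩
    simp only [Function.comp_apply, a.2.left_inv h1]
    exact ⟨trivial, h2⟩
  refine h1.congr_of_eventuallyEq ?_ (by simp [a.2.left_inv hsa])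
  filter_upwards [e1] with q hq
  simp [a.2.left_inv hq]

theorem Smooth.continuous {f : X → Y} (hf : Smooth A B f) : Continuous f :=
  continuousOn_univ.1 hf.1

theorem Smooth.funAt {f : X → Y} (hf : Smooth A B f) {h : Y → F} {x : X}
    (hh : B.FunAt h (f x)) : A.FunAt (h ∘ f) x := by
  intro a ha hs
  have h1 := plotAt_symm ha (a.2.map_source hs)
  have h2 := hf.plotAt h1
  exact FunAt.comp_plot (γ := f ∘ a.2.symm) (by simpa [a.2.left_inv hs] using hh) h2

/-- The inverse charts are themselves plots, and testing on them recovers the definition. -/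
theorem SmoothOn.of_plotAt {f : X → Y} {S : Set X}
    (h : ∀ a ∈ A.charts, ∀ v ∈ a.2.target, a.2.symm v ∈ S →
      B.PlotAt (f ∘ a.2.symm) {v | v ∈ a.2.target ∧ a.2.symm v ∈ S} v) : SmoothOn A B f S := by
  constructor
  · intro x hx
    obtain ⟨a, ha, hs⟩ := A.cover x
    have h1 := (h a ha (a.2 x) (a.2.map_source hs) (by rwa [a.2.left_inv hs])).1
    have h2 : ContinuousWithinAt ((f ∘ a.2.symm) ∘ a.2) (S ∩ a.2.source) x := by
      refine ContinuousWithinAt.comp h1 (a.2.continuousAt hs).continuousWithinAt ?_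
      rintro q ⟨hq, hq'⟩
      exact ⟨a.2.map_source hq', by rwa [a.2.left_inv hq']⟩
    have h3 : ContinuousWithinAt f (S ∩ a.2.source) x := by
      refine h2.congr (fun q hq => ?_) (by simp [a.2.left_inv hs])
      simp [a.2.left_inv hq.2]
    exact (continuousWithinAt_inter (a.2.open_source.mem_nhds hs)).1 h3
  · rintro a ha b hb v ⟨h1, h2, h3⟩
    exact ((h a ha v h1 h2).2 b hb h3).mono (fun q hq => ⟨hq.1, hq.2.1⟩)

theorem Smooth.of_plotAt {f : X → Y}
    (h : ∀ a ∈ A.charts, ∀ v ∈ a.2.target, B.PlotAt (f ∘ a.2.symm) univ v) : Smooth A B f :=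
  SmoothOn.of_plotAt fun a ha v hv _ => (h a ha v hv).mono (subset_univ _)

theorem SmoothOn₂.plotAt {f : X → Y → Z} {T : Set (X × Y)} (hf : SmoothOn₂ A B C f T)
    {γ : E → X} {δ : E → Y} {S : Set E} {p : E} (hγ : A.PlotAt γ S p) (hδ : B.PlotAt δ S p)
    (hp : p ∈ S) (hm : ∀ q ∈ S, (γ q, δ q) ∈ T) : C.PlotAt (fun q => f (γ q) (δ q)) S p := by
  obtain ⟨a, ha, hsa⟩ := A.cover (γ p)
  obtain ⟨b, hb, hsb⟩ := B.cover (δ p)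
  obtain ⟨c, hc, hsc⟩ := C.cover (f (γ p) (δ p))
  have hcont : ContinuousWithinAt (fun q => f (γ q) (δ q)) S p :=
    ContinuousWithinAt.comp (g := fun p : X × Y => f p.1 p.2) (f := fun q => (γ q, δ q))
      (hf.1 _ (hm p hp)) (hγ.1.prodMk hδ.1) hm
  refine PlotAt.of_chart hc hsc hcont ?_
  have e1 : ∀ᶠ q in 𝓝[S] p, γ q ∈ a.2.source := hγ.1 (a.2.open_source.mem_nhds hsa)
  have e2 : ∀ᶠ q in 𝓝[S] p, δ q ∈ b.2.source := hδ.1 (b.2.open_source.mem_nhds hsb)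
  have e3 : ∀ᶠ q in 𝓝[S] p, f (γ q) (δ q) ∈ c.2.source := hcont (c.2.open_source.mem_nhds hsc)
  have h0 := hf.2 a ha b hb c hc (a.2 (γ p), b.2 (δ p)) ⟨a.2.map_source hsa, b.2.map_source hsb, by
    simp only [a.2.left_inv hsa, b.2.left_inv hsb]; exact ⟨hm p hp, hsc⟩⟩
  have h1 : ContDiffWithinAt ℝ ∞ ((fun v : EuclideanSpace ℝ (Fin a.1) × EuclideanSpace ℝ (Fin b.1) =>
        c.2 (f (a.2.symm v.1) (b.2.symm v.2))) ∘ (fun q => (a.2 (γ q), b.2 (δ q)))) S p := by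
    refine ContDiffWithinAt.comp_of_preimage_mem_nhdsWithin p h0
      ((hγ.2 a ha hsa).prodMk (hδ.2 b hb hsb)) ?_
    filter_upwards [e1, e2, e3, self_mem_nhdsWithin] with q h1 h2 h3 h4
    refine ⟨a.2.map_source h1, b.2.map_source h2, ?_⟩
    simp only [a.2.left_inv h1, b.2.left_inv h2]
    exact ⟨hm q h4, h3⟩
  refine h1.congr_of_eventuallyEq ?_ (by simp [a.2.left_inv hsa, b.2.left_inv hsb])
  filter_upwards [e1, e2] with q hq hq'
  simp [a.2.left_inv hq, b.2.left_inv hq']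

theorem SmoothOn₂.of_plotAt {f : X → Y → Z} {S : Set (X × Y)}
    (h : ∀ a ∈ A.charts, ∀ b ∈ B.charts, ∀ v : EuclideanSpace ℝ (Fin a.1) ×
      EuclideanSpace ℝ (Fin b.1), v.1 ∈ a.2.target → v.2 ∈ b.2.target →
      (a.2.symm v.1, b.2.symm v.2) ∈ S →
      C.PlotAt (fun v : EuclideanSpace ℝ (Fin a.1) × EuclideanSpace ℝ (Fin b.1) =>
        f (a.2.symm v.1) (b.2.symm v.2))
        {v | v.1 ∈ a.2.target ∧ v.2 ∈ b.2.target ∧ (a.2.symm v.1, b.2.symm v.2) ∈ S} v) :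
    SmoothOn₂ A B C f S := by
  constructor
  · rintro ⟨x, y⟩ hx
    obtain ⟨a, ha, hsa⟩ := A.cover x
    obtain ⟨b, hb, hsb⟩ := B.cover y
    have h1 := (h a ha b hb (a.2 x, b.2 y) (a.2.map_source hsa) (b.2.map_source hsb)
      (by simpa [a.2.left_inv hsa, b.2.left_inv hsb] using hx)).1
    have h2 : ContinuousWithinAt ((fun v : EuclideanSpace ℝ (Fin a.1) ×
        EuclideanSpace ℝ (Fin b.1) => f (a.2.symm v.1) (b.2.symm v.2)) ∘
        (fun q : X × Y => (a.2 q.1, b.2 q.2))) (S ∩ (a.2.source ×ˢ b.2.source)) (x, y) := by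
      refine ContinuousWithinAt.comp h1 (ContinuousAt.continuousWithinAt ?_) ?_
      · exact ((a.2.continuousAt hsa).comp (x := (x, y)) continuousAt_fst).prodMk
          ((b.2.continuousAt hsb).comp (x := (x, y)) continuousAt_snd)
      · rintro ⟨q, q'⟩ ⟨hq, hq1, hq2⟩
        exact ⟨a.2.map_source hq1, b.2.map_source hq2,
          by simpa [a.2.left_inv hq1, b.2.left_inv hq2] using hq⟩
    have h3 : ContinuousWithinAt (fun p : X × Y => f p.1 p.2)
        (S ∩ (a.2.source ×ˢ b.2.source)) (x, y) := by
      refine h2.congr (fun q hq => ?_) (by simp [a.2.left_inv hsa, b.2.left_inv hsb])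
      simp [a.2.left_inv hq.2.1, b.2.left_inv hq.2.2]
    exact (continuousWithinAt_inter ((a.2.open_source.prod b.2.open_source).mem_nhds
      ⟨hsa, hsb⟩)).1 h3
  · rintro a ha b hb c hc v ⟨h1, h2, h3, h4⟩
    exact ((h a ha b hb v h1 h2 h3).2 c hc h4).mono (fun q hq => ⟨hq.1, hq.2.1, hq.2.2.1⟩)

/-- A smooth curve of points through `x` detects surjectivity of the derivative at `x`. -/
theorem surjective_chartDeriv {f : X → Y} (hf : Smooth A B f) {x : X}
    {a : Σ n : ℕ, OpenPartialHomeomorph X (EuclideanSpace ℝ (Fin n))} (ha : a ∈ A.charts)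
    (hxa : x ∈ a.2.source)
    {b : Σ n : ℕ, OpenPartialHomeomorph Y (EuclideanSpace ℝ (Fin n))} (hb : b ∈ B.charts)
    (hxb : f x ∈ b.2.source) {γ : E → X} {p : E} (hγ : A.PlotAt γ univ p) (hp : γ p = x)
    (hs : Function.Surjective (fderiv ℝ (b.2 ∘ f ∘ γ) p)) :
    Function.Surjective (chartDeriv f a b x) := by
  subst hp
  have h1 : ContDiffAt ℝ ∞ (a.2 ∘ γ) p := hγ.contDiffAt ha hxa
  have h2 : ContDiffAt ℝ ∞ (b.2 ∘ f ∘ a.2.symm) (a.2 (γ p)) :=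
    (hf.funAt (funAt_chart hb hxb)) a ha hxa
  have h3 : b.2 ∘ f ∘ γ =ᶠ[𝓝 p] (b.2 ∘ f ∘ a.2.symm) ∘ (a.2 ∘ γ) := by
    filter_upwards [hγ.continuousAt (a.2.open_source.mem_nhds hxa)] with q hq
    simp [a.2.left_inv hq]
  rw [h3.fderiv_eq, fderiv_comp p (h2.differentiableAt (by simp)) (h1.differentiableAt (by simp))]
    at hs
  exact Function.Surjective.of_comp (g := fderiv ℝ (a.2 ∘ γ) p) hs

/-- Dual to `surjective_chartDeriv`: the derivative of `h ∘ f` factors through that of `f`, so a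
function `h` on the target can detect injectivity. -/
theorem injective_chartDeriv {f : X → Y} (hf : Smooth A B f) {x : X}
    {a : Σ n : ℕ, OpenPartialHomeomorph X (EuclideanSpace ℝ (Fin n))} (ha : a ∈ A.charts)
    (hxa : x ∈ a.2.source)
    {b : Σ n : ℕ, OpenPartialHomeomorph Y (EuclideanSpace ℝ (Fin n))} (hb : b ∈ B.charts)
    (hxb : f x ∈ b.2.source) {h : Y → E} (hh : B.FunAt h (f x))
    (hs : Function.Injective (fderiv ℝ (h ∘ f ∘ a.2.symm) (a.2 x))) :
    Function.Injective (chartDeriv f a b x) := by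
  have h1 : ContDiffAt ℝ ∞ (h ∘ b.2.symm) (b.2 (f x)) := hh b hb hxb
  have h2 : ContDiffAt ℝ ∞ (b.2 ∘ f ∘ a.2.symm) (a.2 x) :=
    (hf.funAt (funAt_chart hb hxb)) a ha hxa
  have hc : ContinuousAt (f ∘ a.2.symm) (a.2 x) :=
    ContinuousAt.comp (by simpa [a.2.left_inv hxa] using hf.continuous.continuousAt)
      (a.2.symm.continuousAt (by simpa using a.2.map_source hxa))
  have h3 : h ∘ f ∘ a.2.symm =ᶠ[𝓝 (a.2 x)] (h ∘ b.2.symm) ∘ (b.2 ∘ f ∘ a.2.symm) := by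
    filter_upwards [hc (b.2.open_source.mem_nhds (by simpa [a.2.left_inv hxa] using hxb))] with q hq
    simp only [Function.comp_apply]
    rw [b.2.left_inv (x := f (a.2.symm q)) hq]
  rw [h3.fderiv_eq, fderiv_comp (a.2 x) (by
    simpa [a.2.left_inv hxa] using h1.differentiableAt (by simp)) (h2.differentiableAt (by simp))]
    at hs
  exact Function.Injective.of_comp hs

/-- A smooth map with smooth local sections through all points is a submersion. -/
theorem Submersion.of_sections {f : X → Y} (hf : Smooth A B f)
    (h : ∀ x, ∃ b ∈ B.charts, f x ∈ b.2.source ∧ ∃ γ : EuclideanSpace ℝ (Fin b.1) → X,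
      A.PlotAt γ univ (b.2 (f x)) ∧ γ (b.2 (f x)) = x ∧
      ∀ᶠ q in 𝓝 (b.2 (f x)), f (γ q) = b.2.symm q) : Submersion A B f := by
  refine ⟨hf, fun x a ha b hb hxa hxb => ?_⟩
  obtain ⟨b', hb', hxb', γ, hγ, hγx, hs⟩ := h x
  refine surjective_chartDeriv hf ha hxa hb hxb hγ hγx ?_
  have h1 : b.2 ∘ f ∘ γ =ᶠ[𝓝 (b'.2 (f x))] b.2 ∘ b'.2.symm := by
    filter_upwards [hs] with q hq
    simp [hq]
  rw [h1.fderiv_eq]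
  have t1 := contDiffAt_transition hb' hb hxb' hxb
  have t2 := contDiffAt_transition hb hb' hxb hxb'
  -- The section lives in the chart `b'`, while the derivative is asked for in `b`. The opposite
  -- transition supplies a right inverse of the derivative of the transition.
  have h2 : (b.2 ∘ b'.2.symm) ∘ (b'.2 ∘ b.2.symm) =ᶠ[𝓝 (b.2 (f x))] id := by
    have : ∀ᶠ q in 𝓝 (b.2 (f x)), b.2.symm q ∈ b'.2.source := by
      refine (b.2.symm.continuousAt (by simpa using b.2.map_source hxb)).eventually ?_
      rw [b.2.left_inv hxb]
      exact b'.2.open_source.mem_nhds hxb'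
    filter_upwards [this, b.2.open_target.mem_nhds (b.2.map_source hxb)] with q hq hq'
    simp [b'.2.left_inv hq, b.2.right_inv hq']
  have h3 := h2.fderiv_eq (𝕜 := ℝ)
  have e : (b'.2 ∘ b.2.symm) (b.2 (f x)) = b'.2 (f x) := by simp [b.2.left_inv hxb]
  rw [fderiv_comp _ (by rw [e]; exact t1.differentiableAt (by simp))
    (t2.differentiableAt (by simp)), e, fderiv_id] at h3
  intro v
  exact ⟨_, DFunLike.congr_fun h3 v⟩

end SmoothAtlas

/-! ### Inverse function theorem and normal form of submersions. -/

/-- The inverse function theorem, with smoothness of the inverse in a neighbourhood. -/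
theorem exists_smooth_localInverse {E F : Type*} [NormedAddCommGroup E] [NormedSpace ℝ E]
    [NormedAddCommGroup F] [NormedSpace ℝ F] [CompleteSpace E] {Q : E → F} {v₀ : E}
    (hQ : ∀ᶠ v in 𝓝 v₀, ContDiffAt ℝ ∞ Q v) (Q' : E ≃L[ℝ] F)
    (hQ' : HasFDerivAt Q (Q' : E →L[ℝ] F) v₀) :
    ∃ R : F → E, (∀ᶠ w in 𝓝 (Q v₀), ContDiffAt ℝ ∞ R w ∧ Q (R w) = w) ∧
      ∀ᶠ v in 𝓝 v₀, R (Q v) = v := by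
  have h := hQ.self_of_nhds
  set e := h.toOpenPartialHomeomorph Q hQ' (by simp) with he
  have hs : v₀ ∈ e.source := h.mem_toOpenPartialHomeomorph_source hQ' (by simp)
  have ht : Q v₀ ∈ e.target := h.image_mem_toOpenPartialHomeomorph_target hQ' (by simp)
  have hcoe : (e : E → F) = Q := h.toOpenPartialHomeomorph_coe hQ' (by simp)
  refine ⟨e.symm, ?_, ?_⟩
  · have hc : ContinuousAt (fderiv ℝ Q) v₀ :=
      (h.fderiv_right (m := 0) (by simp)).continuousAt
    -- Invertible operators form an open set, so the derivative stays invertible near `v₀` and the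
    -- inverse is smooth near `Q v₀`, not just at that point.
    have h1 : ∀ᶠ v in 𝓝 v₀, fderiv ℝ Q v ∈ range ((↑) : (E ≃L[ℝ] F) → (E →L[ℝ] F)) := by
      refine hc.eventually ?_
      rw [hQ'.fderiv]
      exact Q'.nhds
    have hsc : Tendsto e.symm (𝓝 (Q v₀)) (𝓝 v₀) := by
      have := e.symm.continuousAt (x := Q v₀) (by simpa using ht)
      have h2 := e.left_inv hs
      rw [hcoe] at h2
      rwa [ContinuousAt, h2] at this
    filter_upwards [e.open_target.mem_nhds ht, hsc.eventually h1, hsc.eventually hQ]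
      with w hw ⟨L, hL⟩ hw2
    refine ⟨e.contDiffAt_symm (f₀' := L) hw ?_ ?_, ?_⟩
    · rw [hcoe, hL]
      exact (hw2.differentiableAt (by simp)).hasFDerivAt
    · rwa [hcoe]
    · rw [← hcoe]; exact e.right_inv hw
  · filter_upwards [e.open_source.mem_nhds hs] with v hv
    rw [← hcoe]; exact e.left_inv hv

namespace SmoothAtlas

variable {X : Type u} [TopologicalSpace X] {A : SmoothAtlas X}
  {F : Type*} [NormedAddCommGroup F] [NormedSpace ℝ F]

/-- Adapted coordinates for a submersion `f` onto a normed space: `x ↦ (f x, η x)` is a local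
diffeomorphism with inverse `θ`. -/
theorem exists_submersion_coordinates [FiniteDimensional ℝ F] {f : X → F} {x₀ : X}
    (hf : ∀ᶠ x in 𝓝 x₀, A.FunAt f x)
    {a : Σ n : ℕ, OpenPartialHomeomorph X (EuclideanSpace ℝ (Fin n))} (ha : a ∈ A.charts)
    (hxa : x₀ ∈ a.2.source) (hs : Function.Surjective (fderiv ℝ (f ∘ a.2.symm) (a.2 x₀))) :
    ∃ (d : ℕ) (θ : F × EuclideanSpace ℝ (Fin d) → X) (η : X → EuclideanSpace ℝ (Fin d)),
      η x₀ = 0 ∧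
      (∀ᶠ q in 𝓝 (f x₀, (0 : EuclideanSpace ℝ (Fin d))),
        A.PlotAt θ univ q ∧ f (θ q) = q.1 ∧ η (θ q) = q.2) ∧
      ∀ᶠ x in 𝓝 x₀, A.FunAt η x ∧ θ (f x, η x) = x := by
  set L := fderiv ℝ (f ∘ a.2.symm) (a.2 x₀) with hL
  set d := Module.finrank ℝ (LinearMap.ker L.toLinearMap) with hd
  let ι : EuclideanSpace ℝ (Fin d) ≃L[ℝ] LinearMap.ker L.toLinearMap :=
    ContinuousLinearEquiv.ofFinrankEq (by simp [hd])
  let j : EuclideanSpace ℝ (Fin d) →ₗ[ℝ] EuclideanSpace ℝ (Fin a.1) :=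
    (LinearMap.ker L.toLinearMap).subtype ∘ₗ ι.toLinearMap
  have hj : ∀ q, L (j q) = 0 := fun q => (ι q).2
  -- A projection onto the kernel of `L` complements the surjection `L` to an isomorphism, the
  -- derivative of the coordinate map.
  obtain ⟨g, hg⟩ := LinearMap.exists_leftInverse_of_injective j (by
    rw [LinearMap.ker_eq_bot]
    exact Subtype.val_injective.comp ι.injective)
  have hgj : ∀ q, g (j q) = q := fun q => LinearMap.congr_fun hg q
  let P : EuclideanSpace ℝ (Fin a.1) →L[ℝ] EuclideanSpace ℝ (Fin d) := g.toContinuousLinearMap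
  have hP : ∀ q, P (j q) = q := hgj
  have hbij : Function.Bijective (L.prod P) := by
    constructor
    · refine (injective_iff_map_eq_zero _).2 fun v hv => ?_
      obtain ⟨h1, h2⟩ := Prod.mk_inj.1 hv
      obtain ⟨q, hq⟩ := ι.surjective ⟨v, h1⟩
      have hjq : j q = v := congrArg Subtype.val hq
      have h3 := hP q
      rw [hjq] at h3
      rw [← hjq, ← h3, show P v = 0 from h2, map_zero]
    · rintro ⟨p, q⟩
      obtain ⟨v, hv⟩ := hs p
      refine ⟨v + j (q - P v), Prod.ext ?_ ?_⟩
      · simp [hv, hj]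
      · simp [hP]
  let Q' : EuclideanSpace ℝ (Fin a.1) ≃L[ℝ] F × EuclideanSpace ℝ (Fin d) :=
    ContinuousLinearEquiv.ofBijective (L.prod P) (LinearMap.ker_eq_bot.2 hbij.1)
      (LinearMap.range_eq_top.2 hbij.2)
  let η : X → EuclideanSpace ℝ (Fin d) := fun x => P (a.2 x - a.2 x₀)
  have hη : ∀ x ∈ a.2.source, A.FunAt η x := fun x hx =>
    ContDiffAt.comp_funAt (φ := fun v => P (v - a.2 x₀)) (by fun_prop) (funAt_chart ha hx)
  let Q : EuclideanSpace ℝ (Fin a.1) → F × EuclideanSpace ℝ (Fin d) :=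
    fun v => (f (a.2.symm v), η (a.2.symm v))
  have ht : a.2 x₀ ∈ a.2.target := a.2.map_source hxa
  have hts : Tendsto a.2.symm (𝓝 (a.2 x₀)) (𝓝 x₀) := by
    have := a.2.symm.continuousAt (x := a.2 x₀) (by simpa using ht)
    rwa [ContinuousAt, a.2.left_inv hxa] at this
  have hQ : ∀ᶠ v in 𝓝 (a.2 x₀), ContDiffAt ℝ ∞ Q v := by
    filter_upwards [hts.eventually hf, a.2.open_target.mem_nhds ht] with v hv hv2
    exact (hv.comp_plot (plotAt_symm ha hv2)).prodMk
      ((hη _ (a.2.map_target hv2)).comp_plot (plotAt_symm ha hv2))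
  have hf0 : HasFDerivAt (f ∘ a.2.symm) L (a.2 x₀) :=
    ((hf.self_of_nhds a ha hxa).differentiableAt (by simp)).hasFDerivAt
  have hQ' : HasFDerivAt Q (Q' : EuclideanSpace ℝ (Fin a.1) →L[ℝ] _) (a.2 x₀) := by
    refine HasFDerivAt.prodMk hf0 ?_
    have h1 : HasFDerivAt (fun v => P (v - a.2 x₀)) P (a.2 x₀) :=
      P.hasFDerivAt.comp _ ((hasFDerivAt_id _).sub_const _)
    refine h1.congr_of_eventuallyEq ?_
    filter_upwards [a.2.open_target.mem_nhds ht] with v hv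
    simp [η, a.2.right_inv hv]
  have hη0 : η x₀ = 0 := by simp [η]
  have hQ0 : Q (a.2 x₀) = (f x₀, 0) := by simp [Q, a.2.left_inv hxa, hη0]
  obtain ⟨R, hR1, hR2⟩ := exists_smooth_localInverse hQ Q' hQ'
  have hR0 := hR2.self_of_nhds
  rw [hQ0] at hR1 hR0
  have hRc : Tendsto R (𝓝 (f x₀, 0)) (𝓝 (a.2 x₀)) := by
    have := hR1.self_of_nhds.1.continuousAt
    rwa [ContinuousAt, hR0] at this
  refine ⟨d, fun q => a.2.symm (R q), η, hη0, ?_, ?_⟩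
  · filter_upwards [hR1, hRc.eventually (a.2.open_target.mem_nhds ht)] with q hq hq2
    exact ⟨(plotAt_symm ha hq2).comp_contDiffAt hq.1, congrArg Prod.fst hq.2,
      congrArg Prod.snd hq.2⟩
  · filter_upwards [a.2.open_source.mem_nhds hxa, (a.2.continuousAt hxa).eventually hR2]
      with x hx hx2
    refine ⟨hη x hx, ?_⟩
    simp only [Q, a.2.left_inv hx] at hx2
    simp only [hx2, a.2.left_inv hx]

end SmoothAtlas

/-! ### Embedded submanifolds and quotient manifolds. -/

/-- Locally inverse continuous maps restrict to an open partial homeomorphism, whose source and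
target can be chosen inside given neighbourhoods. -/
theorem exists_openPartialHomeomorph {X Y : Type*} [TopologicalSpace X] [TopologicalSpace Y]
    {f : X → Y} {g : Y → X} {x₀ : X} {P : X → Prop} {R : Y → Prop}
    (hf : ∀ᶠ x in 𝓝 x₀, ContinuousAt f x ∧ g (f x) = x)
    (hg : ∀ᶠ y in 𝓝 (f x₀), ContinuousAt g y ∧ f (g y) = y)
    (hP : ∀ᶠ x in 𝓝 x₀, P x) (hR : ∀ᶠ y in 𝓝 (f x₀), R y) :
    ∃ e : OpenPartialHomeomorph X Y, (∀ x, e x = f x) ∧ (∀ y, e.symm y = g y) ∧ x₀ ∈ e.source ∧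
      (∀ x ∈ e.source, P x) ∧ ∀ y ∈ e.target, R y := by
  obtain ⟨U, hU, hUo, hxU⟩ := eventually_nhds_iff.1 (hf.and hP)
  obtain ⟨V, hV, hVo, hxV⟩ := eventually_nhds_iff.1 (hg.and hR)
  have cf : ContinuousOn f U := fun x hx => (hU x hx).1.1.continuousWithinAt
  have cg : ContinuousOn g V := fun y hy => (hV y hy).1.1.continuousWithinAt
  refine ⟨{ toFun := f, invFun := g, source := U ∩ f ⁻¹' V, target := V ∩ g ⁻¹' U
            map_source' := ?_, map_target' := ?_, left_inv' := ?_, right_inv' := ?_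
            open_source := cf.isOpen_inter_preimage hUo hVo
            open_target := cg.isOpen_inter_preimage hVo hUo
            continuousOn_toFun := cf.mono inter_subset_left
            continuousOn_invFun := cg.mono inter_subset_left },
    fun _ => rfl, fun _ => rfl, ⟨hxU, hxV⟩, fun x hx => (hU x hx.1).2, fun y hy => (hV y hy.1).2⟩
  · rintro x ⟨h1, h2⟩
    exact ⟨h2, by rw [mem_preimage, (hU x h1).1.2]; exact h1⟩
  · rintro y ⟨h1, h2⟩
    exact ⟨h2, by rw [mem_preimage, (hV y h1).1.2]; exact h1⟩
  · rintro x ⟨h1, h2⟩; exact (hU x h1).1.2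
  · rintro y ⟨h1, h2⟩; exact (hV y h1).1.2

namespace SmoothAtlas

variable {X : Type u} [TopologicalSpace X] {A : SmoothAtlas X}
  {E : Type*} [NormedAddCommGroup E] [NormedSpace ℝ E]

/-- A chart of a subset `S` of a manifold is adapted if its inverse is smooth as a map to the
manifold, and it extends locally to smooth functions on the manifold. -/
def IsSubChart (A : SmoothAtlas X) (S : Set X) {m : ℕ}
    (e : OpenPartialHomeomorph S (EuclideanSpace ℝ (Fin m))) : Prop :=
  (∀ v ∈ e.target, A.PlotAt (fun v => (e.symm v : X)) univ v) ∧
    ∀ k ∈ e.source, ∃ h : X → EuclideanSpace ℝ (Fin m), A.FunAt h k ∧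
      ∀ᶠ k' : S in 𝓝 k, h k' = e k'

/-- Near each point `e'` extends to a smooth function on the ambient manifold, and the inverse of
`e` is an ambient plot. The transition map is their pairing. -/
theorem IsSubChart.contDiffOn {S : Set X} {m m' : ℕ}
    {e : OpenPartialHomeomorph S (EuclideanSpace ℝ (Fin m))}
    {e' : OpenPartialHomeomorph S (EuclideanSpace ℝ (Fin m'))}
    (he : A.IsSubChart S e) (he' : A.IsSubChart S e') :
    ContDiffOn ℝ ∞ (e' ∘ e.symm) (e.symm ≫ₕ e').source := by
  intro v hv
  have h1 : v ∈ e.target := by simpa using hv.1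
  have h2 : e.symm v ∈ e'.source := hv.2
  obtain ⟨h, hh, hh'⟩ := he'.2 _ h2
  have h3 := FunAt.comp_plot (γ := fun v => (e.symm v : X)) hh (he.1 v h1)
  refine (h3.congr_of_eventuallyEq ?_).contDiffWithinAt
  filter_upwards [(e.symm.continuousAt (x := v) (by simpa using h1)).eventually hh'] with q hq
  exact hq.symm

/-- The manifold structure of an embedded submanifold. -/
def subAtlas (A : SmoothAtlas X) (S : Set X)
    (hS : ∀ k : S, ∃ (m : ℕ) (e : OpenPartialHomeomorph S (EuclideanSpace ℝ (Fin m))),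
      A.IsSubChart S e ∧ k ∈ e.source) : SmoothAtlas S where
  charts := {e | A.IsSubChart S e.2}
  cover k := by
    obtain ⟨m, e, he, hk⟩ := hS k
    exact ⟨⟨m, e⟩, he, hk⟩
  compatible _ ha _ hb := IsSubChart.contDiffOn ha hb

section Sub

variable {S : Set X} {hS : ∀ k : S, ∃ (m : ℕ)
  (e : OpenPartialHomeomorph S (EuclideanSpace ℝ (Fin m))), A.IsSubChart S e ∧ k ∈ e.source}

theorem subAtlas_smooth_val : Smooth (A.subAtlas S hS) A Subtype.val :=
  Smooth.of_plotAt fun _ ha v hv => ha.1 v hv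

/-- Universal property of an embedded submanifold: the charts extend to ambient functions, so
smoothness may be checked in the ambient manifold. -/
theorem subAtlas_plotAt {γ : E → S} {T : Set E} {p : E} (h : A.PlotAt (fun q => (γ q : X)) T p) :
    (A.subAtlas S hS).PlotAt γ T p := by
  have hc : ContinuousWithinAt γ T p :=
    (IsInducing.continuousWithinAt_iff (g := Subtype.val) IsInducing.subtypeVal).2 h.1
  obtain ⟨e, he, hs⟩ := (A.subAtlas S hS).cover (γ p)
  refine PlotAt.of_chart he hs hc ?_
  obtain ⟨f, hf, hf'⟩ := he.2 _ hs
  have h1 := FunAt.comp_plotAt (γ := fun q => (γ q : X)) hf h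
  refine h1.congr_of_eventuallyEq ?_ hf'.self_of_nhds.symm
  filter_upwards [hc.eventually hf'] with q hq
  exact hq.symm

theorem subAtlas_embedding : Embedding (A.subAtlas S hS) A Subtype.val := by
  refine ⟨subAtlas_smooth_val, IsEmbedding.subtypeVal, fun x a ha b hb hxa hxb => ?_⟩
  obtain ⟨h, hh, hh'⟩ := ha.2 x hxa
  refine injective_chartDeriv subAtlas_smooth_val ha hxa hb hxb hh ?_
  have h1 : h ∘ Subtype.val ∘ a.2.symm =ᶠ[𝓝 (a.2 x)] id := by
    have : Tendsto a.2.symm (𝓝 (a.2 x)) (𝓝 x) := by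
      have := a.2.symm.continuousAt (x := a.2 x) (by simpa using a.2.map_source hxa)
      rwa [ContinuousAt, a.2.left_inv hxa] at this
    filter_upwards [this.eventually hh', a.2.open_target.mem_nhds (a.2.map_source hxa)] with q h1 h2
    simp [h1, a.2.right_inv h2]
  rw [h1.fderiv_eq (𝕜 := ℝ), fderiv_id]
  exact fun _ _ h => h

end Sub

/-- A chart of a quotient `π : X → Q` of a manifold is adapted if it is smooth on the manifold, and
its inverse lifts smoothly through each point of the manifold. -/
def IsQuotChart {Q : Type v} [TopologicalSpace Q] (A : SmoothAtlas X) (π : X → Q) {m : ℕ}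
    (e : OpenPartialHomeomorph Q (EuclideanSpace ℝ (Fin m))) : Prop :=
  ∀ x, π x ∈ e.source → A.FunAt (e ∘ π) x ∧
    ∃ γ : EuclideanSpace ℝ (Fin m) → X, A.PlotAt γ univ (e (π x)) ∧ γ (e (π x)) = x ∧
      ∀ᶠ v in 𝓝 (e (π x)), π (γ v) = e.symm v

/-- The manifold structure of the base of a submersion `π`. -/
def quotAtlas {Q : Type v} [TopologicalSpace Q] (A : SmoothAtlas X) (π : X → Q)
    (hπ : Function.Surjective π)
    (h : ∀ x, ∃ (m : ℕ) (e : OpenPartialHomeomorph Q (EuclideanSpace ℝ (Fin m))),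
      A.IsQuotChart π e ∧ π x ∈ e.source) : SmoothAtlas Q where
  charts := {e | A.IsQuotChart π e.2}
  cover k := by
    obtain ⟨x, rfl⟩ := hπ k
    obtain ⟨m, e, he, hk⟩ := h x
    exact ⟨⟨m, e⟩, he, hk⟩
  compatible a ha b hb := by
    intro v hv
    have h1 : v ∈ a.2.target := by simpa using hv.1
    have h2 : a.2.symm v ∈ b.2.source := hv.2
    obtain ⟨x, hx⟩ := hπ (a.2.symm v)
    have h3 : a.2 (π x) = v := by rw [hx, a.2.right_inv h1]
    -- With a lift `γ` of the inverse of `a`, the transition map is `b ∘ π` evaluated along `γ`.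
    obtain ⟨-, γ, hγ, hγx, hs⟩ := ha x (by rw [hx]; exact a.2.map_target h1)
    have h4 := (hb x (hx ▸ h2)).1
    rw [h3] at hγ hγx hs
    rw [← hγx] at h4
    refine ((h4.comp_plot hγ).congr_of_eventuallyEq ?_).contDiffWithinAt
    filter_upwards [hs] with q hq
    simp [hq]

section Quot

variable {Q : Type v} [TopologicalSpace Q] {π : X → Q} {hπ : Function.Surjective π}
  {h : ∀ x, ∃ (m : ℕ) (e : OpenPartialHomeomorph Q (EuclideanSpace ℝ (Fin m))),
      A.IsQuotChart π e ∧ π x ∈ e.source}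

theorem quotAtlas_smooth (hc : Continuous π) : Smooth A (A.quotAtlas π hπ h) π := by
  refine Smooth.of_plotAt fun a ha v hv => ?_
  obtain ⟨b, hb, hs⟩ := (A.quotAtlas π hπ h).cover (π (a.2.symm v))
  have h1 := plotAt_symm ha hv
  refine PlotAt.of_chart hb hs
    (hc.continuousAt.comp h1.continuousAt).continuousWithinAt ?_
  exact FunAt.comp_plotAt (h := b.2 ∘ π) (hb _ hs).1 h1

theorem quotAtlas_submersion (hc : Continuous π) : Submersion A (A.quotAtlas π hπ h) π := by
  refine Submersion.of_sections (quotAtlas_smooth hc) fun x => ?_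
  obtain ⟨b, hb, hs⟩ := (A.quotAtlas π hπ h).cover (π x)
  exact ⟨b, hb, hs, (hb x hs).2⟩

/-- Inverse charts lift through any prescribed point of the fibre, hence so do plots. This is what
allows structure maps of a quotient to be checked upstairs. -/
theorem quotAtlas_lift {γ : E → Q} {T : Set E} {p : E} (hγ : (A.quotAtlas π hπ h).PlotAt γ T p)
    {x : X} (hx : π x = γ p) :
    ∃ δ : E → X, A.PlotAt δ T p ∧ δ p = x ∧ ∀ᶠ q in 𝓝[T] p, π (δ q) = γ q := by
  obtain ⟨b, hb, hs⟩ := (A.quotAtlas π hπ h).cover (π x)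
  obtain ⟨-, σ, hσ, hσx, hσ'⟩ := hb x hs
  have h1 := hγ.2 b hb (hx ▸ hs)
  rw [hx] at hσ hσx hσ' hs
  refine ⟨σ ∘ (b.2 ∘ γ), PlotAt.comp_within (φ := b.2 ∘ γ) hσ h1, hσx, ?_⟩
  filter_upwards [h1.continuousWithinAt.eventually hσ', hγ.1 (b.2.open_source.mem_nhds hs)]
    with q h2 h3
  simp only [Function.comp_apply] at h2 ⊢
  rw [h2, b.2.left_inv h3]

end Quot

end SmoothAtlas

/-! ### Groupoid algebra and coordinates adapted to the source map. -/

namespace LieGroupoid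
open SmoothAtlas

variable {M : Type v} [TopologicalSpace M] {A : SmoothAtlas M}
  {G : Type u} [TopologicalSpace G] {B : SmoothAtlas G} (Γ : LieGroupoid A B)
  {E : Type*} [NormedAddCommGroup E] [NormedSpace ℝ E]

theorem continuous_src : Continuous Γ.src := Γ.src_submersion.1.continuous
theorem continuous_tgt : Continuous Γ.tgt := Γ.tgt_submersion.1.continuous
theorem continuous_inv : Continuous Γ.inv := Γ.smooth_inv.continuous
theorem continuous_unit : Continuous Γ.unit := Γ.smooth_unit.continuous

theorem continuousWithinAt_mul {Λ : Type*} [TopologicalSpace Λ] {f g : Λ → G} {S : Set Λ} {x : Λ}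
    (hf : ContinuousWithinAt f S x) (hg : ContinuousWithinAt g S x)
    (h : ∀ y ∈ S, Γ.src (f y) = Γ.tgt (g y)) (hx : x ∈ S) :
    ContinuousWithinAt (fun y => Γ.mul (f y) (g y)) S x :=
  ContinuousWithinAt.comp (g := fun p : G × G => Γ.mul p.1 p.2) (f := fun q => (f q, g q))
    (Γ.smooth_mul.1 _ (h x hx)) (hf.prodMk hg) h

theorem continuousOn_mul {Λ : Type*} [TopologicalSpace Λ] {f g : Λ → G} {S : Set Λ}
    (hf : ContinuousOn f S) (hg : ContinuousOn g S)
    (h : ∀ y ∈ S, Γ.src (f y) = Γ.tgt (g y)) : ContinuousOn (fun y => Γ.mul (f y) (g y)) S :=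
  fun x hx => Γ.continuousWithinAt_mul (hf x hx) (hg x hx) h hx

theorem continuousAt_mul {Λ : Type*} [TopologicalSpace Λ] {f g : Λ → G} {x : Λ}
    (hf : ContinuousAt f x) (hg : ContinuousAt g x)
    (h : ∀ᶠ y in 𝓝 x, Γ.src (f y) = Γ.tgt (g y)) :
    ContinuousAt (fun y => Γ.mul (f y) (g y)) x :=
  (Γ.continuousWithinAt_mul hf.continuousWithinAt hg.continuousWithinAt (fun _ hy => hy)
    (S := {y | Γ.src (f y) = Γ.tgt (g y)}) h.self_of_nhds).continuousAt h

variable {Γ} in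
theorem plotAt_mul {f g : E → G} {S : Set E} {x : E} (hf : B.PlotAt f S x) (hg : B.PlotAt g S x)
    (h : ∀ y ∈ S, Γ.src (f y) = Γ.tgt (g y)) (hx : x ∈ S) :
    B.PlotAt (fun y => Γ.mul (f y) (g y)) S x :=
  Γ.smooth_mul.plotAt hf hg hx h

variable {Γ} in
-- Composition is smooth only relative to the set of composable pairs. That restriction disappears
-- when the pairs are composable on a whole neighbourhood.
theorem plotAt_mul_nhds {f g : E → G} {x : E} (hf : B.PlotAt f univ x) (hg : B.PlotAt g univ x)
    (h : ∀ᶠ y in 𝓝 x, Γ.src (f y) = Γ.tgt (g y)) :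
    B.PlotAt (fun y => Γ.mul (f y) (g y)) univ x :=
  (plotAt_mul (S := {y | Γ.src (f y) = Γ.tgt (g y)}) (hf.mono (subset_univ _))
    (hg.mono (subset_univ _)) (fun _ hy => hy) h.self_of_nhds).of_mem_nhdsWithin
    (by rw [nhdsWithin_univ]; exact h)

variable {g h k : G}

theorem inv_mul_cancel_left (hgh : Γ.src g = Γ.tgt h) : Γ.mul (Γ.inv g) (Γ.mul g h) = h := by
  rw [← Γ.mul_assoc _ _ _ (Γ.src_inv g) hgh, Γ.inv_mul, hgh, Γ.unit_mul]

theorem mul_inv_cancel_left (hgh : Γ.tgt g = Γ.tgt h) : Γ.mul g (Γ.mul (Γ.inv g) h) = h := by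
  rw [← Γ.mul_assoc _ _ _ (Γ.tgt_inv g).symm ((Γ.src_inv g).trans hgh), Γ.mul_inv, hgh, Γ.unit_mul]

theorem mul_inv_cancel_right (hgh : Γ.src g = Γ.tgt h) : Γ.mul (Γ.mul g h) (Γ.inv h) = g := by
  rw [Γ.mul_assoc _ _ _ hgh (Γ.tgt_inv h).symm, Γ.mul_inv, ← hgh, Γ.mul_unit]

theorem inv_mul_cancel_right (hgh : Γ.src g = Γ.src h) : Γ.mul (Γ.mul g (Γ.inv h)) h = g := by
  rw [Γ.mul_assoc _ _ _ (hgh.trans (Γ.tgt_inv h).symm) (Γ.src_inv h), Γ.inv_mul, ← hgh, Γ.mul_unit]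

theorem inv_eq_of_mul (hgh : Γ.src g = Γ.tgt h) (h1 : Γ.mul g h = Γ.unit (Γ.tgt g)) :
    Γ.inv g = h := by
  rw [← Γ.inv_mul_cancel_left hgh, h1, ← Γ.src_inv g, Γ.mul_unit]

theorem inv_unit (x : M) : Γ.inv (Γ.unit x) = Γ.unit x := by
  refine Γ.inv_eq_of_mul (by rw [Γ.src_unit, Γ.tgt_unit]) ?_
  have := Γ.mul_unit (Γ.unit x)
  rw [Γ.src_unit] at this
  rw [this, Γ.tgt_unit]

theorem inv_inv (g : G) : Γ.inv (Γ.inv g) = g :=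
  Γ.inv_eq_of_mul (Γ.src_inv g) (by rw [Γ.inv_mul, Γ.tgt_inv])

theorem inv_mul_rev (hgh : Γ.src g = Γ.tgt h) :
    Γ.inv (Γ.mul g h) = Γ.mul (Γ.inv h) (Γ.inv g) := by
  have h1 : Γ.src (Γ.inv h) = Γ.tgt (Γ.inv g) := by rw [Γ.src_inv, Γ.tgt_inv, hgh]
  refine Γ.inv_eq_of_mul ?_ ?_
  · rw [Γ.src_mul _ _ hgh, Γ.tgt_mul _ _ h1, Γ.tgt_inv]
  · rw [Γ.mul_assoc _ _ _ hgh (by rw [Γ.tgt_mul _ _ h1, Γ.tgt_inv]),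
      Γ.mul_inv_cancel_left (by rw [Γ.tgt_inv, hgh]), Γ.mul_inv, Γ.tgt_mul _ _ hgh]

/-- Coordinates on the arrows that are adapted to the source map. -/
theorem exists_src_coordinates (g : G)
    {a : Σ n : ℕ, OpenPartialHomeomorph M (EuclideanSpace ℝ (Fin n))} (ha : a ∈ A.charts)
    (hga : Γ.src g ∈ a.2.source) :
    ∃ (d : ℕ) (θ : EuclideanSpace ℝ (Fin a.1) × EuclideanSpace ℝ (Fin d) → G)
      (η : G → EuclideanSpace ℝ (Fin d)), η g = 0 ∧
      (∀ᶠ q in 𝓝 (a.2 (Γ.src g), (0 : EuclideanSpace ℝ (Fin d))),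
        B.PlotAt θ univ q ∧ Γ.src (θ q) = a.2.symm q.1 ∧ η (θ q) = q.2) ∧
      ∀ᶠ h in 𝓝 g, B.FunAt η h ∧ θ (a.2 (Γ.src h), η h) = h := by
  obtain ⟨b, hb, hgb⟩ := B.cover g
  have hsrc : ∀ᶠ h in 𝓝 g, Γ.src h ∈ a.2.source :=
    Γ.continuous_src.continuousAt.eventually (a.2.open_source.mem_nhds hga)
  obtain ⟨d, θ, η, h0, h1, h2⟩ := exists_submersion_coordinates (A := B) (f := a.2 ∘ Γ.src)
    (x₀ := g) (by
      filter_upwards [hsrc] with h hh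
      exact Γ.src_submersion.1.funAt (funAt_chart ha hh)) hb hgb
    (Γ.src_submersion.2 g b hb a ha hgb hga)
  refine ⟨d, θ, η, h0, ?_, h2⟩
  have hθg : θ (a.2 (Γ.src g), 0) = g := by
    have := h2.self_of_nhds.2
    rwa [h0] at this
  have hc : Tendsto θ (𝓝 (a.2 (Γ.src g), 0)) (𝓝 g) := by
    have := h1.self_of_nhds.1.continuousAt
    simp only [Function.comp_apply] at this
    rwa [ContinuousAt, hθg] at this
  filter_upwards [h1, hc.eventually hsrc] with q hq hq2
  refine ⟨hq.1, ?_, hq.2.2⟩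
  rw [← hq.2.1, Function.comp_apply, a.2.left_inv hq2]

end LieGroupoid

/-! ### The constant rank argument for regular groupoids. -/

/-- A subspace of dimension `r` is mapped onto `ℝʳ` by some linear map of the ambient space. -/
theorem exists_continuousLinearMap_surjOn {V : Type*} [NormedAddCommGroup V] [NormedSpace ℝ V]
    [FiniteDimensional ℝ V] (R : Submodule ℝ V) {r : ℕ} (hr : Module.finrank ℝ R = r) :
    ∃ ℓ : V →L[ℝ] EuclideanSpace ℝ (Fin r), ∀ q, ∃ v ∈ R, ℓ v = q := by
  let ι : EuclideanSpace ℝ (Fin r) ≃L[ℝ] R := ContinuousLinearEquiv.ofFinrankEq (by simp [hr])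
  let j : EuclideanSpace ℝ (Fin r) →ₗ[ℝ] V := R.subtype ∘ₗ ι.toLinearMap
  obtain ⟨g, hg⟩ := LinearMap.exists_leftInverse_of_injective j (by
    rw [LinearMap.ker_eq_bot]
    exact Subtype.val_injective.comp ι.injective)
  exact ⟨g.toContinuousLinearMap, fun q => ⟨ι q, (ι q).2, LinearMap.congr_fun hg q⟩⟩

namespace SmoothAtlas

variable {X : Type u} [TopologicalSpace X] {Y : Type v} [TopologicalSpace Y]
  {A : SmoothAtlas X} {B : SmoothAtlas Y}
  {E : Type*} [NormedAddCommGroup E] [NormedSpace ℝ E]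
  {F : Type*} [NormedAddCommGroup F] [NormedSpace ℝ F]
  {F' : Type*} [NormedAddCommGroup F'] [NormedSpace ℝ F']

theorem FunAt.prodMk {f : X → F} {g : X → F'} {x : X} (hf : A.FunAt f x) (hg : A.FunAt g x) :
    A.FunAt (fun x => (f x, g x)) x :=
  fun a ha hs => (hf a ha hs).prodMk (hg a ha hs)

/-- The chain rule. -/
theorem fderiv_comp_plot {f : X → Y} (hf : Smooth A B f)
    {a : Σ n : ℕ, OpenPartialHomeomorph X (EuclideanSpace ℝ (Fin n))} (ha : a ∈ A.charts)
    {b : Σ n : ℕ, OpenPartialHomeomorph Y (EuclideanSpace ℝ (Fin n))} (hb : b ∈ B.charts)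
    {γ : E → X} {p : E} (hγ : A.PlotAt γ univ p)
    (hxa : γ p ∈ a.2.source) (hxb : f (γ p) ∈ b.2.source) :
    fderiv ℝ (fun q => b.2 (f (γ q))) p =
      (chartDeriv f a b (γ p)).comp (fderiv ℝ (fun q => a.2 (γ q)) p) := by
  have h1 : ContDiffAt ℝ ∞ (a.2 ∘ γ) p := hγ.contDiffAt ha hxa
  have h2 : ContDiffAt ℝ ∞ (b.2 ∘ f ∘ a.2.symm) (a.2 (γ p)) :=
    (hf.funAt (funAt_chart hb hxb)) a ha hxa
  have h3 : (fun q => b.2 (f (γ q))) =ᶠ[𝓝 p] (b.2 ∘ f ∘ a.2.symm) ∘ (a.2 ∘ γ) := by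
    filter_upwards [hγ.continuousAt (a.2.open_source.mem_nhds hxa)] with q hq
    simp [a.2.left_inv hq]
  rw [h3.fderiv_eq, fderiv_comp p (h2.differentiableAt (by simp)) (h1.differentiableAt (by simp))]
  rfl

end SmoothAtlas

namespace LieGroupoid
open SmoothAtlas

variable {M : Type v} [TopologicalSpace M] {A : SmoothAtlas M}
  {G : Type u} [TopologicalSpace G] {B : SmoothAtlas G} (Γ : LieGroupoid A B)

/-- Near an arrow of a regular groupoid, the source and `r` functions of the target, where `r` is
the rank, are the components of a submersion. They determine the target locally. -/
theorem IsRegular.exists_coordinates {Γ : LieGroupoid A B} (hreg : Γ.IsRegular) (g₀ : G)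
    {a : Σ n : ℕ, OpenPartialHomeomorph M (EuclideanSpace ℝ (Fin n))} (ha : a ∈ A.charts)
    (hga : Γ.src g₀ ∈ a.2.source)
    {a' : Σ n : ℕ, OpenPartialHomeomorph M (EuclideanSpace ℝ (Fin n))} (ha' : a' ∈ A.charts)
    (hga' : Γ.tgt g₀ ∈ a'.2.source) :
    ∃ (r : ℕ) (ℓ : EuclideanSpace ℝ (Fin a'.1) →L[ℝ] EuclideanSpace ℝ (Fin r)) (d : ℕ)
      (θ : (EuclideanSpace ℝ (Fin a.1) × EuclideanSpace ℝ (Fin r)) × EuclideanSpace ℝ (Fin d) → G)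
      (η : G → EuclideanSpace ℝ (Fin d)), η g₀ = 0 ∧
      (∀ᶠ q in 𝓝 ((a.2 (Γ.src g₀), ℓ (a'.2 (Γ.tgt g₀))), (0 : EuclideanSpace ℝ (Fin d))),
        B.PlotAt θ univ q ∧ Γ.src (θ q) = a.2.symm q.1.1 ∧ a.2 (Γ.src (θ q)) = q.1.1 ∧
        ℓ (a'.2 (Γ.tgt (θ q))) = q.1.2 ∧ η (θ q) = q.2) ∧
      (∀ᶠ g in 𝓝 g₀, B.FunAt η g ∧ θ ((a.2 (Γ.src g), ℓ (a'.2 (Γ.tgt g))), η g) = g) ∧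
      ∃ W ∈ 𝓝 g₀, ∀ g ∈ W, ∀ g' ∈ W, Γ.src g = Γ.src g' →
        ℓ (a'.2 (Γ.tgt g)) = ℓ (a'.2 (Γ.tgt g')) → Γ.tgt g = Γ.tgt g' := by
  obtain ⟨rk, hrk, hrank⟩ := hreg
  obtain ⟨b, hb, hgb⟩ := B.cover g₀
  obtain ⟨r, hr⟩ : ∃ r, rk (Γ.src g₀) = r := ⟨_, rfl⟩
  -- `ℓ` is chosen to map the r-dimensional image of the kernel of the source derivative, under the
  -- target derivative, onto `ℝʳ`.
  obtain ⟨ℓ, hℓ⟩ := exists_continuousLinearMap_surjOn _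
    ((hrank g₀ b hb a ha a' ha' hgb hga hga').trans hr)
  set f : G → EuclideanSpace ℝ (Fin a.1) × EuclideanSpace ℝ (Fin r) :=
    fun g => (a.2 (Γ.src g), ℓ (a'.2 (Γ.tgt g))) with hf
  have hsrc : ∀ᶠ h in 𝓝 g₀, Γ.src h ∈ a.2.source :=
    Γ.continuous_src.continuousAt.eventually (a.2.open_source.mem_nhds hga)
  have htgt : ∀ᶠ h in 𝓝 g₀, Γ.tgt h ∈ a'.2.source :=
    Γ.continuous_tgt.continuousAt.eventually (a'.2.open_source.mem_nhds hga')
  have hfs : ∀ᶠ g in 𝓝 g₀, B.FunAt f g := by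
    filter_upwards [hsrc, htgt] with g h1 h2
    exact (Γ.src_submersion.1.funAt (funAt_chart ha h1)).prodMk
      (ContDiffAt.comp_funAt (φ := ℓ) ℓ.contDiff.contDiffAt
        (Γ.tgt_submersion.1.funAt (funAt_chart ha' h2)))
  have hsurj : Function.Surjective (fderiv ℝ (f ∘ b.2.symm) (b.2 g₀)) := by
    have d1 : HasFDerivAt (a.2 ∘ Γ.src ∘ b.2.symm) (chartDeriv Γ.src b a g₀) (b.2 g₀) :=
      ((Γ.src_submersion.1.funAt (funAt_chart ha hga) b hb hgb).differentiableAt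
        (by simp)).hasFDerivAt
    have d2 : HasFDerivAt (a'.2 ∘ Γ.tgt ∘ b.2.symm) (chartDeriv Γ.tgt b a' g₀) (b.2 g₀) :=
      ((Γ.tgt_submersion.1.funAt (funAt_chart ha' hga') b hb hgb).differentiableAt
        (by simp)).hasFDerivAt
    have d3 : HasFDerivAt (f ∘ b.2.symm) ((chartDeriv Γ.src b a g₀).prod
        (ℓ.comp (chartDeriv Γ.tgt b a' g₀))) (b.2 g₀) :=
      d1.prodMk (ℓ.hasFDerivAt.comp _ d2)
    rw [d3.fderiv]
    rintro ⟨p, q⟩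
    obtain ⟨u, hu⟩ := Γ.src_submersion.2 g₀ b hb a ha hgb hga p
    -- `u` has the right source component; a vector `w` tangent to the source fibre corrects the
    -- second component without changing the first.
    obtain ⟨_, ⟨w, hw, rfl⟩, hw'⟩ := hℓ (q - ℓ (chartDeriv Γ.tgt b a' g₀ u))
    have hw0 : chartDeriv Γ.src b a g₀ w = 0 := hw
    have hw1 : ℓ (chartDeriv Γ.tgt b a' g₀ w) = q - ℓ (chartDeriv Γ.tgt b a' g₀ u) := hw'
    refine ⟨u + w, Prod.ext ?_ ?_⟩
    · simp [hu, hw0]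
    · simp [hw1]
  obtain ⟨d, θ, η, h0, h1, h2⟩ := exists_submersion_coordinates (A := B) hfs hb hgb hsurj
  have hθg : θ (f g₀, 0) = g₀ := by
    have := h2.self_of_nhds.2
    rwa [h0] at this
  have hc : Tendsto θ (𝓝 (f g₀, 0)) (𝓝 g₀) := by
    have := h1.self_of_nhds.1.continuousAt
    rwa [ContinuousAt, hθg] at this
  refine ⟨r, ℓ, d, θ, η, h0, ?_, h2, ?_⟩
  · filter_upwards [h1, hc.eventually hsrc] with q hq hq2
    have e1 : a.2 (Γ.src (θ q)) = q.1.1 := congrArg Prod.fst hq.2.1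
    exact ⟨hq.1, by rw [← e1, a.2.left_inv hq2], e1, congrArg Prod.snd hq.2.1, hq.2.2⟩
  have hrk' : ∀ᶠ g in 𝓝 g₀, rk (Γ.src g) = r :=
    Γ.continuous_src.continuousAt.eventually
      ((hrk.isOpen_fiber r).mem_nhds hr)
  have hev : ∀ᶠ q in 𝓝 (f g₀, (0 : EuclideanSpace ℝ (Fin d))),
      (B.PlotAt θ univ q ∧ f (θ q) = q.1 ∧ η (θ q) = q.2) ∧ Γ.src (θ q) ∈ a.2.source ∧
      Γ.tgt (θ q) ∈ a'.2.source ∧ θ q ∈ b.2.source ∧ rk (Γ.src (θ q)) = r := by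
    filter_upwards [h1, hc.eventually hsrc, hc.eventually htgt,
      hc.eventually (b.2.open_source.mem_nhds hgb), hc.eventually hrk'] with q h1 h2 h3 h4 h5
    exact ⟨h1, h2, h3, h4, h5⟩
  rw [nhds_prod_eq, eventually_prod_iff] at hev
  obtain ⟨pa, hpa, pb, hpb, hab⟩ := hev
  obtain ⟨ε, hε, hball⟩ := Metric.eventually_nhds_iff_ball.1 hpb
  have hηc : Tendsto η (𝓝 g₀) (𝓝 0) := by
    have := h2.self_of_nhds.1.continuousAt
    rwa [ContinuousAt, h0] at this
  -- `pa` is needed on a neighbourhood of `f g` since derivatives in all directions are taken there.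
  -- The ball makes the slices over a fixed value of `f` connected.
  refine ⟨{g | (∀ᶠ p in 𝓝 (f g), pa p) ∧ η g ∈ Metric.ball 0 ε ∧ θ (f g, η g) = g ∧ Γ.tgt g ∈ a'.2.source}, ?_, ?_⟩
  · have hfc : Tendsto f (𝓝 g₀) (𝓝 (f g₀)) := hfs.self_of_nhds.continuousAt
    filter_upwards [hfc.eventually hpa.eventually_nhds, hηc.eventually (Metric.ball_mem_nhds 0 hε), h2, htgt]
      with g k1 k2 k3 k4
    exact ⟨k1, k2, k3.2, k4⟩
  rintro g ⟨k1, k2, k3, k4⟩ g' ⟨k1', k2', k3', k4'⟩ hs ht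
  have hfg : f g' = f g := by simp only [hf, hs, ht]
  rw [hfg] at k3'
  set p := f g with hp
  -- The target is constant on the slice over `p`, because its derivative along the slice vanishes.
  have key : a'.2 (Γ.tgt (θ (p, η g))) = a'.2 (Γ.tgt (θ (p, η g'))) := by
    have hd : ∀ w ∈ Metric.ball (0 : EuclideanSpace ℝ (Fin d)) ε,
        HasFDerivAt (fun w => a'.2 (Γ.tgt (θ (p, w))))
          (0 : EuclideanSpace ℝ (Fin d) →L[ℝ] EuclideanSpace ℝ (Fin a'.1)) w := by
      intro w hw
      obtain ⟨⟨c1, -, -⟩, c2, c3, c4, c5⟩ := hab k1.self_of_nhds (hball w hw)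
      have ev : ∀ᶠ q in 𝓝 (p, w), f (θ q) = q.1 := by
        rw [nhds_prod_eq]
        have o1 : ∀ᶠ w' in 𝓝 w, w' ∈ Metric.ball (0 : EuclideanSpace ℝ (Fin d)) ε :=
          Metric.isOpen_ball.mem_nhds hw
        filter_upwards [k1.prod_mk o1] with q hq
        exact (hab hq.1 (hball _ hq.2)).1.2.1
      set T := fderiv ℝ (fun q => b.2 (θ q)) (p, w) with hT
      have t1 : ∀ x, chartDeriv Γ.src b a (θ (p, w)) (T x) = x.1.1 := by
        intro x
        have e1 := fderiv_comp_plot Γ.src_submersion.1 hb ha c1 c4 c2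
        have e2 : (fun q => a.2 (Γ.src (θ q))) =ᶠ[𝓝 (p, w)] fun q => q.1.1 := by
          filter_upwards [ev] with q hq
          exact congrArg Prod.fst hq
        rw [e2.fderiv_eq] at e1
        have e3 : fderiv ℝ (fun q : (EuclideanSpace ℝ (Fin a.1) × EuclideanSpace ℝ (Fin r)) ×
            EuclideanSpace ℝ (Fin d) => q.1.1) (p, w) =
            (ContinuousLinearMap.fst ℝ _ _).comp (ContinuousLinearMap.fst ℝ _ _) :=
          HasFDerivAt.fderiv (hasFDerivAt_fst.comp _ hasFDerivAt_fst)
        rw [e3] at e1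
        exact (DFunLike.congr_fun e1 x).symm
      have t0 := fderiv_comp_plot Γ.tgt_submersion.1 hb ha' c1 c4 c3
      have dt : DifferentiableAt ℝ (fun q => a'.2 (Γ.tgt (θ q))) (p, w) :=
        ((FunAt.comp_plot (h := a'.2 ∘ Γ.tgt)
          (Γ.tgt_submersion.1.funAt (funAt_chart ha' c3)) c1)).differentiableAt (by simp)
      have t2 : ∀ x, ℓ (chartDeriv Γ.tgt b a' (θ (p, w)) (T x)) = x.1.2 := by
        intro x
        have e1 : HasFDerivAt (fun q => ℓ (a'.2 (Γ.tgt (θ q)))) (ℓ.comp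
            ((chartDeriv Γ.tgt b a' (θ (p, w))).comp T)) (p, w) := by
          refine ℓ.hasFDerivAt.comp _ ?_
          rw [← t0]
          exact dt.hasFDerivAt
        have e2 : (fun q => ℓ (a'.2 (Γ.tgt (θ q)))) =ᶠ[𝓝 (p, w)] fun q => q.1.2 := by
          filter_upwards [ev] with q hq
          exact congrArg Prod.snd hq
        have e3 : HasFDerivAt (fun q : (EuclideanSpace ℝ (Fin a.1) × EuclideanSpace ℝ (Fin r)) ×
            EuclideanSpace ℝ (Fin d) => q.1.2)
            ((ContinuousLinearMap.snd ℝ _ _).comp (ContinuousLinearMap.fst ℝ _ _)) (p, w) :=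
          hasFDerivAt_snd.comp _ hasFDerivAt_fst
        exact DFunLike.congr_fun ((e1.congr_of_eventuallyEq e2.symm).unique e3) x
      set R := Submodule.map (chartDeriv Γ.tgt b a' (θ (p, w))).toLinearMap
          (LinearMap.ker (chartDeriv Γ.src b a (θ (p, w))).toLinearMap) with hR
      have hRr : Module.finrank ℝ R = r := by
        rw [← c5]; exact hrank _ b hb a ha a' ha' c4 c2 c3
      have hmem : ∀ x, x.1.1 = 0 → chartDeriv Γ.tgt b a' (θ (p, w)) (T x) ∈ R := fun x hx =>
        Submodule.mem_map.2 ⟨T x, by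
          rw [LinearMap.mem_ker]; exact (t1 x).trans hx, rfl⟩
      -- Constancy of the rank is used here: `R` still has dimension `r` at the nearby arrow, and
      -- `ℓ` still maps it onto `ℝʳ`, so `ℓ` is injective on `R`.
      have hinj : Function.Injective (ℓ.toLinearMap.domRestrict R) := by
        rw [LinearMap.injective_iff_surjective_of_finrank_eq_finrank (by simp [hRr])]
        intro z
        exact ⟨⟨_, hmem ((0, z), 0) rfl⟩, t2 ((0, z), 0)⟩
      -- Vectors along the slice are tangent to the source fibre and keep `ℓ ∘ tgt` fixed, so their
      -- images lie in `R` and are killed by `ℓ`.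
      have hzero : ∀ x, chartDeriv Γ.tgt b a' (θ (p, w)) (T ((0, 0), x)) = 0 := by
        intro x
        have := @hinj ⟨_, hmem ((0, 0), x) rfl⟩ 0 (by
          rw [map_zero]; exact t2 ((0, 0), x))
        exact congrArg Subtype.val this
      have e1 : HasFDerivAt (fun w => a'.2 (Γ.tgt (θ (p, w))))
          (((chartDeriv Γ.tgt b a' (θ (p, w))).comp T).comp (ContinuousLinearMap.inr ℝ _ _)) w := by
        refine HasFDerivAt.comp w (g := fun q => a'.2 (Γ.tgt (θ q))) (f := fun w => (p, w)) ?_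
          (hasFDerivAt_prodMk_right p w)
        rw [← t0]
        exact dt.hasFDerivAt
      convert e1 using 1
      ext x : 1
      exact (hzero x).symm
    exact Metric.isOpen_ball.is_const_of_fderiv_eq_zero (𝕜 := ℝ)
      (convex_ball (0 : EuclideanSpace ℝ (Fin d)) ε).isPreconnected
      (fun w hw => (hd w hw).differentiableAt.differentiableWithinAt)
      (fun w hw => (hd w hw).fderiv) k2 k2'
  rw [k3, k3'] at key
  exact a'.2.injOn k4 k4' key

end LieGroupoid

/-! ### Smoothness at a point of maps between manifolds. -/

namespace SmoothAtlas

variable {X : Type u} [TopologicalSpace X] {Y : Type v} [TopologicalSpace Y]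
  {A : SmoothAtlas X} {B : SmoothAtlas Y}
  {E : Type*} [NormedAddCommGroup E] [NormedSpace ℝ E]
  {F : Type*} [NormedAddCommGroup F] [NormedSpace ℝ F]

/-- Smoothness at a point of a map between manifolds. -/
def MapAt (A : SmoothAtlas X) (B : SmoothAtlas Y) (f : X → Y) (x : X) : Prop :=
  ∀ a ∈ A.charts, x ∈ a.2.source → B.PlotAt (f ∘ a.2.symm) univ (a.2 x)

theorem MapAt.plotAt {f : X → Y} {γ : E → X} {S : Set E} {p : E} (hf : MapAt A B f (γ p))
    (hγ : A.PlotAt γ S p) : B.PlotAt (f ∘ γ) S p := by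
  obtain ⟨a, ha, hs⟩ := A.cover (γ p)
  refine (PlotAt.comp_within (hf a ha hs) (φ := a.2 ∘ γ) (hγ.2 a ha hs)).congr ?_
    (by simp [a.2.left_inv hs])
  filter_upwards [hγ.1 (a.2.open_source.mem_nhds hs)] with q hq
  simp [a.2.left_inv hq]

theorem MapAt.continuousAt {f : X → Y} {x : X} (hf : MapAt A B f x) : ContinuousAt f x := by
  obtain ⟨a, ha, hs⟩ := A.cover x
  refine ((hf a ha hs).continuousAt.comp (a.2.continuousAt hs)).congr ?_
  filter_upwards [a.2.open_source.mem_nhds hs] with q hq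
  simp [a.2.left_inv hq]

theorem FunAt.comp_mapAt {h : Y → F} {f : X → Y} {x : X} (hh : B.FunAt h (f x))
    (hf : MapAt A B f x) : A.FunAt (h ∘ f) x := fun a ha hs =>
  FunAt.comp_plot (γ := f ∘ a.2.symm) (by simpa [a.2.left_inv hs] using hh) (hf a ha hs)

theorem mapAt_id (x : X) : MapAt A A id x := fun _ ha hs => plotAt_symm ha (PartialEquiv.map_source _ hs)

theorem PlotAt.mapAt_comp {γ : E → Y} {h : X → E} {x : X} (hγ : B.PlotAt γ univ (h x))
    (hh : A.FunAt h x) : MapAt A B (γ ∘ h) x := fun a ha hs =>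
  PlotAt.comp_contDiffAt (φ := h ∘ a.2.symm) (by simpa [a.2.left_inv hs] using hγ) (hh a ha hs)

theorem tendsto_symm {a : Σ n : ℕ, OpenPartialHomeomorph X (EuclideanSpace ℝ (Fin n))} {x : X}
    (hs : x ∈ a.2.source) : Tendsto a.2.symm (𝓝 (a.2 x)) (𝓝 x) := by
  have := a.2.symm.continuousAt (x := a.2 x) (by simpa using a.2.map_source hs)
  rwa [ContinuousAt, a.2.left_inv hs] at this

end SmoothAtlas

/-! ### The core: identity components of the isotropy groups, and their local sections. -/

namespace LieGroupoid
open SmoothAtlas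

variable {M : Type v} [TopologicalSpace M] {A : SmoothAtlas M}
  {G : Type u} [TopologicalSpace G] {B : SmoothAtlas G} (Γ : LieGroupoid A B)

variable {Γ} in
theorem mapAt_mul {X : Type*} [TopologicalSpace X] {C : SmoothAtlas X} {f g : X → G} {x : X}
    (hf : MapAt C B f x) (hg : MapAt C B g x) (h : ∀ᶠ y in 𝓝 x, Γ.src (f y) = Γ.tgt (g y)) :
    MapAt C B (fun y => Γ.mul (f y) (g y)) x := fun a ha hs =>
  plotAt_mul_nhds (f := f ∘ a.2.symm) (g := g ∘ a.2.symm) (hf a ha hs) (hg a ha hs)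
    ((tendsto_symm hs).eventually h)

/-- The isotropy group of `x`. -/
def isotropy (x : M) : Set G := {g | Γ.src g = x ∧ Γ.tgt g = x}

/-- The identity component of the isotropy group of `x`. -/
def coreAt (x : M) : Set G := connectedComponentIn (Γ.isotropy x) (Γ.unit x)

/-- The union of the identity components of the isotropy groups. -/
def core : Set G := {g | g ∈ Γ.coreAt (Γ.src g)}

theorem unit_mem_isotropy (x : M) : Γ.unit x ∈ Γ.isotropy x := ⟨Γ.src_unit x, Γ.tgt_unit x⟩

theorem coreAt_subset_isotropy (x : M) : Γ.coreAt x ⊆ Γ.isotropy x := connectedComponentIn_subset _ _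

theorem unit_mem_coreAt (x : M) : Γ.unit x ∈ Γ.coreAt x :=
  mem_connectedComponentIn (Γ.unit_mem_isotropy x)

theorem isPreconnected_coreAt (x : M) : IsPreconnected (Γ.coreAt x) :=
  isPreconnected_connectedComponentIn

variable {Γ} {g h k : G} {x : M}

theorem src_of_mem_coreAt (hk : k ∈ Γ.coreAt x) : Γ.src k = x := (Γ.coreAt_subset_isotropy x hk).1
theorem tgt_of_mem_coreAt (hk : k ∈ Γ.coreAt x) : Γ.tgt k = x := (Γ.coreAt_subset_isotropy x hk).2

theorem mem_core_of_mem_coreAt (hk : k ∈ Γ.coreAt x) : k ∈ Γ.core := by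
  have := src_of_mem_coreAt hk
  subst this
  exact hk

theorem tgt_eq_src_of_mem_core (hk : k ∈ Γ.core) : Γ.tgt k = Γ.src k := tgt_of_mem_coreAt hk

/-- The left translate of the component by `g` is connected and contains `g` itself, so it lies in
the component of `g`, which is that of the unit. -/
theorem mul_mem_coreAt (hg : g ∈ Γ.coreAt x) (hh : h ∈ Γ.coreAt x) : Γ.mul g h ∈ Γ.coreAt x := by
  have hc : ContinuousOn (fun h => Γ.mul g h) (Γ.coreAt x) :=
    Γ.continuousOn_mul continuousOn_const continuousOn_id fun y hy =>
      (src_of_mem_coreAt hg).trans (tgt_of_mem_coreAt hy).symm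
  have h1 := (Γ.isPreconnected_coreAt x).image _ hc
  have h2 : (fun h => Γ.mul g h) '' Γ.coreAt x ⊆ Γ.isotropy x := by
    rintro _ ⟨y, hy, rfl⟩
    have e : Γ.src g = Γ.tgt y := by rw [src_of_mem_coreAt hg, tgt_of_mem_coreAt hy]
    exact ⟨by simp [Γ.src_mul _ _ e, src_of_mem_coreAt hy],
      by simp [Γ.tgt_mul _ _ e, tgt_of_mem_coreAt hg]⟩
  have h3 : g ∈ (fun h => Γ.mul g h) '' Γ.coreAt x :=
    ⟨Γ.unit x, Γ.unit_mem_coreAt x, by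
      have := Γ.mul_unit g
      rwa [src_of_mem_coreAt hg] at this⟩
  have h4 := h1.subset_connectedComponentIn h3 h2 ⟨h, hh, rfl⟩
  rwa [← connectedComponentIn_eq hg] at h4

theorem inv_mem_coreAt (hg : g ∈ Γ.coreAt x) : Γ.inv g ∈ Γ.coreAt x := by
  have h1 := (Γ.isPreconnected_coreAt x).image _ Γ.continuous_inv.continuousOn
  refine h1.subset_connectedComponentIn ⟨_, Γ.unit_mem_coreAt x, Γ.inv_unit x⟩ ?_ ⟨g, hg, rfl⟩
  rintro _ ⟨y, hy, rfl⟩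
  exact ⟨by rw [Γ.src_inv, tgt_of_mem_coreAt hy], by rw [Γ.tgt_inv, src_of_mem_coreAt hy]⟩

/-- Conjugation by `g` is continuous and takes the unit at the source to the unit at the target.
This normality makes the quotient by the core a groupoid. -/
theorem conj_mem_coreAt (g : G) (hk : k ∈ Γ.coreAt (Γ.src g)) :
    Γ.mul (Γ.mul g k) (Γ.inv g) ∈ Γ.coreAt (Γ.tgt g) := by
  have e1 : ∀ y ∈ Γ.coreAt (Γ.src g), Γ.src g = Γ.tgt y := fun y hy => (tgt_of_mem_coreAt hy).symm
  have e2 : ∀ y ∈ Γ.coreAt (Γ.src g), Γ.src (Γ.mul g y) = Γ.tgt (Γ.inv g) := fun y hy => by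
    rw [Γ.src_mul _ _ (e1 y hy), src_of_mem_coreAt hy, Γ.tgt_inv]
  have hc : ContinuousOn (fun y => Γ.mul (Γ.mul g y) (Γ.inv g)) (Γ.coreAt (Γ.src g)) :=
    Γ.continuousOn_mul (Γ.continuousOn_mul continuousOn_const continuousOn_id e1)
      continuousOn_const e2
  refine ((Γ.isPreconnected_coreAt _).image _ hc).subset_connectedComponentIn
    ⟨_, Γ.unit_mem_coreAt _, by simp [Γ.mul_unit, Γ.mul_inv]⟩ ?_ ⟨k, hk, rfl⟩
  rintro _ ⟨y, hy, rfl⟩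
  exact ⟨by simp [Γ.src_mul _ _ (e2 y hy), Γ.src_inv],
    by simp [Γ.tgt_mul _ _ (e2 y hy), Γ.tgt_mul _ _ (e1 y hy)]⟩

theorem mul_mem_core (hg : g ∈ Γ.core) (hh : h ∈ Γ.core) (e : Γ.src g = Γ.tgt h) :
    Γ.mul g h ∈ Γ.core := by
  have e' : Γ.src h = Γ.src g := by rw [e, tgt_eq_src_of_mem_core hh]
  exact mem_core_of_mem_coreAt (mul_mem_coreAt hg (e' ▸ hh))

theorem inv_mem_core (hg : g ∈ Γ.core) : Γ.inv g ∈ Γ.core :=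
  mem_core_of_mem_coreAt (inv_mem_coreAt hg)

theorem unit_mem_core (x : M) : Γ.unit x ∈ Γ.core := mem_core_of_mem_coreAt (Γ.unit_mem_coreAt x)

/-- Coordinates on the isotropy of a regular groupoid near a unit. -/
theorem IsRegular.exists_isotropy_coordinates (hreg : Γ.IsRegular) (x₀ : M)
    {a : Σ n : ℕ, OpenPartialHomeomorph M (EuclideanSpace ℝ (Fin n))} (ha : a ∈ A.charts)
    (hxa : x₀ ∈ a.2.source) :
    ∃ (d : ℕ) (κ : EuclideanSpace ℝ (Fin a.1) × EuclideanSpace ℝ (Fin d) → G)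
      (η : G → EuclideanSpace ℝ (Fin d)), η (Γ.unit x₀) = 0 ∧
      (∀ᶠ q in 𝓝 (a.2 x₀, (0 : EuclideanSpace ℝ (Fin d))),
        B.PlotAt κ univ q ∧ κ q ∈ Γ.coreAt (a.2.symm q.1) ∧ η (κ q) = q.2) ∧
      ∀ᶠ g in 𝓝 (Γ.unit x₀), B.FunAt η g ∧
        (Γ.src g = Γ.tgt g → κ (a.2 (Γ.src g), η g) = g ∧ g ∈ Γ.core) := by
  obtain ⟨r, ℓ, d, θ, η, h0, h1, h2, W, hW, hWW⟩ := hreg.exists_coordinates (Γ.unit x₀) ha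
    (by rwa [Γ.src_unit]) ha (by rwa [Γ.tgt_unit])
  rw [Γ.src_unit, Γ.tgt_unit] at h1
  have hax : a.2 x₀ ∈ a.2.target := a.2.map_source hxa
  -- Near the unit an arrow is isotropic exactly when `ℓ` takes the same value at its source and its
  -- target; substituting `ℓ q.1` for the target coordinates parametrizes such arrows.
  set κ : EuclideanSpace ℝ (Fin a.1) × EuclideanSpace ℝ (Fin d) → G :=
    fun q => θ ((q.1, ℓ q.1), q.2) with hκ
  have hθ0 : θ ((a.2 x₀, ℓ (a.2 x₀)), 0) = Γ.unit x₀ := by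
    have := h2.self_of_nhds.2
    rwa [h0, Γ.src_unit, Γ.tgt_unit] at this
  have hfst : Tendsto (fun q : EuclideanSpace ℝ (Fin a.1) × EuclideanSpace ℝ (Fin d) => q.1)
      (𝓝 (a.2 x₀, 0)) (𝓝 (a.2 x₀)) := continuousAt_fst
  have hι : Tendsto (fun q : EuclideanSpace ℝ (Fin a.1) × EuclideanSpace ℝ (Fin d) =>
      ((q.1, ℓ q.1), q.2)) (𝓝 (a.2 x₀, 0)) (𝓝 ((a.2 x₀, ℓ (a.2 x₀)), 0)) :=
    Continuous.tendsto' (by fun_prop) _ _ rfl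
  have hκp : ∀ᶠ q in 𝓝 (a.2 x₀, (0 : EuclideanSpace ℝ (Fin d))), B.PlotAt κ univ q ∧
      Γ.src (κ q) = a.2.symm q.1 ∧ η (κ q) = q.2 ∧ ℓ (a.2 (Γ.tgt (κ q))) = ℓ q.1 := by
    filter_upwards [hι.eventually h1] with q hq
    refine ⟨PlotAt.comp_contDiffAt (γ := θ) hq.1 (by fun_prop), hq.2.1, hq.2.2.2.2, hq.2.2.2.1⟩
  have hκc : Tendsto κ (𝓝 (a.2 x₀, 0)) (𝓝 (Γ.unit x₀)) := by
    have := hκp.self_of_nhds.1.continuousAt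
    rwa [ContinuousAt, show κ (a.2 x₀, 0) = Γ.unit x₀ from hθ0] at this
  have hunit : Tendsto (fun y => Γ.unit (a.2.symm y)) (𝓝 (a.2 x₀)) (𝓝 (Γ.unit x₀)) :=
    (Γ.continuous_unit.tendsto x₀).comp (tendsto_symm hxa)
  -- The arrow `κ q` is compared with the unit over the same point: they share the source and the
  -- value of `ℓ` at the target, hence the target.
  have hκt : ∀ᶠ q in 𝓝 (a.2 x₀, (0 : EuclideanSpace ℝ (Fin d))),
      Γ.tgt (κ q) = a.2.symm q.1 := by
    filter_upwards [hκp, hκc.eventually hW, (hunit.comp hfst).eventually hW,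
      hfst.eventually (a.2.open_target.mem_nhds hax)] with q hq q1 q2 q3
    have := hWW _ q1 _ q2 (by rw [hq.2.1, Function.comp_apply, Γ.src_unit])
      (by rw [hq.2.2.2, Function.comp_apply, Γ.tgt_unit, a.2.right_inv q3])
    rw [this, Function.comp_apply, Γ.tgt_unit]
  have hs : Tendsto Γ.src (𝓝 (Γ.unit x₀)) (𝓝 x₀) := by
    simpa only [Γ.src_unit] using Γ.continuous_src.tendsto (Γ.unit x₀)
  have hsa : Tendsto (fun g => a.2 (Γ.src g)) (𝓝 (Γ.unit x₀)) (𝓝 (a.2 x₀)) :=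
    (a.2.continuousAt hxa).tendsto.comp hs
  have hηc : Tendsto η (𝓝 (Γ.unit x₀)) (𝓝 0) := by
    have := h2.self_of_nhds.1.continuousAt
    rwa [ContinuousAt, h0] at this
  have hloc : ∀ᶠ g in 𝓝 (Γ.unit x₀), Γ.src g = Γ.tgt g → κ (a.2 (Γ.src g), η g) = g := by
    filter_upwards [h2] with g hg e
    have := hg.2
    rwa [← e] at this
  -- The isotropy near the unit is sliced, over each point, by the continuous image of a ball. Such
  -- a slice is connected and contains the unit over that point.
  have hcore : ∀ᶠ g in 𝓝 (Γ.unit x₀), Γ.src g = Γ.tgt g → g ∈ Γ.core := by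
    have hev := hκp.and hκt
    rw [nhds_prod_eq, eventually_prod_iff] at hev
    obtain ⟨pa, hpa, pb, hpb, hab⟩ := hev
    obtain ⟨ε, hε, hball⟩ := Metric.eventually_nhds_iff_ball.1 hpb
    have hus : Tendsto (fun g => Γ.unit (Γ.src g)) (𝓝 (Γ.unit x₀)) (𝓝 (Γ.unit x₀)) :=
      (Γ.continuous_unit.tendsto x₀).comp hs
    filter_upwards [hsa.eventually hpa, hηc.eventually (Metric.ball_mem_nhds 0 hε), hloc,
      hus.eventually hloc, (hηc.comp hus).eventually (Metric.ball_mem_nhds 0 hε),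
      hs.eventually (a.2.open_source.mem_nhds hxa)] with g g1 g2 g3 g4 g5 g6 e
    have hc : ContinuousOn (fun w => κ (a.2 (Γ.src g), w))
        (Metric.ball (0 : EuclideanSpace ℝ (Fin d)) ε) := fun w hw =>
      (((hab g1 (hball w hw)).1.1.continuousAt).comp
        (f := fun w => (a.2 (Γ.src g), w)) (by fun_prop)).continuousWithinAt
    have hpre := (convex_ball (0 : EuclideanSpace ℝ (Fin d)) ε).isPreconnected.image _ hc
    have g4' := g4 (by rw [Γ.src_unit, Γ.tgt_unit])
    rw [Γ.src_unit] at g4'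
    refine hpre.subset_connectedComponentIn ⟨_, g5, g4'⟩ ?_ ⟨_, g2, g3 e⟩
    rintro _ ⟨w, hw, rfl⟩
    have := hab g1 (hball w hw)
    simp only [a.2.left_inv g6] at this
    exact ⟨this.1.2.1, this.2⟩
  refine ⟨d, κ, η, h0, ?_, ?_⟩
  · filter_upwards [hκp, hκt, hκc.eventually hcore] with q q1 q2 q3
    refine ⟨q1.1, ?_, q1.2.2.1⟩
    have := q3 (by rw [q1.2.1, q2])
    change κ q ∈ Γ.coreAt (Γ.src (κ q)) at this
    rwa [q1.2.1] at this
  · filter_upwards [h2, hloc, hcore] with g g1 g2 g3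
    exact ⟨g1.1, fun e => ⟨g2 e, g3 e⟩⟩

/-- Through each arrow of the core there is a local smooth section. -/
theorem IsRegular.exists_core_section (hreg : Γ.IsRegular) {x₀ : M}
    {a : Σ n : ℕ, OpenPartialHomeomorph M (EuclideanSpace ℝ (Fin n))} (ha : a ∈ A.charts)
    (hxa : x₀ ∈ a.2.source) {k₀ : G} (hk₀ : k₀ ∈ Γ.coreAt x₀) :
    ∃ σ : EuclideanSpace ℝ (Fin a.1) → G, σ (a.2 x₀) = k₀ ∧
      ∀ᶠ y in 𝓝 (a.2 x₀), B.PlotAt σ univ y ∧ σ y ∈ Γ.coreAt (a.2.symm y) := by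
  -- Arrows lying on a local section are closed under products and inverses, and include all
  -- isotropy near the unit. Such a set exhausts the connected group `coreAt x₀`.
  set S : G → Prop := fun k => ∃ σ : EuclideanSpace ℝ (Fin a.1) → G, σ (a.2 x₀) = k ∧
      ∀ᶠ y in 𝓝 (a.2 x₀), B.PlotAt σ univ y ∧ σ y ∈ Γ.coreAt (a.2.symm y) with hS
  obtain ⟨d, κ, η, h0, h1, h2⟩ := hreg.exists_isotropy_coordinates x₀ ha hxa
  have hcat : ∀ {k}, k ∈ Γ.coreAt (a.2.symm (a.2 x₀)) → k ∈ Γ.coreAt x₀ := fun {k} hk => by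
    rwa [a.2.left_inv hxa] at hk
  have hSc : ∀ k, S k → k ∈ Γ.coreAt x₀ := by
    rintro k ⟨σ, rfl, h⟩
    exact hcat h.self_of_nhds.2
  have hmul : ∀ g h, S g → S h → S (Γ.mul g h) := by
    rintro _ _ ⟨σ, rfl, h⟩ ⟨τ, rfl, h'⟩
    refine ⟨fun y => Γ.mul (σ y) (τ y), rfl, ?_⟩
    have e : ∀ᶠ y in 𝓝 (a.2 x₀), Γ.src (σ y) = Γ.tgt (τ y) := by
      filter_upwards [h, h'] with y y1 y2
      rw [src_of_mem_coreAt y1.2, tgt_of_mem_coreAt y2.2]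
    filter_upwards [h, h', e.eventually_nhds] with y y1 y2 y3
    exact ⟨plotAt_mul_nhds y1.1 y2.1 y3, mul_mem_coreAt y1.2 y2.2⟩
  have hinv : ∀ g, S g → S (Γ.inv g) := by
    rintro _ ⟨σ, rfl, h⟩
    refine ⟨fun y => Γ.inv (σ y), rfl, ?_⟩
    filter_upwards [h] with y y1
    exact ⟨Γ.smooth_inv.plotAt y1.1, inv_mem_coreAt y1.2⟩
  have hηc : Tendsto (fun g => (a.2 x₀, η g)) (𝓝 (Γ.unit x₀)) (𝓝 (a.2 x₀, 0)) := by
    have := h2.self_of_nhds.1.continuousAt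
    rw [ContinuousAt, h0] at this
    exact tendsto_const_nhds.prodMk_nhds this
  have hsmall : ∀ᶠ g in 𝓝 (Γ.unit x₀), g ∈ Γ.isotropy x₀ → S g := by
    filter_upwards [hηc.eventually h1.eventually_nhds, h2] with g g1 g2 g3
    have e := (g2.2 (g3.1.trans g3.2.symm)).1
    rw [g3.1] at e
    refine ⟨fun y => κ (y, η g), e, ?_⟩
    have : Tendsto (fun y => (y, η g)) (𝓝 (a.2 x₀)) (𝓝 (a.2 x₀, η g)) :=
      Continuous.tendsto' (by fun_prop) _ _ rfl
    filter_upwards [this.eventually g1] with y hy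
    exact ⟨PlotAt.comp_contDiffAt (φ := fun y => (y, η g)) hy.1 (by fun_prop), hy.2.1⟩
  have hloc : ∀ k ∈ Γ.coreAt x₀, ∀ᶠ k' in 𝓝[Γ.coreAt x₀] k, S (Γ.mul (Γ.inv k) k') := by
    intro k hk
    have hc : ContinuousWithinAt (fun k' => Γ.mul (Γ.inv k) k') (Γ.coreAt x₀) k :=
      Γ.continuousOn_mul (f := fun _ => Γ.inv k) (g := id) continuousOn_const continuousOn_id
        (fun y hy => by rw [Γ.src_inv, id, tgt_of_mem_coreAt hk, tgt_of_mem_coreAt hy]) k hk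
    have ek : Γ.mul (Γ.inv k) k = Γ.unit x₀ := by rw [Γ.inv_mul, src_of_mem_coreAt hk]
    rw [ContinuousWithinAt, ek] at hc
    filter_upwards [hc.eventually hsmall, self_mem_nhdsWithin] with k' h1 h2
    exact h1 (Γ.coreAt_subset_isotropy _ (mul_mem_coreAt (inv_mem_coreAt hk) h2))
  have hiff : ∀ k ∈ Γ.coreAt x₀, ∀ k' ∈ Γ.coreAt x₀, S (Γ.mul (Γ.inv k) k') → (S k ↔ S k') := by
    intro k hk k' hk' h
    have e1 : Γ.tgt k = Γ.tgt k' := by rw [tgt_of_mem_coreAt hk, tgt_of_mem_coreAt hk']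
    constructor
    · intro h'
      have := hmul _ _ h' h
      rwa [Γ.mul_inv_cancel_left e1] at this
    · intro h'
      have := hmul _ _ h' (hinv _ h)
      rwa [Γ.inv_mul_rev (by rw [Γ.src_inv, e1]), Γ.inv_inv,
        Γ.mul_inv_cancel_left e1.symm] at this
  -- Having the same status for `S` is an equivalence relation with open classes, so on a connected
  -- set it relates any two elements.
  have key := (Γ.isPreconnected_coreAt x₀).induction₂ (fun k k' => S k ↔ S k') (fun k hk => by
      filter_upwards [hloc k hk, self_mem_nhdsWithin] with k' h h'
      exact hiff k hk k' h' h) (fun _ _ _ _ _ _ h h' => h.trans h') (fun _ _ _ _ h => h.symm)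
      (Γ.unit_mem_coreAt x₀) hk₀
  exact key.1 (hsmall.self_of_nhds (Γ.unit_mem_isotropy x₀))

end LieGroupoid

/-! ### The core as an embedded submanifold and as a bundle of Lie groups. -/

namespace LieGroupoid
open SmoothAtlas

variable {M : Type v} [TopologicalSpace M] {A : SmoothAtlas M}
  {G : Type u} [TopologicalSpace G] {B : SmoothAtlas G} {Γ : LieGroupoid A B}
  {E : Type*} [NormedAddCommGroup E] [NormedSpace ℝ E]

/-- Translation by the inverse of a local section of the core is smooth. -/
theorem eventually_mapAt_translate {a : Σ n : ℕ, OpenPartialHomeomorph M (EuclideanSpace ℝ (Fin n))}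
    (ha : a ∈ A.charts) {g₀ : G} (hga : Γ.tgt g₀ ∈ a.2.source) {σ : EuclideanSpace ℝ (Fin a.1) → G}
    (hσ : ∀ᶠ y in 𝓝 (a.2 (Γ.tgt g₀)), B.PlotAt σ univ y ∧ σ y ∈ Γ.coreAt (a.2.symm y)) :
    ∀ᶠ g in 𝓝 g₀, MapAt B B (fun g => Γ.mul (Γ.inv (σ (a.2 (Γ.tgt g)))) g) g ∧
      σ (a.2 (Γ.tgt g)) ∈ Γ.coreAt (Γ.tgt g) := by
  have h1 : Tendsto (fun g => a.2 (Γ.tgt g)) (𝓝 g₀) (𝓝 (a.2 (Γ.tgt g₀))) :=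
    (a.2.continuousAt hga).tendsto.comp (Γ.continuous_tgt.tendsto g₀)
  have h2 : ∀ᶠ g in 𝓝 g₀, Γ.tgt g ∈ a.2.source :=
    Γ.continuous_tgt.continuousAt.eventually (a.2.open_source.mem_nhds hga)
  have h3 : ∀ᶠ g in 𝓝 g₀, σ (a.2 (Γ.tgt g)) ∈ Γ.coreAt (Γ.tgt g) := by
    filter_upwards [h1.eventually hσ, h2] with g g1 g2
    have := g1.2
    rwa [a.2.left_inv g2] at this
  filter_upwards [h1.eventually hσ, h2, h3, h3.eventually_nhds] with g g1 g2 g3 g4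
  refine ⟨mapAt_mul ?_ (mapAt_id g) ?_, g3⟩
  · have e1 : MapAt B B (fun g => σ (a.2 (Γ.tgt g))) g :=
      PlotAt.mapAt_comp (γ := σ) (h := a.2 ∘ Γ.tgt) g1.1
        (Γ.tgt_submersion.1.funAt (funAt_chart ha g2))
    exact fun b hb hs => Γ.smooth_inv.plotAt (e1 b hb hs)
  · filter_upwards [g4] with h hh
    exact (Γ.src_inv _).trans (tgt_of_mem_coreAt hh)

/-- The core is open in the isotropy. -/
theorem IsRegular.eventually_mem_core (hreg : Γ.IsRegular) {k : G} (hk : k ∈ Γ.core) :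
    ∀ᶠ g in 𝓝 k, Γ.src g = Γ.tgt g → g ∈ Γ.core := by
  obtain ⟨a, ha, hxa⟩ := A.cover (Γ.src k)
  obtain ⟨σ, hσ0, hσ⟩ := hreg.exists_core_section ha hxa hk
  obtain ⟨d, κ, η, h0, h1, h2⟩ := hreg.exists_isotropy_coordinates _ ha hxa
  have ek := tgt_eq_src_of_mem_core hk
  rw [← ek] at hσ hxa
  -- Dividing by a section through `k` moves a neighbourhood of `k` to a neighbourhood of a unit,
  -- where isotropic arrows are known to belong to the core.
  have h3 := eventually_mapAt_translate ha hxa hσ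
  have hc := h3.self_of_nhds.1.continuousAt
  rw [ContinuousAt] at hc
  simp only [ek, hσ0] at hc
  rw [Γ.inv_mul] at hc
  filter_upwards [h3, hc.eventually h2] with g g1 g2 e
  have e1 := tgt_of_mem_coreAt g1.2
  have e2 : Γ.src (Γ.inv (σ (a.2 (Γ.tgt g)))) = Γ.tgt g := by rw [Γ.src_inv, e1]
  have h4 := (g2.2 (by
    rw [Γ.src_mul _ _ e2, Γ.tgt_mul _ _ e2, Γ.tgt_inv, src_of_mem_coreAt g1.2, e])).2
  have h5 := mul_mem_core (mem_core_of_mem_coreAt g1.2) h4 (by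
    rw [Γ.tgt_mul _ _ e2, Γ.tgt_inv])
  rwa [Γ.mul_inv_cancel_left e1] at h5

/-- The core of a regular groupoid is covered by submanifold charts. -/
theorem IsRegular.exists_isSubChart_core (hreg : Γ.IsRegular) (k₀ : Γ.core) :
    ∃ (m : ℕ) (e : OpenPartialHomeomorph Γ.core (EuclideanSpace ℝ (Fin m))),
      B.IsSubChart Γ.core e ∧ k₀ ∈ e.source := by
  obtain ⟨k₀, hk₀⟩ := k₀
  set x₀ := Γ.src k₀ with hx₀
  obtain ⟨a, ha, hxa⟩ := A.cover x₀
  have hax : a.2 x₀ ∈ a.2.target := a.2.map_source hxa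
  obtain ⟨σ, hσ0, hσ⟩ := hreg.exists_core_section ha hxa hk₀
  obtain ⟨d, κ, η, h0, h1, h2⟩ := hreg.exists_isotropy_coordinates x₀ ha hxa
  have ek : Γ.tgt k₀ = x₀ := tgt_eq_src_of_mem_core hk₀
  have h3 := eventually_mapAt_translate (g₀ := k₀) ha (ek ▸ hxa) (ek ▸ hσ)
  set τ : G → G := fun g => Γ.mul (Γ.inv (σ (a.2 (Γ.tgt g)))) g with hτ
  have hτ0 : τ k₀ = Γ.unit x₀ := by
    simp only [hτ, ek, hσ0]
    rw [Γ.inv_mul]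
  have hτc : Tendsto τ (𝓝 k₀) (𝓝 (Γ.unit x₀)) := by
    have := h3.self_of_nhds.1.continuousAt
    rwa [ContinuousAt, hτ0] at this
  let Λ : (EuclideanSpace ℝ (Fin a.1) × EuclideanSpace ℝ (Fin d)) ≃L[ℝ]
    EuclideanSpace ℝ (Fin (a.1 + d)) := ContinuousLinearEquiv.ofFinrankEq (by simp)
  -- The chart at `k₀` is the chart at the unit precomposed with the translation `τ`; it is defined
  -- on all arrows near `k₀`, which is the extension that `IsSubChart` asks for.
  set h : G → EuclideanSpace ℝ (Fin (a.1 + d)) := fun g => Λ (a.2 (Γ.src g), η (τ g)) with hh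
  have hsrc : ∀ᶠ g in 𝓝 k₀, Γ.src g ∈ a.2.source :=
    Γ.continuous_src.continuousAt.eventually (a.2.open_source.mem_nhds hxa)
  have hhs : ∀ᶠ g in 𝓝 k₀, B.FunAt h g := by
    filter_upwards [h3, hτc.eventually h2, hsrc] with g g1 g2 g3
    refine ContDiffAt.comp_funAt (φ := Λ) (h := fun g => (a.2 (Γ.src g), η (τ g)))
      Λ.contDiff.contDiffAt (FunAt.prodMk ?_ ?_)
    · exact Γ.src_submersion.1.funAt (funAt_chart ha g3)
    · exact FunAt.comp_mapAt (h := η) (f := τ) g2.1 g1.1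
  have hh0 : h k₀ = Λ (a.2 x₀, 0) := by simp only [hh, hτ0, h0, ← hx₀]
  set ρ : EuclideanSpace ℝ (Fin a.1) × EuclideanSpace ℝ (Fin d) → G :=
    fun q => Γ.mul (σ q.1) (κ q) with hρ
  have hfst : Tendsto (fun q : EuclideanSpace ℝ (Fin a.1) × EuclideanSpace ℝ (Fin d) => q.1)
      (𝓝 (a.2 x₀, 0)) (𝓝 (a.2 x₀)) := continuousAt_fst
  have hcomp : ∀ᶠ q in 𝓝 (a.2 x₀, (0 : EuclideanSpace ℝ (Fin d))),
      Γ.src (σ q.1) = Γ.tgt (κ q) := by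
    filter_upwards [h1, hfst.eventually hσ] with q q1 q2
    rw [src_of_mem_coreAt q2.2, tgt_of_mem_coreAt q1.2.1]
  have hρp : ∀ᶠ q in 𝓝 (a.2 x₀, (0 : EuclideanSpace ℝ (Fin d))),
      B.PlotAt ρ univ q ∧ ρ q ∈ Γ.coreAt (a.2.symm q.1) ∧ h (ρ q) = Λ q := by
    filter_upwards [h1, hfst.eventually hσ, hcomp, hcomp.eventually_nhds,
      hfst.eventually (a.2.open_target.mem_nhds hax)] with q q1 q2 q3 q4 q5
    have hm := mul_mem_coreAt q2.2 q1.2.1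
    refine ⟨plotAt_mul_nhds (q2.1.comp_contDiffAt contDiffAt_fst) q1.1 q4, hm, ?_⟩
    have e1 : τ (ρ q) = κ q := by
      simp only [hτ, hρ, tgt_of_mem_coreAt hm, a.2.right_inv q5]
      exact Γ.inv_mul_cancel_left q3
    have e2 : Γ.src (ρ q) = a.2.symm q.1 := src_of_mem_coreAt hm
    simp only [hh, e1, e2, q1.2.2, a.2.right_inv q5]
  have hρ0 : ρ (a.2 x₀, 0) = k₀ := by
    have h4 := (h2.self_of_nhds.2 (by rw [Γ.src_unit, Γ.tgt_unit])).1
    rw [h0, Γ.src_unit] at h4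
    have := Γ.mul_unit k₀
    simp only [hρ, h4, hσ0]
    exact this
  classical
  let f : Γ.core → EuclideanSpace ℝ (Fin (a.1 + d)) := fun k => h k
  -- The default `k₀` is never attained near the base point, where `ρ` takes values in the core.
  let g : EuclideanSpace ℝ (Fin (a.1 + d)) → Γ.core := fun v =>
    if hv : ρ (Λ.symm v) ∈ Γ.core then ⟨_, hv⟩ else ⟨k₀, hk₀⟩
  have hval : Tendsto (fun k : Γ.core => (k : G)) (𝓝 ⟨k₀, hk₀⟩) (𝓝 k₀) :=
    continuous_subtype_val.continuousAt
  have hΛ : Tendsto Λ.symm (𝓝 (Λ (a.2 x₀, 0))) (𝓝 (a.2 x₀, 0)) :=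
    Continuous.tendsto' Λ.symm.continuous _ _ (Λ.symm_apply_apply _)
  have hgρ : ∀ᶠ v in 𝓝 (Λ (a.2 x₀, 0)), (g v : G) = ρ (Λ.symm v) := by
    filter_upwards [hΛ.eventually hρp] with v hv
    simp only [g, dif_pos (mem_core_of_mem_coreAt hv.2.1)]
  have hgp : ∀ᶠ v in 𝓝 (Λ (a.2 x₀, 0)), B.PlotAt (fun v => (g v : G)) univ v := by
    filter_upwards [hgρ.eventually_nhds, hΛ.eventually hρp] with v hv1 hv2
    exact PlotAt.congr_nhds (hv2.1.comp_contDiffAt Λ.symm.contDiff.contDiffAt) hv1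
  obtain ⟨e, he1, he2, he3, he4, he5⟩ := exists_openPartialHomeomorph (f := f) (g := g)
    (x₀ := ⟨k₀, hk₀⟩)
    (P := fun k => B.FunAt h k) (R := fun v => B.PlotAt (fun v => (g v : G)) univ v) (by
      filter_upwards [hval.eventually hhs, hval.eventually h3, (hτc.comp hval).eventually h2]
        with k k1 k2 k3
      refine ⟨ContinuousAt.comp (g := h) (f := fun k : Γ.core => (k : G)) k1.continuousAt
        continuous_subtype_val.continuousAt, ?_⟩
      have e0 : Γ.tgt (k : G) = Γ.src k := tgt_eq_src_of_mem_core k.2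
      have e1 : Γ.src (Γ.inv (σ (a.2 (Γ.tgt k)))) = Γ.tgt k := by
        rw [Γ.src_inv, tgt_of_mem_coreAt k2.2]
      have e2 : Γ.src (τ k) = Γ.src k := Γ.src_mul _ _ e1
      have e3 : Γ.tgt (τ k) = Γ.src k := by
        rw [← e0]
        exact (Γ.tgt_mul _ _ e1).trans ((Γ.tgt_inv _).trans (src_of_mem_coreAt k2.2))
      have e4 := (k3.2 (e2.trans e3.symm)).1
      simp only [Function.comp_apply, e2] at e4
      have e5 : ρ (Λ.symm (f k)) = k := by
        simp only [hρ, f, hh, Λ.symm_apply_apply, e4]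
        simp only [hτ, ← e0]
        exact Γ.mul_inv_cancel_left (tgt_of_mem_coreAt k2.2)
      have e6 : ρ (Λ.symm (f k)) ∈ Γ.core := e5 ▸ k.2
      refine Subtype.ext ?_
      simp only [g, dif_pos e6, e5]) (by
      simp only [f, hh0]
      filter_upwards [hgp, hgρ, hΛ.eventually hρp] with v v1 v2 v3
      refine ⟨IsInducing.subtypeVal.continuousAt_iff.2 v1.continuousAt, ?_⟩
      rw [v2, v3.2.2, Λ.apply_symm_apply])
    (hval.eventually hhs) (by simpa only [f, hh0] using hgp)
  refine ⟨a.1 + d, e, ⟨fun v hv => ?_, fun k hk => ⟨h, he4 k hk, ?_⟩⟩, he3⟩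
  · simpa only [he2] using he5 v hv
  · exact Eventually.of_forall fun k' => (he1 k').symm

section Core

variable (hreg : Γ.IsRegular)

/-- The smooth structure of the core. -/
noncomputable def coreAtlas (hreg : Γ.IsRegular) : SmoothAtlas Γ.core :=
  B.subAtlas Γ.core hreg.exists_isSubChart_core

open Classical in
/-- The core as a Lie groupoid. -/
noncomputable def coreGroupoid (hreg : Γ.IsRegular) : LieGroupoid A (coreAtlas hreg) where
  src k := Γ.src k
  tgt k := Γ.tgt k
  -- Only products of composable elements are known to stay in the core; `k` is a default for the
  -- others.
  mul k k' := if h : Γ.mul k k' ∈ Γ.core then ⟨_, h⟩ else k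
  inv k := ⟨_, inv_mem_core k.2⟩
  unit x := ⟨_, Γ.unit_mem_core x⟩
  src_submersion := by
    have hs : Smooth (coreAtlas hreg) A fun k => Γ.src k := Smooth.of_plotAt fun a ha v hv =>
      Γ.src_submersion.1.plotAt (subAtlas_smooth_val.plotAt (plotAt_symm ha hv))
    refine Submersion.of_sections hs fun k => ?_
    obtain ⟨a, ha, hxa⟩ := A.cover (Γ.src k)
    obtain ⟨σ, hσ0, hσ⟩ := hreg.exists_core_section ha hxa k.2
    refine ⟨a, ha, hxa, fun y => if h : σ y ∈ Γ.core then ⟨_, h⟩ else k, ?_, ?_, ?_⟩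
    · refine subAtlas_plotAt (hσ.self_of_nhds.1.congr_nhds ?_)
      filter_upwards [hσ] with y hy
      rw [dif_pos (mem_core_of_mem_coreAt hy.2)]
    · simp only [hσ0, k.2, dite_true]
    · filter_upwards [hσ] with y hy
      rw [dif_pos (mem_core_of_mem_coreAt hy.2)]
      exact src_of_mem_coreAt hy.2
  tgt_submersion := by
    have e : (fun k : Γ.core => Γ.tgt k) = fun k : Γ.core => Γ.src k :=
      funext fun k => tgt_eq_src_of_mem_core k.2
    rw [e]
    have hs : Smooth (coreAtlas hreg) A fun k => Γ.src k := Smooth.of_plotAt fun a ha v hv =>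
      Γ.src_submersion.1.plotAt (subAtlas_smooth_val.plotAt (plotAt_symm ha hv))
    refine Submersion.of_sections hs fun k => ?_
    obtain ⟨a, ha, hxa⟩ := A.cover (Γ.src k)
    obtain ⟨σ, hσ0, hσ⟩ := hreg.exists_core_section ha hxa k.2
    refine ⟨a, ha, hxa, fun y => if h : σ y ∈ Γ.core then ⟨_, h⟩ else k, ?_, ?_, ?_⟩
    · refine subAtlas_plotAt (hσ.self_of_nhds.1.congr_nhds ?_)
      filter_upwards [hσ] with y hy
      rw [dif_pos (mem_core_of_mem_coreAt hy.2)]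
    · simp only [hσ0, k.2, dite_true]
    · filter_upwards [hσ] with y hy
      rw [dif_pos (mem_core_of_mem_coreAt hy.2)]
      exact src_of_mem_coreAt hy.2
  smooth_mul := by
    refine SmoothOn₂.of_plotAt fun a ha b hb v hv1 hv2 hv3 => subAtlas_plotAt ?_
    have h1 := (subAtlas_smooth_val.plotAt (plotAt_symm ha hv1)).comp_contDiffAt
      (φ := fun v : EuclideanSpace ℝ (Fin a.1) × EuclideanSpace ℝ (Fin b.1) => v.1)
      (p := v) contDiffAt_fst
    have h2 := (subAtlas_smooth_val.plotAt (plotAt_symm hb hv2)).comp_contDiffAt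
      (φ := fun v : EuclideanSpace ℝ (Fin a.1) × EuclideanSpace ℝ (Fin b.1) => v.2)
      (p := v) contDiffAt_snd
    have hmem : ∀ k k' : Γ.core, Γ.src (k : G) = Γ.tgt k' → Γ.mul k k' ∈ Γ.core :=
      fun k k' e => mul_mem_core k.2 k'.2 e
    refine (plotAt_mul (Γ := Γ) (S := {v : EuclideanSpace ℝ (Fin a.1) ×
      EuclideanSpace ℝ (Fin b.1) | v.1 ∈ a.2.target ∧ v.2 ∈ b.2.target ∧ Γ.src (a.2.symm v.1 : G) = Γ.tgt (b.2.symm v.2 : G)}) (h1.mono (subset_univ _))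
      (h2.mono (subset_univ _)) (fun y hy => hy.2.2) ⟨hv1, hv2, hv3⟩).congr ?_ ?_
    · filter_upwards [self_mem_nhdsWithin] with w hw
      rw [dif_pos (hmem _ _ hw.2.2)]
      rfl
    · rw [dif_pos (hmem _ _ hv3)]
      rfl
  smooth_inv := Smooth.of_plotAt fun a ha v hv =>
    subAtlas_plotAt (Γ.smooth_inv.plotAt (subAtlas_smooth_val.plotAt (plotAt_symm ha hv)))
  smooth_unit := Smooth.of_plotAt fun a ha v hv =>
    subAtlas_plotAt (Γ.smooth_unit.plotAt (plotAt_symm ha hv))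
  src_mul k k' e := by rw [dif_pos (mul_mem_core k.2 k'.2 e)]; exact Γ.src_mul _ _ e
  tgt_mul k k' e := by rw [dif_pos (mul_mem_core k.2 k'.2 e)]; exact Γ.tgt_mul _ _ e
  mul_assoc g h k e e' := by
    have m1 := mul_mem_core g.2 h.2 e
    have m2 := mul_mem_core h.2 k.2 e'
    have e1 := (Γ.src_mul _ _ e).trans e'
    have e2 := e.trans (Γ.tgt_mul _ _ e').symm
    simp only [dif_pos m1, dif_pos m2,
      dif_pos (mul_mem_core g.2 m2 e2), Γ.mul_assoc _ _ _ e e']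
  src_unit := Γ.src_unit
  tgt_unit := Γ.tgt_unit
  unit_mul g := by simp [Γ.unit_mul]
  mul_unit g := by simp [Γ.mul_unit]
  src_inv g := Γ.src_inv g
  tgt_inv g := Γ.tgt_inv g
  inv_mul g := by simp [Γ.inv_mul, Γ.unit_mem_core]
  mul_inv g := by simp [Γ.mul_inv, Γ.unit_mem_core]

theorem coreGroupoid_isHom : IsHom (coreGroupoid hreg) Γ Subtype.val where
  smooth := subAtlas_smooth_val
  src_map _ := rfl
  tgt_map _ := rfl
  map_mul g h e := by
    have : Γ.mul g h ∈ Γ.core := mul_mem_core g.2 h.2 e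
    simp [coreGroupoid, this]
  map_inv _ := rfl
  map_unit _ := rfl

end Core

/-! ### Consequences of properness for the core. -/

/-- The core of a proper regular groupoid is closed. -/
theorem IsRegular.isClosed_core [T2Space M] (hreg : Γ.IsRegular) (hprop : Γ.IsProper) :
    IsClosed Γ.core := by
  have := hprop.1
  have hst : Continuous Γ.srcTgt := Γ.continuous_src.prodMk Γ.continuous_tgt
  rw [← isOpen_compl_iff, isOpen_iff_mem_nhds]
  intro k hk
  by_cases e : Γ.src k = Γ.tgt k
  swap
  · have : IsOpen {g | Γ.src g ≠ Γ.tgt g} := isOpen_ne_fun Γ.continuous_src Γ.continuous_tgt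
    filter_upwards [this.mem_nhds e] with g hg hg'
    exact hg (tgt_eq_src_of_mem_core hg').symm
  set x := Γ.src k with hx
  have hiso : Γ.isotropy x = Γ.srcTgt ⁻¹' {(x, x)} := by
    ext g; simp [isotropy, srcTgt, Prod.ext_iff]
  have hcomp : IsCompact (Γ.isotropy x) := by
    rw [hiso]; exact hprop.2.isCompact_preimage isCompact_singleton
  have hKcl : IsClosed (Γ.coreAt x) := by
    refine isClosed_of_closure_subset ?_
    exact (Γ.isPreconnected_coreAt x).closure.subset_connectedComponentIn
      (subset_closure (Γ.unit_mem_coreAt x))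
      (closure_minimal (Γ.coreAt_subset_isotropy x) hcomp.isClosed)
  -- `O` meets the isotropy of `x` exactly in its identity component, so the remainder of the
  -- compact isotropy group is compact as well.
  set O : Set G := interior {g | Γ.src g = Γ.tgt g → g ∈ Γ.core} with hO
  have hdiff : Γ.isotropy x \ Γ.coreAt x = Γ.isotropy x \ O := by
    ext g
    refine and_congr_right fun hg => not_congr ⟨fun h => ?_, fun h => ?_⟩
    · exact mem_interior_iff_mem_nhds.2 (hreg.eventually_mem_core (mem_core_of_mem_coreAt h))
    · have := interior_subset h (hg.1.trans hg.2.symm)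
      change g ∈ Γ.coreAt (Γ.src g) at this
      rwa [hg.1] at this
  have hcomp' : IsCompact (Γ.isotropy x \ Γ.coreAt x) := by
    rw [hdiff]; exact hcomp.diff isOpen_interior
  obtain ⟨N, N', hN, hN', hKN, hKN', hd⟩ := SeparatedNhds.of_isCompact_isCompact_isClosed
    (hcomp.of_isClosed_subset hKcl (Γ.coreAt_subset_isotropy x)) hcomp' hcomp'.isClosed
    disjoint_sdiff_self_right
  -- As (source, target) is a closed map, the isotropy over points near `x` is still covered by the
  -- two disjoint open sets.
  have hcl : IsClosed (Γ.srcTgt '' (N ∪ N')ᶜ) :=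
    hprop.2.isClosedMap _ (hN.union hN').isClosed_compl
  have hxx : (x, x) ∉ Γ.srcTgt '' (N ∪ N')ᶜ := by
    rintro ⟨g, hg, hg'⟩
    have hgi : g ∈ Γ.isotropy x := by rw [hiso]; exact hg'
    refine hg ?_
    by_cases h : g ∈ Γ.coreAt x
    · exact Or.inl (hKN h)
    · exact Or.inr (hKN' ⟨hgi, h⟩)
  have h1 : ∀ᶠ y in 𝓝 x, (y, y) ∉ Γ.srcTgt '' (N ∪ N')ᶜ :=
    (continuous_id.prodMk continuous_id).continuousAt.eventually (hcl.isOpen_compl.mem_nhds hxx)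
  have h2 : ∀ᶠ y in 𝓝 x, Γ.unit y ∈ N :=
    Γ.continuous_unit.continuousAt.eventually (hN.mem_nhds (hKN (Γ.unit_mem_coreAt x)))
  have hkN' : k ∈ N' := hKN' ⟨⟨rfl, e.symm⟩, hk⟩
  filter_upwards [hN'.mem_nhds hkN', Γ.continuous_src.continuousAt.eventually h1,
    Γ.continuous_src.continuousAt.eventually h2] with g g1 g2 g3 hg
  have hsub : Γ.coreAt (Γ.src g) ⊆ N ∪ N' := by
    intro g' hg'
    by_contra hc
    exact g2 ⟨g', hc, Prod.ext (src_of_mem_coreAt hg') (tgt_of_mem_coreAt hg')⟩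
  -- A nearby identity component is connected and its unit lies in `N`, so it cannot reach `N'`, the
  -- neighbourhood of `k`.
  have := (Γ.isPreconnected_coreAt (Γ.src g)).subset_left_of_subset_union hN hN' hd hsub
    ⟨_, Γ.unit_mem_coreAt _, g3⟩ hg
  exact disjoint_left.1 hd this g1

/-- (Source, target) stays proper on the closed core, where it is the source followed by the
injective diagonal map of `M`. -/
theorem coreGroupoid_isProperMap_src [T2Space M] (hreg : Γ.IsRegular) (hprop : Γ.IsProper) :
    IsProperMap (coreGroupoid hreg).src := by
  have h1 : IsProperMap (fun k : Γ.core => Γ.srcTgt k) :=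
    hprop.2.comp (hreg.isClosed_core hprop).isProperMap_subtypeVal
  have h2 : (fun k : Γ.core => Γ.srcTgt k) = (fun x => (x, x)) ∘ (coreGroupoid hreg).src := by
    funext k
    exact Prod.ext rfl (tgt_eq_src_of_mem_core k.2)
  rw [h2] at h1
  exact isProperMap_of_comp_of_inj (coreGroupoid hreg).continuous_src
    (continuous_id.prodMk continuous_id) h1 (fun x y h => (Prod.ext_iff.1 h).1)

theorem coreGroupoid_isConnected (hreg : Γ.IsRegular) (x : M) :
    IsConnected ((coreGroupoid hreg).src ⁻¹' {x}) := by
  have h1 : (coreGroupoid hreg).src ⁻¹' {x} = Subtype.val ⁻¹' Γ.coreAt x := by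
    ext k
    constructor
    · intro (h : Γ.src k = x)
      rw [mem_preimage, ← h]
      exact k.2
    · exact fun h => src_of_mem_coreAt (Γ := Γ) h
  rw [h1]
  refine ⟨⟨⟨_, Γ.unit_mem_core x⟩, Γ.unit_mem_coreAt x⟩, ?_⟩
  rw [← IsInducing.subtypeVal.isPreconnected_image, Subtype.image_preimage_coe,
    inter_eq_right.2 fun k hk => mem_core_of_mem_coreAt hk]
  exact Γ.isPreconnected_coreAt x

end LieGroupoid

/-! ### The quotient by the core: manifold, groupoid, extension and orbifold properties. -/

namespace SmoothAtlas

variable {X : Type u} [TopologicalSpace X] {A : SmoothAtlas X}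
  {Q : Type v} [TopologicalSpace Q] {π : X → Q} {hπ : Function.Surjective π}
  {h : ∀ x, ∃ (m : ℕ) (e : OpenPartialHomeomorph Q (EuclideanSpace ℝ (Fin m))),
      A.IsQuotChart π e ∧ π x ∈ e.source} {Y : Type w} [TopologicalSpace Y] {C : SmoothAtlas Y}

/-- Inverse charts of the quotient lift locally, so smoothness of `f` is tested on `f ∘ π`. -/
theorem quotAtlas_smooth_of_comp {f : Q → Y} (hf : Smooth A C (f ∘ π)) :
    Smooth (A.quotAtlas π hπ h) C f := by
  refine Smooth.of_plotAt fun a ha v hv => ?_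
  obtain ⟨x, hx⟩ := hπ (a.2.symm v)
  obtain ⟨δ, hδ, hδx, hδ'⟩ := quotAtlas_lift (plotAt_symm ha hv) hx
  rw [nhdsWithin_univ] at hδ'
  refine (hf.plotAt hδ).congr_nhds ?_
  filter_upwards [hδ'] with q hq
  simp [hq]

end SmoothAtlas

namespace LieGroupoid
open SmoothAtlas

variable {M : Type v} [TopologicalSpace M] {A : SmoothAtlas M}
  {G : Type u} [TopologicalSpace G] {B : SmoothAtlas G} (Γ : LieGroupoid A B)
  {g g' h h' k : G}

/-- Two arrows are equivalent if they differ by an element of the core. -/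
def coreSetoid : Setoid G where
  r g g' := ∃ k ∈ Γ.coreAt (Γ.src g), g' = Γ.mul g k
  iseqv :=
    { refl := fun g => ⟨_, Γ.unit_mem_coreAt _, (Γ.mul_unit g).symm⟩
      symm := by
        rintro g _ ⟨k, hk, rfl⟩
        have e : Γ.src g = Γ.tgt k := (tgt_of_mem_coreAt hk).symm
        refine ⟨Γ.inv k, ?_, (Γ.mul_inv_cancel_right e).symm⟩
        rw [Γ.src_mul _ _ e, src_of_mem_coreAt hk]
        exact inv_mem_coreAt hk
      trans := by
        rintro g _ _ ⟨k, hk, rfl⟩ ⟨k', hk', rfl⟩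
        have e : Γ.src g = Γ.tgt k := (tgt_of_mem_coreAt hk).symm
        rw [Γ.src_mul _ _ e, src_of_mem_coreAt hk] at hk'
        refine ⟨_, mul_mem_coreAt hk hk', Γ.mul_assoc _ _ _ e ?_⟩
        rw [src_of_mem_coreAt hk, tgt_of_mem_coreAt hk'] }

/-- The quotient of a groupoid by its core. -/
abbrev CoreQuotient : Type u := Quotient Γ.coreSetoid

/-- The quotient map. -/
def toCoreQuotient (g : G) : Γ.CoreQuotient := Quotient.mk _ g

variable {Γ}

theorem surjective_toCoreQuotient : Function.Surjective Γ.toCoreQuotient := Quotient.mk_surjective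

theorem continuous_toCoreQuotient : Continuous Γ.toCoreQuotient := continuous_quotient_mk'

theorem toCoreQuotient_eq_iff :
    Γ.toCoreQuotient g = Γ.toCoreQuotient g' ↔ ∃ k ∈ Γ.coreAt (Γ.src g), g' = Γ.mul g k :=
  Quotient.eq

/-- This form exhibits the relation as a closed condition once the core is closed, which gives the
Hausdorff property of the quotient. -/
theorem toCoreQuotient_eq_iff' : Γ.toCoreQuotient g = Γ.toCoreQuotient g' ↔
    Γ.src g = Γ.src g' ∧ Γ.tgt g = Γ.tgt g' ∧ Γ.mul (Γ.inv g) g' ∈ Γ.core := by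
  rw [toCoreQuotient_eq_iff]
  constructor
  · rintro ⟨k, hk, rfl⟩
    have e : Γ.src g = Γ.tgt k := (tgt_of_mem_coreAt hk).symm
    refine ⟨?_, (Γ.tgt_mul _ _ e).symm, ?_⟩
    · rw [Γ.src_mul _ _ e, src_of_mem_coreAt hk]
    · rw [Γ.inv_mul_cancel_left e]
      exact mem_core_of_mem_coreAt hk
  · rintro ⟨e1, e2, e3⟩
    refine ⟨_, ?_, (Γ.mul_inv_cancel_left e2).symm⟩
    change _ ∈ Γ.coreAt _ at e3
    rwa [Γ.src_mul _ _ (by rw [Γ.src_inv, e2]), ← e1] at e3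

/-- In group notation (gk)(hk') = (gh)(h⁻¹kh)k', and h⁻¹kh lies in the core by normality. -/
theorem toCoreQuotient_mul (hg : Γ.toCoreQuotient g = Γ.toCoreQuotient g')
    (hh : Γ.toCoreQuotient h = Γ.toCoreQuotient h') (e : Γ.src g = Γ.tgt h) :
    Γ.toCoreQuotient (Γ.mul g h) = Γ.toCoreQuotient (Γ.mul g' h') := by
  rw [toCoreQuotient_eq_iff] at *
  obtain ⟨k, hk, rfl⟩ := hg
  obtain ⟨k', hk', rfl⟩ := hh
  have sk := src_of_mem_coreAt hk
  have tk := tgt_of_mem_coreAt hk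
  have sk' := src_of_mem_coreAt hk'
  have tk' := tgt_of_mem_coreAt hk'
  have h1 := conj_mem_coreAt (Γ := Γ) (Γ.inv h) (k := k) (by rwa [Γ.src_inv, ← e])
  rw [Γ.tgt_inv, Γ.inv_inv] at h1
  set k₁ := Γ.mul (Γ.mul (Γ.inv h) k) h with hk₁
  have e2 : Γ.src k = Γ.tgt h := sk.trans e
  have e1 : Γ.mul h k₁ = Γ.mul k h := by
    rw [hk₁, Γ.mul_assoc _ _ _ (by rw [Γ.src_inv, tk, e]) e2]
    exact Γ.mul_inv_cancel_left (by rw [Γ.tgt_mul _ _ e2, tk, e])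
  have s1 := src_of_mem_coreAt h1
  have t1 := tgt_of_mem_coreAt h1
  refine ⟨Γ.mul k₁ k', ?_, ?_⟩
  · rw [Γ.src_mul _ _ e]
    exact mul_mem_coreAt h1 hk'
  · rw [← Γ.mul_assoc (Γ.mul g h) k₁ k' (by rw [Γ.src_mul _ _ e, t1]) (by rw [s1, tk']),
      Γ.mul_assoc g h k₁ e t1.symm, e1, ← Γ.mul_assoc g k h tk.symm e2,
      Γ.mul_assoc _ h k' (by rw [Γ.src_mul _ _ tk.symm, e2]) tk'.symm]

/-- In group notation (gk)⁻¹ = g⁻¹(gk⁻¹g⁻¹), so normality applies again. -/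
theorem toCoreQuotient_inv (hg : Γ.toCoreQuotient g = Γ.toCoreQuotient g') :
    Γ.toCoreQuotient (Γ.inv g) = Γ.toCoreQuotient (Γ.inv g') := by
  rw [toCoreQuotient_eq_iff] at *
  obtain ⟨k, hk, rfl⟩ := hg
  have sk := src_of_mem_coreAt hk
  have tk := tgt_of_mem_coreAt hk
  refine ⟨Γ.mul (Γ.mul g (Γ.inv k)) (Γ.inv g), ?_, ?_⟩
  · rw [Γ.src_inv]
    exact conj_mem_coreAt g (inv_mem_coreAt hk)
  · have e1 : Γ.src g = Γ.tgt (Γ.inv k) := by rw [Γ.tgt_inv, sk]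
    have e2 : Γ.src (Γ.inv k) = Γ.tgt (Γ.inv g) := by rw [Γ.src_inv, Γ.tgt_inv, tk]
    rw [Γ.inv_mul_rev tk.symm, Γ.mul_assoc _ _ _ e1 e2,
      Γ.inv_mul_cancel_left (by rw [Γ.tgt_mul _ _ e2, e1])]

/-- Parallel arrows near a given arrow differ by an element of the core. -/
theorem IsRegular.eventually_toCoreQuotient_eq (hreg : Γ.IsRegular) (g₀ : G) :
    ∀ᶠ p : G × G in 𝓝 (g₀, g₀), Γ.src p.1 = Γ.src p.2 → Γ.tgt p.1 = Γ.tgt p.2 →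
      Γ.toCoreQuotient p.1 = Γ.toCoreQuotient p.2 := by
  have hc : ContinuousWithinAt (fun p : G × G => Γ.mul (Γ.inv p.1) p.2)
      {p | Γ.tgt p.1 = Γ.tgt p.2} (g₀, g₀) :=
    Γ.continuousWithinAt_mul (Γ.continuous_inv.comp continuous_fst).continuousWithinAt
      continuous_snd.continuousWithinAt (fun p hp => (Γ.src_inv _).trans hp) rfl
  have h1 := hreg.eventually_mem_core (Γ.unit_mem_core (Γ.src g₀))
  rw [ContinuousWithinAt, Γ.inv_mul] at hc
  filter_upwards [eventually_nhdsWithin_iff.1 (hc.eventually h1)] with p hp e1 e2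
  have e3 : Γ.src (Γ.inv p.1) = Γ.tgt p.2 := by rw [Γ.src_inv, e2]
  exact toCoreQuotient_eq_iff'.2 ⟨e1, e2, hp e2 (by
    rw [Γ.src_mul _ _ e3, Γ.tgt_mul _ _ e3, Γ.tgt_inv, e1])⟩

/-- If `h` is equivalent to `g` in `U`, extend the core element that relates them to a local
section. Right multiplication by this section preserves classes and carries a neighbourhood of `h`
into `U`, so the saturation of `U` is open. -/
theorem IsRegular.isOpenMap_toCoreQuotient (hreg : Γ.IsRegular) : IsOpenMap Γ.toCoreQuotient := by
  intro U hU
  change IsOpen (Γ.toCoreQuotient ⁻¹' (Γ.toCoreQuotient '' U))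
  refine isOpen_iff_mem_nhds.2 ?_
  rintro h ⟨g, hg, hgh⟩
  obtain ⟨k, hk, rfl⟩ := toCoreQuotient_eq_iff.1 hgh.symm
  obtain ⟨a, ha, hxa⟩ := A.cover (Γ.src h)
  obtain ⟨σ, hσ0, hσ⟩ := hreg.exists_core_section ha hxa hk
  have h1 : Tendsto (fun g => a.2 (Γ.src g)) (𝓝 h) (𝓝 (a.2 (Γ.src h))) :=
    (a.2.continuousAt hxa).tendsto.comp (Γ.continuous_src.tendsto h)
  have h2 : ∀ᶠ g in 𝓝 h, σ (a.2 (Γ.src g)) ∈ Γ.coreAt (Γ.src g) := by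
    filter_upwards [h1.eventually hσ,
      Γ.continuous_src.continuousAt.eventually (a.2.open_source.mem_nhds hxa)] with g g1 g2
    have := g1.2
    rwa [a.2.left_inv g2] at this
  have h3 : ContinuousAt (fun g => Γ.mul g (σ (a.2 (Γ.src g)))) h := by
    refine Γ.continuousAt_mul continuousAt_id
      (ContinuousAt.comp (g := σ) hσ.self_of_nhds.1.continuousAt h1) ?_
    filter_upwards [h2] with g hg
    exact (tgt_of_mem_coreAt hg).symm
  rw [ContinuousAt, hσ0] at h3
  filter_upwards [h3.eventually (hU.mem_nhds hg), h2] with g g1 g2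
  exact ⟨_, g1, (toCoreQuotient_eq_iff.2 ⟨_, g2, rfl⟩).symm⟩

variable (Γ) in
/-- The source map of the quotient. -/
def quotSrc : Γ.CoreQuotient → M :=
  Quotient.lift Γ.src fun _ _ h => (toCoreQuotient_eq_iff'.1 (toCoreQuotient_eq_iff.2 h)).1

variable (Γ) in
/-- The target map of the quotient. -/
def quotTgt : Γ.CoreQuotient → M :=
  Quotient.lift Γ.tgt fun _ _ h => (toCoreQuotient_eq_iff'.1 (toCoreQuotient_eq_iff.2 h)).2.1

theorem quotSrc_mk (g : G) : Γ.quotSrc (Γ.toCoreQuotient g) = Γ.src g := rfl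
theorem quotTgt_mk (g : G) : Γ.quotTgt (Γ.toCoreQuotient g) = Γ.tgt g := rfl

theorem continuous_quotSrc : Continuous Γ.quotSrc := Γ.continuous_src.quotient_lift _
theorem continuous_quotTgt : Continuous Γ.quotTgt := Γ.continuous_tgt.quotient_lift _

/-- The quotient of a regular groupoid by its core is a manifold. -/
theorem IsRegular.exists_isQuotChart (hreg : Γ.IsRegular) (g₀ : G) :
    ∃ (m : ℕ) (e : OpenPartialHomeomorph Γ.CoreQuotient (EuclideanSpace ℝ (Fin m))),
      B.IsQuotChart Γ.toCoreQuotient e ∧ Γ.toCoreQuotient g₀ ∈ e.source := by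
  obtain ⟨a, ha, hga⟩ := A.cover (Γ.src g₀)
  obtain ⟨a', ha', hga'⟩ := A.cover (Γ.tgt g₀)
  obtain ⟨r, ℓ, d, θ, η, h0, h1, h2, W, hW, hWW⟩ := hreg.exists_coordinates g₀ ha hga ha' hga'
  let Λ : (EuclideanSpace ℝ (Fin a.1) × EuclideanSpace ℝ (Fin r)) ≃L[ℝ]
    EuclideanSpace ℝ (Fin (a.1 + r)) := ContinuousLinearEquiv.ofFinrankEq (by simp)
  set f₀ : G → EuclideanSpace ℝ (Fin a.1) × EuclideanSpace ℝ (Fin r) :=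
    fun g => (a.2 (Γ.src g), ℓ (a'.2 (Γ.tgt g))) with hf₀
  -- The submersion of `IsRegular.exists_coordinates` involves only source and target, so it
  -- descends to the quotient, where it becomes a chart.
  let f : Γ.CoreQuotient → EuclideanSpace ℝ (Fin (a.1 + r)) :=
    fun e => Λ (a.2 (Γ.quotSrc e), ℓ (a'.2 (Γ.quotTgt e)))
  have hff : ∀ g, f (Γ.toCoreQuotient g) = Λ (f₀ g) := fun _ => rfl
  -- The slice where the remaining coordinates vanish meets the classes near `g₀` transversally and
  -- represents the inverse chart.
  let s : EuclideanSpace ℝ (Fin (a.1 + r)) → G := fun v => θ (Λ.symm v, 0)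
  have hsrc : ∀ᶠ g in 𝓝 g₀, Γ.src g ∈ a.2.source :=
    Γ.continuous_src.continuousAt.eventually (a.2.open_source.mem_nhds hga)
  have htgt : ∀ᶠ g in 𝓝 g₀, Γ.tgt g ∈ a'.2.source :=
    Γ.continuous_tgt.continuousAt.eventually (a'.2.open_source.mem_nhds hga')
  have hΛ : Tendsto (fun v => (Λ.symm v, (0 : EuclideanSpace ℝ (Fin d)))) (𝓝 (Λ (f₀ g₀)))
      (𝓝 (f₀ g₀, 0)) := Continuous.tendsto' (by fun_prop) _ _ (by simp)
  have hs : ∀ᶠ v in 𝓝 (Λ (f₀ g₀)), B.PlotAt s univ v ∧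
      Γ.src (s v) = a.2.symm (Λ.symm v).1 ∧ a.2 (Γ.src (s v)) = (Λ.symm v).1 ∧
      Λ (f₀ (s v)) = v := by
    filter_upwards [hΛ.eventually h1] with v hv
    refine ⟨PlotAt.comp_contDiffAt (γ := θ) (φ := fun v => (Λ.symm v, 0)) hv.1 (by fun_prop),
      hv.2.1, hv.2.2.1, ?_⟩
    rw [← Λ.symm.injective.eq_iff, Λ.symm_apply_apply]
    exact Prod.ext hv.2.2.1 hv.2.2.2.1
  have hs0 : s (Λ (f₀ g₀)) = g₀ := by
    have := h2.self_of_nhds.2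
    rw [h0] at this
    simp only [s, Λ.symm_apply_apply]
    exact this
  have hf₀c : ∀ᶠ g in 𝓝 g₀, ContinuousAt f₀ g := by
    filter_upwards [hsrc, htgt] with g g1 g2
    exact ((a.2.continuousAt g1).comp Γ.continuous_src.continuousAt).prodMk
      (ℓ.continuous.continuousAt.comp
        ((a'.2.continuousAt g2).comp Γ.continuous_tgt.continuousAt))
  have hsc : Tendsto (fun g => s (Λ (f₀ g))) (𝓝 g₀) (𝓝 g₀) := by
    have e1 : Tendsto (fun g => Λ (f₀ g)) (𝓝 g₀) (𝓝 (Λ (f₀ g₀))) :=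
      (Λ.continuous.tendsto _).comp hf₀c.self_of_nhds
    have e2 : Tendsto s (𝓝 (Λ (f₀ g₀))) (𝓝 g₀) := by
      have := hs.self_of_nhds.1.continuousAt
      rwa [ContinuousAt, hs0] at this
    exact e2.comp e1
  have hΛf : Tendsto (fun g => Λ (f₀ g)) (𝓝 g₀) (𝓝 (Λ (f₀ g₀))) :=
    (Λ.continuous.tendsto _).comp hf₀c.self_of_nhds
  -- Both arrows have the same source and, by the constant rank argument, the same target; nearby
  -- parallel arrows are equivalent.
  have hinv : ∀ᶠ g in 𝓝 g₀, Γ.toCoreQuotient (s (Λ (f₀ g))) = Γ.toCoreQuotient g := by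
    filter_upwards [hΛf.eventually hs, hsrc, hsc.eventually hW, hW,
      (hsc.prodMk_nhds tendsto_id).eventually (hreg.eventually_toCoreQuotient_eq g₀)]
      with g g1 g2 g3 g4 g5
    have e1 : Γ.src (s (Λ (f₀ g))) = Γ.src g := by
      rw [g1.2.1, Λ.symm_apply_apply, a.2.left_inv g2]
    have e2 : f₀ (s (Λ (f₀ g))) = f₀ g := Λ.injective g1.2.2.2
    exact g5 e1 (hWW _ g3 _ g4 e1 (congrArg Prod.snd e2))
  have hopen : ∀ {P : Γ.CoreQuotient → Prop}, (∀ᶠ g in 𝓝 g₀, P (Γ.toCoreQuotient g)) →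
      ∀ᶠ e in 𝓝 (Γ.toCoreQuotient g₀), P e := fun {P} hP => by
    rw [← hreg.isOpenMap_toCoreQuotient.map_nhds_eq continuous_toCoreQuotient.continuousAt]
    exact hP
  obtain ⟨e, he1, he2, he3, he4, he5⟩ := exists_openPartialHomeomorph (f := f)
    (g := fun v => Γ.toCoreQuotient (s v)) (x₀ := Γ.toCoreQuotient g₀)
    (P := fun e => Γ.quotSrc e ∈ a.2.source ∧ Γ.quotTgt e ∈ a'.2.source)
    (R := fun v => B.PlotAt s univ v ∧
      Γ.src (s v) = a.2.symm (Λ.symm v).1 ∧ a.2 (Γ.src (s v)) = (Λ.symm v).1 ∧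
      Λ (f₀ (s v)) = v) (by
      refine hopen ?_
      filter_upwards [hinv, hsrc, htgt] with g g1 g2 g3
      refine ⟨Λ.continuous.continuousAt.comp (ContinuousAt.prodMk ?_ ?_), g1⟩
      · exact ContinuousAt.comp (x := Γ.toCoreQuotient g) (g := a.2) (f := Γ.quotSrc)
          (a.2.continuousAt g2) continuous_quotSrc.continuousAt
      · exact ℓ.continuous.continuousAt.comp (ContinuousAt.comp (x := Γ.toCoreQuotient g)
          (g := a'.2) (f := Γ.quotTgt) (a'.2.continuousAt g3) continuous_quotTgt.continuousAt)) (by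
      filter_upwards [hs] with v hv
      exact ⟨continuous_toCoreQuotient.continuousAt.comp hv.1.continuousAt, hv.2.2.2⟩)
    (hopen (hsrc.and htgt)) hs
  refine ⟨a.1 + r, e, fun x hx => ⟨?_, ?_⟩, he3⟩
  · obtain ⟨x1, x2⟩ := he4 _ hx
    have e1 : (e : Γ.CoreQuotient → _) ∘ Γ.toCoreQuotient = Λ ∘ f₀ := by
      funext g; simp [he1, hff]
    rw [e1]
    exact ContDiffAt.comp_funAt Λ.contDiff.contDiffAt (FunAt.prodMk
      (Γ.src_submersion.1.funAt (funAt_chart ha x1)) (ContDiffAt.comp_funAt (φ := ℓ)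
        ℓ.contDiff.contDiffAt (Γ.tgt_submersion.1.funAt (funAt_chart ha' x2))))
  · obtain ⟨y, hy⟩ : ∃ y, y = e (Γ.toCoreQuotient x) := ⟨_, rfl⟩
    rw [← hy]
    have hyt : y ∈ e.target := hy ▸ e.map_source hx
    have hy1 : Γ.toCoreQuotient (s y) = Γ.toCoreQuotient x := by
      rw [← he2 y, hy, e.left_inv hx]
    obtain ⟨k, hk, rfl⟩ := toCoreQuotient_eq_iff.1 hy1
    have hyR := he5 y hyt
    have hsa : Γ.src (s y) ∈ a.2.source := by
      have := (he4 _ hx).1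
      rwa [← hy1] at this
    -- The slice passes only through `s y`. Multiplying it by a core section through `k` yields a
    -- lift through the given arrow `Γ.mul (s y) k`.
    obtain ⟨σ, hσ0, hσ⟩ := hreg.exists_core_section ha hsa hk
    rw [hyR.2.2.1] at hσ0 hσ
    have ht : Tendsto (fun v => (Λ.symm v).1) (𝓝 y) (𝓝 (Λ.symm y).1) :=
      Continuous.tendsto' (by fun_prop) _ _ rfl
    have hmem : ∀ᶠ v in 𝓝 y, σ (Λ.symm v).1 ∈ Γ.coreAt (Γ.src (s v)) := by
      filter_upwards [ht.eventually hσ, e.open_target.mem_nhds hyt] with v v1 v2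
      rw [(he5 v v2).2.1]
      exact v1.2
    refine ⟨fun v => Γ.mul (s v) (σ (Λ.symm v).1), plotAt_mul_nhds hyR.1
      (PlotAt.comp_contDiffAt (φ := fun v => (Λ.symm v).1) hσ.self_of_nhds.1 (by fun_prop)) ?_, ?_, ?_⟩
    · filter_upwards [hmem] with v hv
      exact (tgt_of_mem_coreAt hv).symm
    · simp only [hσ0]
    · filter_upwards [hmem] with v hv
      rw [he2]
      exact (toCoreQuotient_eq_iff.2 ⟨_, hv, rfl⟩).symm

/-- The smooth structure of the quotient by the core. -/
noncomputable def quotientAtlas (hreg : Γ.IsRegular) : SmoothAtlas Γ.CoreQuotient :=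
  B.quotAtlas Γ.toCoreQuotient surjective_toCoreQuotient hreg.exists_isQuotChart

variable (Γ) in
/-- The composition of the quotient. -/
noncomputable def quotMul (e e' : Γ.CoreQuotient) : Γ.CoreQuotient :=
  Γ.toCoreQuotient (Γ.mul e.out e'.out)

variable (Γ) in
/-- The inverse of the quotient. -/
noncomputable def quotInv (e : Γ.CoreQuotient) : Γ.CoreQuotient := Γ.toCoreQuotient (Γ.inv e.out)

theorem toCoreQuotient_out (e : Γ.CoreQuotient) : Γ.toCoreQuotient e.out = e := Quotient.out_eq e

theorem quotMul_mk (e : Γ.src g = Γ.tgt h) :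
    Γ.quotMul (Γ.toCoreQuotient g) (Γ.toCoreQuotient h) = Γ.toCoreQuotient (Γ.mul g h) :=
  (toCoreQuotient_mul (toCoreQuotient_out _).symm (toCoreQuotient_out _).symm e).symm

theorem quotInv_mk (g : G) : Γ.quotInv (Γ.toCoreQuotient g) = Γ.toCoreQuotient (Γ.inv g) :=
  toCoreQuotient_inv (toCoreQuotient_out _)

theorem submersion_of_comp_toCoreQuotient (hreg : Γ.IsRegular) {f : Γ.CoreQuotient → M}
    (hf : Submersion B A (f ∘ Γ.toCoreQuotient)) : Submersion (quotientAtlas hreg) A f := by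
  have hs : Smooth (quotientAtlas hreg) A f := quotAtlas_smooth_of_comp hf.1
  refine ⟨hs, fun e c hc a ha hec hea => ?_⟩
  obtain ⟨g, rfl⟩ := surjective_toCoreQuotient e
  obtain ⟨b, hb, hgb⟩ := B.cover g
  have hp : (quotientAtlas hreg).PlotAt (Γ.toCoreQuotient ∘ b.2.symm) univ (b.2 g) :=
    (quotAtlas_smooth continuous_toCoreQuotient).plotAt (plotAt_symm hb (b.2.map_source hgb))
  exact surjective_chartDeriv hs hc hec ha hea hp (by simp [b.2.left_inv hgb])
    (hf.2 g b hb a ha hgb hea)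

/-- The quotient of a regular Lie groupoid by its core. -/
noncomputable def quotientGroupoid (hreg : Γ.IsRegular) :
    LieGroupoid A (quotientAtlas hreg) where
  src := Γ.quotSrc
  tgt := Γ.quotTgt
  mul := Γ.quotMul
  inv := Γ.quotInv
  unit x := Γ.toCoreQuotient (Γ.unit x)
  src_submersion := submersion_of_comp_toCoreQuotient hreg Γ.src_submersion
  tgt_submersion := submersion_of_comp_toCoreQuotient hreg Γ.tgt_submersion
  smooth_mul := by
    refine SmoothOn₂.of_plotAt fun a ha b hb v hv1 hv2 hv3 => ?_
    set T : Set (EuclideanSpace ℝ (Fin a.1) × EuclideanSpace ℝ (Fin b.1)) :=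
      {v | v.1 ∈ a.2.target ∧ v.2 ∈ b.2.target ∧ (a.2.symm v.1, b.2.symm v.2) ∈
        {p : Γ.CoreQuotient × Γ.CoreQuotient | Γ.quotSrc p.1 = Γ.quotTgt p.2}} with hT
    have h1 := ((plotAt_symm ha hv1).comp_contDiffAt (φ := fun v : EuclideanSpace ℝ (Fin a.1) ×
      EuclideanSpace ℝ (Fin b.1) => v.1) (p := v) contDiffAt_fst).mono (subset_univ T)
    have h2 := ((plotAt_symm hb hv2).comp_contDiffAt (φ := fun v : EuclideanSpace ℝ (Fin a.1) ×
      EuclideanSpace ℝ (Fin b.1) => v.2) (p := v) contDiffAt_snd).mono (subset_univ T)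
    obtain ⟨δ₁, hδ₁, -, hδ₁'⟩ := quotAtlas_lift h1 (toCoreQuotient_out _)
    obtain ⟨δ₂, hδ₂, -, hδ₂'⟩ := quotAtlas_lift h2 (toCoreQuotient_out _)
    -- The lifts represent the given classes only near `v`; on `T'` they do, and there they are
    -- composable.
    set T' := {q ∈ T | Γ.toCoreQuotient (δ₁ q) = a.2.symm q.1 ∧
      Γ.toCoreQuotient (δ₂ q) = b.2.symm q.2} with hT'
    have hvT : v ∈ T := ⟨hv1, hv2, hv3⟩
    have hTT' : T' ∈ 𝓝[T] v := by
      filter_upwards [self_mem_nhdsWithin, hδ₁', hδ₂'] with q q1 q2 q3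
      exact ⟨q1, q2, q3⟩
    have hvT' : v ∈ T' := mem_of_mem_nhdsWithin hvT hTT'
    have hcomp : ∀ q ∈ T', Γ.src (δ₁ q) = Γ.tgt (δ₂ q) := by
      rintro q ⟨q1, q2, q3⟩
      have := q1.2.2
      rwa [← q2, ← q3] at this
    have h3 := plotAt_mul (Γ := Γ) (hδ₁.mono (sep_subset _ _)) (hδ₂.mono (sep_subset _ _)) hcomp hvT'
    have h4 : (quotientAtlas hreg).PlotAt _ T' v :=
      (quotAtlas_smooth continuous_toCoreQuotient).plotAt h3
    have e : ∀ q ∈ T', Γ.quotMul (a.2.symm q.1) (b.2.symm q.2) =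
        Γ.toCoreQuotient (Γ.mul (δ₁ q) (δ₂ q)) := fun q hq => by
      rw [← hq.2.1, ← hq.2.2, quotMul_mk (hcomp q hq)]
    refine (h4.of_mem_nhdsWithin hTT').congr ?_ (e v hvT')
    filter_upwards [hTT'] with q hq
    exact e q hq
  smooth_inv := by
    refine quotAtlas_smooth_of_comp (f := Γ.quotInv) ?_
    have e : Γ.quotInv ∘ Γ.toCoreQuotient = Γ.toCoreQuotient ∘ Γ.inv := funext quotInv_mk
    rw [e]
    exact Smooth.of_plotAt fun a ha v hv => (quotAtlas_smooth continuous_toCoreQuotient).plotAt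
      (Γ.smooth_inv.plotAt (plotAt_symm ha hv))
  smooth_unit := Smooth.of_plotAt fun a ha v hv =>
    (quotAtlas_smooth continuous_toCoreQuotient).plotAt
      (Γ.smooth_unit.plotAt (plotAt_symm ha hv))
  src_mul e e' h := by
    obtain ⟨g, rfl⟩ := surjective_toCoreQuotient e
    obtain ⟨g', rfl⟩ := surjective_toCoreQuotient e'
    rw [quotMul_mk h]
    exact Γ.src_mul _ _ h
  tgt_mul e e' h := by
    obtain ⟨g, rfl⟩ := surjective_toCoreQuotient e
    obtain ⟨g', rfl⟩ := surjective_toCoreQuotient e'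
    rw [quotMul_mk h]
    exact Γ.tgt_mul _ _ h
  mul_assoc e e' e'' h h' := by
    obtain ⟨g, rfl⟩ := surjective_toCoreQuotient e
    obtain ⟨g', rfl⟩ := surjective_toCoreQuotient e'
    obtain ⟨g'', rfl⟩ := surjective_toCoreQuotient e''
    rw [quotMul_mk h, quotMul_mk h', quotMul_mk ((Γ.src_mul _ _ h).trans h'),
      quotMul_mk (Eq.trans h (Γ.tgt_mul _ _ h').symm), Γ.mul_assoc _ _ _ h h']
  src_unit := Γ.src_unit
  tgt_unit := Γ.tgt_unit
  unit_mul e := by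
    obtain ⟨g, rfl⟩ := surjective_toCoreQuotient e
    rw [quotTgt_mk, quotMul_mk (Γ.src_unit _), Γ.unit_mul]
  mul_unit e := by
    obtain ⟨g, rfl⟩ := surjective_toCoreQuotient e
    rw [quotSrc_mk, quotMul_mk (Γ.tgt_unit _).symm, Γ.mul_unit]
  src_inv e := by
    obtain ⟨g, rfl⟩ := surjective_toCoreQuotient e
    rw [quotInv_mk]; exact Γ.src_inv g
  tgt_inv e := by
    obtain ⟨g, rfl⟩ := surjective_toCoreQuotient e
    rw [quotInv_mk]; exact Γ.tgt_inv g
  inv_mul e := by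
    obtain ⟨g, rfl⟩ := surjective_toCoreQuotient e
    rw [quotInv_mk, quotMul_mk (Γ.src_inv g), Γ.inv_mul, quotSrc_mk]
  mul_inv e := by
    obtain ⟨g, rfl⟩ := surjective_toCoreQuotient e
    rw [quotInv_mk, quotMul_mk (Γ.tgt_inv g).symm, Γ.mul_inv, quotTgt_mk]

theorem toCoreQuotient_isHom (hreg : Γ.IsRegular) :
    IsHom Γ (quotientGroupoid hreg) Γ.toCoreQuotient where
  smooth := quotAtlas_smooth continuous_toCoreQuotient
  src_map _ := rfl
  tgt_map _ := rfl
  map_mul _ _ e := (quotMul_mk e).symm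
  map_inv g := (quotInv_mk g).symm
  map_unit _ := rfl

/-- The class of an arrow is a translate of an identity component, hence connected, and the class of
a unit is that component itself. -/
theorem isExtension_core (hreg : Γ.IsRegular) : IsExtension (coreGroupoid hreg) Γ
    (quotientGroupoid hreg) Subtype.val Γ.toCoreQuotient where
  groupBundle := funext fun k => (tgt_eq_src_of_mem_core k.2).symm
  hom_j := coreGroupoid_isHom hreg
  hom_π := toCoreQuotient_isHom hreg
  embedding := subAtlas_embedding
  submersion := quotAtlas_submersion continuous_toCoreQuotient
  surjective := surjective_toCoreQuotient
  connected_fibres e := by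
    obtain ⟨g, rfl⟩ := surjective_toCoreQuotient e
    have h1 : Γ.toCoreQuotient ⁻¹' {Γ.toCoreQuotient g} = (Γ.mul g) '' Γ.coreAt (Γ.src g) := by
      ext h
      rw [mem_preimage, mem_singleton_iff, eq_comm, toCoreQuotient_eq_iff]
      exact ⟨fun ⟨k, hk, e⟩ => ⟨k, hk, e.symm⟩, fun ⟨k, hk, e⟩ => ⟨k, hk, e.symm⟩⟩
    rw [h1]
    refine ⟨⟨_, _, Γ.unit_mem_coreAt _, rfl⟩, (Γ.isPreconnected_coreAt _).image _ ?_⟩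
    exact Γ.continuousOn_mul continuousOn_const continuousOn_id
      fun y hy => (tgt_of_mem_coreAt hy).symm
  range_eq_kernel := by
    rw [Subtype.range_coe]
    ext g
    constructor
    · intro hg
      refine ⟨Γ.src g, (toCoreQuotient_eq_iff.2 ⟨g, ?_, ?_⟩).symm⟩
      · rw [Γ.src_unit]; exact hg
      · rw [← tgt_eq_src_of_mem_core hg, Γ.unit_mul]
    · rintro ⟨x, hx⟩
      obtain ⟨k, hk, rfl⟩ := toCoreQuotient_eq_iff.1 hx.symm
      rw [Γ.src_unit] at hk
      have := Γ.unit_mul k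
      rw [tgt_of_mem_coreAt hk] at this
      rw [this]
      exact mem_core_of_mem_coreAt hk

/-- The equivalence relation is closed and the projection open, so the quotient is Hausdorff.
Properness of (source, target) descends along the surjection from the arrows. Fibres are discrete
because nearby parallel arrows are equivalent. -/
theorem quotientGroupoid_isOrbifold [T2Space M] (hreg : Γ.IsRegular) (hprop : Γ.IsProper) :
    (quotientGroupoid hreg).IsOrbifold := by
  have := hprop.1
  have hopen := hreg.isOpenMap_toCoreQuotient
  have hq : IsOpenQuotientMap Γ.toCoreQuotient :=
    ⟨surjective_toCoreQuotient, continuous_toCoreQuotient, hopen⟩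
  refine ⟨⟨?_, ?_⟩, ?_⟩
  · rw [t2Space_iff_of_isOpenQuotientMap hq]
    have h1 : {q : G × G | Γ.toCoreQuotient q.1 = Γ.toCoreQuotient q.2} =
        {q | Γ.src q.1 = Γ.src q.2 ∧ Γ.tgt q.1 = Γ.tgt q.2} ∩
          (fun q => Γ.mul (Γ.inv q.1) q.2) ⁻¹' Γ.core := by
      ext q
      exact toCoreQuotient_eq_iff'.trans and_assoc.symm
    rw [h1]
    refine ContinuousOn.preimage_isClosed_of_isClosed ?_ ?_ (hreg.isClosed_core hprop)
    · exact Γ.continuousOn_mul (Γ.continuous_inv.comp continuous_fst).continuousOn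
        continuous_snd.continuousOn fun y hy => (Γ.src_inv _).trans hy.2
    · exact (isClosed_eq (Γ.continuous_src.comp continuous_fst)
        (Γ.continuous_src.comp continuous_snd)).inter
        (isClosed_eq (Γ.continuous_tgt.comp continuous_fst)
        (Γ.continuous_tgt.comp continuous_snd))
  · exact isProperMap_of_comp_of_surj continuous_toCoreQuotient
      (continuous_quotSrc.prodMk continuous_quotTgt) hprop.2 surjective_toCoreQuotient
  · intro p
    rw [discreteTopology_subtype_iff']
    intro e he
    obtain ⟨g, rfl⟩ := surjective_toCoreQuotient e
    have h1 : Tendsto (fun g' => (g', g)) (𝓝 g) (𝓝 (g, g)) := Continuous.tendsto' (by fun_prop) _ _ rfl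
    obtain ⟨U, hU, hUo, hgU⟩ :=
      eventually_nhds_iff.1 (h1.eventually (hreg.eventually_toCoreQuotient_eq g))
    refine ⟨Γ.toCoreQuotient '' U, hopen _ hUo, ?_⟩
    ext e'
    constructor
    · rintro ⟨⟨g', hg', rfl⟩, h2⟩
      have h3 : (Γ.src g', Γ.tgt g') = (Γ.src g, Γ.tgt g) := h2.trans he.symm
      exact hU g' hg' (Prod.ext_iff.1 h3).1 (Prod.ext_iff.1 h3).2
    · rintro rfl
      exact ⟨⟨g, hgU, rfl⟩, he⟩

end LieGroupoid

/-! ### Families continuous in a topological parameter and smooth in a vector variable;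
superposition operators. -/

/-- A family `φ : Λ → P → F` of maps between normed spaces is smooth at `(t₀, p₀)` if locally
`φ t p = ψ (τ t, p)` for a smooth map `ψ` and a continuous map `τ` to a normed space. -/
def FamSmoothAt {Λ : Type u} [TopologicalSpace Λ] {P F : Type} [NormedAddCommGroup P]
    [NormedSpace ℝ P] [NormedAddCommGroup F] [NormedSpace ℝ F] (φ : Λ → P → F)
    (t₀ : Λ) (p₀ : P) : Prop :=
  ∃ (V : Type) (_ : NormedAddCommGroup V) (_ : NormedSpace ℝ V) (τ : Λ → V) (ψ : V × P → F),
    (∀ᶠ t in 𝓝 t₀, ContinuousAt τ t) ∧ (∀ᶠ q in 𝓝 (τ t₀, p₀), ContDiffAt ℝ ∞ ψ q) ∧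
    ∀ᶠ q : Λ × P in 𝓝 (t₀, p₀), φ q.1 q.2 = ψ (τ q.1, q.2)

section Fam

variable {Λ : Type u} [TopologicalSpace Λ] {P F : Type} [NormedAddCommGroup P]
    [NormedSpace ℝ P] [NormedAddCommGroup F] [NormedSpace ℝ F] {φ : Λ → P → F} {t₀ : Λ} {p₀ : P}

theorem tendsto_prodMap_id {V : Type} [TopologicalSpace V] {τ : Λ → V} (h : ContinuousAt τ t₀) :
    Tendsto (fun q : Λ × P => (τ q.1, q.2)) (𝓝 (t₀, p₀)) (𝓝 (τ t₀, p₀)) :=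
  (h.comp (x := (t₀, p₀)) continuousAt_fst).prodMk_nhds continuousAt_snd

theorem FamSmoothAt.eventually (h : FamSmoothAt φ t₀ p₀) :
    ∀ᶠ q : Λ × P in 𝓝 (t₀, p₀), FamSmoothAt φ q.1 q.2 := by
  obtain ⟨V, _, _, τ, ψ, h1, h2, h3⟩ := h
  filter_upwards [(continuousAt_fst (p := (t₀, p₀))).eventually h1.eventually_nhds,
    (tendsto_prodMap_id h1.self_of_nhds).eventually h2.eventually_nhds, h3.eventually_nhds]
    with q q1 q2 q3
  exact ⟨V, inferInstance, inferInstance, τ, ψ, q1, q2, q3⟩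

theorem FamSmoothAt.continuousAt (h : FamSmoothAt φ t₀ p₀) :
    ContinuousAt (fun q : Λ × P => φ q.1 q.2) (t₀, p₀) := by
  obtain ⟨V, _, _, τ, ψ, h1, h2, h3⟩ := h
  refine ContinuousAt.congr ?_ (EventuallyEq.symm h3)
  exact ContinuousAt.comp (g := ψ) (f := fun q : Λ × P => (τ q.1, q.2))
    h2.self_of_nhds.continuousAt (tendsto_prodMap_id h1.self_of_nhds)

theorem FamSmoothAt.contDiffAt (h : FamSmoothAt φ t₀ p₀) : ContDiffAt ℝ ∞ (φ t₀) p₀ := by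
  obtain ⟨V, _, _, τ, ψ, h1, h2, h3⟩ := h
  have h4 : ContDiffAt ℝ ∞ (fun p => ψ (τ t₀, p)) p₀ :=
    h2.self_of_nhds.comp p₀ (f := fun p => (τ t₀, p)) (by fun_prop)
  have h5 : Tendsto (fun p : P => (t₀, p)) (𝓝 p₀) (𝓝 (t₀, p₀)) :=
    Continuous.tendsto' (by fun_prop) _ _ rfl
  exact h4.congr_of_eventuallyEq (h5.eventually h3)

/-- The derivative of a smooth family is a smooth family. -/
theorem FamSmoothAt.fderiv (h : FamSmoothAt φ t₀ p₀) :
    FamSmoothAt (fun t p => fderiv ℝ (φ t) p) t₀ p₀ := by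
  obtain ⟨V, _, _, τ, ψ, h1, h2, h3⟩ := h
  -- Only the vector variable is differentiated, so the continuous map `τ` is untouched and the form
  -- of the family persists.
  refine ⟨V, inferInstance, inferInstance, τ, fun q => (_root_.fderiv ℝ ψ q).comp (ContinuousLinearMap.inr ℝ V P), h1,
    ?_, ?_⟩
  · filter_upwards [h2] with q hq
    exact (hq.fderiv_right (m := ∞) (by simp)).clm_comp contDiffAt_const
  · filter_upwards [h3.eventually_nhds, (tendsto_prodMap_id h1.self_of_nhds).eventually h2]
      with q q1 q2
    have h5 : Tendsto (fun p : P => (q.1, p)) (𝓝 q.2) (𝓝 (q.1, q.2)) :=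
      Continuous.tendsto' (by fun_prop) _ _ rfl
    have h6 : φ q.1 =ᶠ[𝓝 q.2] fun p => ψ (τ q.1, p) := h5.eventually q1
    rw [h6.fderiv_eq]
    exact ((q2.differentiableAt (by simp)).hasFDerivAt.comp q.2
      (hasFDerivAt_prodMk_right (τ q.1) q.2)).fderiv

end Fam

section Nemytskii

variable {Λ : Type u} [TopologicalSpace Λ] [CompactSpace Λ] {P : Type} [NormedAddCommGroup P]
    [NormedSpace ℝ P]

open Classical in
/-- The superposition operator `u ↦ (t ↦ φ t (u t))`. -/
noncomputable def superposition {F : Type} [NormedAddCommGroup F] (φ : Λ → P → F)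
    (u : C(Λ, P)) : C(Λ, F) :=
  if h : Continuous fun t => φ t (u t) then ⟨_, h⟩ else 0

/-- Pointwise application of operators. -/
noncomputable def pointwiseApply (Λ : Type u) [TopologicalSpace Λ] [CompactSpace Λ] (P F : Type)
    [NormedAddCommGroup P] [NormedSpace ℝ P] [NormedAddCommGroup F] [NormedSpace ℝ F] :
    C(Λ, P →L[ℝ] F) →L[ℝ] C(Λ, P) →L[ℝ] C(Λ, F) :=
  LinearMap.mkContinuous₂ (LinearMap.mk₂ ℝ
    (fun (L : C(Λ, P →L[ℝ] F)) (u : C(Λ, P)) =>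
      (⟨fun t => L t (u t), L.continuous.clm_apply u.continuous⟩ : C(Λ, F)))
    (fun L L' u => by ext t; simp) (fun c L u => by ext t; simp) (fun L u u' => by ext t; simp)
    (fun c L u => by ext t; simp)) 1 fun L u => by
    rw [one_mul, ContinuousMap.norm_le _ (by positivity)]
    intro t
    exact ((L t).le_opNorm _).trans
      (mul_le_mul (L.norm_coe_le_norm t) (u.norm_coe_le_norm t) (by positivity) (by positivity))

variable {F : Type} [NormedAddCommGroup F] [NormedSpace ℝ F] {φ : Λ → P → F} {U : Set P}

theorem pointwiseApply_apply (L : C(Λ, P →L[ℝ] F)) (u : C(Λ, P)) (t : Λ) :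
    pointwiseApply Λ P F L u t = L t (u t) := rfl

theorem superposition_apply (hφ : ∀ t, ∀ p ∈ U, FamSmoothAt φ t p) {u : C(Λ, P)}
    (hu : MapsTo u univ U) (t : Λ) : superposition φ u t = φ t (u t) := by
  have h : Continuous fun t => φ t (u t) := continuous_iff_continuousAt.2 fun t =>
    ContinuousAt.comp (g := fun q : Λ × P => φ q.1 q.2) (f := fun t => (t, u t))
      (hφ t _ (hu trivial)).continuousAt (by fun_prop)
  simp [superposition, h]

theorem isOpen_mapsTo (hU : IsOpen U) : IsOpen {u : C(Λ, P) | MapsTo u univ U} :=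
  ContinuousMap.isOpen_setOfPred_mapsTo isCompact_univ hU

/-- The derivative acts pointwise. The mean value inequality bounds the error at each `t`, and
compactness of `Λ` makes the bound uniform. -/
theorem hasFDerivAt_superposition (hU : IsOpen U) (hφ : ∀ t, ∀ p ∈ U, FamSmoothAt φ t p)
    {u : C(Λ, P)} (hu : MapsTo u univ U) :
    HasFDerivAt (superposition φ)
      (pointwiseApply Λ P F (superposition (fun t p => fderiv ℝ (φ t) p) u)) u := by
  have hφ' : ∀ t, ∀ p ∈ U, FamSmoothAt (fun t p => fderiv ℝ (φ t) p) t p :=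
    fun t p hp => (hφ t p hp).fderiv
  rw [hasFDerivAt_iff_isLittleO, Asymptotics.isLittleO_iff]
  intro ε hε
  -- The tube lemma yields one radius on which the derivatives oscillate by at most `ε` for all `t`.
  have key : ∀ᶠ q in 𝓝 (0 : P), ∀ t ∈ (univ : Set Λ), u t + q ∈ U ∧
      ‖fderiv ℝ (φ t) (u t + q) - fderiv ℝ (φ t) (u t)‖ ≤ ε := by
    refine isCompact_univ.eventually_forall_of_forall_eventually fun t _ => ?_
    have c1 : ContinuousAt (fun z : P × Λ => (z.2, u z.2 + z.1)) (0, t) := by fun_prop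
    have c2 : ContinuousAt (fun z : P × Λ => (z.2, u z.2)) (0, t) := by fun_prop
    have h0 := (hφ' t _ (hu (mem_univ t))).continuousAt
    have e1 : Tendsto (fun z : P × Λ => fderiv ℝ (φ z.2) (u z.2 + z.1)) (𝓝 (0, t))
        (𝓝 (fderiv ℝ (φ t) (u t))) := by
      have : Tendsto (fun z : P × Λ => (z.2, u z.2 + z.1)) (𝓝 (0, t)) (𝓝 (t, u t)) := by
        simpa [ContinuousAt] using c1
      exact h0.tendsto.comp this
    have e2 : Tendsto (fun z : P × Λ => fderiv ℝ (φ z.2) (u z.2)) (𝓝 (0, t))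
        (𝓝 (fderiv ℝ (φ t) (u t))) := h0.tendsto.comp c2
    have e3 := (e1.sub e2).norm
    rw [sub_self, norm_zero] at e3
    have e4 : Tendsto (fun z : P × Λ => u z.2 + z.1) (𝓝 (0, t)) (𝓝 (u t)) := by
      have : ContinuousAt (fun z : P × Λ => u z.2 + z.1) (0, t) := by fun_prop
      simpa [ContinuousAt] using this
    filter_upwards [e3.eventually (eventually_le_nhds hε),
      e4.eventually (hU.mem_nhds (hu (mem_univ t)))] with z z1 z2
    exact ⟨z2, z1⟩
  obtain ⟨δ, hδ, hball⟩ := Metric.eventually_nhds_iff_ball.1 key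
  have hev : ∀ᶠ u' in 𝓝 u, ‖u' - u‖ < δ := by
    have : Tendsto (fun u' => ‖u' - u‖) (𝓝 u) (𝓝 0) := by
      have h := (continuous_id.sub (continuous_const (y := u))).norm.tendsto u
      simpa using h
    exact this.eventually (gt_mem_nhds hδ)
  filter_upwards [hev, (isOpen_mapsTo hU).mem_nhds hu] with u' hu'1 hu'2
  rw [ContinuousMap.norm_le _ (by positivity)]
  intro t
  simp only [ContinuousMap.sub_apply, superposition_apply hφ hu, superposition_apply hφ hu'2,
    pointwiseApply_apply, superposition_apply hφ' hu]
  have hlt : ∀ t, ‖u' t - u t‖ < δ := fun t =>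
    lt_of_le_of_lt ((u' - u).norm_coe_le_norm t) hu'1
  have hdiff : ∀ x ∈ Metric.ball (u t) δ,
      HasFDerivWithinAt (φ t) (fderiv ℝ (φ t) x) (Metric.ball (u t) δ) x := by
    intro x hx
    have hx' := (hball (x - u t) (by simpa [dist_eq_norm] using hx) t trivial).1
    rw [add_sub_cancel] at hx'
    exact ((hφ t x hx').contDiffAt.differentiableAt (by simp)).hasFDerivAt.hasFDerivWithinAt
  have hbd : ∀ x ∈ Metric.ball (u t) δ, ‖fderiv ℝ (φ t) x - fderiv ℝ (φ t) (u t)‖ ≤ ε := by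
    intro x hx
    have hx' := (hball (x - u t) (by simpa [dist_eq_norm] using hx) t trivial).2
    rwa [add_sub_cancel] at hx'
  refine ((convex_ball (u t) δ).norm_image_sub_le_of_norm_hasFDerivWithin_le' hdiff hbd
    (Metric.mem_ball_self hδ) (by simpa [dist_eq_norm] using hlt t)).trans ?_
  exact mul_le_mul_of_nonneg_left ((u' - u).norm_coe_le_norm t) hε.le

/-- Superposition operators of smooth families are smooth. -/
theorem contDiffOn_superposition (hU : IsOpen U) (hφ : ∀ t, ∀ p ∈ U, FamSmoothAt φ t p) :
    ContDiffOn ℝ ∞ (superposition φ) {u | MapsTo u univ U} := by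
  rw [contDiffOn_infty]
  intro n
  -- The derivative is again a superposition operator, of a family with values in `P →L[ℝ] F`; hence
  -- the target space must vary.
  induction n generalizing F with
  | zero =>
    refine contDiffOn_zero.2 fun u hu => ?_
    exact (hasFDerivAt_superposition hU hφ hu).continuousAt.continuousWithinAt
  | succ n ih =>
    rw [Nat.cast_succ, contDiffOn_succ_iff_fderiv_of_isOpen (isOpen_mapsTo hU)]
    refine ⟨fun u hu => (hasFDerivAt_superposition hU hφ
      hu).differentiableAt.differentiableWithinAt, by simp, ?_⟩
    have h1 := ih (φ := fun t p => fderiv ℝ (φ t) p) fun t p hp => (hφ t p hp).fderiv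
    have h2 : ContDiff ℝ n (pointwiseApply Λ P F) :=
      ContinuousLinearMap.contDiff (𝕜 := ℝ) (E := C(Λ, P →L[ℝ] F)) (F := C(Λ, P) →L[ℝ] C(Λ, F)) _
    exact (h2.comp_contDiffOn h1).congr fun u hu => (hasFDerivAt_superposition hU hφ hu).fderiv

end Nemytskii

section FamSmooth

variable {Λ : Type u} [TopologicalSpace Λ] {P F F' : Type} [NormedAddCommGroup P]
    [NormedSpace ℝ P] [NormedAddCommGroup F] [NormedSpace ℝ F] [NormedAddCommGroup F']
    [NormedSpace ℝ F'] {φ : Λ → P → F} {t₀ : Λ} {p₀ : P}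

theorem tendsto_fst_prodMk {V V' : Type} [TopologicalSpace V] [TopologicalSpace V'] {v : V}
    {v' : V'} {p : P} : Tendsto (fun q : (V × V') × P => (q.1.1, q.2)) (𝓝 ((v, v'), p))
      (𝓝 (v, p)) := Continuous.tendsto' (by fun_prop) _ _ rfl

theorem tendsto_snd_prodMk {V V' : Type} [TopologicalSpace V] [TopologicalSpace V'] {v : V}
    {v' : V'} {p : P} : Tendsto (fun q : (V × V') × P => (q.1.2, q.2)) (𝓝 ((v, v'), p))
      (𝓝 (v', p)) := Continuous.tendsto' (by fun_prop) _ _ rfl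

theorem FamSmoothAt.prodMk {φ' : Λ → P → F'} (h : FamSmoothAt φ t₀ p₀)
    (h' : FamSmoothAt φ' t₀ p₀) : FamSmoothAt (fun t p => (φ t p, φ' t p)) t₀ p₀ := by
  obtain ⟨V, _, _, τ, ψ, h1, h2, h3⟩ := h
  obtain ⟨V', _, _, τ', ψ', h1', h2', h3'⟩ := h'
  refine ⟨V × V', inferInstance, inferInstance, fun t => (τ t, τ' t),
    fun q => (ψ (q.1.1, q.2), ψ' (q.1.2, q.2)), ?_, ?_, ?_⟩
  · filter_upwards [h1, h1'] with t t1 t2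
    exact t1.prodMk t2
  · filter_upwards [tendsto_fst_prodMk.eventually h2, tendsto_snd_prodMk.eventually h2']
      with q q1 q2
    exact (q1.comp q (f := fun q => (q.1.1, q.2)) (by fun_prop)).prodMk
      (q2.comp q (f := fun q => (q.1.2, q.2)) (by fun_prop))
  · filter_upwards [h3, h3'] with q q1 q2
    rw [q1, q2]

theorem FamSmoothAt.of_continuous {τ : Λ → F} (h : Continuous τ) :
    FamSmoothAt (fun t (_ : P) => τ t) t₀ p₀ :=
  ⟨F, inferInstance, inferInstance, τ, Prod.fst, Eventually.of_forall fun _ => h.continuousAt,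
    Eventually.of_forall fun _ => contDiffAt_fst, Eventually.of_forall fun _ => rfl⟩

theorem FamSmoothAt.of_contDiff {g : P → F} (h : ContDiff ℝ ∞ g) :
    FamSmoothAt (fun (_ : Λ) p => g p) t₀ p₀ :=
  ⟨ℝ, inferInstance, inferInstance, fun _ => 0, fun q => g q.2,
    Eventually.of_forall fun _ => continuousAt_const,
    Eventually.of_forall fun _ => (h.comp contDiff_snd).contDiffAt, Eventually.of_forall fun _ => rfl⟩

theorem FamSmoothAt.comp {g : F → F'} (hg : ContDiff ℝ ∞ g) (h : FamSmoothAt φ t₀ p₀) :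
    FamSmoothAt (fun t p => g (φ t p)) t₀ p₀ := by
  obtain ⟨V, _, _, τ, ψ, h1, h2, h3⟩ := h
  refine ⟨V, inferInstance, inferInstance, τ, fun q => g (ψ q), h1, ?_, ?_⟩
  · filter_upwards [h2] with q hq
    exact hg.contDiffAt.comp q hq
  · filter_upwards [h3] with q hq
    simp only [hq]

end FamSmooth

/-! ### Smooth families with values in a manifold. -/

namespace SmoothAtlas

variable {X : Type v} [TopologicalSpace X] (B : SmoothAtlas X)
  {Λ : Type u} [TopologicalSpace Λ] {P P' F : Type} [NormedAddCommGroup P]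
    [NormedSpace ℝ P] [NormedAddCommGroup P'] [NormedSpace ℝ P'] [NormedAddCommGroup F]
    [NormedSpace ℝ F] {φ : Λ → P → X} {t₀ : Λ} {p₀ : P}

/-- Smooth families of maps from a normed space to a manifold, see `FamSmoothAt`. -/
def FamPlotAt (φ : Λ → P → X) (t₀ : Λ) (p₀ : P) : Prop :=
  ∃ (V : Type) (_ : NormedAddCommGroup V) (_ : NormedSpace ℝ V) (τ : Λ → V) (ψ : V × P → X),
    (∀ᶠ t in 𝓝 t₀, ContinuousAt τ t) ∧ (∀ᶠ q in 𝓝 (τ t₀, p₀), B.PlotAt ψ univ q) ∧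
    ∀ᶠ q : Λ × P in 𝓝 (t₀, p₀), φ q.1 q.2 = ψ (τ q.1, q.2)

variable {B}

theorem FamPlotAt.eventually (h : B.FamPlotAt φ t₀ p₀) :
    ∀ᶠ q : Λ × P in 𝓝 (t₀, p₀), B.FamPlotAt φ q.1 q.2 := by
  obtain ⟨V, _, _, τ, ψ, h1, h2, h3⟩ := h
  filter_upwards [(continuousAt_fst (p := (t₀, p₀))).eventually h1.eventually_nhds,
    (tendsto_prodMap_id h1.self_of_nhds).eventually h2.eventually_nhds, h3.eventually_nhds]
    with q q1 q2 q3
  exact ⟨V, inferInstance, inferInstance, τ, ψ, q1, q2, q3⟩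

theorem FamPlotAt.continuousAt (h : B.FamPlotAt φ t₀ p₀) :
    ContinuousAt (fun q : Λ × P => φ q.1 q.2) (t₀, p₀) := by
  obtain ⟨V, _, _, τ, ψ, h1, h2, h3⟩ := h
  refine ContinuousAt.congr ?_ (EventuallyEq.symm h3)
  exact ContinuousAt.comp (g := ψ) (f := fun q : Λ × P => (τ q.1, q.2))
    h2.self_of_nhds.continuousAt (tendsto_prodMap_id h1.self_of_nhds)

theorem FamPlotAt.plotAt (h : B.FamPlotAt φ t₀ p₀) : B.PlotAt (φ t₀) univ p₀ := by
  obtain ⟨V, _, _, τ, ψ, h1, h2, h3⟩ := h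
  have h4 : B.PlotAt (fun p => ψ (τ t₀, p)) univ p₀ :=
    PlotAt.comp_contDiffAt (φ := fun p => (τ t₀, p)) h2.self_of_nhds (by fun_prop)
  have h5 : Tendsto (fun p : P => (t₀, p)) (𝓝 p₀) (𝓝 (t₀, p₀)) :=
    Continuous.tendsto' (by fun_prop) _ _ rfl
  exact h4.congr_nhds (h5.eventually h3)

theorem FamPlotAt.congr {φ' : Λ → P → X} (h : B.FamPlotAt φ t₀ p₀)
    (he : ∀ᶠ q : Λ × P in 𝓝 (t₀, p₀), φ' q.1 q.2 = φ q.1 q.2) : B.FamPlotAt φ' t₀ p₀ := by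
  obtain ⟨V, _, _, τ, ψ, h1, h2, h3⟩ := h
  refine ⟨V, inferInstance, inferInstance, τ, ψ, h1, h2, ?_⟩
  filter_upwards [h3, he] with q q1 q2
  rw [q2, q1]

theorem _root_.FamSmoothAt.comp_plot {φ : Λ → P → F} {γ : F → X} (hφ : FamSmoothAt φ t₀ p₀)
    (hγ : ∀ᶠ q in 𝓝 (φ t₀ p₀), B.PlotAt γ univ q) :
    B.FamPlotAt (fun t p => γ (φ t p)) t₀ p₀ := by
  obtain ⟨V, _, _, τ, ψ, h1, h2, h3⟩ := hφ
  refine ⟨V, inferInstance, inferInstance, τ, fun q => γ (ψ q), h1, ?_, ?_⟩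
  · have hc := h2.self_of_nhds.continuousAt
    rw [ContinuousAt, ← h3.self_of_nhds] at hc
    filter_upwards [h2, hc.eventually hγ] with q q1 q2
    exact PlotAt.comp_contDiffAt (φ := ψ) q2 q1
  · filter_upwards [h3] with q hq
    simp only [hq]

theorem FamPlotAt.comp_funAt {h : X → F} (hφ : B.FamPlotAt φ t₀ p₀)
    (hh : ∀ᶠ k in 𝓝 (φ t₀ p₀), B.FunAt h k) : FamSmoothAt (fun t p => h (φ t p)) t₀ p₀ := by
  obtain ⟨V, _, _, τ, ψ, h1, h2, h3⟩ := hφ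
  refine ⟨V, inferInstance, inferInstance, τ, fun q => h (ψ q), h1, ?_, ?_⟩
  · have hc := h2.self_of_nhds.continuousAt
    rw [ContinuousAt, ← h3.self_of_nhds] at hc
    filter_upwards [h2, hc.eventually hh] with q q1 q2
    exact FunAt.comp_plot (γ := ψ) q2 q1
  · filter_upwards [h3] with q hq
    simp only [hq]

theorem FamPlotAt.reparam {Λ' : Type w} [TopologicalSpace Λ'] {σ : Λ' → Λ} (hσ : Continuous σ)
    {g : P' → P} (hg : ContDiff ℝ ∞ g) {t₀ : Λ'} {p₀ : P'} (h : B.FamPlotAt φ (σ t₀) (g p₀)) :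
    B.FamPlotAt (fun t p => φ (σ t) (g p)) t₀ p₀ := by
  obtain ⟨V, _, _, τ, ψ, h1, h2, h3⟩ := h
  refine ⟨V, inferInstance, inferInstance, fun t => τ (σ t), fun q => ψ (q.1, g q.2), ?_, ?_, ?_⟩
  · filter_upwards [hσ.continuousAt.eventually h1] with t ht
    exact ht.comp hσ.continuousAt
  · have hc : Tendsto (fun q : V × P' => (q.1, g q.2)) (𝓝 (τ (σ t₀), p₀)) (𝓝 (τ (σ t₀), g p₀)) :=
      Continuous.tendsto' (continuous_fst.prodMk (hg.continuous.comp continuous_snd)) _ _ rfl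
    filter_upwards [hc.eventually h2] with q hq
    exact PlotAt.comp_contDiffAt (φ := fun q : V × P' => (q.1, g q.2)) hq
      (contDiffAt_fst.prodMk (hg.contDiffAt.comp q contDiffAt_snd))
  · have hc : Tendsto (fun q : Λ' × P' => (σ q.1, g q.2)) (𝓝 (t₀, p₀)) (𝓝 (σ t₀, g p₀)) :=
      Continuous.tendsto' ((hσ.comp continuous_fst).prodMk (hg.continuous.comp continuous_snd))
        _ _ rfl
    exact hc.eventually h3

theorem FamPlotAt.of_plot {γ : P → X} (h : ∀ᶠ p in 𝓝 p₀, B.PlotAt γ univ p) :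
    B.FamPlotAt (fun (_ : Λ) p => γ p) t₀ p₀ :=
  FamSmoothAt.comp_plot (φ := fun (_ : Λ) p => p) (FamSmoothAt.of_contDiff contDiff_id) h

end SmoothAtlas

/-! ### Bundles of Lie groups: products of families and coordinates around the units. -/

namespace LieGroupoid
open SmoothAtlas

variable {M : Type v} [TopologicalSpace M] {A : SmoothAtlas M}
  {K : Type u} [TopologicalSpace K] {B : SmoothAtlas K} {κ : LieGroupoid A B}

theorem IsGroupBundle.tgt_eq (hb : κ.IsGroupBundle) (k : K) : κ.tgt k = κ.src k :=
  (congrFun hb k).symm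

/-- The multiplication of a bundle of Lie groups extends locally to a smooth map that is defined on
all pairs. -/
theorem IsGroupBundle.exists_extension_mul (hb : κ.IsGroupBundle) {k₁ k₂ : K}
    (h : κ.src k₁ = κ.src k₂) :
    ∃ m : K → K → K, (∀ᶠ q : K × K in 𝓝 (k₁, k₂), κ.src q.1 = κ.src q.2 →
      m q.1 q.2 = κ.mul q.1 q.2) ∧ ∀ᶠ q : K × K in 𝓝 (k₁, k₂),
        ∀ (E : Type) [NormedAddCommGroup E] [NormedSpace ℝ E] (γ δ : E → K) (p : E),
          γ p = q.1 → δ p = q.2 → B.PlotAt γ univ p → B.PlotAt δ univ p →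
          B.PlotAt (fun e => m (γ e) (δ e)) univ p := by
  obtain ⟨a, ha, hxa⟩ := A.cover (κ.src k₂)
  obtain ⟨d, θ, η, h0, h1, h2⟩ := κ.exists_src_coordinates k₂ ha hxa
  have hxa' : κ.src k₁ ∈ a.2.source := h ▸ hxa
  have hc2 : Tendsto (fun q : K × K => q.2) (𝓝 (k₁, k₂)) (𝓝 k₂) := continuousAt_snd
  have hs1 : Tendsto (fun q : K × K => κ.src q.1) (𝓝 (k₁, k₂)) (𝓝 (κ.src k₁)) :=
    (κ.continuous_src.comp continuous_fst).continuousAt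
  have hη : Tendsto (fun q : K × K => η q.2) (𝓝 (k₁, k₂)) (𝓝 0) := by
    have := h2.self_of_nhds.1.continuousAt
    rw [ContinuousAt, h0] at this
    exact this.comp hc2
  have hq : Tendsto (fun q : K × K => (a.2 (κ.src q.1), η q.2)) (𝓝 (k₁, k₂))
      (𝓝 (a.2 (κ.src k₂), 0)) := by
    rw [← h]
    exact ((a.2.continuousAt hxa').tendsto.comp hs1).prodMk_nhds hη
  have hsa : ∀ᶠ q : K × K in 𝓝 (k₁, k₂), κ.src q.1 ∈ a.2.source :=
    hs1.eventually (a.2.open_source.mem_nhds hxa')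
  -- The second factor is moved to the fibre of the first along the coordinate `η`, which changes
  -- nothing if the fibres already agree.
  refine ⟨fun k k' => κ.mul k (θ (a.2 (κ.src k), η k')), ?_, ?_⟩
  · filter_upwards [hc2.eventually h2] with q q1 e
    rw [e, q1.2]
  · have hcomp : ∀ᶠ q : K × K in 𝓝 (k₁, k₂),
        κ.src q.1 = κ.tgt (θ (a.2 (κ.src q.1), η q.2)) := by
      filter_upwards [hq.eventually h1, hsa] with q q1 q2
      rw [hb.tgt_eq, q1.2.1, a.2.left_inv q2]
    filter_upwards [hq.eventually h1, hsa, hc2.eventually h2, hcomp.eventually_nhds]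
      with q q1 q2 q3 q4 E _ _ γ δ p hγ hδ pγ pδ
    obtain ⟨k, k'⟩ := q
    dsimp only at hγ hδ
    subst hγ hδ
    refine plotAt_mul_nhds pγ ?_ ((pγ.continuousAt.prodMk pδ.continuousAt).eventually q4)
    refine PlotAt.comp_contDiffAt (φ := fun e => (a.2 (κ.src (γ e)), η (δ e))) q1.1
      (ContDiffAt.prodMk ?_ ?_)
    · exact FunAt.comp_plot (h := a.2 ∘ κ.src)
        (κ.src_submersion.1.funAt (funAt_chart ha q2)) pγ
    · exact FunAt.comp_plot q3.1 pδ

section Fam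

variable {Λ : Type w} [TopologicalSpace Λ] {P : Type} [NormedAddCommGroup P]
    [NormedSpace ℝ P] {φ φ' : Λ → P → K} {t₀ : Λ} {p₀ : P}

/-- The families have independent auxiliary parameters, and for most pairs of them the values are
not composable. The extended multiplication is defined for all pairs. -/
theorem IsGroupBundle.famPlotAt_mul (hb : κ.IsGroupBundle) (h : B.FamPlotAt φ t₀ p₀)
    (h' : B.FamPlotAt φ' t₀ p₀)
    (hs : ∀ᶠ q : Λ × P in 𝓝 (t₀, p₀), κ.src (φ q.1 q.2) = κ.src (φ' q.1 q.2)) :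
    B.FamPlotAt (fun t p => κ.mul (φ t p) (φ' t p)) t₀ p₀ := by
  have hc := h.continuousAt.prodMk h'.continuousAt
  obtain ⟨m, hm1, hm2⟩ := hb.exists_extension_mul hs.self_of_nhds
  obtain ⟨V, _, _, τ, ψ, h1, h2, h3⟩ := h
  obtain ⟨V', _, _, τ', ψ', h1', h2', h3'⟩ := h'
  refine ⟨V × V', inferInstance, inferInstance, fun t => (τ t, τ' t),
    fun q => m (ψ (q.1.1, q.2)) (ψ' (q.1.2, q.2)), ?_, ?_, ?_⟩
  · filter_upwards [h1, h1'] with t t1 t2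
    exact t1.prodMk t2
  · have c1 : Tendsto (fun q : (V × V') × P => ψ (q.1.1, q.2)) (𝓝 ((τ t₀, τ' t₀), p₀))
        (𝓝 (φ t₀ p₀)) := by
      rw [show φ t₀ p₀ = ψ (τ t₀, p₀) from h3.self_of_nhds]
      exact h2.self_of_nhds.continuousAt.tendsto.comp tendsto_fst_prodMk
    have c2 : Tendsto (fun q : (V × V') × P => ψ' (q.1.2, q.2)) (𝓝 ((τ t₀, τ' t₀), p₀))
        (𝓝 (φ' t₀ p₀)) := by
      rw [show φ' t₀ p₀ = ψ' (τ' t₀, p₀) from h3'.self_of_nhds]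
      exact h2'.self_of_nhds.continuousAt.tendsto.comp tendsto_snd_prodMk
    filter_upwards [tendsto_fst_prodMk.eventually h2, tendsto_snd_prodMk.eventually h2',
      (c1.prodMk_nhds c2).eventually hm2] with q q1 q2 q3
    exact q3 _ (fun q : (V × V') × P => ψ (q.1.1, q.2)) (fun q => ψ' (q.1.2, q.2)) q rfl rfl
      (PlotAt.comp_contDiffAt (φ := fun q : (V × V') × P => (q.1.1, q.2)) q1 (by fun_prop))
      (PlotAt.comp_contDiffAt (φ := fun q : (V × V') × P => (q.1.2, q.2)) q2 (by fun_prop))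
  · filter_upwards [h3, h3', hs, hc.eventually hm1] with q q1 q2 q3 q4
    rw [← q1, ← q2, q4 q3]

theorem famPlotAt_inv (h : B.FamPlotAt φ t₀ p₀) :
    B.FamPlotAt (fun t p => κ.inv (φ t p)) t₀ p₀ := by
  obtain ⟨V, _, _, τ, ψ, h1, h2, h3⟩ := h
  refine ⟨V, inferInstance, inferInstance, τ, fun q => κ.inv (ψ q), h1, ?_, ?_⟩
  · filter_upwards [h2] with q hq
    exact κ.smooth_inv.plotAt hq
  · filter_upwards [h3] with q hq
    simp only [hq]

end Fam

/-- Coordinates on a bundle of Lie groups near a unit, which vanish on the units. -/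
structure UnitCoordinates (κ : LieGroupoid A B)
    (a : Σ n : ℕ, OpenPartialHomeomorph M (EuclideanSpace ℝ (Fin n))) (x₀ : M) where
  d : ℕ
  θ : EuclideanSpace ℝ (Fin a.1) × EuclideanSpace ℝ (Fin d) → K
  η : K → EuclideanSpace ℝ (Fin d)
  mem : a ∈ A.charts
  mem_source : x₀ ∈ a.2.source
  plot : ∀ᶠ q in 𝓝 (a.2 x₀, (0 : EuclideanSpace ℝ (Fin d))),
    B.PlotAt θ univ q ∧ κ.src (θ q) = a.2.symm q.1 ∧ η (θ q) = q.2
  coord : ∀ᶠ k in 𝓝 (κ.unit x₀), B.FunAt η k ∧ θ (a.2 (κ.src k), η k) = k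
  unit : ∀ᶠ y in 𝓝 (a.2 x₀), θ (y, 0) = κ.unit (a.2.symm y)

/-- Subtracting from the fibre coordinate its value `u` on the units makes it vanish along them. -/
theorem nonempty_unitCoordinates (κ : LieGroupoid A B)
    {a : Σ n : ℕ, OpenPartialHomeomorph M (EuclideanSpace ℝ (Fin n))} (ha : a ∈ A.charts)
    {x₀ : M} (hxa : x₀ ∈ a.2.source) : Nonempty (κ.UnitCoordinates a x₀) := by
  obtain ⟨d, θ, η, h0, h1, h2⟩ := κ.exists_src_coordinates (κ.unit x₀) ha (by rwa [κ.src_unit])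
  rw [κ.src_unit] at h1
  set u : EuclideanSpace ℝ (Fin a.1) → EuclideanSpace ℝ (Fin d) :=
    fun y => η (κ.unit (a.2.symm y)) with hu
  have hax : a.2 x₀ ∈ a.2.target := a.2.map_source hxa
  have hat : ∀ᶠ y in 𝓝 (a.2 x₀), y ∈ a.2.target := a.2.open_target.mem_nhds hax
  have hunit : Tendsto (fun y => κ.unit (a.2.symm y)) (𝓝 (a.2 x₀)) (𝓝 (κ.unit x₀)) :=
    (κ.continuous_unit.tendsto x₀).comp (tendsto_symm hxa)
  have hus : ∀ᶠ y in 𝓝 (a.2 x₀), ContDiffAt ℝ ∞ u y := by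
    filter_upwards [hunit.eventually h2, hat] with y y1 y2
    exact FunAt.comp_plot (γ := fun y => κ.unit (a.2.symm y)) y1.1
      (κ.smooth_unit.plotAt (plotAt_symm ha y2))
  have hu0 : u (a.2 x₀) = 0 := by simp only [hu, a.2.left_inv hxa, h0]
  have hηu : ∀ᶠ y in 𝓝 (a.2 x₀), θ (y, u y) = κ.unit (a.2.symm y) := by
    filter_upwards [hunit.eventually h2, hat] with y y1 y2
    have := y1.2
    rwa [κ.src_unit, a.2.right_inv y2] at this
  have hfst : Tendsto (fun q : EuclideanSpace ℝ (Fin a.1) × EuclideanSpace ℝ (Fin d) => q.1)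
      (𝓝 (a.2 x₀, 0)) (𝓝 (a.2 x₀)) := continuousAt_fst
  have hsh : Tendsto (fun q : EuclideanSpace ℝ (Fin a.1) × EuclideanSpace ℝ (Fin d) =>
      (q.1, u q.1 + q.2)) (𝓝 (a.2 x₀, 0)) (𝓝 (a.2 x₀, 0)) := by
    have c1 : Tendsto (fun q : EuclideanSpace ℝ (Fin a.1) × EuclideanSpace ℝ (Fin d) => u q.1)
      (𝓝 (a.2 x₀, 0)) (𝓝 0) := by
      have := hus.self_of_nhds.continuousAt.tendsto.comp hfst
      rwa [hu0] at this
    have c2 : Tendsto (fun q : EuclideanSpace ℝ (Fin a.1) × EuclideanSpace ℝ (Fin d) => q.2)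
      (𝓝 (a.2 x₀, 0)) (𝓝 0) := continuousAt_snd
    simpa using hfst.prodMk_nhds (c1.add c2)
  have hsrc : Tendsto κ.src (𝓝 (κ.unit x₀)) (𝓝 x₀) := by
    simpa only [κ.src_unit] using κ.continuous_src.tendsto (κ.unit x₀)
  have hsa : Tendsto (fun k => a.2 (κ.src k)) (𝓝 (κ.unit x₀)) (𝓝 (a.2 x₀)) :=
    (a.2.continuousAt hxa).tendsto.comp hsrc
  exact ⟨{
    d := d
    θ := fun q => θ (q.1, u q.1 + q.2)
    η := fun k => η k - u (a.2 (κ.src k))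
    mem := ha
    mem_source := hxa
    plot := by
      filter_upwards [hsh.eventually h1, hfst.eventually hus, hfst.eventually hat] with q q1 q2 q3
      refine ⟨PlotAt.comp_contDiffAt (φ := fun q : EuclideanSpace ℝ (Fin a.1) ×
        EuclideanSpace ℝ (Fin d) => (q.1, u q.1 + q.2)) q1.1 ?_, q1.2.1, ?_⟩
      · exact contDiffAt_fst.prodMk ((q2.comp q contDiffAt_fst).add contDiffAt_snd)
      · rw [q1.2.2, q1.2.1, a.2.right_inv q3]
        simp
    coord := by
      filter_upwards [h2, hsa.eventually hus, hsrc.eventually (a.2.open_source.mem_nhds hxa)]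
        with k k1 k2 k3
      refine ⟨ContDiffAt.comp_funAt (φ := fun v : EuclideanSpace ℝ (Fin d) ×
        EuclideanSpace ℝ (Fin d) => v.1 - v.2)
        (h := fun k => (η k, u (a.2 (κ.src k)))) (by fun_prop) (k1.1.prodMk ?_), ?_⟩
      · exact ContDiffAt.comp_funAt (h := a.2 ∘ κ.src) k2
          (κ.src_submersion.1.funAt (funAt_chart ha k3))
      · rw [add_sub_cancel, k1.2]
    unit := by
      filter_upwards [hηu] with y hy
      rw [add_zero, hy] }⟩

namespace UnitCoordinates

variable {a : Σ n : ℕ, OpenPartialHomeomorph M (EuclideanSpace ℝ (Fin n))} {x₀ : M}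

theorem symm_base (c : κ.UnitCoordinates a x₀) : a.2.symm (a.2 x₀) = x₀ := a.2.left_inv c.mem_source

theorem θ_base (c : κ.UnitCoordinates a x₀) : c.θ (a.2 x₀, 0) = κ.unit x₀ := by rw [c.unit.self_of_nhds, c.symm_base]

theorem η_unit (c : κ.UnitCoordinates a x₀) : c.η (κ.unit x₀) = 0 := by
  rw [← c.θ_base]; exact c.plot.self_of_nhds.2.2

theorem tendsto_η (c : κ.UnitCoordinates a x₀) : Tendsto c.η (𝓝 (κ.unit x₀)) (𝓝 0) := by
  have := c.coord.self_of_nhds.1.continuousAt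
  rwa [ContinuousAt, c.η_unit] at this

end UnitCoordinates

end LieGroupoid

/-! ### A fibre of the bundle as a Lie group. -/

namespace LieGroupoid
open SmoothAtlas

variable {M : Type v} [TopologicalSpace M] {A : SmoothAtlas M}
  {K : Type u} [TopologicalSpace K] {B : SmoothAtlas K} (κ : LieGroupoid A B)

/-- The source fibre over `x`, which for a bundle of Lie groups is a Lie group. -/
abbrev Fibre (x : M) : Type u := ↥(κ.src ⁻¹' {x})

namespace Fibre

variable {κ} {x : M}

theorem src_coe (l : κ.Fibre x) : κ.src (l : K) = x := l.2

theorem ext {l l' : κ.Fibre x} (h : (l : K) = l') : l = l' := Subtype.ext h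

theorem continuous_coe : Continuous fun l : κ.Fibre x => (l : K) := continuous_subtype_val

variable [hb : Fact κ.IsGroupBundle]

theorem tgt_coe (l : κ.Fibre x) : κ.tgt (l : K) = x := (hb.out.tgt_eq _).trans l.2

noncomputable instance : Group (κ.Fibre x) where
  mul l l' := ⟨κ.mul l l', (κ.src_mul _ _ (l.src_coe.trans l'.tgt_coe.symm)).trans l'.2⟩
  one := ⟨κ.unit x, κ.src_unit x⟩
  inv l := ⟨κ.inv l, (κ.src_inv _).trans l.tgt_coe⟩
  mul_assoc l l' l'' := Subtype.ext (κ.mul_assoc _ _ _ (l.src_coe.trans l'.tgt_coe.symm)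
    (l'.src_coe.trans l''.tgt_coe.symm))
  one_mul l := Subtype.ext (by
    have := κ.unit_mul (l : K)
    rw [l.tgt_coe] at this
    exact this)
  mul_one l := Subtype.ext (by
    have := κ.mul_unit (l : K)
    rw [l.src_coe] at this
    exact this)
  inv_mul_cancel l := Subtype.ext (by
    have := κ.inv_mul (l : K)
    rw [l.src_coe] at this
    exact this)

theorem coe_mul (l l' : κ.Fibre x) : ((l * l' : κ.Fibre x) : K) = κ.mul l l' := rfl

theorem coe_one : ((1 : κ.Fibre x) : K) = κ.unit x := rfl

theorem coe_inv (l : κ.Fibre x) : ((l⁻¹ : κ.Fibre x) : K) = κ.inv l := rfl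

instance : IsTopologicalGroup (κ.Fibre x) where
  continuous_mul := by
    refine Continuous.subtype_mk (f := fun p : κ.Fibre x × κ.Fibre x => κ.mul p.1 p.2) ?_ _
    exact continuousOn_univ.1 (κ.continuousOn_mul
      (continuous_coe.comp continuous_fst).continuousOn
      (continuous_coe.comp continuous_snd).continuousOn
      fun p _ => p.1.src_coe.trans p.2.tgt_coe.symm)
  continuous_inv := Continuous.subtype_mk (f := fun p : κ.Fibre x => κ.inv p)
    (κ.continuous_inv.comp continuous_coe) _

variable {E : Type} [NormedAddCommGroup E] [NormedSpace ℝ E] {γ δ : E → κ.Fibre x} {p : E}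

theorem plotAt_mul (hγ : B.PlotAt (fun e => (γ e : K)) univ p)
    (hδ : B.PlotAt (fun e => (δ e : K)) univ p) :
    B.PlotAt (fun e => ((γ e * δ e : κ.Fibre x) : K)) univ p :=
  plotAt_mul_nhds hγ hδ (Eventually.of_forall fun e => (γ e).src_coe.trans (δ e).tgt_coe.symm)

theorem plotAt_inv (hγ : B.PlotAt (fun e => (γ e : K)) univ p) :
    B.PlotAt (fun e => (((γ e)⁻¹ : κ.Fibre x) : K)) univ p := κ.smooth_inv.plotAt hγ

end Fibre

namespace UnitCoordinates

variable {κ} {a : Σ n : ℕ, OpenPartialHomeomorph M (EuclideanSpace ℝ (Fin n))} {x₀ : M}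
  (c : κ.UnitCoordinates a x₀) [hb : Fact κ.IsGroupBundle]

open Classical in
/-- The parametrization of the fibre near its unit. -/
noncomputable def param (v : EuclideanSpace ℝ (Fin c.d)) : κ.Fibre x₀ :=
  if h : κ.src (c.θ (a.2 x₀, v)) = x₀ then ⟨_, h⟩ else 1

theorem tendsto_prodMk_base : Tendsto (fun v : EuclideanSpace ℝ (Fin c.d) => (a.2 x₀, v)) (𝓝 0)
    (𝓝 (a.2 x₀, 0)) := Continuous.tendsto' (by fun_prop) _ _ rfl

theorem coe_param : ∀ᶠ v in 𝓝 0, (c.param v : K) = c.θ (a.2 x₀, v) := by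
  filter_upwards [c.tendsto_prodMk_base.eventually c.plot] with v hv
  have h : κ.src (c.θ (a.2 x₀, v)) = x₀ := by rw [hv.2.1, c.symm_base]
  simp only [param, h, dite_true]

theorem plotAt_param : ∀ᶠ v in 𝓝 0, B.PlotAt (fun v => (c.param v : K)) univ v := by
  filter_upwards [c.tendsto_prodMk_base.eventually c.plot, c.coe_param.eventually_nhds]
    with v hv hv'
  exact (PlotAt.comp_contDiffAt (φ := fun v => (a.2 x₀, v)) hv.1 (by fun_prop)).congr_nhds hv'

theorem η_param : ∀ᶠ v in 𝓝 0, c.η (c.param v) = v := by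
  filter_upwards [c.tendsto_prodMk_base.eventually c.plot, c.coe_param] with v hv hv'
  rw [hv', hv.2.2]

theorem param_zero : c.param 0 = 1 := by
  refine Fibre.ext ?_
  rw [c.coe_param.self_of_nhds, c.θ_base, Fibre.coe_one]

theorem tendsto_coe_one :
    Tendsto (fun l : κ.Fibre x₀ => (l : K)) (𝓝 1) (𝓝 (κ.unit x₀)) :=
  Fibre.continuous_coe.tendsto 1

theorem param_η : ∀ᶠ l : κ.Fibre x₀ in 𝓝 1, c.param (c.η l) = l := by
  filter_upwards [tendsto_coe_one.eventually c.coord,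
    (c.tendsto_η.comp tendsto_coe_one).eventually c.coe_param] with l h1 h2
  refine Fibre.ext ?_
  have := h1.2
  rw [Fibre.src_coe] at this
  exact h2.trans this

/-- Right translation by the inverse of `k` moves the coordinates at the unit to `k`, with the same
dimension `c.d` everywhere. Off the fibre this translation is replaced by the extended
multiplication, which gives the ambient extension of the chart. -/
theorem exists_isSubChart (k : κ.Fibre x₀) :
    ∃ e : OpenPartialHomeomorph ↥(κ.src ⁻¹' {x₀}) (EuclideanSpace ℝ (Fin c.d)),
      B.IsSubChart (κ.src ⁻¹' {x₀}) e ∧ k ∈ e.source := by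
  have hk : Tendsto (fun l : κ.Fibre x₀ => l * k⁻¹) (𝓝 k) (𝓝 1) :=
    Continuous.tendsto' (by fun_prop) _ _ (by simp)
  have hη : c.η ((k * k⁻¹ : κ.Fibre x₀) : K) = 0 := by
    rw [mul_inv_cancel, Fibre.coe_one, c.η_unit]
  obtain ⟨m, hm1, hm2⟩ := hb.out.exists_extension_mul (k₁ := (k : K))
    (k₂ := ((k⁻¹ : κ.Fibre x₀) : K)) (by rw [Fibre.src_coe, Fibre.src_coe])
  have hmk : m k ((k⁻¹ : κ.Fibre x₀) : K) = κ.unit x₀ := by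
    rw [hm1.self_of_nhds (by rw [Fibre.src_coe, Fibre.src_coe]), ← Fibre.coe_mul, mul_inv_cancel,
      Fibre.coe_one]
  have hl : Tendsto (fun q : K => (q, ((k⁻¹ : κ.Fibre x₀) : K))) (𝓝 (k : K))
      (𝓝 ((k : K), ((k⁻¹ : κ.Fibre x₀) : K))) := Continuous.tendsto' (by fun_prop) _ _ rfl
  have hmap : ∀ᶠ q in 𝓝 (k : K), MapAt B B (fun q => m q ((k⁻¹ : κ.Fibre x₀) : K)) q := by
    filter_upwards [hl.eventually hm2] with q hq e he hs
    exact hq _ e.2.symm (fun _ => ((k⁻¹ : κ.Fibre x₀) : K)) (e.2 q) (e.2.left_inv hs) rfl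
      (plotAt_symm he (e.2.map_source hs)) (plotAt_const _ _ _)
  have hfun : ∀ᶠ q in 𝓝 (k : K), B.FunAt (fun q => c.η (m q ((k⁻¹ : κ.Fibre x₀) : K))) q := by
    have := hmap.self_of_nhds.continuousAt
    rw [ContinuousAt, hmk] at this
    filter_upwards [hmap, this.eventually c.coord] with q h1 h2
    exact FunAt.comp_mapAt h2.1 h1
  have hcoe : Tendsto (fun l : κ.Fibre x₀ => (l : K)) (𝓝 k) (𝓝 (k : K)) :=
    Fibre.continuous_coe.tendsto k
  have hext : ∀ᶠ l : κ.Fibre x₀ in 𝓝 k,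
      c.η (m l ((k⁻¹ : κ.Fibre x₀) : K)) = c.η ((l * k⁻¹ : κ.Fibre x₀) : K) := by
    filter_upwards [(hl.comp hcoe).eventually hm1] with l h1
    rw [Fibre.coe_mul]
    exact congrArg c.η (h1 (by simp [Fibre.src_coe]))
  obtain ⟨e, he1, he2, hks, he3, he4⟩ := exists_openPartialHomeomorph (x₀ := k)
    (f := fun l : κ.Fibre x₀ => c.η ((l * k⁻¹ : κ.Fibre x₀) : K))
    (g := fun v => c.param v * k)
    (P := fun l => B.FunAt (fun q => c.η (m q ((k⁻¹ : κ.Fibre x₀) : K))) l ∧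
      ∀ᶠ l' : κ.Fibre x₀ in 𝓝 l,
        c.η (m l' ((k⁻¹ : κ.Fibre x₀) : K)) = c.η ((l' * k⁻¹ : κ.Fibre x₀) : K))
    (R := fun v => B.PlotAt (fun v => ((c.param v * k : κ.Fibre x₀) : K)) univ v)
    (by
      filter_upwards [hk.eventually c.param_η,
        (tendsto_coe_one.comp hk).eventually c.coord] with l h1 h2
      refine ⟨?_, by rw [h1, _root_.inv_mul_cancel_right]⟩
      exact ContinuousAt.comp (g := c.η) (f := fun l : κ.Fibre x₀ => ((l * k⁻¹ : κ.Fibre x₀) : K))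
        h2.1.continuousAt
        (Fibre.continuous_coe.comp (continuous_mul_const k⁻¹)).continuousAt)
    (by
      rw [hη]
      filter_upwards [c.η_param, c.plotAt_param] with v h1 h2
      refine ⟨?_, by rw [_root_.mul_inv_cancel_right, h1]⟩
      have : ContinuousAt c.param v :=
        (IsInducing.continuousAt_iff (g := Subtype.val) IsInducing.subtypeVal).2 h2.continuousAt
      exact this.mul continuousAt_const)
    ((hcoe.eventually hfun).and hext.eventually_nhds)
    (by
      rw [hη]
      filter_upwards [c.plotAt_param] with v h
      exact Fibre.plotAt_mul h (plotAt_const _ _ _))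
  refine ⟨e, ⟨fun v hv => ?_, fun l hl => ⟨_, (he3 l hl).1, ?_⟩⟩, hks⟩
  · have := he4 v hv
    simp only [he2]
    exact this
  · simp only [he1]
    exact (he3 l hl).2

/-- The charts of the fibre. -/
@[reducible] noncomputable def chartedSpace :
    ChartedSpace (EuclideanSpace ℝ (Fin c.d)) (κ.Fibre x₀) where
  atlas := {e | B.IsSubChart (κ.src ⁻¹' {x₀}) e}
  chartAt k := (c.exists_isSubChart k).choose
  mem_chart_source k := (c.exists_isSubChart k).choose_spec.2
  chart_mem_atlas k := (c.exists_isSubChart k).choose_spec.1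

theorem isManifold : @IsManifold ℝ _ _ _ _ _ _ (𝓡 c.d) ∞ (κ.Fibre x₀) _ c.chartedSpace := by
  let _ := c.chartedSpace
  refine isManifold_of_contDiffOn _ _ _ fun e e' he he' => ?_
  have h : B.IsSubChart (κ.src ⁻¹' {x₀}) e := he
  have := h.contDiffOn he'
  simp only [OpenPartialHomeomorph.trans_source] at this
  simpa using this

omit hb in
theorem _root_.SmoothAtlas.IsSubChart.contDiffAt {m : ℕ} {S : Set K}
    {e : OpenPartialHomeomorph S (EuclideanSpace ℝ (Fin m))} (he : B.IsSubChart S e)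
    {E : Type} [NormedAddCommGroup E] [NormedSpace ℝ E] {γ : E → S} {T : Set E} {p : E}
    (hγ : B.PlotAt (fun v => (γ v : K)) T p) (hp : γ p ∈ e.source) :
    ContDiffWithinAt ℝ ∞ (e ∘ γ) T p := by
  have hc : ContinuousWithinAt γ T p :=
    (IsInducing.continuousWithinAt_iff (g := Subtype.val) IsInducing.subtypeVal).2 hγ.1
  obtain ⟨f, hf, hf'⟩ := he.2 _ hp
  refine (FunAt.comp_plotAt (γ := fun q => (γ q : K)) hf hγ).congr_of_eventuallyEq ?_
    hf'.self_of_nhds.symm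
  filter_upwards [hc.eventually hf'] with q hq
  exact hq.symm

/-- The fibre is embedded, so smoothness of its operations is inherited from those of the groupoid
along inverse charts. -/
theorem lieGroup : @LieGroup ℝ _ _ _ _ _ _ (𝓡 c.d) ∞ (κ.Fibre x₀) _ _ c.chartedSpace := by
  let _ := c.chartedSpace
  have hchart : ∀ k : κ.Fibre x₀,
      B.IsSubChart (κ.src ⁻¹' {x₀}) (chartAt (EuclideanSpace ℝ (Fin c.d)) k) :=
    fun k => chart_mem_atlas (EuclideanSpace ℝ (Fin c.d)) k
  have hsymm : ∀ k : κ.Fibre x₀, B.PlotAt (fun v =>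
      (((chartAt (EuclideanSpace ℝ (Fin c.d)) k).symm v : κ.Fibre x₀) : K)) univ
        (chartAt (EuclideanSpace ℝ (Fin c.d)) k k) :=
    fun k => (hchart k).1 _ (mem_chart_target _ k)
  exact
  { c.isManifold with
    contMDiff_mul := by
      rintro ⟨k, k'⟩
      refine contMDiffAt_iff.2 ⟨continuous_mul.continuousAt, ?_⟩
      have h := Fibre.plotAt_mul (p := (chartAt (EuclideanSpace ℝ (Fin c.d)) k k,
          chartAt (EuclideanSpace ℝ (Fin c.d)) k' k'))
        (γ := fun v : EuclideanSpace ℝ (Fin c.d) × EuclideanSpace ℝ (Fin c.d) =>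
            (chartAt (EuclideanSpace ℝ (Fin c.d)) k).symm v.1)
        (δ := fun v : EuclideanSpace ℝ (Fin c.d) × EuclideanSpace ℝ (Fin c.d) =>
            (chartAt (EuclideanSpace ℝ (Fin c.d)) k').symm v.2)
        (PlotAt.comp_contDiffAt (γ := fun v =>
          (((chartAt (EuclideanSpace ℝ (Fin c.d)) k).symm v : κ.Fibre x₀) : K)) (φ := Prod.fst)
          (hsymm k) contDiffAt_fst)
        (PlotAt.comp_contDiffAt (γ := fun v =>
          (((chartAt (EuclideanSpace ℝ (Fin c.d)) k').symm v : κ.Fibre x₀) : K)) (φ := Prod.snd)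
          (hsymm k') contDiffAt_snd)
      have := (hchart (k * k')).contDiffAt h (by simp)
      rw [ModelWithCorners.range_eq_univ]
      exact this
    contMDiff_inv := by
      intro k
      refine contMDiffAt_iff.2 ⟨continuous_id.inv.continuousAt, ?_⟩
      have := (hchart k⁻¹).contDiffAt (Fibre.plotAt_inv (hsymm k)) (by simp)
      simpa [extChartAt, Function.comp_def] using this }

theorem ofManifold_plotAt {E : Type} [NormedAddCommGroup E] [NormedSpace ℝ E]
    {γ : E → κ.Fibre x₀} {T : Set E} {p : E} (h : B.PlotAt (fun q => (γ q : K)) T p) :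
    letI := c.chartedSpace
    haveI := c.isManifold
    (ofManifold c.d (κ.Fibre x₀)).PlotAt γ T p := by
  refine ⟨(IsInducing.continuousWithinAt_iff (g := Subtype.val) IsInducing.subtypeVal).2 h.1, ?_⟩
  rintro _ ⟨e, he, rfl⟩ hs
  exact SmoothAtlas.IsSubChart.contDiffAt (e := e) he h hs

end UnitCoordinates

end LieGroupoid

/-! ### Transport of a compact fibre to nearby fibres. -/

namespace LieGroupoid
open SmoothAtlas

variable {M : Type v} [TopologicalSpace M] {A : SmoothAtlas M}
  {K : Type u} [TopologicalSpace K] {B : SmoothAtlas K} {κ : LieGroupoid A B}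
  {a : Σ n : ℕ, OpenPartialHomeomorph M (EuclideanSpace ℝ (Fin n))} {x₀ : M}

/-- `f` transports the elements of the fibre over `x₀` that are close to `l` to the nearby fibres:
it is continuous in the element of the fibre and smooth in the base point. -/
structure IsTransportAt (κ : LieGroupoid A B)
    (a : Σ n : ℕ, OpenPartialHomeomorph M (EuclideanSpace ℝ (Fin n))) (x₀ : M)
    (f : κ.Fibre x₀ → EuclideanSpace ℝ (Fin a.1) → K) (l : κ.Fibre x₀) : Prop where
  plot : B.FamPlotAt f l (a.2 x₀)
  base : ∀ᶠ l' in 𝓝 l, f l' (a.2 x₀) = l'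
  src : ∀ᶠ q : κ.Fibre x₀ × EuclideanSpace ℝ (Fin a.1) in 𝓝 (l, a.2 x₀),
    κ.src (f q.1 q.2) = a.2.symm q.2

namespace IsTransportAt

variable {f g : κ.Fibre x₀ → EuclideanSpace ℝ (Fin a.1) → K} {l : κ.Fibre x₀}

theorem tendsto_prodMk : Tendsto (fun l' : κ.Fibre x₀ => (l', a.2 x₀)) (𝓝 l) (𝓝 (l, a.2 x₀)) :=
  Continuous.tendsto' (by fun_prop) _ _ rfl

theorem eventually (h : κ.IsTransportAt a x₀ f l) : ∀ᶠ l' in 𝓝 l, κ.IsTransportAt a x₀ f l' := by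
  filter_upwards [tendsto_prodMk.eventually h.plot.eventually, h.base.eventually_nhds,
    tendsto_prodMk.eventually h.src.eventually_nhds] with l' h1 h2 h3
  exact ⟨h1, h2, h3⟩

theorem congr (h : κ.IsTransportAt a x₀ f l)
    (he : ∀ᶠ q : κ.Fibre x₀ × EuclideanSpace ℝ (Fin a.1) in 𝓝 (l, a.2 x₀),
      g q.1 q.2 = f q.1 q.2) : κ.IsTransportAt a x₀ g l where
  plot := h.plot.congr he
  base := by
    filter_upwards [h.base, tendsto_prodMk.eventually he] with l' h1 h2
    exact h2.trans h1
  src := by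
    filter_upwards [h.src, he] with q h1 h2
    rw [h2, h1]

theorem congr_left (h : κ.IsTransportAt a x₀ f l) (he : ∀ᶠ l' in 𝓝 l, g l' = f l') :
    κ.IsTransportAt a x₀ g l := by
  refine h.congr ?_
  filter_upwards [(continuousAt_fst (p := (l, a.2 x₀))).eventually he] with q hq
  exact congrFun hq q.2

end IsTransportAt

/-- In coordinates adapted to the source, keep the fibre coordinate and move the base point. -/
theorem exists_isTransportAt (κ : LieGroupoid A B) (ha : a ∈ A.charts) (hxa : x₀ ∈ a.2.source)
    (l : κ.Fibre x₀) : ∃ f, κ.IsTransportAt a x₀ f l := by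
  obtain ⟨d, θ, η, h0, h1, h2⟩ := κ.exists_src_coordinates (l : K) ha
    (by rwa [Fibre.src_coe])
  rw [Fibre.src_coe] at h1
  have hcoe : Tendsto (fun l' : κ.Fibre x₀ => (l' : K)) (𝓝 l) (𝓝 (l : K)) :=
    Fibre.continuous_coe.tendsto l
  have hη : ∀ᶠ l' : κ.Fibre x₀ in 𝓝 l, ContinuousAt (fun l' : κ.Fibre x₀ => η l') l' := by
    filter_upwards [hcoe.eventually h2] with l' h
    exact h.1.continuousAt.comp (f := fun l' : κ.Fibre x₀ => (l' : K))
      Fibre.continuous_coe.continuousAt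
  have hsw : Tendsto (fun q : EuclideanSpace ℝ (Fin d) × EuclideanSpace ℝ (Fin a.1) => (q.2, q.1))
      (𝓝 (η l, a.2 x₀)) (𝓝 (a.2 x₀, 0)) := Continuous.tendsto' (by fun_prop) _ _ (by rw [h0])
  refine ⟨fun l' y => θ (y, η l'), ⟨EuclideanSpace ℝ (Fin d), inferInstance, inferInstance,
    fun l' => η l', fun q => θ (q.2, q.1), hη, ?_, Eventually.of_forall fun _ => rfl⟩, ?_, ?_⟩
  · filter_upwards [hsw.eventually h1] with q hq
    exact PlotAt.comp_contDiffAt (φ := fun q : EuclideanSpace ℝ (Fin d) ×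
      EuclideanSpace ℝ (Fin a.1) => (q.2, q.1)) hq.1 (by fun_prop)
  · filter_upwards [hcoe.eventually h2] with l' h
    have := h.2
    rwa [Fibre.src_coe] at this
  · filter_upwards [(hsw.comp (tendsto_prodMap_id
    (τ := fun l' : κ.Fibre x₀ => η l') (p₀ := a.2 x₀) hη.self_of_nhds)).eventually h1]
      with q hq
    exact hq.2.1

namespace UnitCoordinates

variable (c : κ.UnitCoordinates a x₀) [hb : Fact κ.IsGroupBundle]
  {f g : κ.Fibre x₀ → EuclideanSpace ℝ (Fin a.1) → K} {l : κ.Fibre x₀}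

/-- Interpolation between two transports. -/
noncomputable def blend (ρ : κ.Fibre x₀ → ℝ) (f g : κ.Fibre x₀ → EuclideanSpace ℝ (Fin a.1) → K)
    (l : κ.Fibre x₀) (y : EuclideanSpace ℝ (Fin a.1)) : K :=
  κ.mul (c.θ (y, ρ l • c.η (κ.mul (f l y) (κ.inv (g l y))))) (g l y)

theorem famPlotAt_div (hf : κ.IsTransportAt a x₀ f l) (hg : κ.IsTransportAt a x₀ g l) :
    B.FamPlotAt (fun l y => κ.mul (f l y) (κ.inv (g l y))) l (a.2 x₀) := by
  refine hb.out.famPlotAt_mul hf.plot (famPlotAt_inv hg.plot) ?_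
  filter_upwards [hf.src, hg.src] with q h1 h2
  rw [κ.src_inv, hb.out.tgt_eq, h1, h2]

theorem div_base (hf : κ.IsTransportAt a x₀ f l) (hg : κ.IsTransportAt a x₀ g l) :
    ∀ᶠ l' in 𝓝 l, κ.mul (f l' (a.2 x₀)) (κ.inv (g l' (a.2 x₀))) = κ.unit x₀ := by
  filter_upwards [hf.base, hg.base] with l' h1 h2
  rw [h1, h2, κ.mul_inv, Fibre.tgt_coe]

theorem tendsto_div (hf : κ.IsTransportAt a x₀ f l) (hg : κ.IsTransportAt a x₀ g l) :
    Tendsto (fun q : κ.Fibre x₀ × EuclideanSpace ℝ (Fin a.1) =>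
      κ.mul (f q.1 q.2) (κ.inv (g q.1 q.2))) (𝓝 (l, a.2 x₀)) (𝓝 (κ.unit x₀)) := by
  have := (famPlotAt_div hf hg).continuousAt
  rwa [ContinuousAt, (div_base hf hg).self_of_nhds] at this

/-- Over `x₀` both transports are the identity, so nearby their quotient has small coordinates that
can be scaled by `ρ`. Since transports are only required to be continuous along the fibre, a
continuous `ρ` is enough. -/
theorem isTransportAt_blend (ρ : C(κ.Fibre x₀, ℝ)) (hf : κ.IsTransportAt a x₀ f l)
    (hg : κ.IsTransportAt a x₀ g l) : κ.IsTransportAt a x₀ (c.blend ρ f g) l := by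
  have h1 : FamSmoothAt (fun l y => c.η (κ.mul (f l y) (κ.inv (g l y)))) l (a.2 x₀) :=
    (famPlotAt_div hf hg).comp_funAt (by
      rw [(div_base hf hg).self_of_nhds]
      exact c.coord.mono fun _ h => h.1)
  have h2 : FamSmoothAt (fun l y => (y, ρ l • c.η (κ.mul (f l y) (κ.inv (g l y))))) l (a.2 x₀) :=
    FamSmoothAt.prodMk (FamSmoothAt.of_contDiff contDiff_id)
      (FamSmoothAt.comp (g := fun p : ℝ × EuclideanSpace ℝ (Fin c.d) => p.1 • p.2)
        (contDiff_fst.smul contDiff_snd) ((FamSmoothAt.of_continuous ρ.continuous).prodMk h1))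
  have h3 : (a.2 x₀, ρ l • c.η (κ.mul (f l (a.2 x₀)) (κ.inv (g l (a.2 x₀))))) = (a.2 x₀, 0) := by
    rw [(div_base hf hg).self_of_nhds, c.η_unit, smul_zero]
  have h4 : B.FamPlotAt (fun l y => c.θ (y, ρ l • c.η (κ.mul (f l y) (κ.inv (g l y))))) l
      (a.2 x₀) := h2.comp_plot (by
    rw [h3]
    exact c.plot.mono fun _ h => h.1)
  have h5 : Tendsto (fun q : κ.Fibre x₀ × EuclideanSpace ℝ (Fin a.1) =>
      (q.2, ρ q.1 • c.η (κ.mul (f q.1 q.2) (κ.inv (g q.1 q.2))))) (𝓝 (l, a.2 x₀))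
      (𝓝 (a.2 x₀, 0)) := by
    rw [← h3]
    exact h2.continuousAt
  have hs : ∀ᶠ q : κ.Fibre x₀ × EuclideanSpace ℝ (Fin a.1) in 𝓝 (l, a.2 x₀),
      κ.src (c.θ (q.2, ρ q.1 • c.η (κ.mul (f q.1 q.2) (κ.inv (g q.1 q.2))))) =
        κ.src (g q.1 q.2) := by
    filter_upwards [h5.eventually c.plot, hg.src] with q q1 q2
    rw [q1.2.1, q2]
  refine ⟨hb.out.famPlotAt_mul h4 hg.plot hs, ?_, ?_⟩
  · filter_upwards [div_base hf hg, hg.base] with l' h1 h2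
    have := κ.unit_mul (l' : K)
    rw [Fibre.tgt_coe] at this
    rw [blend, h1, c.η_unit, smul_zero, c.θ_base, h2, this]
  · filter_upwards [hg.src, hs] with q q1 q2
    rw [blend, κ.src_mul _ _ (q2.trans (hb.out.tgt_eq _).symm), q1]

theorem blend_one {ρ : κ.Fibre x₀ → ℝ} (hf : κ.IsTransportAt a x₀ f l)
    (hg : κ.IsTransportAt a x₀ g l) :
    ∀ᶠ q : κ.Fibre x₀ × EuclideanSpace ℝ (Fin a.1) in 𝓝 (l, a.2 x₀),
      ρ q.1 = 1 → c.blend ρ f g q.1 q.2 = f q.1 q.2 := by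
  filter_upwards [(tendsto_div hf hg).eventually c.coord, hf.src, hg.src,
    (continuousAt_snd (p := (l, a.2 x₀))).eventually (a.2.open_target.mem_nhds
      (a.2.map_source c.mem_source))] with q q1 q2 q3 q4 h
  have := q1.2
  have e : κ.src (f q.1 q.2) = κ.src (g q.1 q.2) := q2.trans q3.symm
  rw [κ.src_mul _ _ (by rw [κ.tgt_inv, e]), κ.src_inv,
    hb.out.tgt_eq, q3, a.2.right_inv q4] at this
  rw [blend, h, one_smul, this, κ.inv_mul_cancel_right e]

theorem blend_zero {ρ : κ.Fibre x₀ → ℝ} (hg : κ.IsTransportAt a x₀ g l) :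
    ∀ᶠ q : κ.Fibre x₀ × EuclideanSpace ℝ (Fin a.1) in 𝓝 (l, a.2 x₀),
      ρ q.1 = 0 → c.blend ρ f g q.1 q.2 = g q.1 q.2 := by
  filter_upwards [hg.src, (continuousAt_snd (p := (l, a.2 x₀))).eventually c.unit] with q q1 q2 h
  have := κ.unit_mul (g q.1 q.2)
  rw [hb.out.tgt_eq, q1] at this
  rw [blend, h, zero_smul, q2, this]

/-- There is a transport of the whole compact fibre to the nearby fibres. -/
theorem exists_transport (c : κ.UnitCoordinates a x₀) [T2Space K] [CompactSpace (κ.Fibre x₀)] :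
    ∃ f, ∀ l, κ.IsTransportAt a x₀ f l := by
  -- Working on closures leaves room to interpolate when two sets are joined.
  suffices h : ∃ f, ∀ l ∈ closure (univ : Set (κ.Fibre x₀)), κ.IsTransportAt a x₀ f l by
    simpa using h
  refine IsCompact.induction_on (p := fun C : Set (κ.Fibre x₀) => ∃ f, ∀ l ∈ closure C,
    κ.IsTransportAt a x₀ f l) isCompact_univ ?_ ?_ ?_ ?_
  · exact ⟨fun l _ => l, by simp⟩
  · rintro s t hst ⟨f, hf⟩
    exact ⟨f, fun l hl => hf l (closure_mono hst hl)⟩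
  · rintro s t ⟨f, hf⟩ ⟨g, hg⟩
    have hO : IsOpen {l | κ.IsTransportAt a x₀ f l} :=
      isOpen_iff_mem_nhds.2 fun l hl => IsTransportAt.eventually hl
    -- Two nested open sets around the closure of `s`: `f` is a transport on the closure of `V`, and
    -- `ρ` falls from 1 on the closure of `V'` to 0 outside `V`.
    obtain ⟨V, hV, hsV, hVO⟩ := normal_exists_closure_subset isClosed_closure hO hf
    obtain ⟨V', hV', hsV', hVV'⟩ := normal_exists_closure_subset isClosed_closure hV hsV
    obtain ⟨ρ, hρ0, hρ1, -⟩ := exists_continuous_zero_one_of_isClosed (hV.isClosed_compl)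
      (isClosed_closure (s := V')) (disjoint_compl_left_iff_subset.2 hVV')
    classical
    -- On `V'` the map `g` need not be a transport, so the blend is avoided there. A point of the
    -- closure of the union outside `V'` lies in the closure of `t`, where `g` is a transport.
    refine ⟨fun l => if l ∈ V' then f l else if l ∈ closure V then c.blend ρ f g l else g l, ?_⟩
    intro l hl
    by_cases h1 : l ∈ V'
    · refine (hVO (subset_closure (hVV' (subset_closure h1)))).congr_left ?_
      filter_upwards [hV'.mem_nhds h1] with l' hl'
      rw [if_pos hl']
    · have hgl : κ.IsTransportAt a x₀ g l := by
        rw [closure_union] at hl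
        exact hl.elim (fun h => absurd (hsV' h) h1) (hg l)
      by_cases h2 : l ∈ closure V
      · have hfl := hVO h2
        refine (c.isTransportAt_blend ρ hfl hgl).congr ?_
        filter_upwards [c.blend_one (ρ := ρ) hfl hgl, c.blend_zero (f := f) (ρ := ρ) hgl]
          with q q1 q2
        by_cases h3 : q.1 ∈ V'
        · rw [if_pos h3, q1 (hρ1 (subset_closure h3))]
        · rw [if_neg h3]
          by_cases h4 : q.1 ∈ closure V
          · rw [if_pos h4]
          · rw [if_neg h4, q2 (hρ0 fun h => h4 (subset_closure h))]
      · refine hgl.congr_left ?_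
        filter_upwards [isClosed_closure.isOpen_compl.mem_nhds h2] with l' hl'
        rw [if_neg (fun h => hl' (subset_closure (hVV' (subset_closure h)))), if_neg hl']
  · intro l _
    obtain ⟨f, hf⟩ := κ.exists_isTransportAt c.mem c.mem_source l
    obtain ⟨t, ht, htc, hts⟩ := exists_mem_nhds_isClosed_subset hf.eventually
    exact ⟨t, mem_nhdsWithin_of_mem_nhds ht, f, by rwa [htc.closure_eq]⟩

end UnitCoordinates

end LieGroupoid

/-! ### Uniform estimates and Haar means over a compact parameter space. -/

section Compact

variable {Λ : Type u} [TopologicalSpace Λ] [CompactSpace Λ]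

theorem eventually_forall_of_compactSpace {P : Type*} [TopologicalSpace P] {p₀ : P}
    {p : Λ → P → Prop} (h : ∀ t, ∀ᶠ q : Λ × P in 𝓝 (t, p₀), p q.1 q.2) :
    ∀ᶠ p' in 𝓝 p₀, ∀ t, p t p' := by
  refine (isCompact_univ.eventually_forall_of_forall_eventually (x₀ := p₀)
    (P := fun p' t => p t p') fun t _ => ?_).mono fun p' h t => h t trivial
  exact (Continuous.tendsto' continuous_swap (p₀, t) (t, p₀) rfl).eventually (h t)

/-- A smooth family of maps is strictly differentiable, uniformly in the parameter. -/
theorem FamSmoothAt.eventually_norm_sub_le {P F : Type} [NormedAddCommGroup P]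
    [NormedSpace ℝ P] [NormedAddCommGroup F] [NormedSpace ℝ F] {φ : Λ → P → F} {p₀ : P}
    (hφ : ∀ t, FamSmoothAt φ t p₀) {ε : ℝ} (hε : 0 < ε) :
    ∀ᶠ q : P × P in 𝓝 (p₀, p₀), ∀ t,
      ‖φ t q.1 - φ t q.2 - _root_.fderiv ℝ (φ t) p₀ (q.1 - q.2)‖ ≤ ε * ‖q.1 - q.2‖ := by
  have h : ∀ᶠ p in 𝓝 p₀, ∀ t, DifferentiableAt ℝ (φ t) p ∧
      ‖_root_.fderiv ℝ (φ t) p - _root_.fderiv ℝ (φ t) p₀‖ ≤ ε := by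
    refine eventually_forall_of_compactSpace fun t => ?_
    have h1 : ContinuousAt (fun q : Λ × P => _root_.fderiv ℝ (φ q.1) q.2) (t, p₀) :=
      (hφ t).fderiv.continuousAt
    have h2 : ContinuousAt (fun q : Λ × P => _root_.fderiv ℝ (φ q.1) p₀) (t, p₀) :=
      ContinuousAt.comp (g := fun q : Λ × P => _root_.fderiv ℝ (φ q.1) q.2)
        (f := fun q : Λ × P => (q.1, p₀)) h1 (by fun_prop)
    have h3 := (h1.sub h2).norm
    simp only [ContinuousAt, Pi.sub_apply, sub_self, norm_zero] at h3
    filter_upwards [(hφ t).eventually, h3.eventually (gt_mem_nhds hε)] with q q1 q2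
    exact ⟨q1.contDiffAt.differentiableAt (by simp), q2.le⟩
  obtain ⟨δ, hδ, hb⟩ := Metric.eventually_nhds_iff_ball.1 h
  filter_upwards [prod_mem_nhds (Metric.ball_mem_nhds p₀ hδ) (Metric.ball_mem_nhds p₀ hδ)]
    with q hq t
  exact (convex_ball p₀ δ).norm_image_sub_le_of_norm_fderiv_le' (fun p hp => (hb p hp t).1)
    (fun p hp => (hb p hp t).2) hq.2 hq.1

end Compact

section Mean

variable {L : Type u} [Group L] [TopologicalSpace L] [IsTopologicalGroup L] [CompactSpace L]
  {W W' : Type} [NormedAddCommGroup W] [NormedSpace ℝ W] [NormedAddCommGroup W'] [NormedSpace ℝ W']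

open MeasureTheory in
/-- The mean of a continuous function on a compact group. -/
noncomputable def mean (L : Type u) [Group L] [TopologicalSpace L] [IsTopologicalGroup L]
    [CompactSpace L] (W : Type) [NormedAddCommGroup W] [NormedSpace ℝ W] : C(L, W) →L[ℝ] W :=
  letI : MeasurableSpace L := borel L
  haveI : BorelSpace L := ⟨rfl⟩
  have hi : ∀ u : C(L, W), Integrable u (Measure.haarMeasure (⊤ : TopologicalSpace.PositiveCompacts L)) :=
    fun u => u.continuous.integrable_of_hasCompactSupport (HasCompactSupport.of_compactSpace _)
  LinearMap.mkContinuous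
    { toFun := fun u => ∫ l, u l ∂(Measure.haarMeasure (⊤ : TopologicalSpace.PositiveCompacts L))
      map_add' := fun u u' => integral_add (hi u) (hi u')
      map_smul' := fun r u => integral_smul r u } 1 fun u => by
    rw [one_mul]
    refine (norm_integral_le_of_norm_le_const (Eventually.of_forall u.norm_coe_le_norm)).trans ?_
    have : Measure.haarMeasure (⊤ : TopologicalSpace.PositiveCompacts L) univ = 1 := by
      simpa using Measure.haarMeasure_self (K₀ := (⊤ : TopologicalSpace.PositiveCompacts L))
    simp [Measure.real, this]

theorem norm_mean_le (u : C(L, W)) : ‖mean L W u‖ ≤ ‖u‖ := by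
  refine ((mean L W).le_opNorm u).trans ?_
  have : ‖mean L W‖ ≤ 1 := by
    unfold mean
    exact LinearMap.mkContinuous_norm_le _ zero_le_one _
  nlinarith [norm_nonneg u]

open MeasureTheory in
theorem mean_const [CompleteSpace W] (w : W) : mean L W (ContinuousMap.const L w) = w := by
  let _ : MeasurableSpace L := borel L
  have : BorelSpace L := ⟨rfl⟩
  have : Measure.haarMeasure (⊤ : TopologicalSpace.PositiveCompacts L) univ = 1 := by
    simpa using Measure.haarMeasure_self (K₀ := (⊤ : TopologicalSpace.PositiveCompacts L))
  simp [mean, Measure.real, this]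

open MeasureTheory in
theorem mean_comp_mul_left (u : C(L, W)) (l : L) :
    mean L W (u.comp ⟨fun h => l * h, by fun_prop⟩) = mean L W u := by
  let _ : MeasurableSpace L := borel L
  have : BorelSpace L := ⟨rfl⟩
  exact integral_mul_left_eq_self (μ := Measure.haarMeasure
    (⊤ : TopologicalSpace.PositiveCompacts L)) u l

open MeasureTheory in
theorem mean_comp_clm [CompleteSpace W] [CompleteSpace W'] (T : W →L[ℝ] W') (u : C(L, W)) :
    mean L W' ((T : C(W, W')).comp u) = T (mean L W u) := by
  let _ : MeasurableSpace L := borel L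
  have : BorelSpace L := ⟨rfl⟩
  exact T.integral_comp_comm
    (u.continuous.integrable_of_hasCompactSupport (HasCompactSupport.of_compactSpace _))

/-- The mean in the second variable. -/
noncomputable def partialMean (L : Type u) [Group L] [TopologicalSpace L] [IsTopologicalGroup L]
    [CompactSpace L] (W : Type) [NormedAddCommGroup W] [NormedSpace ℝ W] :
    C(L × L, W) →L[ℝ] C(L, W) :=
  LinearMap.mkContinuous
    { toFun := fun u => (⟨mean L W, (mean L W).continuous⟩ : C(C(L, W), W)).comp u.curry
      map_add' := fun u u' => by ext l; exact map_add (mean L W) (u.curry l) (u'.curry l)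
      map_smul' := fun r u => by ext l; exact map_smul (mean L W) r (u.curry l) } 1 fun u => by
    rw [one_mul, ContinuousMap.norm_le _ (norm_nonneg _)]
    intro l
    refine (norm_mean_le _).trans ((ContinuousMap.norm_le _ (norm_nonneg _)).2 fun h => ?_)
    exact u.norm_coe_le_norm (l, h)

theorem partialMean_apply (u : C(L × L, W)) (l : L) :
    partialMean L W u l = mean L W (u.curry l) := rfl

/-- A 2-cochain on a compact group that is approximately a cocycle, and whose partial mean is a
coboundary, vanishes. -/
theorem eq_zero_of_norm_cocycle_le [CompleteSpace W] (c : C(L × L, W)) (Ad : L → W →L[ℝ] W)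
    (hAd : ∀ l h w, Ad (l * h) w = Ad l (Ad h w)) (m : W)
    (hm : ∀ l, partialMean L W c l = Ad l m - m)
    (hc : ∀ l h k, ‖c (l, h) + c (l * h, k) - Ad l (c (h, k)) - c (l, h * k)‖ ≤ ‖c‖ / 2) :
    c = 0 := by
  have h1 : ∀ l h, ‖c (l, h)‖ ≤ ‖c‖ / 2 := by
    intro l h
    -- The cocycle expression is averaged over its last variable. Left invariance removes the shift
    -- by `h`, and the three partial means cancel because together they form the coboundary of a
    -- coboundary.
    have h2 : mean L W (ContinuousMap.const L (c (l, h)) + c.curry (l * h) -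
        ((Ad l : C(W, W)).comp (c.curry h)) - (c.curry l).comp ⟨fun k => h * k, by fun_prop⟩) =
          c (l, h) := by
      simp only [map_sub, map_add, mean_const, mean_comp_clm, mean_comp_mul_left,
        ← partialMean_apply, hm, hAd]
      abel
    rw [← h2]
    refine (norm_mean_le _).trans ((ContinuousMap.norm_le _ (by positivity)).2 fun k => ?_)
    exact hc l h k
  have h3 : ‖c‖ ≤ ‖c‖ / 2 := (ContinuousMap.norm_le _ (by positivity)).2 fun q => h1 q.1 q.2
  have := norm_nonneg c
  exact norm_eq_zero.1 (by linarith)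

end Mean

/-! ### Rigidity: correcting an approximate homomorphism of a compact group. -/

section Correction

variable {L : Type u} [Group L] [TopologicalSpace L] [IsTopologicalGroup L] [CompactSpace L]
  {Y W : Type} [NormedAddCommGroup Y] [NormedSpace ℝ Y] [NormedAddCommGroup W] [NormedSpace ℝ W]

/-- The arguments on which the failure of `ξ` to define a homomorphism depends. -/
noncomputable def cochainArgs (L : Type u) [Group L] [TopologicalSpace L] [IsTopologicalGroup L]
    [CompactSpace L] (Y W : Type) [NormedAddCommGroup Y] [NormedSpace ℝ Y] [NormedAddCommGroup W]
    [NormedSpace ℝ W] : Y × C(L, W) →L[ℝ] C(L × L, Y × W × W × W) :=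
  LinearMap.mkContinuous
    { toFun := fun p => ⟨fun q => (p.1, p.2 q.1, p.2 q.2, p.2 (q.1 * q.2)), by fun_prop⟩
      map_add' := fun p p' => by ext q <;> rfl
      map_smul' := fun r p => by ext q <;> rfl } 1 fun p => by
    rw [one_mul, ContinuousMap.norm_le _ (norm_nonneg _)]
    intro q
    have h1 : ‖p.1‖ ≤ ‖p‖ := norm_fst_le p
    have h2 : ∀ l, ‖p.2 l‖ ≤ ‖p‖ := fun l => (p.2.norm_coe_le_norm l).trans (norm_snd_le p)
    exact max_le h1 (max_le (h2 _) (max_le (h2 _) (h2 _)))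

theorem tendsto_cochainArgs (y₀ : Y) : Tendsto (cochainArgs L Y W) (𝓝 (y₀, 0))
    (𝓝 (ContinuousMap.const (L × L) (y₀, 0, 0, 0))) :=
  (cochainArgs L Y W).continuous.tendsto' _ _ (by ext q <;> rfl)

theorem eventually_forall_cochainArgs {y₀ : Y} {p : Y × W × W × W → Prop}
    (hp : ∀ᶠ q in 𝓝 (y₀, (0 : W), (0 : W), (0 : W)), p q) :
    ∀ᶠ u : Y × C(L, W) in 𝓝 (y₀, 0), ∀ l h : L, p (u.1, u.2 l, u.2 h, u.2 (l * h)) := by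
  obtain ⟨U, hU, hUo, hU0⟩ := eventually_nhds_iff.1 hp
  filter_upwards [(tendsto_cochainArgs (L := L) (W := W) y₀).eventually
    ((isOpen_mapsTo hUo).mem_nhds (fun _ _ => hU0))] with u hu l h
  exact hU _ (hu (x := (l, h)) trivial)

variable [CompleteSpace Y] [CompleteSpace W] {y₀ : Y} {c : L × L → Y × W × W × W → W}
  {Ad : L → W →L[ℝ] W}

/-- By the implicit function theorem, a perturbation of the zero cochain can be chosen such that the
partial mean of its failure to be a homomorphism is a coboundary. -/
theorem exists_gauge (hc : ∀ t, FamSmoothAt c t (y₀, 0, 0, 0)) (hc0 : ∀ t, c t (y₀, 0, 0, 0) = 0)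
    (hc' : ∀ l h w₁ w₂ w₃, fderiv ℝ (c (l, h)) (y₀, 0, 0, 0) (0, w₁, w₂, w₃) =
      w₁ + Ad l w₂ - w₃) :
    ∃ ξ : Y → C(L, W), (∀ᶠ y in 𝓝 y₀, ContDiffAt ℝ ∞ ξ y) ∧ ξ y₀ = 0 ∧
      Tendsto (fun y => superposition c (cochainArgs L Y W (y, ξ y))) (𝓝 y₀) (𝓝 0) ∧
      ∀ᶠ y in 𝓝 y₀, (∀ t, superposition c (cochainArgs L Y W (y, ξ y)) t =
          c t (cochainArgs L Y W (y, ξ y) t)) ∧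
        ∀ l, partialMean L W (superposition c (cochainArgs L Y W (y, ξ y))) l =
          Ad l (mean L W (ξ y)) - mean L W (ξ y) := by
  obtain ⟨U, hU, hUo, hU0⟩ := eventually_nhds_iff.1
    (eventually_forall_of_compactSpace fun t => (hc t).eventually)
  have hU' : ∀ t, ∀ p ∈ U, FamSmoothAt c t p := fun t p hp => hU p hp t
  have hUm : MapsTo (ContinuousMap.const (L × L) (y₀, (0 : W), (0 : W), (0 : W))) univ U :=
    fun _ _ => hU0
  have hJ0 : cochainArgs L Y W (y₀, 0) = ContinuousMap.const (L × L) (y₀, 0, 0, 0) := by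
    ext q <;> rfl
  have hUJ : ∀ᶠ p in 𝓝 (y₀, (0 : C(L, W))), MapsTo (cochainArgs L Y W p) univ U :=
    (tendsto_cochainArgs y₀).eventually ((isOpen_mapsTo hUo).mem_nhds hUm)
  set S : Y × C(L, W) → C(L × L, W) := fun p => superposition c (cochainArgs L Y W p) with hS
  have hSs : ∀ᶠ p in 𝓝 (y₀, (0 : C(L, W))), ContDiffAt ℝ ∞ S p := by
    filter_upwards [hUJ] with p hp
    exact ((contDiffOn_superposition hUo hU').contDiffAt ((isOpen_mapsTo hUo).mem_nhds hp)).comp p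
      (cochainArgs L Y W).contDiff.contDiffAt
  have hS0 : S (y₀, 0) = 0 := by
    ext t
    simp only [hS, hJ0]
    rw [superposition_apply hU' hUm]
    exact hc0 t
  set D := fderiv ℝ S (y₀, 0) with hD
  have hSD : HasFDerivAt S D (y₀, 0) :=
    (hSs.self_of_nhds.differentiableAt (by simp)).hasFDerivAt
  -- The linearized defect is ξ(l) + Ad(l)ξ(h) − ξ(lh). Averaging over h turns the last two terms
  -- into Ad(l)m − m, with m the mean of ξ.
  have hDa : ∀ ξ : C(L, W), ∀ l, partialMean L W (D (0, ξ)) l =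
      ξ l + (Ad l (mean L W ξ) - mean L W ξ) := by
    intro ξ l
    have h1 : D = (pointwiseApply (L × L) (Y × W × W × W) W (superposition
        (fun t p => fderiv ℝ (c t) p) (ContinuousMap.const (L × L) (y₀, 0, 0, 0)))).comp
          (cochainArgs L Y W) := by
      have h2 := hasFDerivAt_superposition hUo hU' hUm
      rw [← hJ0] at h2 ⊢
      exact (h2.comp (y₀, (0 : C(L, W))) (cochainArgs L Y W).hasFDerivAt).fderiv
    have h3 : (D (0, ξ)).curry l = ContinuousMap.const L (ξ l) + ((Ad l : C(W, W)).comp ξ) -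
        ξ.comp ⟨fun h => l * h, by fun_prop⟩ := by
      ext h
      rw [h1]
      change superposition (fun t p => fderiv ℝ (c t) p) _ (l, h) _ = _
      rw [superposition_apply (U := U) (fun t p hp => (hU' t p hp).fderiv) hUm]
      exact hc' l h _ _ _
    rw [partialMean_apply, h3, map_sub, map_add, mean_const, mean_comp_clm, mean_comp_mul_left]
    abel
  -- Subtracting the coboundary of the mean of ξ makes the partial derivative of `Φ` in ξ the
  -- identity. The zeros of `Φ` are the cochains for which the partial mean of the defect is that
  -- coboundary.
  set Φ : Y × C(L, W) → C(L, W) := fun p =>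
    partialMean L W (S p) - partialMean L W (D (0, p.2)) + p.2 with hΦ
  set N : Y × C(L, W) →L[ℝ] C(L, W) :=
    (partialMean L W).comp (D.comp ((ContinuousLinearMap.inr ℝ Y C(L, W)).comp
      (ContinuousLinearMap.snd ℝ Y C(L, W)))) with hN
  have hΦd : HasFDerivAt Φ ((partialMean L W).comp D - N + ContinuousLinearMap.snd ℝ Y C(L, W))
      (y₀, 0) :=
    (((partialMean L W).hasFDerivAt.comp _ hSD).sub N.hasFDerivAt).add
      (ContinuousLinearMap.snd ℝ Y C(L, W)).hasFDerivAt
  have hΦ0 : Φ (y₀, 0) = 0 := by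
    have : D (0, 0) = 0 := map_zero D
    simp [hΦ, hS0, this]
  have hQs : ∀ᶠ p in 𝓝 (y₀, (0 : C(L, W))), ContDiffAt ℝ ∞ (fun p => (p.1, Φ p)) p := by
    filter_upwards [hSs] with p hp
    exact contDiffAt_fst.prodMk ((((partialMean L W).contDiff.contDiffAt.comp p hp).sub
      N.contDiff.contDiffAt).add contDiffAt_snd)
  -- Triangular with identities on the diagonal, hence invertible.
  set Q' : (Y × C(L, W)) ≃L[ℝ] (Y × C(L, W)) := ContinuousLinearEquiv.skewProd
    (ContinuousLinearEquiv.refl ℝ Y) (ContinuousLinearEquiv.refl ℝ C(L, W))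
    (((partialMean L W).comp D).comp (ContinuousLinearMap.inl ℝ Y C(L, W))) with hQ'
  have hQd : HasFDerivAt (fun p => (p.1, Φ p)) (Q' : Y × C(L, W) →L[ℝ] Y × C(L, W)) (y₀, 0) := by
    refine (hasFDerivAt_fst.prodMk hΦd).congr_fderiv ?_
    refine ContinuousLinearMap.ext fun p => Prod.ext rfl ?_
    have h1 : D p = D (p.1, 0) + D (0, p.2) := by rw [← map_add]; simp
    simp [hN, hQ', h1]
    abel
  obtain ⟨R, hR1, hR2⟩ := exists_smooth_localInverse hQs Q' hQd
  rw [hΦ0] at hR1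
  have hR0 : R (y₀, 0) = (y₀, 0) := by
    have := hR2.self_of_nhds
    rwa [hΦ0] at this
  have hι : Tendsto (fun y : Y => (y, (0 : C(L, W)))) (𝓝 y₀) (𝓝 (y₀, 0)) :=
    Continuous.tendsto' (by fun_prop) _ _ rfl
  have hξs : ∀ᶠ y in 𝓝 y₀, ContDiffAt ℝ ∞ (fun y => (R (y, 0)).2) y := by
    filter_upwards [hι.eventually hR1] with y hy
    exact contDiffAt_snd.comp y (hy.1.comp y (f := fun y : Y => (y, (0 : C(L, W)))) (by fun_prop))
  have hξ0 : (R (y₀, 0)).2 = 0 := by rw [hR0]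
  have hξt : Tendsto (fun y => (y, (R (y, 0)).2)) (𝓝 y₀) (𝓝 (y₀, 0)) := by
    have := hξs.self_of_nhds.continuousAt
    rw [ContinuousAt, hξ0] at this
    exact tendsto_id.prodMk_nhds this
  refine ⟨fun y => (R (y, 0)).2, hξs, hξ0, ?_, ?_⟩
  · have := hSs.self_of_nhds.continuousAt
    rw [ContinuousAt, hS0] at this
    exact this.comp hξt
  · filter_upwards [hι.eventually hR1, hξt.eventually hUJ] with y h1 h2
    refine ⟨fun t => superposition_apply hU' h2 t, fun l => ?_⟩
    have h3 : R (y, 0) = (y, (R (y, 0)).2) := Prod.ext (show (R (y, 0)).1 = y from congrArg Prod.fst h1.2) rfl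
    have h4 : Φ (R (y, 0)) = 0 := congrArg Prod.snd h1.2
    rw [h3] at h4
    have h5 := congrArg (fun u : C(L, W) => u l) h4
    simp only [hΦ, ContinuousMap.add_apply, ContinuousMap.sub_apply, hDa,
      ContinuousMap.zero_apply] at h5
    change partialMean L W (S (y, (R (y, 0)).2)) l = _
    rw [← sub_eq_zero, ← h5]
    abel

/-- Rigidity of compact groups: if the failure `c` of `ξ` to be a homomorphism vanishes for the zero
cochain, and satisfies the cocycle identity `hid`, then it vanishes for a small perturbation that
depends smoothly on the parameters. -/
theorem exists_correction (hc : ∀ t, FamSmoothAt c t (y₀, 0, 0, 0))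
    (hc0 : ∀ t, c t (y₀, 0, 0, 0) = 0)
    (hc' : ∀ l h w₁ w₂ w₃, fderiv ℝ (c (l, h)) (y₀, 0, 0, 0) (0, w₁, w₂, w₃) =
      w₁ + Ad l w₂ - w₃)
    (hAd : ∀ l h w, Ad (l * h) w = Ad l (Ad h w)) {conj : L → Y × W × W → W}
    (hj : ∀ l, FamSmoothAt conj l (y₀, 0, 0))
    (hj0 : ∀ᶠ p : Y × W in 𝓝 (y₀, 0), ∀ l, conj l (p.1, p.2, 0) = 0)
    (hj' : ∀ l w, fderiv ℝ (conj l) (y₀, 0, 0) (0, 0, w) = Ad l w) {μ : Y × W × W → W}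
    (hμ : ContDiffAt ℝ ∞ μ (y₀, 0, 0)) (hμ0 : ∀ᶠ y in 𝓝 y₀, μ (y, 0, 0) = 0)
    (hμ' : ∀ w₁ w₂, fderiv ℝ μ (y₀, 0, 0) (0, w₁, w₂) = w₁ + w₂)
    (hid : ∀ᶠ p : Y × C(L, W) in 𝓝 (y₀, 0), ∀ l h k,
      μ (p.1, c (l, h) (cochainArgs L Y W p (l, h)), c (l * h, k) (cochainArgs L Y W p (l * h, k)))
        = μ (p.1, conj l (p.1, p.2 l, c (h, k) (cochainArgs L Y W p (h, k))),
          c (l, h * k) (cochainArgs L Y W p (l, h * k)))) :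
    ∃ ξ : Y → C(L, W), (∀ᶠ y in 𝓝 y₀, ContDiffAt ℝ ∞ ξ y) ∧ ξ y₀ = 0 ∧
      ∀ᶠ y in 𝓝 y₀, ∀ t, c t (cochainArgs L Y W (y, ξ y) t) = 0 := by
  obtain ⟨ξ, hξ, hξ0, hcl, hcm⟩ := exists_gauge hc hc0 hc'
  refine ⟨ξ, hξ, hξ0, ?_⟩
  have hξc : Tendsto ξ (𝓝 y₀) (𝓝 0) := by
    have := hξ.self_of_nhds.continuousAt
    rwa [ContinuousAt, hξ0] at this
  obtain ⟨N, hN⟩ : ∃ N : ℝ, ∀ l w, ‖Ad l w‖ ≤ N * ‖w‖ := by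
    have h1 : Continuous fun l => fderiv ℝ (conj l) (y₀, 0, 0) :=
      continuous_iff_continuousAt.2 fun l => ContinuousAt.comp
        (g := fun q : L × (Y × W × W) => fderiv ℝ (conj q.1) q.2)
        (f := fun l => (l, (y₀, (0 : W), (0 : W)))) (hj l).fderiv.continuousAt (by fun_prop)
    obtain ⟨N, hN⟩ := isCompact_univ.exists_bound_of_continuousOn h1.continuousOn
    refine ⟨N, fun l w => ?_⟩
    rw [← hj']
    refine (ContinuousLinearMap.le_opNorm _ _).trans ?_
    rw [show ‖((0 : Y), (0 : W), w)‖ = ‖w‖ by simp [Prod.norm_def]]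
    exact mul_le_mul_of_nonneg_right (hN l trivial) (norm_nonneg w)
  set N' := max N 0 with hN'
  have hN0 : 0 ≤ N' := le_max_right _ _
  -- The three linearization errors below sum to at most `ε * (N' + 3) * ‖C‖`, so this choice keeps
  -- them within `‖C‖ / 2`.
  set ε : ℝ := 1 / (2 * (N' + 4)) with hε
  have hε0 : 0 < ε := by positivity
  have hε1 : ε ≤ 1 := by
    rw [hε, div_le_one (by positivity)]
    linarith
  have hε2 : ε * (N' + 4) = 1 / 2 := by
    rw [hε]
    field_simp
  -- Strict differentiability is applied to `p` and `(p.1, 0, 0)`, where `μ` vanishes. The error is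
  -- thereby proportional to the `W`-components alone and not to the distance of `p.1` from `y₀`.
  have hμe : ∀ᶠ p : Y × W × W in 𝓝 (y₀, 0, 0),
      ‖μ p - p.2.1 - p.2.2‖ ≤ ε * max ‖p.2.1‖ ‖p.2.2‖ := by
    have h1 := (hμ.hasStrictFDerivAt (by simp)).isLittleO.def hε0
    have h2 : Tendsto (fun p : Y × W × W => (p, (p.1, (0 : W), (0 : W)))) (𝓝 (y₀, 0, 0))
        (𝓝 ((y₀, 0, 0), (y₀, 0, 0))) := Continuous.tendsto' (by fun_prop) _ _ rfl
    filter_upwards [h2.eventually h1, (continuousAt_fst (p := (y₀, (0 : W), (0 : W)))).eventually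
      hμ0] with p p1 p2
    have h3 : p - (p.1, 0, 0) = (0, p.2.1, p.2.2) := by ext <;> simp
    simp only [p2, h3, hμ', sub_zero] at p1
    simpa [Prod.norm_def, sub_sub] using p1
  have hje : ∀ᶠ p : Y × W × W in 𝓝 (y₀, 0, 0), ∀ l,
      ‖conj l p - Ad l p.2.2‖ ≤ ε * ‖p.2.2‖ := by
    have h1 := FamSmoothAt.eventually_norm_sub_le hj hε0
    have h2 : Tendsto (fun p : Y × W × W => (p, (p.1, p.2.1, (0 : W)))) (𝓝 (y₀, 0, 0))
        (𝓝 ((y₀, 0, 0), (y₀, 0, 0))) := Continuous.tendsto' (by fun_prop) _ _ rfl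
    have h4 : Tendsto (fun p : Y × W × W => (p.1, p.2.1)) (𝓝 (y₀, 0, 0)) (𝓝 (y₀, 0)) :=
      Continuous.tendsto' (by fun_prop) _ _ rfl
    filter_upwards [h2.eventually h1, h4.eventually hj0] with p p1 p2 l
    have h3 : p - (p.1, p.2.1, 0) = (0, 0, p.2.2) := by ext <;> simp
    have := p1 l
    simp only [p2 l, h3, hj', sub_zero] at this
    simpa [Prod.norm_def] using this
  obtain ⟨δ, hδ, hμb⟩ := Metric.eventually_nhds_iff_ball.1 (hμe.and hje)
  have hmem : ∀ {y w w'}, dist y y₀ < δ → ‖w‖ < δ → ‖w'‖ < δ →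
      (y, w, w') ∈ Metric.ball (y₀, (0 : W), (0 : W)) δ := by
    intro y w w' h1 h2 h3
    rw [Metric.mem_ball, Prod.dist_eq, Prod.dist_eq, dist_zero_right, dist_zero_right]
    exact max_lt h1 (max_lt h2 h3)
  -- The conjugated defect `w` below can be `N' + 1` times as large as `C`; the margin keeps it in
  -- the `δ`-ball too.
  have hδ' : 0 < δ / (N' + 2) := by positivity
  have hcs : ∀ᶠ y in 𝓝 y₀, ‖superposition c (cochainArgs L Y W (y, ξ y))‖ < δ / (N' + 2) := by
    have := hcl.norm
    rw [norm_zero] at this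
    exact this.eventually (gt_mem_nhds hδ')
  have hξs : ∀ᶠ y in 𝓝 y₀, ‖ξ y‖ < δ := by
    have := hξc.norm
    rw [norm_zero] at this
    exact this.eventually (gt_mem_nhds hδ)
  filter_upwards [hcm, hcs, hξs, Metric.ball_mem_nhds y₀ hδ,
    (tendsto_id.prodMk_nhds hξc).eventually hid] with y h1 h2 h3 h4 h5
  set C := superposition c (cochainArgs L Y W (y, ξ y)) with hC
  simp only [id, ← h1.1] at h5
  have hC0 := norm_nonneg C
  have hCδ : ‖C‖ * (N' + 2) < δ := by rwa [lt_div_iff₀ (by positivity)] at h2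
  have hCle : ∀ t, ‖C t‖ ≤ ‖C‖ := C.norm_coe_le_norm
  have key : C = 0 := by
    refine eq_zero_of_norm_cocycle_le C Ad hAd _ h1.2 fun l h k => ?_
    have hw : ‖C (h, k)‖ < δ := by nlinarith [hCle (h, k)]
    have hξl : ‖ξ y l‖ < δ := ((ξ y).norm_coe_le_norm l).trans_lt h3
    have e1 := (hμb _ (hmem h4 hξl hw)).2 l
    set w := conj l (y, ξ y l, C (h, k)) with hwdef
    have e1' : ‖w - Ad l (C (h, k))‖ ≤ ε * ‖C‖ :=
      e1.trans (mul_le_mul_of_nonneg_left (hCle _) hε0.le)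
    have e2 : ‖Ad l (C (h, k))‖ ≤ N' * ‖C‖ := (hN _ _).trans
      (mul_le_mul (le_max_left _ _) (hCle _) (norm_nonneg _) hN0)
    have e3 : ‖w‖ ≤ (N' + 1) * ‖C‖ := by
      have := norm_add_le (w - Ad l (C (h, k))) (Ad l (C (h, k)))
      rw [sub_add_cancel] at this
      nlinarith
    have e4 := (hμb _ (hmem h4 (show ‖C (l, h)‖ < δ by nlinarith [hCle (l, h)])
      (show ‖C (l * h, k)‖ < δ by nlinarith [hCle (l * h, k)]))).1
    have e5 := (hμb _ (hmem h4 (show ‖w‖ < δ by nlinarith)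
      (show ‖C (l, h * k)‖ < δ by nlinarith [hCle (l, h * k)]))).1
    dsimp only at e4 e5
    rw [h5 l h k] at e4
    have e4' : ‖μ (y, w, C (l, h * k)) - C (l, h) - C (l * h, k)‖ ≤ ε * ‖C‖ :=
      e4.trans (mul_le_mul_of_nonneg_left (max_le (hCle _) (hCle _)) hε0.le)
    have e5' : ‖μ (y, w, C (l, h * k)) - w - C (l, h * k)‖ ≤ ε * ((N' + 1) * ‖C‖) :=
      e5.trans (mul_le_mul_of_nonneg_left (max_le e3
        ((hCle _).trans (by nlinarith))) hε0.le)
    -- By `hid` both sides of the nonlinear cocycle identity equal the same value of `μ`; what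
    -- remains of the linear expression is the three errors.
    have e6 : C (l, h) + C (l * h, k) - Ad l (C (h, k)) - C (l, h * k) =
        (μ (y, w, C (l, h * k)) - w - C (l, h * k)) -
          (μ (y, w, C (l, h * k)) - C (l, h) - C (l * h, k)) + (w - Ad l (C (h, k))) := by abel
    rw [e6]
    refine (norm_add_le _ _).trans ((add_le_add (norm_sub_le _ _) le_rfl).trans ?_)
    have : ε * ((N' + 1) * ‖C‖) + ε * ‖C‖ + ε * ‖C‖ ≤ ε * (N' + 4) * ‖C‖ := by nlinarith
    rw [hε2] at this
    linarith
  intro t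
  rw [← h1.1, key]
  rfl

end Correction

/-! ### Group operations in coordinates, the adjoint action and the defect of a transport. -/

theorem fderiv_apply_of_eventuallyEq {P F W : Type*} [NormedAddCommGroup P] [NormedSpace ℝ P]
    [NormedAddCommGroup F] [NormedSpace ℝ F] [NormedAddCommGroup W] [NormedSpace ℝ W] {g : P → F}
    {p₀ : P} (hg : DifferentiableAt ℝ g p₀) (i : W →L[ℝ] P) {g' : W → F}
    (h : ∀ᶠ w in 𝓝 0, g (p₀ + i w) = g' w) (w : W) : fderiv ℝ g p₀ (i w) = fderiv ℝ g' 0 w := by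
  have h1 : HasFDerivAt (fun w => p₀ + i w) i 0 := i.hasFDerivAt.const_add p₀
  have h2 : HasFDerivAt g (fderiv ℝ g p₀) (p₀ + i 0) := by simpa using hg.hasFDerivAt
  have h3 : HasFDerivAt g' ((fderiv ℝ g p₀).comp i) 0 :=
    (h2.comp (0 : W) h1).congr_of_eventuallyEq (h.mono fun _ h => h.symm)
  rw [h3.fderiv]
  rfl

namespace LieGroupoid
open SmoothAtlas

variable {M : Type v} [TopologicalSpace M] {A : SmoothAtlas M}
  {K : Type u} [TopologicalSpace K] {B : SmoothAtlas K} {κ : LieGroupoid A B}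
  {a : Σ n : ℕ, OpenPartialHomeomorph M (EuclideanSpace ℝ (Fin n))} {x₀ : M}

namespace UnitCoordinates

variable (c : κ.UnitCoordinates a x₀) [hb : Fact κ.IsGroupBundle]

section Group

variable {E : Type} [NormedAddCommGroup E] [NormedSpace ℝ E] {γ : E → κ.Fibre x₀} {p : E}

theorem contDiffAt_η (hγ : B.PlotAt (fun e => (γ e : K)) univ p) (h1 : γ p = 1) :
    ContDiffAt ℝ ∞ (fun e => c.η (γ e)) p :=
  FunAt.comp_plot (γ := fun e => (γ e : K)) (h := c.η)
    (by rw [h1]; exact c.coord.self_of_nhds.1) hγ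

theorem tendsto_of_plotAt (hγ : B.PlotAt (fun e => (γ e : K)) univ p) : Tendsto γ (𝓝 p) (𝓝 (γ p)) :=
  (IsInducing.continuousAt_iff (g := Subtype.val) IsInducing.subtypeVal).2 hγ.continuousAt

theorem plotAt_param_comp {φ : E → EuclideanSpace ℝ (Fin c.d)} (hφ : ContDiffAt ℝ ∞ φ p)
    (h0 : φ p = 0) : B.PlotAt (fun e => (c.param (φ e) : K)) univ p :=
  PlotAt.comp_contDiffAt (γ := fun v => (c.param v : K)) (φ := φ)
    (by rw [h0]; exact c.plotAt_param.self_of_nhds) hφ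

/-- Multiplication in coordinates. -/
noncomputable def mulCoord
    (p : EuclideanSpace ℝ (Fin c.d) × EuclideanSpace ℝ (Fin c.d)) : EuclideanSpace ℝ (Fin c.d) :=
  c.η ((c.param p.1 * c.param p.2 : κ.Fibre x₀) : K)

theorem contDiffAt_mulCoord : ContDiffAt ℝ ∞ c.mulCoord (0, 0) :=
  c.contDiffAt_η (Fibre.plotAt_mul (c.plotAt_param_comp (φ := Prod.fst) contDiffAt_fst rfl)
    (c.plotAt_param_comp (φ := Prod.snd) contDiffAt_snd rfl)) (by simp [c.param_zero])

/-- With the unit in one slot, multiplication is the identity in the other. -/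
theorem fderiv_mulCoord (w₁ w₂ : EuclideanSpace ℝ (Fin c.d)) :
    fderiv ℝ c.mulCoord (0, 0) (w₁, w₂) = w₁ + w₂ := by
  have hd := c.contDiffAt_mulCoord.differentiableAt (by simp)
  have h1 := fderiv_apply_of_eventuallyEq hd (ContinuousLinearMap.inl ℝ _ _) (g' := id) (by
    filter_upwards [c.η_param] with w hw
    simp [mulCoord, c.param_zero, hw]) w₁
  have h2 := fderiv_apply_of_eventuallyEq hd (ContinuousLinearMap.inr ℝ _ _) (g' := id) (by
    filter_upwards [c.η_param] with w hw
    simp [mulCoord, c.param_zero, hw]) w₂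
  rw [show (w₁, w₂) = ContinuousLinearMap.inl ℝ _ _ w₁ + ContinuousLinearMap.inr ℝ _ _ w₂ by simp,
    map_add, h1, h2]
  simp

/-- Differentiate the identity g g⁻¹ = 1 at the unit. -/
theorem fderiv_inv (w : EuclideanSpace ℝ (Fin c.d)) :
    fderiv ℝ (fun w => c.η (((c.param w)⁻¹ : κ.Fibre x₀) : K)) 0 w = -w := by
  have hp := Fibre.plotAt_inv c.plotAt_param.self_of_nhds
  have hd : DifferentiableAt ℝ (fun w => c.η (((c.param w)⁻¹ : κ.Fibre x₀) : K)) 0 :=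
    (c.contDiffAt_η hp (by simp [c.param_zero])).differentiableAt (by simp)
  have h0 : c.η (((c.param 0)⁻¹ : κ.Fibre x₀) : K) = 0 := by
    rw [c.param_zero, inv_one, Fibre.coe_one, c.η_unit]
  have h1 : HasFDerivAt c.mulCoord (fderiv ℝ c.mulCoord (0, 0))
      (0, c.η (((c.param 0)⁻¹ : κ.Fibre x₀) : K)) := by
    rw [h0]
    exact (c.contDiffAt_mulCoord.differentiableAt (by simp)).hasFDerivAt
  have h2 := h1.comp (0 : EuclideanSpace ℝ (Fin c.d)) ((hasFDerivAt_id _).prodMk hd.hasFDerivAt)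
  have ht := tendsto_of_plotAt hp
  rw [c.param_zero, inv_one] at ht
  have h3 : (c.mulCoord ∘ fun w => (id w, c.η (((c.param w)⁻¹ : κ.Fibre x₀) : K)))
      =ᶠ[𝓝 0] fun _ => 0 := by
    filter_upwards [ht.eventually c.param_η] with w hw
    simp only [Function.comp_apply, mulCoord, id, hw, mul_inv_cancel]
    rw [Fibre.coe_one, c.η_unit]
  have h4 := h2.congr_of_eventuallyEq h3.symm |>.unique (hasFDerivAt_const 0 _)
  have h5 := congrArg (fun T => T w) h4
  simp only [ContinuousLinearMap.comp_apply, ContinuousLinearMap.prod_apply, fderiv_mulCoord,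
    ContinuousLinearMap.id_apply, _root_.zero_apply] at h5
  exact eq_neg_of_add_eq_zero_right h5

theorem plotAt_conj (l : κ.Fibre x₀) :
    B.PlotAt (fun w => ((l * c.param w * l⁻¹ : κ.Fibre x₀) : K)) univ 0 :=
  Fibre.plotAt_mul (Fibre.plotAt_mul (plotAt_const _ _ _) c.plotAt_param.self_of_nhds)
    (plotAt_const _ _ _)

/-- The adjoint action of the fibre. -/
noncomputable def Ad (l : κ.Fibre x₀) :
    EuclideanSpace ℝ (Fin c.d) →L[ℝ] EuclideanSpace ℝ (Fin c.d) :=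
  fderiv ℝ (fun w => c.η ((l * c.param w * l⁻¹ : κ.Fibre x₀) : K)) 0

theorem hasFDerivAt_conj (l : κ.Fibre x₀) :
    HasFDerivAt (fun w => c.η ((l * c.param w * l⁻¹ : κ.Fibre x₀) : K)) (c.Ad l) 0 :=
  ((c.contDiffAt_η (c.plotAt_conj l) (by simp [c.param_zero])).differentiableAt
    (by simp)).hasFDerivAt

/-- Conjugation by a product is the composite of the conjugations; apply the chain rule at the unit.
-/
theorem Ad_mul (l h : κ.Fibre x₀) (w : EuclideanSpace ℝ (Fin c.d)) :
    c.Ad (l * h) w = c.Ad l (c.Ad h w) := by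
  have h0 : c.η ((h * c.param 0 * h⁻¹ : κ.Fibre x₀) : K) = 0 := by
    rw [c.param_zero, mul_one, mul_inv_cancel, Fibre.coe_one, c.η_unit]
  have h1 := c.hasFDerivAt_conj l
  rw [← h0] at h1
  have h2 := h1.comp (0 : EuclideanSpace ℝ (Fin c.d)) (c.hasFDerivAt_conj h)
  have ht := tendsto_of_plotAt (c.plotAt_conj h)
  simp only [c.param_zero, mul_one, mul_inv_cancel] at ht
  refine congrArg (fun T => T w) ((c.hasFDerivAt_conj (l * h)).unique (h2.congr_of_eventuallyEq ?_))
  filter_upwards [ht.eventually c.param_η] with w hw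
  simp only [Function.comp_apply, hw]
  congr 2
  group

end Group

variable {f : κ.Fibre x₀ → EuclideanSpace ℝ (Fin a.1) → K}

/-- The perturbations of a transport. -/
noncomputable def perturb (f : κ.Fibre x₀ → EuclideanSpace ℝ (Fin a.1) → K) (l : κ.Fibre x₀)
    (p : EuclideanSpace ℝ (Fin a.1) × EuclideanSpace ℝ (Fin c.d)) : K :=
  κ.mul (c.θ p) (f l p.1)

theorem famPlotAt_perturb (hf : ∀ l, κ.IsTransportAt a x₀ f l) (l : κ.Fibre x₀) :
    B.FamPlotAt (c.perturb f) l (a.2 x₀, 0) := by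
  refine hb.out.famPlotAt_mul (φ := fun _ p => c.θ p) (φ' := fun l p => f l p.1)
    (FamPlotAt.of_plot (c.plot.mono fun _ h => h.1))
    (FamPlotAt.reparam (σ := id) (g := Prod.fst) continuous_id contDiff_fst (hf l).plot) ?_
  have h1 : Tendsto (fun q : κ.Fibre x₀ × (EuclideanSpace ℝ (Fin a.1) ×
      EuclideanSpace ℝ (Fin c.d)) => (q.1, q.2.1)) (𝓝 (l, (a.2 x₀, 0))) (𝓝 (l, a.2 x₀)) :=
    Continuous.tendsto' (by fun_prop) _ _ rfl
  filter_upwards [h1.eventually (hf l).src,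
    (continuousAt_snd (p := (l, (a.2 x₀, (0 : EuclideanSpace ℝ (Fin c.d)))))).eventually c.plot]
    with q q1 q2
  rw [q1, q2.2.1]

theorem src_perturb [CompactSpace (κ.Fibre x₀)] (hf : ∀ l, κ.IsTransportAt a x₀ f l) :
    ∀ᶠ p in 𝓝 (a.2 x₀, 0), ∀ l, κ.src (c.perturb f l p) = a.2.symm p.1 := by
  have h : ∀ᶠ y in 𝓝 (a.2 x₀), ∀ l, κ.src (f l y) = a.2.symm y :=
    eventually_forall_of_compactSpace fun l => (hf l).src
  filter_upwards [(continuousAt_fst (p := (a.2 x₀, (0 : EuclideanSpace ℝ (Fin c.d))))).eventually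
    h, c.plot] with p h1 h2 l
  rw [perturb, κ.src_mul _ _ (by rw [hb.out.tgt_eq, h1, h2.2.1]), h1]

theorem perturb_base (hf : ∀ l, κ.IsTransportAt a x₀ f l) :
    ∀ᶠ w in 𝓝 0, ∀ l, c.perturb f l (a.2 x₀, w) = ((c.param w * l : κ.Fibre x₀) : K) := by
  filter_upwards [c.coe_param] with w hw l
  rw [perturb, (hf l).base.self_of_nhds, Fibre.coe_mul, hw]

theorem perturb_zero (hf : ∀ l, κ.IsTransportAt a x₀ f l) (l : κ.Fibre x₀) :
    c.perturb f l (a.2 x₀, 0) = l := by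
  rw [(c.perturb_base hf).self_of_nhds, c.param_zero, one_mul]

/-- The failure of a perturbation of a transport to be multiplicative. -/
noncomputable def defect (f : κ.Fibre x₀ → EuclideanSpace ℝ (Fin a.1) → K)
    (t : κ.Fibre x₀ × κ.Fibre x₀) (p : EuclideanSpace ℝ (Fin a.1) × EuclideanSpace ℝ (Fin c.d) ×
      EuclideanSpace ℝ (Fin c.d) × EuclideanSpace ℝ (Fin c.d)) : K :=
  κ.mul (κ.mul (c.perturb f t.1 (p.1, p.2.1)) (c.perturb f t.2 (p.1, p.2.2.1)))
    (κ.inv (c.perturb f (t.1 * t.2) (p.1, p.2.2.2)))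

/-- The conjugation by a perturbation of a transport. -/
noncomputable def conjugate (f : κ.Fibre x₀ → EuclideanSpace ℝ (Fin a.1) → K)
    (l : κ.Fibre x₀) (p : EuclideanSpace ℝ (Fin a.1) × EuclideanSpace ℝ (Fin c.d) ×
      EuclideanSpace ℝ (Fin c.d)) : K :=
  κ.mul (κ.mul (c.perturb f l (p.1, p.2.1)) (c.θ (p.1, p.2.2)))
    (κ.inv (c.perturb f l (p.1, p.2.1)))

section

variable [CompactSpace (κ.Fibre x₀)]

theorem src_perturb_args (hf : ∀ l, κ.IsTransportAt a x₀ f l) :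
    ∀ᶠ p : EuclideanSpace ℝ (Fin a.1) × EuclideanSpace ℝ (Fin c.d) ×
      EuclideanSpace ℝ (Fin c.d) × EuclideanSpace ℝ (Fin c.d) in 𝓝 (a.2 x₀, 0, 0, 0), ∀ l,
      κ.src (c.perturb f l (p.1, p.2.1)) = a.2.symm p.1 ∧
      κ.src (c.perturb f l (p.1, p.2.2.1)) = a.2.symm p.1 ∧
      κ.src (c.perturb f l (p.1, p.2.2.2)) = a.2.symm p.1 := by
  have h := c.src_perturb hf
  filter_upwards [(Continuous.tendsto' (f := fun p : EuclideanSpace ℝ (Fin a.1) ×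
    EuclideanSpace ℝ (Fin c.d) × EuclideanSpace ℝ (Fin c.d) × EuclideanSpace ℝ (Fin c.d) =>
      (p.1, p.2.1)) (by fun_prop) (a.2 x₀, 0, 0, 0) _ rfl).eventually h,
    (Continuous.tendsto' (f := fun p : EuclideanSpace ℝ (Fin a.1) ×
    EuclideanSpace ℝ (Fin c.d) × EuclideanSpace ℝ (Fin c.d) × EuclideanSpace ℝ (Fin c.d) =>
      (p.1, p.2.2.1)) (by fun_prop) (a.2 x₀, 0, 0, 0) _ rfl).eventually h,
    (Continuous.tendsto' (f := fun p : EuclideanSpace ℝ (Fin a.1) ×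
    EuclideanSpace ℝ (Fin c.d) × EuclideanSpace ℝ (Fin c.d) × EuclideanSpace ℝ (Fin c.d) =>
      (p.1, p.2.2.2)) (by fun_prop) (a.2 x₀, 0, 0, 0) _ rfl).eventually h] with p h1 h2 h3 l
  exact ⟨h1 l, h2 l, h3 l⟩

theorem famPlotAt_defect (hf : ∀ l, κ.IsTransportAt a x₀ f l) (t : κ.Fibre x₀ × κ.Fibre x₀) :
    B.FamPlotAt (c.defect f) t (a.2 x₀, 0, 0, 0) := by
  have hs := (continuousAt_snd (p := (t, (a.2 x₀, (0 : EuclideanSpace ℝ (Fin c.d)),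
    (0 : EuclideanSpace ℝ (Fin c.d)), (0 : EuclideanSpace ℝ (Fin c.d)))))).eventually
      (c.src_perturb_args hf)
  refine hb.out.famPlotAt_mul (hb.out.famPlotAt_mul
    (FamPlotAt.reparam (φ := c.perturb f) (σ := Prod.fst) continuous_fst
      (g := fun p : EuclideanSpace ℝ (Fin a.1) × EuclideanSpace ℝ (Fin c.d) ×
        EuclideanSpace ℝ (Fin c.d) × EuclideanSpace ℝ (Fin c.d) => (p.1, p.2.1)) (by fun_prop)
      (c.famPlotAt_perturb hf _))
    (FamPlotAt.reparam (φ := c.perturb f) (σ := Prod.snd) continuous_snd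
      (g := fun p : EuclideanSpace ℝ (Fin a.1) × EuclideanSpace ℝ (Fin c.d) ×
        EuclideanSpace ℝ (Fin c.d) × EuclideanSpace ℝ (Fin c.d) => (p.1, p.2.2.1)) (by fun_prop)
      (c.famPlotAt_perturb hf _)) ?_) (famPlotAt_inv
    (FamPlotAt.reparam (φ := c.perturb f) (σ := fun t : κ.Fibre x₀ × κ.Fibre x₀ => t.1 * t.2) continuous_mul
      (g := fun p : EuclideanSpace ℝ (Fin a.1) × EuclideanSpace ℝ (Fin c.d) ×
        EuclideanSpace ℝ (Fin c.d) × EuclideanSpace ℝ (Fin c.d) => (p.1, p.2.2.2)) (by fun_prop)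
      (c.famPlotAt_perturb hf _))) ?_
  · filter_upwards [hs] with q hq
    rw [(hq _).1, (hq _).2.1]
  · filter_upwards [hs] with q hq
    rw [κ.src_inv, hb.out.tgt_eq, (hq _).2.2, κ.src_mul, (hq _).2.1]
    rw [hb.out.tgt_eq, (hq _).1, (hq _).2.1]

theorem src_conj_args (hf : ∀ l, κ.IsTransportAt a x₀ f l) :
    ∀ᶠ p : EuclideanSpace ℝ (Fin a.1) × EuclideanSpace ℝ (Fin c.d) ×
      EuclideanSpace ℝ (Fin c.d) in 𝓝 (a.2 x₀, 0, 0), ∀ l,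
      κ.src (c.perturb f l (p.1, p.2.1)) = a.2.symm p.1 ∧
      κ.src (c.θ (p.1, p.2.2)) = a.2.symm p.1 := by
  filter_upwards [(Continuous.tendsto' (f := fun p : EuclideanSpace ℝ (Fin a.1) ×
    EuclideanSpace ℝ (Fin c.d) × EuclideanSpace ℝ (Fin c.d) =>
      (p.1, p.2.1)) (by fun_prop) (a.2 x₀, 0, 0) _ rfl).eventually (c.src_perturb hf),
    (Continuous.tendsto' (f := fun p : EuclideanSpace ℝ (Fin a.1) ×
    EuclideanSpace ℝ (Fin c.d) × EuclideanSpace ℝ (Fin c.d) =>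
      (p.1, p.2.2)) (by fun_prop) (a.2 x₀, 0, 0) _ rfl).eventually c.plot] with p h1 h2 l
  exact ⟨h1 l, h2.2.1⟩

theorem famPlotAt_conjugate (hf : ∀ l, κ.IsTransportAt a x₀ f l) (l : κ.Fibre x₀) :
    B.FamPlotAt (c.conjugate f) l (a.2 x₀, 0, 0) := by
  have hs := (continuousAt_snd (p := (l, (a.2 x₀, (0 : EuclideanSpace ℝ (Fin c.d)),
    (0 : EuclideanSpace ℝ (Fin c.d)))))).eventually (c.src_conj_args hf)
  have h1 := FamPlotAt.reparam (φ := c.perturb f) (σ := id) continuous_id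
      (g := fun p : EuclideanSpace ℝ (Fin a.1) × EuclideanSpace ℝ (Fin c.d) ×
        EuclideanSpace ℝ (Fin c.d) => (p.1, p.2.1)) (by fun_prop) (t₀ := l)
      (p₀ := (a.2 x₀, 0, 0)) (c.famPlotAt_perturb hf _)
  refine hb.out.famPlotAt_mul (hb.out.famPlotAt_mul h1
    (FamPlotAt.reparam (φ := fun (_ : κ.Fibre x₀) p => c.θ p) (σ := id) continuous_id
      (g := fun p : EuclideanSpace ℝ (Fin a.1) × EuclideanSpace ℝ (Fin c.d) ×
        EuclideanSpace ℝ (Fin c.d) => (p.1, p.2.2)) (by fun_prop)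
      (FamPlotAt.of_plot (c.plot.mono fun _ h => h.1))) ?_) (famPlotAt_inv h1) ?_
  · filter_upwards [hs] with q hq
    exact (hq _).1.trans (hq q.1).2.symm
  · filter_upwards [hs] with q hq
    rw [κ.src_inv, hb.out.tgt_eq, κ.src_mul]
    · exact (hq q.1).2.trans (hq _).1.symm
    · rw [hb.out.tgt_eq]
      exact (hq _).1.trans (hq q.1).2.symm

end

end UnitCoordinates

end LieGroupoid

/-! ### The cocycle identity for the defect, and transport by homomorphisms. -/

namespace LieGroupoid
open SmoothAtlas

variable {M : Type v} [TopologicalSpace M] {A : SmoothAtlas M}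
  {K : Type u} [TopologicalSpace K] {B : SmoothAtlas K} {κ : LieGroupoid A B}
  {a : Σ n : ℕ, OpenPartialHomeomorph M (EuclideanSpace ℝ (Fin n))} {x₀ : M}

namespace UnitCoordinates

variable (c : κ.UnitCoordinates a x₀)

theorem η_unit_nhds : ∀ᶠ y in 𝓝 (a.2 x₀), c.η (κ.unit (a.2.symm y)) = 0 := by
  have h : Tendsto (fun y => (y, (0 : EuclideanSpace ℝ (Fin c.d)))) (𝓝 (a.2 x₀))
      (𝓝 (a.2 x₀, 0)) := Continuous.tendsto' (by fun_prop) _ _ rfl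
  filter_upwards [h.eventually c.plot, c.unit] with y h1 h2
  rw [← h2, h1.2.2]

variable [hb : Fact κ.IsGroupBundle] {f : κ.Fibre x₀ → EuclideanSpace ℝ (Fin a.1) → K}

/-- Multiplication in coordinates, in the fibres over a chart. -/
noncomputable def fibreMulCoord (p : EuclideanSpace ℝ (Fin a.1) × EuclideanSpace ℝ (Fin c.d) ×
    EuclideanSpace ℝ (Fin c.d)) : EuclideanSpace ℝ (Fin c.d) :=
  c.η (κ.mul (c.θ (p.1, p.2.1)) (c.θ (p.1, p.2.2)))

theorem contDiffAt_fibreMulCoord : ContDiffAt ℝ ∞ c.fibreMulCoord (a.2 x₀, 0, 0) := by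
  have h1 : Tendsto (fun p : EuclideanSpace ℝ (Fin a.1) × EuclideanSpace ℝ (Fin c.d) ×
      EuclideanSpace ℝ (Fin c.d) => (p.1, p.2.1)) (𝓝 (a.2 x₀, 0, 0)) (𝓝 (a.2 x₀, 0)) :=
    Continuous.tendsto' (by fun_prop) _ _ rfl
  have h2 : Tendsto (fun p : EuclideanSpace ℝ (Fin a.1) × EuclideanSpace ℝ (Fin c.d) ×
      EuclideanSpace ℝ (Fin c.d) => (p.1, p.2.2)) (𝓝 (a.2 x₀, 0, 0)) (𝓝 (a.2 x₀, 0)) :=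
    Continuous.tendsto' (by fun_prop) _ _ rfl
  refine FunAt.comp_plot (h := c.η) (γ := fun p : EuclideanSpace ℝ (Fin a.1) ×
    EuclideanSpace ℝ (Fin c.d) × EuclideanSpace ℝ (Fin c.d) =>
      κ.mul (c.θ (p.1, p.2.1)) (c.θ (p.1, p.2.2))) ?_ (plotAt_mul_nhds
    (PlotAt.comp_contDiffAt (φ := fun p : EuclideanSpace ℝ (Fin a.1) ×
      EuclideanSpace ℝ (Fin c.d) × EuclideanSpace ℝ (Fin c.d) => (p.1, p.2.1))
      c.plot.self_of_nhds.1 (by fun_prop))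
    (PlotAt.comp_contDiffAt (φ := fun p : EuclideanSpace ℝ (Fin a.1) ×
      EuclideanSpace ℝ (Fin c.d) × EuclideanSpace ℝ (Fin c.d) => (p.1, p.2.2))
      c.plot.self_of_nhds.1 (by fun_prop)) ?_)
  · have := κ.mul_unit (κ.unit x₀)
    rw [κ.src_unit] at this
    dsimp only
    rw [c.θ_base, this]
    exact c.coord.self_of_nhds.1
  · filter_upwards [h1.eventually c.plot, h2.eventually c.plot] with p p1 p2
    rw [hb.out.tgt_eq, p1.2.1, p2.2.1]

theorem fibreMulCoord_zero : ∀ᶠ y in 𝓝 (a.2 x₀), c.fibreMulCoord (y, 0, 0) = 0 := by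
  filter_upwards [c.η_unit_nhds, c.unit] with y h1 h2
  have := κ.mul_unit (κ.unit (a.2.symm y))
  rw [κ.src_unit] at this
  rw [fibreMulCoord, h2, this, h1]

theorem fderiv_fibreMulCoord (w₁ w₂ : EuclideanSpace ℝ (Fin c.d)) :
    fderiv ℝ c.fibreMulCoord (a.2 x₀, 0, 0) (0, w₁, w₂) = w₁ + w₂ := by
  rw [← c.fderiv_mulCoord]
  refine fderiv_apply_of_eventuallyEq (c.contDiffAt_fibreMulCoord.differentiableAt (by simp))
    (ContinuousLinearMap.inr ℝ _ _) ?_ (w₁, w₂)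
  filter_upwards [(continuousAt_fst (p := ((0 : EuclideanSpace ℝ (Fin c.d)),
      (0 : EuclideanSpace ℝ (Fin c.d))))).eventually c.coe_param,
    (continuousAt_snd (p := ((0 : EuclideanSpace ℝ (Fin c.d)),
      (0 : EuclideanSpace ℝ (Fin c.d))))).eventually c.coe_param] with w h1 h2
  simp [fibreMulCoord, mulCoord, Fibre.coe_mul, h1, h2]

theorem defect_zero (hf : ∀ l, κ.IsTransportAt a x₀ f l) (t : κ.Fibre x₀ × κ.Fibre x₀) :
    c.defect f t (a.2 x₀, 0, 0, 0) = κ.unit x₀ := by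
  simp only [defect, c.perturb_zero hf]
  rw [← Fibre.coe_mul, ← Fibre.coe_inv, ← Fibre.coe_mul, mul_inv_cancel, Fibre.coe_one]

theorem conjugate_zero (hf : ∀ l, κ.IsTransportAt a x₀ f l) (l : κ.Fibre x₀) :
    c.conjugate f l (a.2 x₀, 0, 0) = κ.unit x₀ := by
  simp only [conjugate, c.perturb_zero hf, c.θ_base]
  rw [← Fibre.coe_one, ← Fibre.coe_mul, ← Fibre.coe_inv, ← Fibre.coe_mul, mul_one, mul_inv_cancel]

variable [CompactSpace (κ.Fibre x₀)]

theorem famSmoothAt_defect (hf : ∀ l, κ.IsTransportAt a x₀ f l) (t : κ.Fibre x₀ × κ.Fibre x₀) :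
    FamSmoothAt (fun t p => c.η (c.defect f t p)) t (a.2 x₀, 0, 0, 0) :=
  (c.famPlotAt_defect hf t).comp_funAt (by
    rw [c.defect_zero hf]
    exact c.coord.mono fun _ h => h.1)

theorem famSmoothAt_conjugate (hf : ∀ l, κ.IsTransportAt a x₀ f l) (l : κ.Fibre x₀) :
    FamSmoothAt (fun l p => c.η (c.conjugate f l p)) l (a.2 x₀, 0, 0) :=
  (c.famPlotAt_conjugate hf l).comp_funAt (by
    rw [c.conjugate_zero hf]
    exact c.coord.mono fun _ h => h.1)

/-- Vary one slot at a time over `x₀`, where the transport is the identity. The defect is then the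
perturbing element itself, its conjugate by `l`, or its inverse. -/
theorem fderiv_defect (hf : ∀ l, κ.IsTransportAt a x₀ f l) (l h : κ.Fibre x₀)
    (w₁ w₂ w₃ : EuclideanSpace ℝ (Fin c.d)) :
    fderiv ℝ (fun p => c.η (c.defect f (l, h) p)) (a.2 x₀, 0, 0, 0) (0, w₁, w₂, w₃) =
      w₁ + c.Ad l w₂ - w₃ := by
  have hd := (c.famSmoothAt_defect hf (l, h)).contDiffAt.differentiableAt (by simp)
  have h0 : ∀ l : κ.Fibre x₀, c.perturb f l (a.2 x₀, 0) = l := c.perturb_zero hf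
  have h1 := fderiv_apply_of_eventuallyEq hd
    ((0 : _ →L[ℝ] _).prod ((ContinuousLinearMap.id ℝ _).prod ((0 : _ →L[ℝ] _).prod 0)))
    (g' := id) (by
      filter_upwards [c.perturb_base hf, c.η_param] with w hw hw'
      simp only [defect, ContinuousLinearMap.prod_apply, ContinuousLinearMap.id_apply,
        _root_.zero_apply, Prod.mk_add_mk, add_zero, zero_add, h0, hw]
      rw [← Fibre.coe_mul, ← Fibre.coe_inv, ← Fibre.coe_mul]
      simpa [mul_assoc] using hw') w₁
  have h2 := fderiv_apply_of_eventuallyEq hd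
    ((0 : _ →L[ℝ] _).prod ((0 : _ →L[ℝ] _).prod ((ContinuousLinearMap.id ℝ _).prod 0)))
    (g' := fun w => c.η ((l * c.param w * l⁻¹ : κ.Fibre x₀) : K)) (by
      filter_upwards [c.perturb_base hf] with w hw
      simp only [defect, ContinuousLinearMap.prod_apply, ContinuousLinearMap.id_apply,
        _root_.zero_apply, Prod.mk_add_mk, add_zero, zero_add, h0, hw]
      rw [← Fibre.coe_mul, ← Fibre.coe_inv, ← Fibre.coe_mul]
      congr 2
      group) w₂
  have h3 := fderiv_apply_of_eventuallyEq hd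
    ((0 : _ →L[ℝ] _).prod ((0 : _ →L[ℝ] _).prod ((0 : _ →L[ℝ] _).prod
      (ContinuousLinearMap.id ℝ _))))
    (g' := fun w => c.η (((c.param w)⁻¹ : κ.Fibre x₀) : K)) (by
      filter_upwards [c.perturb_base hf] with w hw
      simp only [defect, ContinuousLinearMap.prod_apply, ContinuousLinearMap.id_apply,
        _root_.zero_apply, Prod.mk_add_mk, add_zero, zero_add, h0, hw]
      rw [← Fibre.coe_mul, ← Fibre.coe_inv, ← Fibre.coe_mul]
      congr 2
      group) w₃
  rw [c.fderiv_inv] at h3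
  have h4 : ((0 : EuclideanSpace ℝ (Fin a.1)), w₁, w₂, w₃) =
      (0, w₁, 0, 0) + ((0, 0, w₂, 0) + (0, 0, 0, w₃)) := by simp
  rw [h4, map_add, map_add]
  refine (congrArg₂ _ h1 (congrArg₂ _ h2 h3)).trans ?_
  simp only [fderiv_id, ContinuousLinearMap.id_apply, Ad]
  abel

theorem fderiv_conjugate (hf : ∀ l, κ.IsTransportAt a x₀ f l) (l : κ.Fibre x₀)
    (w : EuclideanSpace ℝ (Fin c.d)) :
    fderiv ℝ (fun p => c.η (c.conjugate f l p)) (a.2 x₀, 0, 0) (0, 0, w) = c.Ad l w := by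
  refine fderiv_apply_of_eventuallyEq
    ((c.famSmoothAt_conjugate hf l).contDiffAt.differentiableAt (by simp))
    ((0 : _ →L[ℝ] _).prod ((0 : _ →L[ℝ] _).prod (ContinuousLinearMap.id ℝ _))) ?_ w
  filter_upwards [c.coe_param] with w hw
  simp only [conjugate, ContinuousLinearMap.prod_apply, ContinuousLinearMap.id_apply,
    _root_.zero_apply, Prod.mk_add_mk, add_zero, zero_add, c.perturb_zero hf, ← hw]
  rfl

/-- Uniformly on the compact parameter space the defect stays where the coordinates are injective,
so a vanishing coordinate forces the defect to be a unit. -/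
theorem defect_coord (hf : ∀ l, κ.IsTransportAt a x₀ f l) :
    ∀ᶠ q in 𝓝 (a.2 x₀, 0, 0, 0), ∀ t, c.θ (q.1, c.η (c.defect f t q)) = c.defect f t q := by
  refine eventually_forall_of_compactSpace fun t => ?_
  have h1 := (c.famPlotAt_defect hf t).continuousAt
  rw [ContinuousAt, c.defect_zero hf] at h1
  have h2 : Tendsto (fun q : (κ.Fibre x₀ × κ.Fibre x₀) × (EuclideanSpace ℝ (Fin a.1) ×
      EuclideanSpace ℝ (Fin c.d) × EuclideanSpace ℝ (Fin c.d) × EuclideanSpace ℝ (Fin c.d)) =>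
        q.2) (𝓝 (t, (a.2 x₀, 0, 0, 0))) (𝓝 (a.2 x₀, 0, 0, 0)) := continuousAt_snd
  filter_upwards [h1.eventually c.coord, h2.eventually (c.src_perturb_args hf),
    h2.eventually (continuousAt_fst.eventually (a.2.open_target.mem_nhds
      (a.2.map_source c.mem_source)))] with q h1 h2 h3
  have h4 : κ.src (c.defect f q.1 q.2) = a.2.symm q.2.1 := by
    rw [defect, κ.src_mul, κ.src_inv, hb.out.tgt_eq, (h2 _).2.2]
    rw [κ.tgt_inv, (h2 _).2.2, κ.src_mul, (h2 _).2.1]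
    rw [hb.out.tgt_eq, (h2 _).1, (h2 _).2.1]
  have := h1.2
  rwa [h4, a.2.right_inv h3] at this

theorem conjugate_coord (hf : ∀ l, κ.IsTransportAt a x₀ f l) :
    ∀ᶠ q in 𝓝 (a.2 x₀, 0, 0), ∀ l, c.θ (q.1, c.η (c.conjugate f l q)) = c.conjugate f l q := by
  refine eventually_forall_of_compactSpace fun l => ?_
  have h1 := (c.famPlotAt_conjugate hf l).continuousAt
  rw [ContinuousAt, c.conjugate_zero hf] at h1
  have h2 : Tendsto (fun q : κ.Fibre x₀ × (EuclideanSpace ℝ (Fin a.1) ×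
      EuclideanSpace ℝ (Fin c.d) × EuclideanSpace ℝ (Fin c.d)) =>
        q.2) (𝓝 (l, (a.2 x₀, 0, 0))) (𝓝 (a.2 x₀, 0, 0)) := continuousAt_snd
  filter_upwards [h1.eventually c.coord, h2.eventually (c.src_conj_args hf),
    h2.eventually (continuousAt_fst.eventually (a.2.open_target.mem_nhds
      (a.2.map_source c.mem_source)))] with q h1 h2 h3
  have h4 : κ.src (c.conjugate f q.1 q.2) = a.2.symm q.2.1 := by
    rw [conjugate, κ.src_mul, κ.src_inv, hb.out.tgt_eq, (h2 _).1]
    rw [κ.tgt_inv, (h2 _).1, κ.src_mul, (h2 q.1).2]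
    rw [hb.out.tgt_eq, (h2 _).1, (h2 q.1).2]
  have := h1.2
  rwa [h4, a.2.right_inv h3] at this

theorem conjugate_unit (hf : ∀ l, κ.IsTransportAt a x₀ f l) :
    ∀ᶠ p in 𝓝 (a.2 x₀, 0), ∀ l, c.η (c.conjugate f l (p.1, p.2, 0)) = 0 := by
  have h : Tendsto (fun p : EuclideanSpace ℝ (Fin a.1) × EuclideanSpace ℝ (Fin c.d) => p.1)
    (𝓝 (a.2 x₀, 0)) (𝓝 (a.2 x₀)) := continuousAt_fst
  filter_upwards [c.src_perturb hf, h.eventually c.unit, h.eventually c.η_unit_nhds]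
    with p h1 h2 h3 l
  have := κ.mul_unit (c.perturb f l (p.1, p.2))
  rw [h1] at this
  rw [conjugate, h2, this, κ.mul_inv, hb.out.tgt_eq, h1, h3]

/-- The defect satisfies a nonlinear cocycle identity. -/
theorem defect_cocycle (hf : ∀ l, κ.IsTransportAt a x₀ f l) :
    ∀ᶠ p : EuclideanSpace ℝ (Fin a.1) × C(κ.Fibre x₀, EuclideanSpace ℝ (Fin c.d)) in
      𝓝 (a.2 x₀, 0), ∀ l h k,
      c.fibreMulCoord (p.1, c.η (c.defect f (l, h) (cochainArgs _ _ _ p (l, h))),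
          c.η (c.defect f (l * h, k) (cochainArgs _ _ _ p (l * h, k)))) =
        c.fibreMulCoord (p.1,
          c.η (c.conjugate f l (p.1, p.2 l,
            c.η (c.defect f (h, k) (cochainArgs _ _ _ p (h, k))))),
          c.η (c.defect f (l, h * k) (cochainArgs _ _ _ p (l, h * k)))) := by
  obtain ⟨U, hU, V, hV, hUV⟩ := mem_nhds_prod_iff.1 (c.conjugate_coord hf)
  obtain ⟨V₁, hV₁, V₂, hV₂, hV₁₂⟩ := mem_nhds_prod_iff.1 hV
  have hsmall : ∀ᶠ q in 𝓝 (a.2 x₀, 0, 0, 0), ∀ t, c.η (c.defect f t q) ∈ V₂ := by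
    refine eventually_forall_of_compactSpace fun t => ?_
    refine (c.famSmoothAt_defect hf t).continuousAt.eventually ?_
    dsimp only
    rw [c.defect_zero hf, c.η_unit]
    exact hV₂
  have hfst : ∀ᶠ q : EuclideanSpace ℝ (Fin a.1) × EuclideanSpace ℝ (Fin c.d) ×
      EuclideanSpace ℝ (Fin c.d) × EuclideanSpace ℝ (Fin c.d) in 𝓝 (a.2 x₀, 0, 0, 0),
      q.1 ∈ U ∧ q.2.1 ∈ V₁ :=
    (Continuous.tendsto' (f := fun q : EuclideanSpace ℝ (Fin a.1) × EuclideanSpace ℝ (Fin c.d) ×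
      EuclideanSpace ℝ (Fin c.d) × EuclideanSpace ℝ (Fin c.d) => (q.1, q.2.1)) (by fun_prop)
      (a.2 x₀, 0, 0, 0) (a.2 x₀, 0) rfl).eventually (prod_mem_nhds hU hV₁)
  filter_upwards [eventually_forall_cochainArgs (c.defect_coord hf),
    eventually_forall_cochainArgs hsmall, eventually_forall_cochainArgs hfst,
    eventually_forall_cochainArgs (c.src_perturb_args hf)] with p h1 h2 h3 h4 l h k
  -- Inside one fibre the claim becomes an identity valid for any map `g` between groups: with
  -- c(l,h) = g(l) g(h) g(lh)⁻¹, one has c(l,h) c(lh,k) = g(l) c(h,k) g(l)⁻¹ c(l,hk).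
  let g : κ.Fibre x₀ → κ.Fibre (a.2.symm p.1) := fun l => ⟨c.perturb f l (p.1, p.2 l), (h4 l l l).1⟩
  have hD : ∀ l h, c.θ (p.1, c.η (c.defect f (l, h) (cochainArgs _ _ _ p (l, h)))) =
      ((g l * g h * (g (l * h))⁻¹ : κ.Fibre (a.2.symm p.1)) : K) := fun l h => h1 l h (l, h)
  have hC : c.θ (p.1, c.η (c.conjugate f l (p.1, p.2 l,
      c.η (c.defect f (h, k) (cochainArgs _ _ _ p (h, k)))))) =
        ((g l * (g h * g k * (g (h * k))⁻¹) * (g l)⁻¹ : κ.Fibre (a.2.symm p.1)) : K) := by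
    refine (hUV (mk_mem_prod (h3 l l).1 (hV₁₂ (mk_mem_prod (h3 l l).2 (h2 h k (h, k))))) l).trans ?_
    exact congrArg (fun z => κ.mul (κ.mul (g l) z) (κ.inv (g l))) (hD h k)
  simp only [fibreMulCoord, hD, hC]
  rw [← Fibre.coe_mul, ← Fibre.coe_mul]
  congr 2
  rw [_root_.mul_assoc l h k]
  group

/-- A transport of the compact fibre can be perturbed to group homomorphisms. -/
theorem exists_multiplicative_transport [T2Space K] (c : κ.UnitCoordinates a x₀) :
    ∃ f : κ.Fibre x₀ → EuclideanSpace ℝ (Fin a.1) → K, (∀ l, κ.IsTransportAt a x₀ f l) ∧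
      ∃ ξ : EuclideanSpace ℝ (Fin a.1) → C(κ.Fibre x₀, EuclideanSpace ℝ (Fin c.d)),
        (∀ᶠ y in 𝓝 (a.2 x₀), ContDiffAt ℝ ∞ ξ y) ∧ ξ (a.2 x₀) = 0 ∧
        ∀ᶠ y in 𝓝 (a.2 x₀), ∀ l h, κ.mul (c.perturb f l (y, ξ y l)) (c.perturb f h (y, ξ y h)) =
          c.perturb f (l * h) (y, ξ y (l * h)) := by
  obtain ⟨f, hf⟩ := c.exists_transport
  obtain ⟨ξ, hξ, hξ0, hc⟩ := exists_correction (c.famSmoothAt_defect hf)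
    (fun t => by rw [c.defect_zero hf, c.η_unit]) (c.fderiv_defect hf) c.Ad_mul
    (c.famSmoothAt_conjugate hf) (c.conjugate_unit hf) (c.fderiv_conjugate hf)
    c.contDiffAt_fibreMulCoord c.fibreMulCoord_zero c.fderiv_fibreMulCoord (c.defect_cocycle hf)
  refine ⟨f, hf, ξ, hξ, hξ0, ?_⟩
  have hξc : Tendsto (fun y => (y, ξ y)) (𝓝 (a.2 x₀)) (𝓝 (a.2 x₀, 0)) := by
    have := hξ.self_of_nhds.continuousAt
    rw [ContinuousAt, hξ0] at this
    exact tendsto_id.prodMk_nhds this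
  filter_upwards [hc, c.unit, hξc.eventually (eventually_forall_cochainArgs (c.defect_coord hf)),
    hξc.eventually (eventually_forall_cochainArgs (c.src_perturb_args hf))] with y h1 h2 h3 h4 l h
  let g : κ.Fibre x₀ → κ.Fibre (a.2.symm y) := fun l => ⟨c.perturb f l (y, ξ y l), (h4 l l l).1⟩
  -- A vanishing coordinate of the defect is the coordinate of the unit, by the normalization of
  -- `UnitCoordinates`.
  have hg : ((g l * g h * (g (l * h))⁻¹ : κ.Fibre (a.2.symm y)) : K) =
      ((1 : κ.Fibre (a.2.symm y)) : K) := by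
    rw [Fibre.coe_one, ← h2]
    have := h3 l h (l, h)
    rw [show c.η (c.defect f (l, h) (y, ξ y l, ξ y h, ξ y (l * h))) = 0 from h1 (l, h)] at this
    exact this.symm
  exact congrArg Subtype.val (mul_inv_eq_one.1 (Fibre.ext hg))

end UnitCoordinates

end LieGroupoid

/-! ### Positivity of means and smooth bump functions on the fibre. -/

section Mean

variable {L : Type u} [Group L] [TopologicalSpace L] [IsTopologicalGroup L] [CompactSpace L]
  {W : Type} [NormedAddCommGroup W] [NormedSpace ℝ W]

open MeasureTheory in
theorem norm_mean_le_mean {u : C(L, W)} {g : C(L, ℝ)} (h : ∀ l, ‖u l‖ ≤ g l) :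
    ‖mean L W u‖ ≤ mean L ℝ g := by
  let _ : MeasurableSpace L := borel L
  have : BorelSpace L := ⟨rfl⟩
  exact norm_integral_le_of_norm_le
    (g.continuous.integrable_of_hasCompactSupport (HasCompactSupport.of_compactSpace _))
    (Eventually.of_forall h)

open MeasureTheory in
theorem mean_pos {g : C(L, ℝ)} (h : ∀ l, 0 ≤ g l) {l : L} (hl : g l ≠ 0) : 0 < mean L ℝ g := by
  let _ : MeasurableSpace L := borel L
  have : BorelSpace L := ⟨rfl⟩
  exact g.continuous.integral_pos_of_hasCompactSupport_nonneg_nonzero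
    (HasCompactSupport.of_compactSpace _) h hl

/-- Appending constants to a continuous function. -/
noncomputable def constProd (L : Type u) [TopologicalSpace L] [CompactSpace L] (P W : Type)
    [NormedAddCommGroup P] [NormedSpace ℝ P] [NormedAddCommGroup W] [NormedSpace ℝ W] :
    P × C(L, W) →L[ℝ] C(L, P × W) :=
  LinearMap.mkContinuous
    { toFun := fun p => ⟨fun l => (p.1, p.2 l), by fun_prop⟩
      map_add' := fun p p' => by ext l <;> rfl
      map_smul' := fun r p => by ext l <;> rfl } 1 fun p => by
    rw [one_mul, ContinuousMap.norm_le _ (norm_nonneg _)]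
    intro l
    exact max_le (norm_fst_le p) ((p.2.norm_coe_le_norm l).trans (norm_snd_le p))

theorem constProd_apply {P : Type} [NormedAddCommGroup P] [NormedSpace ℝ P] (p : P × C(L, W))
    (l : L) : constProd L P W p l = (p.1, p.2 l) := rfl

end Mean

section

variable {L : Type u} [TopologicalSpace L] [CompactSpace L] {P W : Type} [NormedAddCommGroup P]
  [NormedSpace ℝ P] [NormedAddCommGroup W] [NormedSpace ℝ W]

theorem constProd_zero (p₀ : P) :
    constProd L P W (p₀, 0) = ContinuousMap.const L (p₀, 0) := by
  ext l <;> rfl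

theorem eventually_mapsTo_constProd {p₀ : P} {U : Set (P × W)} (hU : IsOpen U)
    (h0 : (p₀, 0) ∈ U) : ∀ᶠ q in 𝓝 (p₀, 0), MapsTo (constProd L P W q) univ U := by
  refine (constProd L P W).continuous.continuousAt.eventually ((isOpen_mapsTo hU).mem_nhds ?_)
  rw [constProd_zero]
  exact fun _ _ => h0

theorem eventually_forall_constProd {p₀ : P} {p : P × W → Prop} (hp : ∀ᶠ q in 𝓝 (p₀, 0), p q) :
    ∀ᶠ q : P × C(L, W) in 𝓝 (p₀, 0), ∀ l, p (q.1, q.2 l) := by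
  obtain ⟨U, hU, hUo, hU0⟩ := eventually_nhds_iff.1 hp
  filter_upwards [eventually_mapsTo_constProd hUo hU0] with q hq l
  exact hU _ (hq (x := l) trivial)

end

namespace LieGroupoid
open SmoothAtlas

variable {M : Type v} [TopologicalSpace M] {A : SmoothAtlas M}
  {K : Type u} [TopologicalSpace K] {B : SmoothAtlas K} {κ : LieGroupoid A B}
  {a : Σ n : ℕ, OpenPartialHomeomorph M (EuclideanSpace ℝ (Fin n))} {x₀ : M}

/-- A local transport frozen at the base point presents the inclusion of the fibre as a smooth
family. -/
theorem famPlotAt_coe (κ : LieGroupoid A B) (ha : a ∈ A.charts) (hxa : x₀ ∈ a.2.source) {P : Type}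
    [NormedAddCommGroup P] [NormedSpace ℝ P] (l : κ.Fibre x₀) (p : P) :
    B.FamPlotAt (fun (l : κ.Fibre x₀) (_ : P) => (l : K)) l p := by
  obtain ⟨f, hf⟩ := κ.exists_isTransportAt ha hxa l
  refine (FamPlotAt.reparam (σ := id) continuous_id (g := fun _ : P => a.2 x₀) contDiff_const
    hf.plot).congr ?_
  filter_upwards [(continuousAt_fst (p := (l, p))).eventually hf.base] with q hq
  exact hq.symm

namespace UnitCoordinates

variable (c : κ.UnitCoordinates a x₀) [hb : Fact κ.IsGroupBundle]

/-- Smooth bump functions on the fibre. -/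
theorem exists_bump (c : κ.UnitCoordinates a x₀) [T2Space K] {s : Set (κ.Fibre x₀)} (hs : s ∈ 𝓝 1) :
    ∃ φ : C(κ.Fibre x₀, ℝ), (∀ l, 0 ≤ φ l) ∧ φ 1 = 1 ∧ (∀ l, l ∉ s → ∀ᶠ l' in 𝓝 l, φ l' = 0) ∧
      ∀ l : κ.Fibre x₀, ∃ g : K → ℝ, (∀ᶠ k in 𝓝 (l : K), B.FunAt g k) ∧
        ∀ᶠ l' : κ.Fibre x₀ in 𝓝 l, φ l' = g l' := by
  have hgood : ∀ᶠ l : κ.Fibre x₀ in 𝓝 1, l ∈ s ∧ (∀ᶠ k in 𝓝 (l : K), B.FunAt c.η k) ∧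
      ∀ᶠ l' : κ.Fibre x₀ in 𝓝 l, c.param (c.η l') = l' := by
    filter_upwards [hs, tendsto_coe_one.eventually c.coord.eventually_nhds,
      c.param_η.eventually_nhds] with l h1 h2 h3
    exact ⟨h1, h2.mono fun _ h => h.1, h3⟩
  have hp := tendsto_of_plotAt c.plotAt_param.self_of_nhds
  rw [c.param_zero] at hp
  obtain ⟨r, hr, hball⟩ := Metric.eventually_nhds_iff_ball.1
    ((hp.eventually hgood).and (c.plotAt_param.and c.η_param))
  -- The outer radius `r / 2` keeps the closed ball inside the ball of radius `r`, so the image `C`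
  -- of the closed ball is compact and lies in the good region.
  let b : ContDiffBump (0 : EuclideanSpace ℝ (Fin c.d)) :=
    ⟨r / 3, r / 2, by positivity, by linarith⟩
  have hsub : Metric.closedBall (0 : EuclideanSpace ℝ (Fin c.d)) (r / 2) ⊆ Metric.ball 0 r :=
    Metric.closedBall_subset_ball (by linarith)
  set C : Set (κ.Fibre x₀) := c.param '' Metric.closedBall 0 (r / 2) with hC
  have hCc : IsClosed C := ((isCompact_closedBall _ _).image_of_continuousOn fun v hv =>
    ContinuousAt.continuousWithinAt (tendsto_of_plotAt (hball v (hsub hv)).2.1)).isClosed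
  have hCg : ∀ l ∈ C, l ∈ s ∧ (∀ᶠ k in 𝓝 (l : K), B.FunAt c.η k) ∧
      ∀ᶠ l' : κ.Fibre x₀ in 𝓝 l, c.param (c.η l') = l' := by
    rintro _ ⟨v, hv, rfl⟩
    exact (hball v (hsub hv)).1
  classical
  let φ : κ.Fibre x₀ → ℝ := fun l => if l ∈ C then b (c.η l) else 0
  have hφ0 : ∀ l ∉ C, ∀ᶠ l' in 𝓝 l, φ l' = 0 := by
    intro l hl
    filter_upwards [hCc.isOpen_compl.mem_nhds hl] with l' hl'
    exact if_neg hl'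
  -- The extension by zero agrees with `b` across the boundary of `C`: a nearby point outside `C`
  -- has coordinate outside the support of the bump.
  have hφ1 : ∀ l ∈ C, ∀ᶠ l' in 𝓝 l, φ l' = b (c.η l') := by
    intro l hl
    filter_upwards [(hCg l hl).2.2] with l' hl'
    by_cases h : l' ∈ C
    · exact if_pos h
    · refine (if_neg h).trans (b.zero_of_le_dist ?_).symm
      by_contra! hd
      exact h ⟨c.η l', hd.le, hl'⟩
  have hφg : ∀ l : κ.Fibre x₀, ∃ g : K → ℝ, (∀ᶠ k in 𝓝 (l : K), B.FunAt g k) ∧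
        ∀ᶠ l' : κ.Fibre x₀ in 𝓝 l, φ l' = g l' := by
    intro l
    by_cases hl : l ∈ C
    · refine ⟨fun k => b (c.η k), ?_, hφ1 l hl⟩
      filter_upwards [(hCg l hl).2.1] with k hk
      exact ContDiffAt.comp_funAt (φ := b) b.contDiff.contDiffAt hk
    · exact ⟨fun _ => 0, Eventually.of_forall fun _ _ _ _ => contDiffAt_const, hφ0 l hl⟩
  have hφc : Continuous φ := by
    refine continuous_iff_continuousAt.2 fun l => ?_
    obtain ⟨g, hg, hg'⟩ := hφg l
    exact (ContinuousAt.comp (g := g) (f := fun l : κ.Fibre x₀ => (l : K))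
      hg.self_of_nhds.continuousAt Fibre.continuous_coe.continuousAt).congr (EventuallyEq.symm hg')
  have h1C : (1 : κ.Fibre x₀) ∈ C := ⟨0, by simp; positivity, c.param_zero⟩
  refine ⟨⟨φ, hφc⟩, fun l => ?_, ?_, fun l hl => hφ0 l fun h => hl (hCg l h).1, hφg⟩
  · change 0 ≤ if l ∈ C then b (c.η l) else 0
    split_ifs
    exacts [b.nonneg, le_rfl]
  · refine (if_pos h1C).trans ?_
    rw [Fibre.coe_one, c.η_unit]
    exact b.one_of_mem_closedBall (by simp; positivity)

end UnitCoordinates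

end LieGroupoid

theorem FamSmoothAt.congr {Λ : Type u} [TopologicalSpace Λ] {P F : Type} [NormedAddCommGroup P]
    [NormedSpace ℝ P] [NormedAddCommGroup F] [NormedSpace ℝ F] {φ φ' : Λ → P → F} {t₀ : Λ} {p₀ : P}
    (h : FamSmoothAt φ t₀ p₀) (he : ∀ᶠ q : Λ × P in 𝓝 (t₀, p₀), φ' q.1 q.2 = φ q.1 q.2) :
    FamSmoothAt φ' t₀ p₀ := by
  obtain ⟨V, _, _, τ, ψ, h1, h2, h3⟩ := h
  refine ⟨V, inferInstance, inferInstance, τ, ψ, h1, h2, ?_⟩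
  filter_upwards [h3, he] with q q1 q2
  rw [q2, q1]

/-! ### Families of homomorphisms and the kernel of the smoothing operator. -/

namespace LieGroupoid
open SmoothAtlas

variable {M : Type v} [TopologicalSpace M] {A : SmoothAtlas M}
  {K : Type u} [TopologicalSpace K] {B : SmoothAtlas K} {κ : LieGroupoid A B}
  {a : Σ n : ℕ, OpenPartialHomeomorph M (EuclideanSpace ℝ (Fin n))} {x₀ : M}

namespace UnitCoordinates

/-- A transport of the compact fibre over `x₀` to the nearby fibres by group homomorphisms. -/
structure MultiplicativeTransport (c : κ.UnitCoordinates a x₀) [Fact κ.IsGroupBundle]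
    [CompactSpace (κ.Fibre x₀)] where
  f : κ.Fibre x₀ → EuclideanSpace ℝ (Fin a.1) → K
  ξ : EuclideanSpace ℝ (Fin a.1) → C(κ.Fibre x₀, EuclideanSpace ℝ (Fin c.d))
  isTransportAt : ∀ l, κ.IsTransportAt a x₀ f l
  contDiffAt : ∀ᶠ y in 𝓝 (a.2 x₀), ContDiffAt ℝ ∞ ξ y
  ξ_base : ξ (a.2 x₀) = 0
  map_mul : ∀ᶠ y in 𝓝 (a.2 x₀), ∀ l h,
    κ.mul (c.perturb f l (y, ξ y l)) (c.perturb f h (y, ξ y h)) = c.perturb f (l * h) (y, ξ y (l * h))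

variable (c : κ.UnitCoordinates a x₀) [hb : Fact κ.IsGroupBundle]

section Weight

variable {P : Type} [NormedAddCommGroup P] [NormedSpace ℝ P] {p₀ : P}
  {v : P → EuclideanSpace ℝ (Fin c.d)}

theorem famPlotAt_inv_param_mul (hv : ContDiff ℝ ∞ v) (hv0 : v p₀ = 0) (h : κ.Fibre x₀) :
    B.FamPlotAt (fun (h : κ.Fibre x₀) p => (((c.param (v p))⁻¹ * h : κ.Fibre x₀) : K)) h p₀ := by
  have hvt : Tendsto v (𝓝 p₀) (𝓝 0) := by
    rw [← hv0]
    exact hv.continuous.tendsto p₀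
  refine hb.out.famPlotAt_mul (φ := fun _ p => (((c.param (v p))⁻¹ : κ.Fibre x₀) : K))
    (FamPlotAt.of_plot ?_) (famPlotAt_coe κ c.mem c.mem_source h p₀)
    (Eventually.of_forall fun q => by rw [Fibre.src_coe, Fibre.src_coe])
  filter_upwards [hvt.eventually c.plotAt_param] with p hp
  exact PlotAt.comp_contDiffAt (γ := fun w => (((c.param w)⁻¹ : κ.Fibre x₀) : K)) (φ := v)
    (Fibre.plotAt_inv hp) hv.contDiffAt

theorem tendsto_inv_param_mul (hv : ContDiff ℝ ∞ v) (hv0 : v p₀ = 0) (h : κ.Fibre x₀) :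
    Tendsto (fun q : κ.Fibre x₀ × P => (c.param (v q.2))⁻¹ * q.1) (𝓝 (h, p₀)) (𝓝 h) := by
  have h1 : ContinuousAt (fun q : κ.Fibre x₀ × P => (c.param (v q.2))⁻¹ * q.1) (h, p₀) :=
    (IsInducing.continuousAt_iff (g := Subtype.val) IsInducing.subtypeVal).2
      (c.famPlotAt_inv_param_mul hv hv0 h).continuousAt
  simpa [ContinuousAt, hv0, c.param_zero] using h1

/-- The group variable enters only through the argument of the smooth bump, never through the
transport, which is not yet known to be smooth along the fibre. -/
theorem famSmoothAt_weight {φ : κ.Fibre x₀ → ℝ} (hv : ContDiff ℝ ∞ v) (hv0 : v p₀ = 0)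
    {h : κ.Fibre x₀} (hφ : ∃ g : K → ℝ, (∀ᶠ k in 𝓝 (h : K), B.FunAt g k) ∧
        ∀ᶠ l' : κ.Fibre x₀ in 𝓝 h, φ l' = g l') :
    FamSmoothAt (fun (h : κ.Fibre x₀) p => φ ((c.param (v p))⁻¹ * h)) h p₀ := by
  obtain ⟨g, hg, hg'⟩ := hφ
  refine ((c.famPlotAt_inv_param_mul hv hv0 h).comp_funAt (h := g) ?_).congr
    ((c.tendsto_inv_param_mul hv hv0 h).eventually hg')
  rwa [hv0, c.param_zero, inv_one, one_mul]

end Weight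

theorem famPlotAt_param_mul (h : κ.Fibre x₀) :
    B.FamPlotAt (fun (h : κ.Fibre x₀) w => ((c.param w * h : κ.Fibre x₀) : K)) h 0 :=
  hb.out.famPlotAt_mul (φ := fun _ w => (c.param w : K)) (FamPlotAt.of_plot c.plotAt_param)
    (famPlotAt_coe κ c.mem c.mem_source h 0)
    (Eventually.of_forall fun q => by rw [Fibre.src_coe, Fibre.src_coe])

theorem famSmoothAt_param_mul {h : κ.Fibre x₀} (hh : ∀ᶠ k in 𝓝 (h : K), B.FunAt c.η k) :
    FamSmoothAt (fun (h : κ.Fibre x₀) w => c.η ((c.param w * h : κ.Fibre x₀) : K)) h 0 :=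
  (c.famPlotAt_param_mul h).comp_funAt (by rwa [c.param_zero, one_mul])

/-- At `h = 1` the derivative is the identity, and it depends continuously on `h`. A weighted mean
of such derivatives is then injective. -/
theorem fderiv_param_mul_nhds : ∀ᶠ h : κ.Fibre x₀ in 𝓝 1,
    ‖fderiv ℝ (fun w => c.η ((c.param w * h : κ.Fibre x₀) : K)) 0 -
      ContinuousLinearMap.id ℝ _‖ < 1 / 2 := by
  have h1 := (c.famSmoothAt_param_mul (h := 1) (c.coord.mono fun _ h => h.1)).fderiv.continuousAt
  have h2 : Tendsto (fun h : κ.Fibre x₀ => (h, (0 : EuclideanSpace ℝ (Fin c.d)))) (𝓝 1)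
      (𝓝 (1, 0)) := Continuous.tendsto' (by fun_prop) _ _ rfl
  have h3 : fderiv ℝ (fun w => c.η ((c.param w * 1 : κ.Fibre x₀) : K)) 0 =
      ContinuousLinearMap.id ℝ _ := by
    have : (fun w => c.η ((c.param w * 1 : κ.Fibre x₀) : K)) =ᶠ[𝓝 0] id := by
      filter_upwards [c.η_param] with w hw
      rw [mul_one, hw, id]
    rw [this.fderiv_eq, fderiv_id]
  have h4 := ((h1.tendsto.comp h2).sub_const (ContinuousLinearMap.id ℝ _)).norm
  dsimp only at h4
  rw [h3, sub_self, norm_zero] at h4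
  exact h4.eventually (gt_mem_nhds (by norm_num))

namespace MultiplicativeTransport

variable {c} [CompactSpace (κ.Fibre x₀)] (τ : c.MultiplicativeTransport)

/-- The transport as a map of two variables. -/
noncomputable def map (l : κ.Fibre x₀) (y : EuclideanSpace ℝ (Fin a.1)) : K :=
  c.perturb τ.f l (y, τ.ξ y l)

theorem tendsto_ξ : Tendsto (fun y => (y, τ.ξ y)) (𝓝 (a.2 x₀)) (𝓝 (a.2 x₀, 0)) := by
  have := τ.contDiffAt.self_of_nhds.continuousAt
  rw [ContinuousAt, τ.ξ_base] at this
  exact tendsto_id.prodMk_nhds this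

theorem map_base (l : κ.Fibre x₀) : τ.map l (a.2 x₀) = l := by
  rw [map, τ.ξ_base, ContinuousMap.zero_apply, c.perturb_zero τ.isTransportAt]

theorem src_map : ∀ᶠ y in 𝓝 (a.2 x₀), ∀ l, κ.src (τ.map l y) = a.2.symm y := by
  filter_upwards [τ.tendsto_ξ.eventually
    (eventually_forall_constProd (c.src_perturb τ.isTransportAt))] with y hy l
  exact hy l l

theorem famPlotAt_perturb : ∀ᶠ y in 𝓝 (a.2 x₀), ∀ l,
    B.FamPlotAt (c.perturb τ.f) l (y, τ.ξ y l) := by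
  filter_upwards [τ.tendsto_ξ.eventually (eventually_forall_constProd
    (eventually_forall_of_compactSpace fun l =>
      (c.famPlotAt_perturb τ.isTransportAt l).eventually))] with y hy l
  exact hy l l

theorem plotAt_map : ∀ᶠ y in 𝓝 (a.2 x₀), ∀ l, B.PlotAt (τ.map l) univ y := by
  filter_upwards [τ.famPlotAt_perturb, τ.contDiffAt] with y h1 h2 l
  have h3 : ContDiffAt ℝ ∞ (fun y => τ.ξ y l) y :=
    (ContinuousMap.evalCLM (M := EuclideanSpace ℝ (Fin c.d)) ℝ l).contDiff.contDiffAt.comp y h2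
  exact PlotAt.comp_contDiffAt (φ := fun y => (y, τ.ξ y l)) (h1 l).plotAt
    (contDiffAt_id.prodMk h3)

/-- The correction is continuous in y with values in C(L, W), and evaluation is jointly continuous
because the fibre is compact. -/
theorem continuousAt_map : ∀ᶠ y in 𝓝 (a.2 x₀), ∀ l,
    ContinuousAt (fun q : κ.Fibre x₀ × EuclideanSpace ℝ (Fin a.1) => τ.map q.1 q.2) (l, y) := by
  filter_upwards [τ.famPlotAt_perturb, τ.contDiffAt] with y h1 h2 l
  have h3 : ContinuousAt (fun q : κ.Fibre x₀ × EuclideanSpace ℝ (Fin a.1) => τ.ξ q.2 q.1) (l, y) :=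
    ContinuousAt.comp (g := fun q : C(κ.Fibre x₀, EuclideanSpace ℝ (Fin c.d)) × κ.Fibre x₀ =>
      q.1 q.2) (f := fun q : κ.Fibre x₀ × EuclideanSpace ℝ (Fin a.1) => (τ.ξ q.2, q.1))
      continuous_eval.continuousAt
      ((h2.continuousAt.comp (x := (l, y)) continuousAt_snd).prodMk continuousAt_fst)
  exact ContinuousAt.comp (g := fun q : κ.Fibre x₀ × (EuclideanSpace ℝ (Fin a.1) ×
      EuclideanSpace ℝ (Fin c.d)) => c.perturb τ.f q.1 q.2)
    (f := fun q : κ.Fibre x₀ × EuclideanSpace ℝ (Fin a.1) => (q.1, q.2, τ.ξ q.2 q.1))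
    (h1 l).continuousAt (continuousAt_fst.prodMk (continuousAt_snd.prodMk h3))

theorem tendsto_map_param : Tendsto (fun q : EuclideanSpace ℝ (Fin c.d) ×
    EuclideanSpace ℝ (Fin a.1) => τ.map (c.param q.1) q.2) (𝓝 (0, a.2 x₀)) (𝓝 (κ.unit x₀)) := by
  have h1 := τ.continuousAt_map.self_of_nhds 1
  rw [ContinuousAt, τ.map_base, Fibre.coe_one] at h1
  have h2 := tendsto_of_plotAt c.plotAt_param.self_of_nhds
  rw [c.param_zero] at h2
  have h3 : Tendsto (fun q : EuclideanSpace ℝ (Fin c.d) × EuclideanSpace ℝ (Fin a.1) => q.1)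
    (𝓝 (0, a.2 x₀)) (𝓝 0) := continuousAt_fst
  exact h1.comp ((h2.comp h3).prodMk_nhds continuousAt_snd)

/-- The transport in coordinates. -/
noncomputable def coordMap (q : EuclideanSpace ℝ (Fin c.d) × EuclideanSpace ℝ (Fin a.1)) :
    EuclideanSpace ℝ (Fin c.d) := c.η (τ.map (c.param q.1) q.2)

theorem tendsto_coordMap : Tendsto τ.coordMap (𝓝 (0, a.2 x₀)) (𝓝 0) :=
  c.tendsto_η.comp τ.tendsto_map_param

theorem θ_coordMap : ∀ᶠ q in 𝓝 (0, a.2 x₀), c.θ (q.2, τ.coordMap q) = τ.map (c.param q.1) q.2 := by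
  have h : Tendsto (fun q : EuclideanSpace ℝ (Fin c.d) × EuclideanSpace ℝ (Fin a.1) => q.2)
    (𝓝 (0, a.2 x₀)) (𝓝 (a.2 x₀)) := continuousAt_snd
  filter_upwards [τ.tendsto_map_param.eventually c.coord, h.eventually τ.src_map,
    h.eventually (a.2.open_target.mem_nhds (a.2.map_source c.mem_source))] with q h1 h2 h3
  have := h1.2
  rwa [h2, a.2.right_inv h3] at this

/-- The integrand of the smoothing operator. -/
noncomputable def kernel (φ : κ.Fibre x₀ → ℝ) (h : κ.Fibre x₀)
    (p : (EuclideanSpace ℝ (Fin c.d) × EuclideanSpace ℝ (Fin a.1) × EuclideanSpace ℝ (Fin c.d)) ×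
      EuclideanSpace ℝ (Fin c.d)) : EuclideanSpace ℝ (Fin c.d) :=
  φ ((c.param p.1.1)⁻¹ * h) • c.η (κ.mul (c.θ p.1.2) (c.perturb τ.f h (p.1.2.1, p.2)))

/-- Away from the unit `η` need not be smooth, but there the weight vanishes identically nearby;
where it does not, `h` is in the domain of smoothness of `η`. -/
theorem famSmoothAt_kernel {φ : κ.Fibre x₀ → ℝ} {h : κ.Fibre x₀}
    (hφ : ∃ g : K → ℝ, (∀ᶠ k in 𝓝 (h : K), B.FunAt g k) ∧
        ∀ᶠ l' : κ.Fibre x₀ in 𝓝 h, φ l' = g l')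
    (hh : (∀ᶠ l' in 𝓝 h, φ l' = 0) ∨ ∀ᶠ k in 𝓝 (h : K), B.FunAt c.η k) :
    FamSmoothAt (τ.kernel φ) h ((0, a.2 x₀, 0), 0) := by
  rcases hh with hh | hh
  · refine (FamSmoothAt.of_contDiff (g := fun _ => 0) contDiff_const).congr ?_
    filter_upwards [(c.tendsto_inv_param_mul (v := fun p : (EuclideanSpace ℝ (Fin c.d) ×
      EuclideanSpace ℝ (Fin a.1) × EuclideanSpace ℝ (Fin c.d)) × EuclideanSpace ℝ (Fin c.d) =>
        p.1.1) (p₀ := ((0, a.2 x₀, 0), 0)) (by fun_prop) rfl h).eventually hh] with q hq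
    rw [kernel, hq, zero_smul]
  · have h1 : B.FamPlotAt (fun h (p : (EuclideanSpace ℝ (Fin c.d) × EuclideanSpace ℝ (Fin a.1) ×
        EuclideanSpace ℝ (Fin c.d)) × EuclideanSpace ℝ (Fin c.d)) =>
          c.perturb τ.f h (p.1.2.1, p.2)) h ((0, a.2 x₀, 0), 0) :=
      FamPlotAt.reparam (σ := id) continuous_id (g := fun p : (EuclideanSpace ℝ (Fin c.d) ×
        EuclideanSpace ℝ (Fin a.1) × EuclideanSpace ℝ (Fin c.d)) × EuclideanSpace ℝ (Fin c.d) =>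
          (p.1.2.1, p.2)) (by fun_prop) (c.famPlotAt_perturb τ.isTransportAt h)
    have h2 : B.FamPlotAt (fun (_ : κ.Fibre x₀) (p : (EuclideanSpace ℝ (Fin c.d) ×
        EuclideanSpace ℝ (Fin a.1) × EuclideanSpace ℝ (Fin c.d)) × EuclideanSpace ℝ (Fin c.d)) =>
          c.θ p.1.2) h ((0, a.2 x₀, 0), 0) :=
      FamPlotAt.reparam (φ := fun _ p => c.θ p) (σ := id) continuous_id
        (g := fun p : (EuclideanSpace ℝ (Fin c.d) × EuclideanSpace ℝ (Fin a.1) ×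
          EuclideanSpace ℝ (Fin c.d)) × EuclideanSpace ℝ (Fin c.d) => p.1.2) (by fun_prop)
        (FamPlotAt.of_plot (c.plot.mono fun _ h => h.1))
    have h3 := hb.out.famPlotAt_mul h2 h1 (by
      have e1 : Tendsto (fun q : κ.Fibre x₀ × ((EuclideanSpace ℝ (Fin c.d) ×
        EuclideanSpace ℝ (Fin a.1) × EuclideanSpace ℝ (Fin c.d)) × EuclideanSpace ℝ (Fin c.d)) =>
          q.2.1.2) (𝓝 (h, ((0, a.2 x₀, 0), 0))) (𝓝 (a.2 x₀, 0)) :=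
        Continuous.tendsto' (by fun_prop) _ _ rfl
      have e2 : Tendsto (fun q : κ.Fibre x₀ × ((EuclideanSpace ℝ (Fin c.d) ×
        EuclideanSpace ℝ (Fin a.1) × EuclideanSpace ℝ (Fin c.d)) × EuclideanSpace ℝ (Fin c.d)) =>
          (q.2.1.2.1, q.2.2)) (𝓝 (h, ((0, a.2 x₀, 0), 0))) (𝓝 (a.2 x₀, 0)) :=
        Continuous.tendsto' (by fun_prop) _ _ rfl
      filter_upwards [e1.eventually c.plot, e2.eventually (c.src_perturb τ.isTransportAt)]
        with q q1 q2
      rw [q1.2.1, q2])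
    have h4 := h3.comp_funAt (h := c.η) (by
      dsimp only
      rw [c.θ_base, c.perturb_zero τ.isTransportAt, ← Fibre.coe_one, ← Fibre.coe_mul, one_mul]
      exact hh)
    exact FamSmoothAt.comp (g := fun p : ℝ × EuclideanSpace ℝ (Fin c.d) => p.1 • p.2)
      (contDiff_fst.smul contDiff_snd)
      ((c.famSmoothAt_weight (v := fun p : (EuclideanSpace ℝ (Fin c.d) ×
        EuclideanSpace ℝ (Fin a.1) × EuclideanSpace ℝ (Fin c.d)) × EuclideanSpace ℝ (Fin c.d) =>
        p.1.1) (by fun_prop) rfl hφ).prodMk h4)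

end MultiplicativeTransport

theorem nonempty_multiplicativeTransport [CompactSpace (κ.Fibre x₀)] [T2Space K] :
    Nonempty c.MultiplicativeTransport := by
  obtain ⟨f, hf, ξ, hξ, hξ0, hm⟩ := c.exists_multiplicative_transport
  exact ⟨⟨f, ξ, hf, hξ, hξ0, hm⟩⟩

end UnitCoordinates

end LieGroupoid

/-! ### Haar smoothing: joint smoothness of the transport near the unit. -/

namespace LieGroupoid
open SmoothAtlas

variable {M : Type v} [TopologicalSpace M] {A : SmoothAtlas M}
  {K : Type u} [TopologicalSpace K] {B : SmoothAtlas K} {κ : LieGroupoid A B}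
  {a : Σ n : ℕ, OpenPartialHomeomorph M (EuclideanSpace ℝ (Fin n))} {x₀ : M}

namespace UnitCoordinates
namespace MultiplicativeTransport

variable {c : κ.UnitCoordinates a x₀} [hb : Fact κ.IsGroupBundle] [CompactSpace (κ.Fibre x₀)]
  (τ : c.MultiplicativeTransport)

/-- The smoothing operator, before the substitution of the correction `τ.ξ`. -/
noncomputable def preSmoothing (φ : κ.Fibre x₀ → ℝ)
    (p : (EuclideanSpace ℝ (Fin c.d) × EuclideanSpace ℝ (Fin a.1) × EuclideanSpace ℝ (Fin c.d)) ×
      C(κ.Fibre x₀, EuclideanSpace ℝ (Fin c.d))) : EuclideanSpace ℝ (Fin c.d) :=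
  mean _ _ (superposition (τ.kernel φ) (constProd _ _ _ p))

/-- The average over `h` of the coordinates of the products with `τ.map h y`. -/
noncomputable def smoothing (φ : κ.Fibre x₀ → ℝ)
    (q : EuclideanSpace ℝ (Fin c.d) × EuclideanSpace ℝ (Fin a.1) × EuclideanSpace ℝ (Fin c.d)) :
    EuclideanSpace ℝ (Fin c.d) :=
  τ.preSmoothing φ (q, τ.ξ q.2.1)

variable {φ : C(κ.Fibre x₀, ℝ)}

/-- The mean is linear and superposition is smooth. The correction is an independent variable in the
Banach space C(L, W), to be replaced later by the smooth map `τ.ξ`. -/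
theorem contDiffAt_preSmoothing (hφ : ∀ h, FamSmoothAt (τ.kernel φ) h ((0, a.2 x₀, 0), 0)) :
    ∀ᶠ p in 𝓝 ((0, a.2 x₀, 0), 0), ContDiffAt ℝ ∞ (τ.preSmoothing φ) p := by
  obtain ⟨U, hU, hUo, hU0⟩ := eventually_nhds_iff.1
    (eventually_forall_of_compactSpace fun h => (hφ h).eventually)
  filter_upwards [eventually_mapsTo_constProd hUo hU0] with p hp
  exact (mean _ _).contDiff.contDiffAt.comp p (((contDiffOn_superposition hUo
    fun t p hp => hU p hp t).contDiffAt ((isOpen_mapsTo hUo).mem_nhds hp)).comp p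
      (constProd (κ.Fibre x₀) (EuclideanSpace ℝ (Fin c.d) ×
      EuclideanSpace ℝ (Fin a.1) × EuclideanSpace ℝ (Fin c.d)) (EuclideanSpace ℝ (Fin c.d))).contDiff.contDiffAt)

theorem tendsto_smoothing_args : Tendsto (fun q : EuclideanSpace ℝ (Fin c.d) ×
    EuclideanSpace ℝ (Fin a.1) × EuclideanSpace ℝ (Fin c.d) => (q, τ.ξ q.2.1)) (𝓝 (0, a.2 x₀, 0))
      (𝓝 ((0, a.2 x₀, 0), 0)) := by
  have h : Tendsto (fun q : EuclideanSpace ℝ (Fin c.d) ×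
    EuclideanSpace ℝ (Fin a.1) × EuclideanSpace ℝ (Fin c.d) => q.2.1) (𝓝 (0, a.2 x₀, 0))
      (𝓝 (a.2 x₀)) := Continuous.tendsto' (by fun_prop) _ _ rfl
  exact tendsto_id.prodMk_nhds ((continuous_snd.tendsto _).comp (τ.tendsto_ξ.comp h))

theorem contDiffAt_smoothing (hφ : ∀ h, FamSmoothAt (τ.kernel φ) h ((0, a.2 x₀, 0), 0)) :
    ∀ᶠ q in 𝓝 (0, a.2 x₀, 0), ContDiffAt ℝ ∞ (τ.smoothing φ) q := by
  have h : Tendsto (fun q : EuclideanSpace ℝ (Fin c.d) ×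
    EuclideanSpace ℝ (Fin a.1) × EuclideanSpace ℝ (Fin c.d) => q.2.1) (𝓝 (0, a.2 x₀, 0))
      (𝓝 (a.2 x₀)) := Continuous.tendsto' (by fun_prop) _ _ rfl
  filter_upwards [τ.tendsto_smoothing_args.eventually (τ.contDiffAt_preSmoothing hφ),
    h.eventually τ.contDiffAt] with q h1 h2
  exact h1.comp q (f := fun q : EuclideanSpace ℝ (Fin c.d) × EuclideanSpace ℝ (Fin a.1) ×
    EuclideanSpace ℝ (Fin c.d) => (q, τ.ξ q.2.1)) (contDiffAt_id.prodMk
      (h2.comp q (f := fun q : EuclideanSpace ℝ (Fin c.d) × EuclideanSpace ℝ (Fin a.1) ×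
        EuclideanSpace ℝ (Fin c.d) => q.2.1) (by fun_prop)))

/-- Left invariance of the mean. -/
theorem smoothing_coordMap (hφ : ∀ h, FamSmoothAt (τ.kernel φ) h ((0, a.2 x₀, 0), 0)) :
    ∀ᶠ q in 𝓝 (0, a.2 x₀),
      τ.smoothing φ (0, q.2, τ.coordMap q) = τ.smoothing φ (q.1, q.2, 0) := by
  obtain ⟨U, hU, hUo, hU0⟩ := eventually_nhds_iff.1
    (eventually_forall_of_compactSpace fun h => (hφ h).eventually)
  have hU' : ∀ t, ∀ p ∈ U, FamSmoothAt (τ.kernel φ) t p := fun t p hp => hU p hp t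
  have h1 : Tendsto (fun q : EuclideanSpace ℝ (Fin c.d) × EuclideanSpace ℝ (Fin a.1) => q.2)
    (𝓝 (0, a.2 x₀)) (𝓝 (a.2 x₀)) := continuousAt_snd
  have h2 : Tendsto (fun q : EuclideanSpace ℝ (Fin c.d) × EuclideanSpace ℝ (Fin a.1) =>
      (q.1, q.2, (0 : EuclideanSpace ℝ (Fin c.d)))) (𝓝 (0, a.2 x₀)) (𝓝 (0, a.2 x₀, 0)) :=
    Continuous.tendsto' (by fun_prop) _ _ rfl
  have h3 : Tendsto (fun q : EuclideanSpace ℝ (Fin c.d) × EuclideanSpace ℝ (Fin a.1) =>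
      ((0 : EuclideanSpace ℝ (Fin c.d)), q.2, τ.coordMap q)) (𝓝 (0, a.2 x₀))
        (𝓝 (0, a.2 x₀, 0)) := tendsto_const_nhds.prodMk_nhds (h1.prodMk_nhds τ.tendsto_coordMap)
  have h4 := τ.tendsto_smoothing_args.eventually (eventually_mapsTo_constProd hUo hU0)
  filter_upwards [h2.eventually h4, h3.eventually h4, h1.eventually τ.map_mul, h1.eventually c.unit,
    h1.eventually τ.src_map, τ.θ_coordMap] with q m1 m2 hm hu hs hθ
  -- The substitution of `c.param q.1 * h` for `h` cancels the shift in the bump, and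
  -- multiplicativity splits the transport of the product; its first factor has coordinate `coordMap
  -- q`.
  rw [smoothing, preSmoothing, smoothing, preSmoothing,
    ← mean_comp_mul_left (superposition (τ.kernel φ) (constProd _ _ _ ((q.1, q.2, 0), τ.ξ q.2)))
      (c.param q.1)]
  congr 1
  ext1 h
  rw [ContinuousMap.comp_apply, superposition_apply hU' m1, superposition_apply hU' m2]
  have e1 := κ.unit_mul (τ.map (c.param q.1 * h) q.2)
  rw [hb.out.tgt_eq, hs] at e1
  simp only [kernel, constProd_apply, c.param_zero, inv_one, one_mul, ContinuousMap.coe_mk,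
    _root_.inv_mul_cancel_left, hθ, hu]
  congr 2
  exact (hm _ _).trans e1.symm

theorem fderiv_kernel {h : κ.Fibre x₀} (hφ : FamSmoothAt (τ.kernel φ) h ((0, a.2 x₀, 0), 0))
    (hh : ∀ᶠ k in 𝓝 (h : K), B.FunAt c.η k) (w : EuclideanSpace ℝ (Fin c.d)) :
    fderiv ℝ (τ.kernel φ h) ((0, a.2 x₀, 0), 0) ((0, 0, w), 0) =
      φ h • fderiv ℝ (fun w => c.η ((c.param w * h : κ.Fibre x₀) : K)) 0 w := by
  have h1 := fderiv_apply_of_eventuallyEq (hφ.contDiffAt.differentiableAt (by simp))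
    (((0 : _ →L[ℝ] _).prod ((0 : _ →L[ℝ] _).prod (ContinuousLinearMap.id ℝ _))).prod 0)
    (g' := fun w => φ h • c.η ((c.param w * h : κ.Fibre x₀) : K)) (by
      filter_upwards [c.coe_param] with w hw
      simp only [kernel, ContinuousLinearMap.prod_apply, ContinuousLinearMap.id_apply,
        _root_.zero_apply, Prod.mk_add_mk, add_zero, zero_add, c.param_zero, inv_one, one_mul,
        c.perturb_zero τ.isTransportAt, ← hw]
      rfl) w
  refine h1.trans ?_
  rw [fderiv_fun_const_smul ((c.famSmoothAt_param_mul hh).contDiffAt.differentiableAt (by simp))]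
  rfl

/-- The derivative is the φ-weighted mean of operators within 1/2 of the identity. If it kills `w`,
then the positive mean of φ times the norm of `w` is at most half of itself. -/
theorem fderiv_smoothing_injective (hφ : ∀ h, FamSmoothAt (τ.kernel φ) h ((0, a.2 x₀, 0), 0))
    (hφ0 : ∀ h, 0 ≤ φ h) (hφ1 : φ 1 = 1)
    (hφs : ∀ h, φ h ≠ 0 → (∀ᶠ k in 𝓝 (h : K), B.FunAt c.η k) ∧
      ‖fderiv ℝ (fun w => c.η ((c.param w * h : κ.Fibre x₀) : K)) 0 -
        ContinuousLinearMap.id ℝ _‖ ≤ 1 / 2)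
    {w : EuclideanSpace ℝ (Fin c.d)}
    (hφz : ∀ h, φ h = 0 → fderiv ℝ (τ.kernel φ h) ((0, a.2 x₀, 0), 0) ((0, 0, w), 0) = 0)
    (hw : fderiv ℝ (τ.preSmoothing φ) ((0, a.2 x₀, 0), 0) ((0, 0, w), 0) = 0) : w = 0 := by
  obtain ⟨U, hU, hUo, hU0⟩ := eventually_nhds_iff.1
    (eventually_forall_of_compactSpace fun h => (hφ h).eventually)
  have hU' : ∀ t, ∀ p ∈ U, FamSmoothAt (τ.kernel φ) t p := fun t p hp => hU p hp t
  have hm : MapsTo (constProd (κ.Fibre x₀) _ (EuclideanSpace ℝ (Fin c.d))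
      (((0 : EuclideanSpace ℝ (Fin c.d)), a.2 x₀, (0 : EuclideanSpace ℝ (Fin c.d))), 0)) univ U := by
    rw [constProd_zero]
    exact fun _ _ => hU0
  have h1 := ((mean (κ.Fibre x₀) (EuclideanSpace ℝ (Fin c.d))).hasFDerivAt.comp _
    ((hasFDerivAt_superposition hUo hU' hm).comp _ (constProd (κ.Fibre x₀) (EuclideanSpace ℝ (Fin c.d) ×
      EuclideanSpace ℝ (Fin a.1) × EuclideanSpace ℝ (Fin c.d)) (EuclideanSpace ℝ (Fin c.d))).hasFDerivAt)).fderiv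
  have h2 : fderiv ℝ (τ.preSmoothing φ) ((0, a.2 x₀, 0), 0) = _ := h1
  rw [h2] at hw
  set G : C(κ.Fibre x₀, EuclideanSpace ℝ (Fin c.d)) := pointwiseApply (κ.Fibre x₀) _ _
    (superposition (fun t p => fderiv ℝ (τ.kernel φ t) p) (constProd (κ.Fibre x₀) _ _
      (((0 : EuclideanSpace ℝ (Fin c.d)), a.2 x₀, (0 : EuclideanSpace ℝ (Fin c.d))), 0)))
      (constProd (κ.Fibre x₀) _ _ (((0, 0, w), 0))) with hG
  have hG0 : mean _ _ G = 0 := hw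
  have hGh : ∀ h, G h = fderiv ℝ (τ.kernel φ h) ((0, a.2 x₀, 0), 0) ((0, 0, w), 0) := by
    intro h
    rw [hG, pointwiseApply_apply,
      superposition_apply (U := U) (fun t p hp => (hU' t p hp).fderiv) hm]
    rfl
  have h3 : ∀ h, ‖((((ContinuousLinearMap.toSpanSingleton ℝ w : ℝ →L[ℝ] _) :
      C(ℝ, EuclideanSpace ℝ (Fin c.d))).comp φ) - G) h‖ ≤
        (((ContinuousLinearMap.toSpanSingleton ℝ (‖w‖ / 2) : ℝ →L[ℝ] ℝ) : C(ℝ, ℝ)).comp φ) h := by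
    intro h
    change ‖φ h • w - G h‖ ≤ φ h • (‖w‖ / 2)
    by_cases h0 : φ h = 0
    · rw [hGh, hφz h h0, h0]
      simp
    · have hs := hφs h h0
      rw [hGh, τ.fderiv_kernel (hφ h) hs.1, ← smul_sub, norm_smul, Real.norm_of_nonneg (hφ0 h),
        smul_eq_mul]
      refine mul_le_mul_of_nonneg_left ?_ (hφ0 h)
      rw [norm_sub_rev]
      have := ((fderiv ℝ (fun w => c.η ((c.param w * h : κ.Fibre x₀) : K)) 0 -
        ContinuousLinearMap.id ℝ _).le_opNorm w).trans
          (mul_le_mul_of_nonneg_right hs.2 (norm_nonneg w))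
      rw [_root_.sub_apply, ContinuousLinearMap.id_apply] at this
      linarith
  have h4 := norm_mean_le_mean h3
  rw [map_sub, hG0, sub_zero, mean_comp_clm, mean_comp_clm] at h4
  have hpos : 0 < mean (κ.Fibre x₀) ℝ φ := mean_pos hφ0 (l := 1) (by rw [hφ1]; exact one_ne_zero)
  simp only [ContinuousLinearMap.toSpanSingleton_apply, norm_smul, Real.norm_of_nonneg hpos.le,
    smul_eq_mul] at h4
  have h5 := le_of_mul_le_mul_left h4 hpos
  exact norm_le_zero_iff.1 (by linarith)

/-- By `smoothing_coordMap`, the coordinate of the transport solves an equation F(0, y, w) = F(v, y,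
0) with `F` smooth and invertible in `w`. This upgrades continuity along the fibre to smoothness, as
for continuous homomorphisms of Lie groups. -/
theorem contDiffAt_coordMap [T2Space K] :
    ∀ᶠ q in 𝓝 (0, a.2 x₀), ContDiffAt ℝ ∞ τ.coordMap q := by
  have hs : {h : κ.Fibre x₀ | (∀ᶠ k in 𝓝 (h : K), B.FunAt c.η k) ∧
      ‖fderiv ℝ (fun w => c.η ((c.param w * h : κ.Fibre x₀) : K)) 0 -
        ContinuousLinearMap.id ℝ _‖ < 1 / 2} ∈ 𝓝 1 := by
    filter_upwards [tendsto_coe_one.eventually c.coord.eventually_nhds, c.fderiv_param_mul_nhds]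
      with h h1 h2
    exact ⟨h1.mono fun _ h => h.1, h2⟩
  obtain ⟨φ, hφ0, hφ1, hφs, hφg⟩ := c.exists_bump hs
  have hφ : ∀ h, FamSmoothAt (τ.kernel φ) h ((0, a.2 x₀, 0), 0) := by
    intro h
    refine τ.famSmoothAt_kernel (hφg h) ?_
    by_cases h1 : h ∈ {h : κ.Fibre x₀ | (∀ᶠ k in 𝓝 (h : K), B.FunAt c.η k) ∧
      ‖fderiv ℝ (fun w => c.η ((c.param w * h : κ.Fibre x₀) : K)) 0 -
        ContinuousLinearMap.id ℝ _‖ < 1 / 2}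
    · exact Or.inr h1.1
    · exact Or.inl (hφs h h1)
  -- A zero of φ may still lie in the region where `η` is smooth, and then the derivative formula
  -- applies; otherwise the kernel vanishes near the base point.
  have hφz : ∀ w h, φ h = 0 →
      fderiv ℝ (τ.kernel φ h) ((0, a.2 x₀, 0), 0) ((0, 0, w), 0) = 0 := by
    intro w h h0
    by_cases h1 : h ∈ {h : κ.Fibre x₀ | (∀ᶠ k in 𝓝 (h : K), B.FunAt c.η k) ∧
      ‖fderiv ℝ (fun w => c.η ((c.param w * h : κ.Fibre x₀) : K)) 0 -
        ContinuousLinearMap.id ℝ _‖ < 1 / 2}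
    · rw [τ.fderiv_kernel (hφ h) h1.1, h0, zero_smul]
    · have h2 : Tendsto (fun p : (EuclideanSpace ℝ (Fin c.d) × EuclideanSpace ℝ (Fin a.1) ×
          EuclideanSpace ℝ (Fin c.d)) × EuclideanSpace ℝ (Fin c.d) => (h, p))
          (𝓝 ((0, a.2 x₀, 0), 0)) (𝓝 (h, ((0, a.2 x₀, 0), 0))) :=
        Continuous.tendsto' (by fun_prop) _ _ rfl
      have h3 : τ.kernel φ h =ᶠ[𝓝 ((0, a.2 x₀, 0), 0)] fun _ => 0 := by
        filter_upwards [h2.eventually ((c.tendsto_inv_param_mul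
          (v := fun p : (EuclideanSpace ℝ (Fin c.d) × EuclideanSpace ℝ (Fin a.1) ×
            EuclideanSpace ℝ (Fin c.d)) × EuclideanSpace ℝ (Fin c.d) => p.1.1)
          (p₀ := ((0, a.2 x₀, 0), 0)) (by fun_prop) rfl h).eventually (hφs h h1))] with p hp
        rw [kernel, hp, zero_smul]
      rw [h3.fderiv_eq]
      simp
  set J : EuclideanSpace ℝ (Fin a.1) × EuclideanSpace ℝ (Fin c.d) → EuclideanSpace ℝ (Fin c.d) :=
    fun p => τ.smoothing φ (0, p) with hJ
  have hJs : ∀ᶠ p in 𝓝 (a.2 x₀, 0), ContDiffAt ℝ ∞ J p := by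
    have h1 : Tendsto (fun p : EuclideanSpace ℝ (Fin a.1) × EuclideanSpace ℝ (Fin c.d) =>
      ((0 : EuclideanSpace ℝ (Fin c.d)), p)) (𝓝 (a.2 x₀, 0)) (𝓝 (0, a.2 x₀, 0)) :=
      Continuous.tendsto' (by fun_prop) _ _ rfl
    filter_upwards [h1.eventually (τ.contDiffAt_smoothing hφ)] with p hp
    exact hp.comp p (f := fun p : EuclideanSpace ℝ (Fin a.1) × EuclideanSpace ℝ (Fin c.d) =>
      ((0 : EuclideanSpace ℝ (Fin c.d)), p)) (by fun_prop)
  have hJd := (hJs.self_of_nhds.differentiableAt (by simp)).hasFDerivAt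
  set D : EuclideanSpace ℝ (Fin c.d) →L[ℝ] EuclideanSpace ℝ (Fin c.d) :=
    (fderiv ℝ J (a.2 x₀, 0)).comp (ContinuousLinearMap.inr ℝ _ _) with hD
  have hDinj : Function.Injective D := by
    rw [injective_iff_map_eq_zero]
    intro w hw
    refine τ.fderiv_smoothing_injective hφ hφ0 hφ1 (fun h h0 => ?_) (hφz w) ?_
    · by_contra h1
      exact h0 (hφs h (fun h2 => h1 ⟨h2.1, h2.2.le⟩)).self_of_nhds
    · have e1 := fderiv_apply_of_eventuallyEq
        ((τ.contDiffAt_preSmoothing hφ).self_of_nhds.differentiableAt (by simp))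
        (((0 : _ →L[ℝ] _).prod ((0 : _ →L[ℝ] _).prod
          (ContinuousLinearMap.id ℝ (EuclideanSpace ℝ (Fin c.d))))).prod 0)
        (g' := fun w => J (a.2 x₀, w)) (Eventually.of_forall fun w => by
          simp [hJ, smoothing, τ.ξ_base]) w
      have e2 := fderiv_apply_of_eventuallyEq (hJs.self_of_nhds.differentiableAt (by simp))
        (ContinuousLinearMap.inr ℝ _ _) (g' := fun w => J (a.2 x₀, w))
        (Eventually.of_forall fun w => by simp) w
      exact e1.trans (e2.symm.trans hw)
  set D' : EuclideanSpace ℝ (Fin c.d) ≃L[ℝ] EuclideanSpace ℝ (Fin c.d) :=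
    (LinearEquiv.ofInjectiveEndo D.toLinearMap hDinj).toContinuousLinearEquiv with hD'
  set Q' : (EuclideanSpace ℝ (Fin a.1) × EuclideanSpace ℝ (Fin c.d)) ≃L[ℝ]
      (EuclideanSpace ℝ (Fin a.1) × EuclideanSpace ℝ (Fin c.d)) :=
    ContinuousLinearEquiv.skewProd (ContinuousLinearEquiv.refl ℝ _) D'
      ((fderiv ℝ J (a.2 x₀, 0)).comp (ContinuousLinearMap.inl ℝ _ _)) with hQ'
  have hQd : HasFDerivAt (fun p : EuclideanSpace ℝ (Fin a.1) × EuclideanSpace ℝ (Fin c.d) =>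
      (p.1, J p)) (Q' : _ →L[ℝ] EuclideanSpace ℝ (Fin a.1) × EuclideanSpace ℝ (Fin c.d))
        (a.2 x₀, 0) := by
    refine (hasFDerivAt_fst.prodMk hJd).congr_fderiv (ContinuousLinearMap.ext fun p => ?_)
    refine Prod.ext rfl ?_
    change fderiv ℝ J (a.2 x₀, 0) p = D p.2 + fderiv ℝ J (a.2 x₀, 0) (p.1, 0)
    rw [hD, ContinuousLinearMap.comp_apply, ← map_add]
    simp
  obtain ⟨R, hR1, hR2⟩ := exists_smooth_localInverse
    (hJs.mono fun p hp => contDiffAt_fst.prodMk hp) Q' hQd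
  have h1 : Tendsto (fun q : EuclideanSpace ℝ (Fin c.d) × EuclideanSpace ℝ (Fin a.1) =>
      (q.2, τ.coordMap q)) (𝓝 (0, a.2 x₀)) (𝓝 (a.2 x₀, 0)) :=
    Tendsto.prodMk_nhds continuousAt_snd τ.tendsto_coordMap
  have h2 : Tendsto (fun q : EuclideanSpace ℝ (Fin c.d) × EuclideanSpace ℝ (Fin a.1) =>
      (q.1, q.2, (0 : EuclideanSpace ℝ (Fin c.d)))) (𝓝 (0, a.2 x₀)) (𝓝 (0, a.2 x₀, 0)) :=
    Continuous.tendsto' (by fun_prop) _ _ rfl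
  have h3 : Tendsto (fun q : EuclideanSpace ℝ (Fin c.d) × EuclideanSpace ℝ (Fin a.1) =>
      (q.2, τ.smoothing φ (q.1, q.2, 0))) (𝓝 (0, a.2 x₀)) (𝓝 (a.2 x₀, J (a.2 x₀, 0))) :=
    Tendsto.prodMk_nhds continuousAt_snd
      ((τ.contDiffAt_smoothing hφ).self_of_nhds.continuousAt.tendsto.comp h2)
  -- `R` inverts the map (y, w) ↦ (y, J(y, w)), so the right side expresses the transport through
  -- smooth maps only.
  have h4 : τ.coordMap =ᶠ[𝓝 (0, a.2 x₀)] fun q => (R (q.2, τ.smoothing φ (q.1, q.2, 0))).2 := by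
    filter_upwards [τ.smoothing_coordMap hφ, h1.eventually hR2] with q q1 q2
    rw [← q1]
    exact (congrArg Prod.snd q2).symm
  filter_upwards [h4.eventually_nhds, h3.eventually hR1,
    h2.eventually (τ.contDiffAt_smoothing hφ)] with q q1 q2 q3
  refine ContDiffAt.congr_of_eventuallyEq ?_ q1
  refine contDiffAt_snd.comp q (q2.1.comp q (f := fun q : EuclideanSpace ℝ (Fin c.d) ×
    EuclideanSpace ℝ (Fin a.1) => (q.2, τ.smoothing φ (q.1, q.2, 0))) (contDiffAt_snd.prodMk
      (q3.comp q (f := fun q : EuclideanSpace ℝ (Fin c.d) × EuclideanSpace ℝ (Fin a.1) =>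
        (q.1, q.2, (0 : EuclideanSpace ℝ (Fin c.d)))) (by fun_prop))))

end MultiplicativeTransport
end UnitCoordinates

end LieGroupoid

/-! ### The transport is a local diffeomorphism and injective on the fibre. -/

namespace LieGroupoid
open SmoothAtlas

variable {M : Type v} [TopologicalSpace M] {A : SmoothAtlas M}
  {K : Type u} [TopologicalSpace K] {B : SmoothAtlas K} {κ : LieGroupoid A B}
  {a : Σ n : ℕ, OpenPartialHomeomorph M (EuclideanSpace ℝ (Fin n))} {x₀ : M}

namespace UnitCoordinates
namespace MultiplicativeTransport

variable {c : κ.UnitCoordinates a x₀} [hb : Fact κ.IsGroupBundle] [CompactSpace (κ.Fibre x₀)]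
  (τ : c.MultiplicativeTransport)

/-- The points to which the fibre over `x₀` is transported by group homomorphisms. -/
def IsGood (y : EuclideanSpace ℝ (Fin a.1)) : Prop :=
  (∀ l, κ.src (τ.map l y) = a.2.symm y) ∧
    ∀ l h, κ.mul (τ.map l y) (τ.map h y) = τ.map (l * h) y

theorem eventually_isGood : ∀ᶠ y in 𝓝 (a.2 x₀), τ.IsGood y := by
  filter_upwards [τ.src_map, τ.map_mul] with y h1 h2
  exact ⟨h1, h2⟩

variable {τ} in
/-- The transport as a homomorphism between fibres. -/
noncomputable def IsGood.hom {y : EuclideanSpace ℝ (Fin a.1)} (h : τ.IsGood y) :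
    κ.Fibre x₀ →* κ.Fibre (a.2.symm y) :=
  MonoidHom.mk' (fun l => ⟨τ.map l y, h.1 l⟩) fun l l' => Fibre.ext (h.2 l l').symm

variable {τ} in
theorem IsGood.map_one {y : EuclideanSpace ℝ (Fin a.1)} (h : τ.IsGood y) :
    τ.map 1 y = κ.unit (a.2.symm y) :=
  congrArg Subtype.val (_root_.map_one h.hom)

/-- Write γ(e) as γ(p) times a factor close to the unit. The transport of γ(p) is smooth in the base
point, that of the small factor by `contDiffAt_coordMap`, and multiplicativity joins them. -/
theorem isTransport_smooth [T2Space K] : ∀ᶠ y in 𝓝 (a.2 x₀), ∀ (E : Type) [NormedAddCommGroup E]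
    [NormedSpace ℝ E] (γ : E → κ.Fibre x₀) (δ : E → EuclideanSpace ℝ (Fin a.1)) (p : E),
    B.PlotAt (fun e => (γ e : K)) univ p → ContDiffAt ℝ ∞ δ p → δ p = y →
      B.PlotAt (fun e => τ.map (γ e) (δ e)) univ p := by
  have h1 : Tendsto (fun y => ((0 : EuclideanSpace ℝ (Fin c.d)), y)) (𝓝 (a.2 x₀))
    (𝓝 (0, a.2 x₀)) := Continuous.tendsto' (by fun_prop) _ _ rfl
  have h2 : Tendsto (fun y => (y, (0 : EuclideanSpace ℝ (Fin c.d)))) (𝓝 (a.2 x₀))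
    (𝓝 (a.2 x₀, 0)) := Continuous.tendsto' (by fun_prop) _ _ rfl
  filter_upwards [h1.eventually τ.contDiffAt_coordMap, h1.eventually τ.θ_coordMap.eventually_nhds,
    h2.eventually c.plot, τ.eventually_isGood.eventually_nhds, τ.plotAt_map, c.η_unit_nhds]
    with y e1 e2 e3 e4 e5 e6 E _ _ γ δ p hγ hδ hy
  subst hy
  have hd : B.PlotAt (fun e => (((γ p)⁻¹ * γ e : κ.Fibre x₀) : K)) univ p :=
    Fibre.plotAt_mul (plotAt_const _ _ _) hγ
  have hv : ContDiffAt ℝ ∞ (fun e => c.η (((γ p)⁻¹ * γ e : κ.Fibre x₀) : K)) p :=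
    c.contDiffAt_η hd (by simp)
  have hdt := tendsto_of_plotAt hd
  rw [inv_mul_cancel] at hdt
  have hvp : c.η (((γ p)⁻¹ * γ p : κ.Fibre x₀) : K) = 0 := by
    rw [inv_mul_cancel, Fibre.coe_one, c.η_unit]
  have hq : ContDiffAt ℝ ∞ (fun e => (c.η (((γ p)⁻¹ * γ e : κ.Fibre x₀) : K), δ e)) p :=
    hv.prodMk hδ
  have hqt : Tendsto (fun e => (c.η (((γ p)⁻¹ * γ e : κ.Fibre x₀) : K), δ e)) (𝓝 p)
      (𝓝 (0, δ p)) := by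
    rw [← hvp]
    exact hq.continuousAt
  have h0 : τ.coordMap (0, δ p) = 0 := by
    rw [coordMap, c.param_zero, e4.self_of_nhds.map_one, e6]
  have hP : B.PlotAt (fun e => c.θ (δ e,
      τ.coordMap (c.η (((γ p)⁻¹ * γ e : κ.Fibre x₀) : K), δ e))) univ p := by
    refine PlotAt.comp_contDiffAt (γ := c.θ) (φ := fun e => (δ e,
      τ.coordMap (c.η (((γ p)⁻¹ * γ e : κ.Fibre x₀) : K), δ e))) ?_ (hδ.prodMk ?_)
    · rw [hvp, h0]
      exact e3.1
    · refine ContDiffAt.comp p (g := τ.coordMap) ?_ hq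
      rw [hvp]
      exact e1
  have hP' : B.PlotAt (fun e => τ.map ((γ p)⁻¹ * γ e) (δ e)) univ p := by
    refine hP.congr_nhds ?_
    filter_upwards [hqt.eventually e2, hdt.eventually c.param_η] with e q1 q2
    rw [q1, q2]
  have hgood := hδ.continuousAt.eventually e4
  refine (plotAt_mul_nhds (Γ := κ) (PlotAt.comp_contDiffAt (φ := δ) (e5 (γ p)) hδ) hP' ?_).congr_nhds ?_
  · filter_upwards [hgood] with e he
    rw [hb.out.tgt_eq, he.1]
    exact he.1 _
  · filter_upwards [hgood] with e he
    have := he.2 (γ p) ((γ p)⁻¹ * γ e)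
    rw [_root_.mul_inv_cancel_left] at this
    exact this.symm

theorem fderiv_coordMap [T2Space K] (v : EuclideanSpace ℝ (Fin c.d)) :
    fderiv ℝ τ.coordMap (0, a.2 x₀) (v, 0) = v := by
  have h := fderiv_apply_of_eventuallyEq
    (τ.contDiffAt_coordMap.self_of_nhds.differentiableAt (by simp))
    (ContinuousLinearMap.inl ℝ _ _) (g' := id) (by
      filter_upwards [c.η_param] with w hw
      simp [coordMap, τ.map_base, hw]) v
  simpa using h

/-- The transport is a local diffeomorphism. -/
theorem exists_localInverse [T2Space K] : ∃ χ : K → κ.Fibre x₀,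
    (∀ᶠ k in 𝓝 (κ.unit x₀), MapAt B B (fun k => (χ k : K)) k ∧
      τ.map (χ k) (a.2 (κ.src k)) = k) ∧
    ∀ᶠ q : κ.Fibre x₀ × EuclideanSpace ℝ (Fin a.1) in 𝓝 (1, a.2 x₀), χ (τ.map q.1 q.2) = q.1 := by
  have hd := (τ.contDiffAt_coordMap.self_of_nhds.differentiableAt (by simp)).hasFDerivAt
  have h0 : τ.coordMap (0, a.2 x₀) = 0 := by
    rw [coordMap, τ.map_base, c.param_zero, Fibre.coe_one, c.η_unit]
  -- Over `x₀` the transport is the identity, so its derivative along the fibre is the identity and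
  -- the full derivative is triangular.
  let Q' : (EuclideanSpace ℝ (Fin c.d) × EuclideanSpace ℝ (Fin a.1)) ≃L[ℝ]
      (EuclideanSpace ℝ (Fin a.1) × EuclideanSpace ℝ (Fin c.d)) :=
    (ContinuousLinearEquiv.prodComm ℝ _ _).trans (ContinuousLinearEquiv.skewProd
      (ContinuousLinearEquiv.refl ℝ _) (ContinuousLinearEquiv.refl ℝ _)
      ((fderiv ℝ τ.coordMap (0, a.2 x₀)).comp (ContinuousLinearMap.inr ℝ _ _)))
  have hQd : HasFDerivAt (fun q : EuclideanSpace ℝ (Fin c.d) × EuclideanSpace ℝ (Fin a.1) =>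
      (q.2, τ.coordMap q)) (Q' : _ →L[ℝ] EuclideanSpace ℝ (Fin a.1) × EuclideanSpace ℝ (Fin c.d))
        (0, a.2 x₀) := by
    refine (hasFDerivAt_snd.prodMk hd).congr_fderiv (ContinuousLinearMap.ext fun q => ?_)
    refine Prod.ext rfl ?_
    change fderiv ℝ τ.coordMap (0, a.2 x₀) q = q.1 + fderiv ℝ τ.coordMap (0, a.2 x₀) (0, q.2)
    conv_rhs => rw [← τ.fderiv_coordMap q.1, ← map_add]
    simp
  obtain ⟨R, hR1, hR2⟩ := exists_smooth_localInverse
    (τ.contDiffAt_coordMap.mono fun q hq => contDiffAt_snd.prodMk hq) Q' hQd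
  rw [h0] at hR1
  have hR0 : R (a.2 x₀, 0) = (0, a.2 x₀) := by
    have := hR2.self_of_nhds
    rwa [h0] at this
  have hsrc : Tendsto κ.src (𝓝 (κ.unit x₀)) (𝓝 x₀) := by
    simpa only [κ.src_unit] using κ.continuous_src.tendsto (κ.unit x₀)
  have hk : Tendsto (fun k => (a.2 (κ.src k), c.η k)) (𝓝 (κ.unit x₀)) (𝓝 (a.2 x₀, 0)) :=
    ((a.2.continuousAt c.mem_source).tendsto.comp hsrc).prodMk_nhds c.tendsto_η
  have hRt : Tendsto R (𝓝 (a.2 x₀, 0)) (𝓝 (0, a.2 x₀)) := by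
    have := hR1.self_of_nhds.1.continuousAt
    rwa [ContinuousAt, hR0] at this
  have hfst : Tendsto (fun q : EuclideanSpace ℝ (Fin c.d) × EuclideanSpace ℝ (Fin a.1) => q.1)
    (𝓝 (0, a.2 x₀)) (𝓝 0) := continuousAt_fst
  refine ⟨fun k => c.param (R (a.2 (κ.src k), c.η k)).1, ?_, ?_⟩
  · filter_upwards [hk.eventually hR1, (hRt.comp hk).eventually τ.θ_coordMap, c.coord,
      (hfst.comp (hRt.comp hk)).eventually c.plotAt_param,
      hsrc.eventually (a.2.open_source.mem_nhds c.mem_source)] with k k1 k2 k3 k4 k5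
    constructor
    · refine PlotAt.mapAt_comp (γ := fun v => (c.param v : K))
        (h := fun k => (R (a.2 (κ.src k), c.η k)).1) k4 ?_
      refine ContDiffAt.comp_funAt (φ := fun q => (R q).1) (h := fun k => (a.2 (κ.src k), c.η k))
        (contDiffAt_fst.comp _ k1.1) (FunAt.prodMk ?_ k3.1)
      exact κ.src_submersion.1.funAt (funAt_chart c.mem k5)
    · have e1 : (R (a.2 (κ.src k), c.η k)).2 = a.2 (κ.src k) := congrArg Prod.fst k1.2
      have e2 : τ.coordMap (R (a.2 (κ.src k), c.η k)) = c.η k := congrArg Prod.snd k1.2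
      simp only [Function.comp_apply, e2, e1] at k2
      rw [← k2, k3.2]
  · have hl : Tendsto (fun q : κ.Fibre x₀ × EuclideanSpace ℝ (Fin a.1) => q.1)
      (𝓝 (1, a.2 x₀)) (𝓝 1) := continuousAt_fst
    have hy : Tendsto (fun q : κ.Fibre x₀ × EuclideanSpace ℝ (Fin a.1) => q.2)
      (𝓝 (1, a.2 x₀)) (𝓝 (a.2 x₀)) := continuousAt_snd
    have hv : Tendsto (fun q : κ.Fibre x₀ × EuclideanSpace ℝ (Fin a.1) => (c.η q.1, q.2))
      (𝓝 (1, a.2 x₀)) (𝓝 (0, a.2 x₀)) :=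
      ((c.tendsto_η.comp tendsto_coe_one).comp hl).prodMk_nhds hy
    filter_upwards [hv.eventually hR2, hl.eventually c.param_η, hy.eventually τ.src_map,
      hy.eventually (a.2.open_target.mem_nhds (a.2.map_source c.mem_source))] with q q1 q2 q3 q4
    simp only [coordMap, q2] at q1
    rw [q3, a.2.right_inv q4, q1, q2]

/-- It suffices that kernels are trivial. Near the unit the local inverse excludes further kernel
elements; away from it, transported elements stay apart from the units by the Hausdorff property.
Compactness makes this uniform. -/
theorem eventually_injective [T2Space K] :
    ∀ᶠ y in 𝓝 (a.2 x₀), Function.Injective fun l => τ.map l y := by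
  obtain ⟨χ, -, hχ⟩ := τ.exists_localInverse
  have h1 : ∀ᶠ y in 𝓝 (a.2 x₀), ∀ l, τ.map l y = κ.unit (a.2.symm y) → l = 1 := by
    refine eventually_forall_of_compactSpace fun l => ?_
    have hy : Tendsto (fun q : κ.Fibre x₀ × EuclideanSpace ℝ (Fin a.1) => q.2)
      (𝓝 (l, a.2 x₀)) (𝓝 (a.2 x₀)) := continuousAt_snd
    by_cases hl : l = 1
    · subst hl
      have h2 : Tendsto (fun q : κ.Fibre x₀ × EuclideanSpace ℝ (Fin a.1) => ((1 : κ.Fibre x₀), q.2))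
        (𝓝 (1, a.2 x₀)) (𝓝 (1, a.2 x₀)) := Continuous.tendsto' (by fun_prop) _ _ rfl
      filter_upwards [hχ, h2.eventually hχ, hy.eventually τ.eventually_isGood] with q q1 q2 q3 q4
      rw [← q1, q4, ← q3.map_one, q2]
    · have h2 := τ.continuousAt_map.self_of_nhds l
      rw [ContinuousAt, τ.map_base] at h2
      have h3 : Tendsto (fun q : κ.Fibre x₀ × EuclideanSpace ℝ (Fin a.1) =>
          κ.unit (a.2.symm q.2)) (𝓝 (l, a.2 x₀)) (𝓝 (κ.unit x₀)) :=
        ((κ.continuous_unit.tendsto x₀).comp (tendsto_symm c.mem_source)).comp hy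
      filter_upwards [(h2.prodMk_nhds h3).eventually
        (isClosed_diagonal.isOpen_compl.mem_nhds fun h => hl (Fibre.ext h))] with q q1 q2
      exact absurd q2 q1
  filter_upwards [h1, τ.eventually_isGood] with y h2 h3 l l' h
  have h4 : Function.Injective h3.hom := (injective_iff_map_eq_one h3.hom).2 fun l hl =>
    h2 l (congrArg Subtype.val hl)
  exact h4 (Fibre.ext h)

/-- Near the fibre over `x₀`, the transport has smooth local inverses. -/
theorem exists_localInverse_at [T2Space K] (l : κ.Fibre x₀) : ∃ χ : K → κ.Fibre x₀,
    ∀ᶠ k in 𝓝 (l : K), MapAt B B (fun k => (χ k : K)) k ∧ τ.map (χ k) (a.2 (κ.src k)) = k := by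
  obtain ⟨χ, hχ, -⟩ := τ.exists_localInverse
  have hsrc : Tendsto κ.src (𝓝 (l : K)) (𝓝 x₀) := by
    simpa only [Fibre.src_coe] using κ.continuous_src.tendsto (l : K)
  have hy : Tendsto (fun k => a.2 (κ.src k)) (𝓝 (l : K)) (𝓝 (a.2 x₀)) :=
    (a.2.continuousAt c.mem_source).tendsto.comp hsrc
  have hsa := hsrc.eventually (a.2.open_source.mem_nhds c.mem_source)
  -- Dividing by the transport of `l` brings `k` close to a unit; its preimage is then multiplied by
  -- `l` again.
  set δ : K → K := fun k => κ.mul (κ.inv (τ.map l (a.2 (κ.src k)))) k with hδ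
  have hc : ∀ᶠ k in 𝓝 (l : K), κ.src (κ.inv (τ.map l (a.2 (κ.src k)))) = κ.tgt k := by
    filter_upwards [hy.eventually τ.src_map, hsa] with k k1 k2
    rw [κ.src_inv, hb.out.tgt_eq, k1, a.2.left_inv k2, hb.out.tgt_eq]
  have hδm : ∀ᶠ k in 𝓝 (l : K), MapAt B B δ k := by
    filter_upwards [hy.eventually τ.plotAt_map, hsa, hc.eventually_nhds] with k k1 k2 k3
    have e1 : MapAt B B (fun k => τ.map l (a.2 (κ.src k))) k :=
      PlotAt.mapAt_comp (γ := τ.map l) (h := fun k => a.2 (κ.src k)) (k1 l)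
        (κ.src_submersion.1.funAt (funAt_chart c.mem k2))
    exact mapAt_mul (fun b hb' hs => κ.smooth_inv.plotAt (e1 b hb' hs)) (mapAt_id k) k3
  have hδ0 : δ l = κ.unit x₀ := by
    simp only [hδ, Fibre.src_coe, τ.map_base, κ.inv_mul]
  have hδt : Tendsto δ (𝓝 (l : K)) (𝓝 (κ.unit x₀)) := by
    rw [← hδ0]
    exact hδm.self_of_nhds.continuousAt
  refine ⟨fun k => l * χ (δ k), ?_⟩
  filter_upwards [hδt.eventually hχ, hδm, hy.eventually τ.eventually_isGood, hc, hsa]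
    with k k1 k2 k3 k4 k5
  constructor
  · intro b hb' hs
    refine Fibre.plotAt_mul (plotAt_const _ _ _)
      (MapAt.plotAt (f := fun k => (χ k : K)) (γ := δ ∘ b.2.symm) ?_ (k2 b hb' hs))
    rw [Function.comp_apply, b.2.left_inv hs]
    exact k1.1
  · have e1 : κ.src (δ k) = κ.src k := κ.src_mul _ _ k4
    have e2 := k1.2
    rw [e1] at e2
    rw [← k3.2, e2, hδ]
    refine κ.mul_inv_cancel_left ?_
    rw [hb.out.tgt_eq, k3.1, a.2.left_inv k5, hb.out.tgt_eq]

end MultiplicativeTransport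
end UnitCoordinates

end LieGroupoid

/-! ### Local triviality of proper bundles of Lie groups, and the conclusion. -/

namespace LieGroupoid
open SmoothAtlas

variable {M : Type v} [TopologicalSpace M] {A : SmoothAtlas M}
  {K : Type u} [TopologicalSpace K] {B : SmoothAtlas K} {κ : LieGroupoid A B}

/-- A proper bundle of Lie groups with Hausdorff total space is locally trivial. -/
theorem IsGroupBundle.isLocallyTrivial (hb : κ.IsGroupBundle) [T2Space K]
    (hp : IsProperMap κ.src) : κ.IsLocallyTrivial := by
  classical
  intro x₀
  obtain ⟨a, ha, hxa⟩ := A.cover x₀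
  haveI : Fact κ.IsGroupBundle := ⟨hb⟩
  haveI : CompactSpace (κ.Fibre x₀) :=
    isCompact_iff_compactSpace.1 (hp.isCompact_preimage isCompact_singleton)
  obtain ⟨c⟩ := nonempty_unitCoordinates κ ha hxa
  obtain ⟨τ⟩ := c.nonempty_multiplicativeTransport
  have hay : Tendsto a.2 (𝓝 x₀) (𝓝 (a.2 x₀)) := a.2.continuousAt hxa
  -- Smooth local inverses exist near each point of the fibre over `x₀`. As the source map is
  -- closed, they exist at all points over a neighbourhood of `x₀`, so there the transport is onto.
  have hk := hp.isClosedMap.eventually_nhds_fiber (p := fun k => ∃ χ : K → κ.Fibre x₀,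
      MapAt B B (fun k => (χ k : K)) k ∧ ∀ᶠ k' in 𝓝 k, τ.map (χ k') (a.2 (κ.src k')) = k') x₀ (by
    intro k hk
    obtain ⟨χ, hχ⟩ := τ.exists_localInverse_at (⟨k, hk⟩ : κ.Fibre x₀)
    filter_upwards [hχ.eventually_nhds] with k' h1
    exact ⟨χ, h1.self_of_nhds.1, h1.mono fun _ h => h.2⟩)
  have has : ∀ᶠ x in 𝓝 x₀, x ∈ a.2.source := a.2.open_source.mem_nhds hxa
  obtain ⟨U, hU, hUo, hxU⟩ := eventually_nhds_iff.1
    (hk.and (has.and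
      (hay.eventually (τ.eventually_isGood.and (τ.eventually_injective.and τ.isTransport_smooth)))))
  -- The choice is forced over `U` by injectivity, so `χ` agrees with the smooth local inverses; 1
  -- is a default elsewhere.
  set χ : K → κ.Fibre x₀ := fun k =>
    if h : ∃ l, τ.map l (a.2 (κ.src k)) = k then h.choose else 1 with hχ
  have hχ_spec : ∀ k, κ.src k ∈ U → ∀ l, τ.map l (a.2 (κ.src k)) = k → χ k = l := by
    intro k hk' l hl
    have h : ∃ l, τ.map l (a.2 (κ.src k)) = k := ⟨l, hl⟩
    rw [hχ]
    simp only [dif_pos h]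
    exact (hU _ hk').2.2.2.1 (h.choose_spec.trans hl.symm)
  have hχ_map : ∀ k, κ.src k ∈ U → τ.map (χ k) (a.2 (κ.src k)) = k := by
    intro k hk'
    obtain ⟨χ', -, h2⟩ := (hU _ hk').1 k rfl
    rw [hχ_spec k hk' _ h2.self_of_nhds, h2.self_of_nhds]
  have hsrc : ∀ l, ∀ y ∈ U, κ.src (τ.map l (a.2 y)) = y := fun l y hy =>
    ((hU y hy).2.2.1.1 l).trans (a.2.left_inv (hU y hy).2.1)
  refine ⟨U, hUo, hxU, c.d, κ.Fibre x₀, inferInstance, inferInstance, c.chartedSpace, c.lieGroup,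
    χ, fun l y => τ.map l (a.2 y), ?_, ?_, hχ_map, ?_, ?_⟩
  · refine SmoothOn.of_plotAt fun b hb' v hv hvU => ?_
    obtain ⟨χ', h1, h2⟩ := (hU _ hvU).1 (b.2.symm v) rfl
    refine c.ofManifold_plotAt (PlotAt.mono ?_ (subset_univ _))
    refine (h1.plotAt (plotAt_symm hb' hv)).congr_nhds ?_
    have hs : Tendsto b.2.symm (𝓝 v) (𝓝 (b.2.symm v)) := (plotAt_symm hb' hv).continuousAt
    filter_upwards [hs.eventually h2, hs.eventually
      ((hUo.preimage κ.continuous_src).mem_nhds hvU)] with w w1 w2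
    exact congrArg Subtype.val (hχ_spec _ w2 _ w1)
  · refine SmoothOn₂.of_plotAt ?_
    rintro _ ⟨e, he, rfl⟩ b hb' v hv1 hv2 ⟨-, hvU⟩
    have he' : B.IsSubChart (κ.src ⁻¹' {x₀}) e := he
    refine PlotAt.mono ?_ (subset_univ _)
    refine (hU _ hvU).2.2.2.2 _ (fun v => e.symm v.1) (fun v => a.2 (b.2.symm v.2)) v ?_ ?_ rfl
    · exact PlotAt.comp_contDiffAt (γ := fun w => (e.symm w : K)) (φ := Prod.fst) (he'.1 _ hv1)
        contDiffAt_fst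
    · exact ((plotAt_symm hb' hv2).comp_contDiffAt (φ := Prod.snd) contDiffAt_snd).contDiffAt ha
        (hU _ hvU).2.1
  · exact fun l y hy => ⟨hsrc l y hy, hχ_spec _ (by rwa [hsrc l y hy]) _ (by rw [hsrc l y hy])⟩
  · intro k k' hk' hkk
    have h1 := hχ_map k hk'
    have h2 := hχ_map k' (hkk ▸ hk')
    rw [← hkk] at h2
    have h3 : κ.src (κ.mul k k') = κ.src k :=
      (κ.src_mul _ _ (hkk.trans (hb.tgt_eq _).symm)).trans hkk.symm
    refine hχ_spec _ (by rwa [h3]) _ ?_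
    rw [h3, ← (hU _ hk').2.2.1.2, h1, h2]

end LieGroupoid

theorem corollary2p6 {M : Type v} [TopologicalSpace M] [T2Space M] (A : SmoothAtlas M)
    {G : Type u} [TopologicalSpace G] (B : SmoothAtlas G) (Γ : LieGroupoid A B)
    (hreg : Γ.IsRegular) (hprop : Γ.IsProper) :
    ∃ (K : Type u) (_ : TopologicalSpace K) (AK : SmoothAtlas K) (κ : LieGroupoid A AK)
      (E : Type u) (_ : TopologicalSpace E) (AE : SmoothAtlas E) (ε : LieGroupoid A AE)
      (j : K → G) (π : G → E),
      LieGroupoid.IsExtension κ Γ ε j π ∧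
      ε.IsOrbifold ∧
      κ.IsLocallyTrivialCompactConnectedGroupBundle := by
  haveI := hprop.1
  have hp := LieGroupoid.coreGroupoid_isProperMap_src hreg hprop
  have hext := LieGroupoid.isExtension_core hreg
  exact ⟨Γ.core, inferInstance, LieGroupoid.coreAtlas hreg, LieGroupoid.coreGroupoid hreg,
    Γ.CoreQuotient, inferInstance, LieGroupoid.quotientAtlas hreg, LieGroupoid.quotientGroupoid hreg,
    Subtype.val, Γ.toCoreQuotient, hext, LieGroupoid.quotientGroupoid_isOrbifold hreg hprop,
    hext.groupBundle, hext.groupBundle.isLocallyTrivial hp, hp,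
    fun x => ⟨hp.isCompact_preimage isCompact_singleton,
      LieGroupoid.coreGroupoid_isConnected hreg x⟩⟩
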